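/- Let $T\ge 0$, write $c=\sqrt{T+1}$, let $0<\alpha<2$, and fix a number $m\in(-2/c,0)$, which normalizes the spatial shift. For $\varepsilon,\bar\mu,\bar\lambda>0$ put $\delta=\bar\lambda^2/\bar\mu^2$, $s_\varepsilon=c-\varepsilon$ and $$n_{\varepsilon,+}=\frac{s_\varepsilon^2}{T+1},\qquad u_{\varepsilon,+}=s_\varepsilon\Big(1-\frac1{n_{\varepsilon,+}}\Big),\qquad \phi_{\varepsilon,+}=\log n_{\varepsilon,+},\qquad a_\varepsilon=\frac1\varepsilon\log\frac{s_\varepsilon^2}{T+1}+\frac2c .$$ With viscosity $\mu=\varepsilon\bar\mu$, Debye length $\lambda=\varepsilon^{1/2}\bar\lambda$ and the variable $z=(x-s_\varepsilon t)/\bar\mu$ (and $'=d/dz$), a *shock profile* of the one-dimensional Navier–Stokes–Poisson system for ions is a $C^\infty$ solution $[n_\varepsilon,u_\varepsilon,\phi_\varepsilon]$ on $\mathbb R$, with $n_\varepsilon>0$, of $$-s_\varepsilon n_\varepsilon'+(n_\varepsilon u_\varepsilon)'=0,\quad -s_\varepsilon (n_\varepsilon u_\varepsilon)'+(n_\varepsilon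 u_\varepsilon^2+Tn_\varepsilon)'=\varepsilon u_\varepsilon''-n_\varepsilon\phi_\varepsilon',\quad -\varepsilon\delta\phi_\varepsilon''=n_\varepsilon-e^{\phi_\varepsilon},$$ with limits $[1,0,0]$ at $-\infty$ and $[n_{\varepsilon,+},u_{\varepsilon,+},\phi_{\varepsilon,+}]$ at $+\infty$. *First-order profiles.* $[n_1,u_1,\phi_1]$ are smooth, with $u_1=c\,n_1$, $\phi_1=n_1$, $n_1(0)=m$, limits $[0,0,0]$ at $-\infty$ and $[-\frac2c,-2,-\frac2c]$ at $+\infty$, and $$2c\,n_1'+2c^2n_1n_1'-c\,n_1''+\delta n_1'''=0,\quad 2u_1'+2u_1u_1'-u_1''+\tfrac{\delta}{c}u_1'''=0,\quad 2c\,\phi_1'+2c^2\phi_1\phi_1'-c\,\phi_1''+\delta\phi_1'''=0 .$$ *Modified first-order profiles.* $[n_{1,\varepsilon},u_{1,\varepsilon},\phi_{1,\varepsilon}]$ are smooth, equal to $[n_1,u_1,\phi_1]$ at $z=0$, with limits $[0,0,0]$ at $-\infty$ and $\varepsilon^{-1}\{[n_{\varepsilon,+},u_{\varepsilon,+},\phi_{\varepsilon,+}]-[1,0,0]\}$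 at $+\infty$, and $$(2c-\varepsilon)n_{1,\varepsilon}'+2c^2n_{1,\varepsilon}n_{1,\varepsilon}'-c\,n_{1,\varepsilon}''+\delta n_{1,\varepsilon}'''=0,\qquad \Big(2+\frac{\varepsilon}{c-\varepsilon}\Big)u_{1,\varepsilon}'+2u_{1,\varepsilon}u_{1,\varepsilon}'-u_{1,\varepsilon}''+\frac{\delta}{c}u_{1,\varepsilon}'''=0,$$ $$(2c-c^2a_\varepsilon)\phi_{1,\varepsilon}'+2c^2\phi_{1,\varepsilon}\phi_{1,\varepsilon}'-c\,\phi_{1,\varepsilon}''+\delta\phi_{1,\varepsilon}'''=0 .$$ The second-order correction is $[n_2,u_2,\phi_2]=\varepsilon^{-1}[n_{1,\varepsilon}-n_1,\,u_{1,\varepsilon}-u_1,\,\phi_{1,\varepsilon}-\phi_1]$. *Norms.* With $w_\alpha(z)=\exp(\alpha\sqrt{1+|z|^2})$ put $\|f\|_{L^2_\alpha}=\|w_\alpha f\|_{L^2}$, $\|f\|_{H^k_\alpha}=\big(\sum_{i=0}^k\|f^{(i)}\|_{L^2_\alpha}^2\big)^{1/2}$ and $$\|[n,\phi]\|_{X_{\alpha,k}}=\|n\|_{H^k_\alpha}+\|\phi\|_{H^k_\alpha}+\sqrt{\varepsilon\delta}\,\|\phi^{(k+1)}\|_{L^2_\alpha}+\varepsilon\delta\,\|\phi^{(k+2)}\|_{L^2_\alpha}.$$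 **Theorem.** There are positive constants $\varepsilon_0,\delta_0,\hat c_1,\hat c_2$ and $C_k$ $(k\ge0)$, depending only on $T,\alpha,m$ (and $C_k$ also on $k$), such that whenever $0<\varepsilon\le\varepsilon_0$ and $0<\delta=\bar\lambda^2/\bar\mu^2\le\delta_0$, one has $\hat c_1\varepsilon\le 1-n_{\varepsilon,+}\le\hat c_2\varepsilon$; the profiles $[n_1,u_1,\phi_1]$ and $[n_{1,\varepsilon},u_{1,\varepsilon},\phi_{1,\varepsilon}]$ exist and are unique; and there is exactly one shock profile of the form $$[n_\varepsilon,u_\varepsilon,\phi_\varepsilon]=[1,0,0]+\varepsilon[n_1,u_1,\phi_1]+\varepsilon^2[n_2+n_R,\,u_2+u_R,\,\phi_2+\phi_R],\qquad n_R(0)=0 .$$ Its remainder satisfies $$u_R=n_\varepsilon^{-1}(s_\varepsilon-\varepsilon u_{1,\varepsilon})n_R+\varepsilon^{-1}n_\varepsilon^{-1}(s_\varepsilon n_{1,\varepsilon}-u_{1,\varepsilon}-\varepsilon n_{1,\varepsilon}u_{1,\varepsilon}),$$ $$n_R'=2(1+c\,n_1)n_R+\tfrac{\delta}{c}\phi_R''+r_1+r_2+r_3,\qquad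 -\varepsilon\delta\phi_R''=n_R-\phi_R+r_4+r_5+r_6,$$ where, with $N=n_{1,\varepsilon}$, $\Phi=\phi_{1,\varepsilon}$, $$r_1=\Big(\frac1c+N\Big)N'+\frac{\delta(1+\varepsilon N)}{\varepsilon c}\{(1+\varepsilon N)\Phi''-N''\}-\frac{\delta(1+\varepsilon N)^2}{2c}(\Phi')^2,$$ $$r_2=\frac{\varepsilon n_R}{c}\Big\{\frac{2c^2}{\varepsilon}(N-n_1)-1+2(2c-\varepsilon)N+3c^2N^2+2\delta(1+\varepsilon N)\Phi''-\varepsilon\delta(1+\varepsilon N)(\Phi')^2\Big\}+\frac{\varepsilon\delta(2N+\varepsilon N^2)}{c}\phi_R''+\frac{\varepsilon n_R'}{c}-\frac{\varepsilon\delta\Phi'(1+\varepsilon N)^2}{c}\phi_R',$$ $$r_3=\frac{\varepsilon}{c}\Big[c^2(2+3\varepsilon N)-s_\varepsilon^2+\varepsilon^2\delta\Phi''-\frac{\delta\varepsilon^3}2(\Phi')^2\Big]n_R^2+c\,\varepsilon^3n_R^3+\frac{2\varepsilon^2\delta(1+\varepsilon N)n_R\phi_R''}{c}+\frac{\varepsilon^4\delta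 n_R^2\phi_R''}{c}-\frac{\varepsilon^3\delta\Phi'\phi_R'[2n_R(1+\varepsilon N)+\varepsilon^2n_R^2]}{c}-\frac{\varepsilon^2\delta(\phi_R')^2(1+\varepsilon N+\varepsilon^2n_R)^2}{2c},$$ $$r_4=\varepsilon^{-2}(1+\varepsilon N-e^{\varepsilon\Phi})+\delta\Phi'',\qquad r_5=(1-e^{\varepsilon\Phi})\phi_R,\qquad r_6=\varepsilon^{-2}e^{\varepsilon\Phi}(1-e^{\varepsilon^2\phi_R}+\varepsilon^2\phi_R),$$ and for every integer $k\ge2$, with $C_k$ independent of $\varepsilon$ and $\delta$, $$\|[n_R,\phi_R]\|_{X_{\alpha,k}}\le C_k,\qquad \|u_R\|_{H^k_\alpha}\le C_k .$$ -/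

import Mathlib

open Filter Topology MeasureTheory
open scoped ENNReal ContDiff

noncomputable section

namespace IonShock

/-! ### Far-field states -/

/-- Acoustic speed `√(T+1)` of the quasi-neutral Euler system at the state `[n, u] = [1, 0]`. -/
def soundSpeed (T : ℝ) : ℝ := Real.sqrt (T + 1)

/-- Shock speed `s_ε = √(T+1) - ε`. -/
def shockSpeed (T ε : ℝ) : ℝ := soundSpeed T - ε

/-- Downstream density, given by the Rankine-Hugoniot conditions with upstream state `[1, 0]`. -/
def nPlus (T ε : ℝ) : ℝ := shockSpeed T ε ^ 2 / (T + 1)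

/-- Downstream velocity. -/
def uPlus (T ε : ℝ) : ℝ := shockSpeed T ε * (1 - 1 / nPlus T ε)

/-- Downstream potential (quasi-neutrality `φ₊ = log n₊`). -/
def phiPlus (T ε : ℝ) : ℝ := Real.log (nPlus T ε)

/-- `a_ε = ε⁻¹ log (s_ε² / (T+1)) + 2 / √(T+1)`. -/
def aCoeff (T ε : ℝ) : ℝ :=
  1 / ε * Real.log (shockSpeed T ε ^ 2 / (T + 1)) + 2 / soundSpeed T

/-! ### Profiles -/

/-- Three functions of the travelling-wave variable: density, velocity, potential. -/
@[ext]
structure Triple where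
  n : ℝ → ℝ
  u : ℝ → ℝ
  φ : ℝ → ℝ

/-- A shock profile: a smooth solution, with positive density, of the rescaled travelling-wave
system for the Navier-Stokes-Poisson equations, connecting `[1, 0, 0]` at `-∞` to the downstream
state at `+∞`. -/
structure IsShockProfile (T ε δ : ℝ) (p : Triple) : Prop where
  smooth_n : ContDiff ℝ ∞ p.n
  smooth_u : ContDiff ℝ ∞ p.u
  smooth_φ : ContDiff ℝ ∞ p.φ
  density_pos : ∀ z, 0 < p.n z
  mass : ∀ z, -shockSpeed T ε * deriv p.n z + deriv (fun y => p.n y * p.u y) z = 0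
  momentum : ∀ z,
    -shockSpeed T ε * deriv (fun y => p.n y * p.u y) z
        + deriv (fun y => p.n y * p.u y ^ 2 + T * p.n y) z
      = ε * iteratedDeriv 2 p.u z - p.n z * deriv p.φ z
  poisson : ∀ z, -(ε * δ * iteratedDeriv 2 p.φ z) = p.n z - Real.exp (p.φ z)
  left_n : Tendsto p.n atBot (𝓝 1)
  left_u : Tendsto p.u atBot (𝓝 0)
  left_φ : Tendsto p.φ atBot (𝓝 0)
  right_n : Tendsto p.n atTop (𝓝 (nPlus T ε))
  right_u : Tendsto p.u atTop (𝓝 (uPlus T ε))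
  right_φ : Tendsto p.φ atTop (𝓝 (phiPlus T ε))

/-- `f` is a smooth travelling front of the KdV-Burgers equation
`c f' + 2 b f f' - d f'' + e f''' = 0` with `f(-∞) = 0` and `f(+∞) = r`. -/
structure IsKdVBurgersFront (c b d e r : ℝ) (f : ℝ → ℝ) : Prop where
  smooth : ContDiff ℝ ∞ f
  eqn : ∀ z, c * deriv f z + 2 * b * f z * deriv f z - d * iteratedDeriv 2 f z
    + e * iteratedDeriv 3 f z = 0
  left : Tendsto f atBot (𝓝 0)
  right : Tendsto f atTop (𝓝 r)

/-- The first-order KdV-Burgers shock profiles `[n₁, u₁, φ₁]`, linked by `u₁ = √(T+1) n₁` and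
`φ₁ = n₁`; the spatial shift is fixed by the value `m` at the origin. -/
structure IsFirstOrder (T δ m : ℝ) (p : Triple) : Prop where
  front_n : IsKdVBurgersFront (2 * soundSpeed T) (T + 1) (soundSpeed T) δ
    (-(2 / soundSpeed T)) p.n
  front_u : IsKdVBurgersFront 2 1 1 (δ / soundSpeed T) (-2) p.u
  front_φ : IsKdVBurgersFront (2 * soundSpeed T) (T + 1) (soundSpeed T) δ
    (-(2 / soundSpeed T)) p.φ
  u_eq : ∀ z, p.u z = soundSpeed T * p.n z
  φ_eq : ∀ z, p.φ z = p.n z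
  shift : p.n 0 = m

/-- The modified first-order profiles `[n_{1,ε}, u_{1,ε}, φ_{1,ε}]`, whose far fields are those of
the shock profile exactly; the shifts are fixed by the values of `[n₁, u₁, φ₁]` at the origin. -/
structure IsModifiedFirstOrder (T ε δ : ℝ) (p₁ p : Triple) : Prop where
  front_n : IsKdVBurgersFront (2 * soundSpeed T - ε) (T + 1) (soundSpeed T) δ
    (1 / ε * (nPlus T ε - 1)) p.n
  front_u : IsKdVBurgersFront (2 + ε / (soundSpeed T - ε)) 1 1 (δ / soundSpeed T)
    (1 / ε * uPlus T ε) p.u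
  front_φ : IsKdVBurgersFront (2 * soundSpeed T - aCoeff T ε * (T + 1)) (T + 1) (soundSpeed T) δ
    (1 / ε * phiPlus T ε) p.φ
  shift_n : p.n 0 = p₁.n 0
  shift_u : p.u 0 = p₁.u 0
  shift_φ : p.φ 0 = p₁.φ 0

/-- The second-order correction `[n₂, u₂, φ₂] = ε⁻¹ [n_{1,ε} - n₁, u_{1,ε} - u₁, φ_{1,ε} - φ₁]`. -/
def secondOrder (ε : ℝ) (p₁ pε : Triple) : Triple where
  n := fun z => ε⁻¹ * (pε.n z - p₁.n z)
  u := fun z => ε⁻¹ * (pε.u z - p₁.u z)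
  φ := fun z => ε⁻¹ * (pε.φ z - p₁.φ z)

/-- `p = [1,0,0] + ε [n₁,u₁,φ₁] + ε² [n₂+n_R, u₂+u_R, φ₂+φ_R]`. -/
structure HasExpansion (ε : ℝ) (p₁ p₂ pR p : Triple) : Prop where
  n_eq : ∀ z, p.n z = 1 + ε * p₁.n z + ε ^ 2 * (p₂.n z + pR.n z)
  u_eq : ∀ z, p.u z = ε * p₁.u z + ε ^ 2 * (p₂.u z + pR.u z)
  φ_eq : ∀ z, p.φ z = ε * p₁.φ z + ε ^ 2 * (p₂.φ z + pR.φ z)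

/-! ### The equations for the remainder -/

def r₁ (T ε δ : ℝ) (q : Triple) (z : ℝ) : ℝ :=
  (1 / soundSpeed T + q.n z) * deriv q.n z
    + δ * (1 + ε * q.n z) / (ε * soundSpeed T)
      * ((1 + ε * q.n z) * iteratedDeriv 2 q.φ z - iteratedDeriv 2 q.n z)
    - δ * (1 + ε * q.n z) ^ 2 / (2 * soundSpeed T) * deriv q.φ z ^ 2

def r₂ (T ε δ : ℝ) (p₁ q r : Triple) (z : ℝ) : ℝ :=
  ε * r.n z / soundSpeed T
      * (2 * (T + 1) * ε⁻¹ * (q.n z - p₁.n z) - 1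
        + 2 * (2 * soundSpeed T - ε) * q.n z + 3 * (T + 1) * q.n z ^ 2
        + 2 * δ * (1 + ε * q.n z) * iteratedDeriv 2 q.φ z
        - ε * δ * (1 + ε * q.n z) * deriv q.φ z ^ 2)
    + ε * δ * (2 * q.n z + ε * q.n z ^ 2) / soundSpeed T * iteratedDeriv 2 r.φ z
    + ε * deriv r.n z / soundSpeed T
    - ε * δ * deriv q.φ z * (1 + ε * q.n z) ^ 2 / soundSpeed T * deriv r.φ z

def r₃ (T ε δ : ℝ) (q r : Triple) (z : ℝ) : ℝ :=
  ε * ((T + 1) * (2 + 3 * ε * q.n z) - shockSpeed T ε ^ 2 + ε ^ 2 * δ * iteratedDeriv 2 q.φ z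
        - δ / 2 * ε ^ 3 * deriv q.φ z ^ 2) * r.n z ^ 2 / soundSpeed T
    + soundSpeed T * ε ^ 3 * r.n z ^ 3
    + 2 * ε ^ 2 * δ * (1 + ε * q.n z) * r.n z * iteratedDeriv 2 r.φ z / soundSpeed T
    + ε ^ 4 * δ * r.n z ^ 2 * iteratedDeriv 2 r.φ z / soundSpeed T
    - ε ^ 3 * δ * deriv q.φ z * deriv r.φ z
      * (2 * r.n z * (1 + ε * q.n z) + ε ^ 2 * r.n z ^ 2) / soundSpeed T
    - ε ^ 2 * δ * deriv r.φ z ^ 2 * (1 + ε * q.n z + ε ^ 2 * r.n z) ^ 2 / (2 * soundSpeed T)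

def r₄ (ε δ : ℝ) (q : Triple) (z : ℝ) : ℝ :=
  (ε ^ 2)⁻¹ * (1 + ε * q.n z - Real.exp (ε * q.φ z)) + δ * iteratedDeriv 2 q.φ z

def r₅ (ε : ℝ) (q r : Triple) (z : ℝ) : ℝ :=
  (1 - Real.exp (ε * q.φ z)) * r.φ z

def r₆ (ε : ℝ) (q r : Triple) (z : ℝ) : ℝ :=
  (ε ^ 2)⁻¹ * Real.exp (ε * q.φ z) * (1 - Real.exp (ε ^ 2 * r.φ z) + ε ^ 2 * r.φ z)

/-- The system for the remainder `r = [n_R, u_R, φ_R]`, given the first-order profiles `p₁` and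
the modified first-order profiles `q`. -/
structure SolvesRemainderSystem (T ε δ : ℝ) (p₁ q r : Triple) : Prop where
  eqn_n : ∀ z, deriv r.n z
    = 2 * (1 + soundSpeed T * p₁.n z) * r.n z + δ / soundSpeed T * iteratedDeriv 2 r.φ z
      + r₁ T ε δ q z + r₂ T ε δ p₁ q r z + r₃ T ε δ q r z
  eqn_φ : ∀ z, -(ε * δ * iteratedDeriv 2 r.φ z)
    = r.n z - r.φ z + r₄ ε δ q z + r₅ ε q r z + r₆ ε q r z
  eqn_u : ∀ z, r.u z
    = (1 + ε * q.n z + ε ^ 2 * r.n z)⁻¹ * (shockSpeed T ε - ε * q.u z) * r.n z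
      + ε⁻¹ * (1 + ε * q.n z + ε ^ 2 * r.n z)⁻¹
        * (shockSpeed T ε * q.n z - q.u z - ε * q.n z * q.u z)

/-! ### Exponentially weighted norms

The functions measured below are smooth, so weak derivatives are classical ones. The norms take
values in `[0, ∞]`; a finite value expresses membership in the space. -/

/-- The weight `w_α(z) = exp (α √(1 + |z|²))`. -/
def weight (α z : ℝ) : ℝ := Real.exp (α * Real.sqrt (1 + |z| ^ 2))

/-- `‖w_α f‖_{L²}`. -/
def normL2 (α : ℝ) (f : ℝ → ℝ) : ℝ≥0∞ := eLpNorm (fun z => weight α z * f z) 2 volume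

/-- `‖f‖_{H^k_α} = (∑_{i ≤ k} ‖w_α f^{(i)}‖_{L²}²)^{1/2}`. -/
def normH (α : ℝ) (k : ℕ) (f : ℝ → ℝ) : ℝ≥0∞ :=
  (∑ i ∈ Finset.range (k + 1), normL2 α (iteratedDeriv i f) ^ 2) ^ (1 / 2 : ℝ)

/-- The norm of `[n, φ]` in `X_{α,k}`. -/
def normX (ε δ α : ℝ) (k : ℕ) (n φ : ℝ → ℝ) : ℝ≥0∞ :=
  normH α k n + normH α k φ
    + ENNReal.ofReal (Real.sqrt (ε * δ)) * normL2 α (iteratedDeriv (k + 1) φ)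
    + ENNReal.ofReal (ε * δ) * normL2 α (iteratedDeriv (k + 2) φ)

end IonShock

end

namespace IonShock

/-! ### Exponential weights and first-order linear equations -/

/-! Let σ = 1 - n₊ be the shock strength, which is of order ε. Writing n = 1 - σ g, φ' = -σ y and n
- e^φ = σ τ x, with τ = ε s and e = δ / s, turns the integrated travelling-wave equations into one
slow equation g' = k g (1 - g) + x + O(σ) and two fast ones, e y' = x and (τ x)' = y - g' + O(σ).
This is `IsFrontSys`. KdV-Burgers fronts, divided by their far-field value, solve the same system
with σ = τ = 0 and other values of k and e. All profiles of the theorem therefore lie in one family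
of fronts with small e, σ, τ, close to the logistic front g₀' = k g₀ (1 - g₀). Since k is close to
2, the logistic tails decay almost like e^{-2|z|}, which is why α < 2 is the natural range.

The perturbation is singular, but no power of e or τ is lost: eliminating x from the fast equations
leaves the operator (1 - p ∂)(1 + q ∂) with small p, q ≥ 0, and each factor has an explicit inverse
that is bounded in exponential weights (`fast_bound`, `resolv_bound`). The slow equation, linearised
at the logistic front, reads d' = k (1 - 2 g₀) d + F. It is stable in both directions away from the
origin, so prescribing d(0) determines a decaying solution and no solvability condition appears
(`slow_bound`).

Existence (`exists_front`) is a contraction around the logistic front in a weighted space.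
Differentiating the system gives decay of all derivatives, uniformly in the parameters
(`front_dec`). The uniformity is carried by the predicate `Dec` for indexed families.

Uniqueness of bounded fronts with given g(0) (`front_unique`) measures differences with the growing
weight e^{η|z|}, so only boundedness is needed. It applies to an arbitrary profile once that profile
has a priori bounds. For KdV-Burgers these follow from an energy that increases along the orbit
(`kdv_bounds`). For shock profiles (`exists_shock_apriori`), with v = 1 / n, there is a Lyapunov
function with derivative ε s v'² and total variation O(ε³). Together with the maximum principle for
the Poisson equation, a bound for φ' that is uniform in δ, and a momentum functional limiting the
density overshoot, it shows that 1 - v and φ' are O(ε).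

The remainder is estimated by comparison (`exists_frontFamily_diff`): two fronts whose parameters
differ by O(ε) have a difference quotient solving a linearised KdV-Burgers equation with a bounded
decaying source, so the quotient and all its derivatives decay uniformly (`linear_kdv_dec`). The
density and velocity remainders are explicit combinations of such quotients and of decaying
functions; for the potential this holds for the derivative, which is then integrated from infinity.
The equations for the remainder are exact algebra (`solvesRemainderSystem`). -/

/-- The exponential weight `e^{-a|z|}`. -/
noncomputable def ew (a z : ℝ) : ℝ := Real.exp (-(a * |z|))

lemma ew_pos (a z : ℝ) : 0 < ew a z := Real.exp_pos _

lemma ew_zero (z : ℝ) : ew 0 z = 1 := by simp [ew]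

lemma ew_at_zero (a : ℝ) : ew a 0 = 1 := by simp [ew]

lemma ew_neg_arg (a z : ℝ) : ew a (-z) = ew a z := by simp [ew]

lemma ew_mul (a b z : ℝ) : ew a z * ew b z = ew (a + b) z := by
  simp only [ew, ← Real.exp_add]; congr 1; ring

lemma ew_anti {a b : ℝ} (h : a ≤ b) (z : ℝ) : ew b z ≤ ew a z := by
  apply Real.exp_le_exp.mpr
  nlinarith [abs_nonneg z]

lemma ew_le_one {a : ℝ} (h : 0 ≤ a) (z : ℝ) : ew a z ≤ 1 := by
  simpa [ew_zero] using ew_anti h z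

lemma ew_of_nonneg (a : ℝ) {z : ℝ} (h : 0 ≤ z) : ew a z = Real.exp (-(a * z)) := by
  simp [ew, abs_of_nonneg h]

lemma ew_of_nonpos (a : ℝ) {z : ℝ} (h : z ≤ 0) : ew a z = Real.exp (a * z) := by
  simp [ew, abs_of_nonpos h]

/-- Triangle inequality in the exponent. The absolute value of `a` also covers growing weights,
because the uniqueness argument takes `a` negative. -/
lemma ew_shift (a z t : ℝ) : ew a (z + t) ≤ ew a z * Real.exp (|a| * |t|) := by
  rw [ew, ew, ← Real.exp_add]
  apply Real.exp_le_exp.mpr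
  have h1 : |z + t| - |z| ≤ |t| := by linarith [abs_add_le z t]
  have h2 : |z| - |z + t| ≤ |t| := by
    have := abs_sub_abs_le_abs_sub z (z + t)
    simpa using this
  have h3 : |(|z| - |z + t|)| ≤ |t| := abs_le.mpr ⟨by linarith, h2⟩
  have h4 : a * (|z| - |z + t|) ≤ |a| * |t| := by
    calc a * (|z| - |z + t|) ≤ |a * (|z| - |z + t|)| := le_abs_self _
      _ = |a| * |(|z| - |z + t|)| := abs_mul _ _
      _ ≤ |a| * |t| := by gcongr
  linarith

lemma continuous_ew (a : ℝ) : Continuous (ew a) := by unfold ew; fun_prop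

/-- The function h - (C / b) e^{-bt} is increasing and tends to zero, hence it is nonpositive at the
origin. -/
lemma le_div_of_deriv_ge {h h' : ℝ → ℝ} {C b : ℝ} (hb : 0 < b)
    (hd : ∀ t, 0 ≤ t → HasDerivAt h (h' t) t)
    (hle : ∀ t, 0 ≤ t → -(C * Real.exp (-(b * t))) ≤ h' t)
    (hl : Tendsto h atTop (𝓝 0)) : h 0 ≤ C / b := by
  set f : ℝ → ℝ := fun t => h t - C / b * Real.exp (-(b * t)) with hf
  have hder : ∀ t, 0 ≤ t → HasDerivAt f (h' t + C * Real.exp (-(b * t))) t := by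
    intro t ht
    have h1 : HasDerivAt (fun t : ℝ => Real.exp (-(b * t))) (Real.exp (-(b * t)) * (-(b * 1))) t :=
      (((hasDerivAt_id t).const_mul b).neg).exp
    exact ((hd t ht).sub (h1.const_mul (C / b))).congr_deriv (by field_simp; ring)
  have hmono : MonotoneOn f (Set.Ici 0) := by
    apply monotoneOn_of_deriv_nonneg (convex_Ici 0)
    · intro t ht; exact (hder t ht).continuousAt.continuousWithinAt
    · intro t ht; rw [interior_Ici] at ht
      exact (hder t (le_of_lt ht)).differentiableAt.differentiableWithinAt
    · intro t ht; rw [interior_Ici] at ht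
      rw [(hder t (le_of_lt ht)).deriv]
      linarith [hle t (le_of_lt ht)]
  have hexp : Tendsto (fun t : ℝ => Real.exp (-(b * t))) atTop (𝓝 0) :=
    Real.tendsto_exp_neg_atTop_nhds_zero.comp (tendsto_id.const_mul_atTop hb)
  have hlim : Tendsto f atTop (𝓝 0) := by
    have := hl.sub (hexp.const_mul (C / b))
    simpa [hf] using this
  have : f 0 ≤ 0 := by
    apply ge_of_tendsto hlim
    filter_upwards [eventually_ge_atTop (0 : ℝ)] with t ht
    exact hmono (Set.mem_Ici.mpr le_rfl) ht ht
  simp only [hf, mul_zero, neg_zero, Real.exp_zero, mul_one] at this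
  linarith

lemma abs_le_div_of_deriv_le {h h' : ℝ → ℝ} {C b : ℝ} (hb : 0 < b)
    (hd : ∀ t, 0 ≤ t → HasDerivAt h (h' t) t)
    (hle : ∀ t, 0 ≤ t → |h' t| ≤ C * Real.exp (-(b * t)))
    (hl : Tendsto h atTop (𝓝 0)) : |h 0| ≤ C / b := by
  rw [abs_le]
  constructor
  · have := le_div_of_deriv_ge (h := fun t => -h t) (h' := fun t => -h' t) (C := C) hb
      (fun t ht => (hd t ht).neg) (fun t ht => by
        have := (abs_le.mp (hle t ht)).2; linarith) (by simpa using hl.neg)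
    linarith
  · exact le_div_of_deriv_ge hb hd (fun t ht => (abs_le.mp (hle t ht)).1) hl

/-- A weighted-bounded solution of `q v' = G - v` is bounded by twice the bound of `G`,
whatever the sign of `q`. -/
lemma first_order_bound {a q K K' : ℝ} {v G : ℝ → ℝ} (haq : |a| * |q| ≤ 1 / 2)
    (hv : ∀ z, HasDerivAt (fun z => q * v z) (G z - v z) z)
    (hv' : ∀ z, |v z| ≤ K' * ew a z) (hG : ∀ z, |G z| ≤ K * ew a z) (z : ℝ) :
    |v z| ≤ 2 * K * ew a z := by
  have hK : 0 ≤ K := by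
    have := (abs_nonneg _).trans (hG 0); simpa [ew_at_zero] using this
  by_cases hq : q = 0
  · have h1 : G z - v z = 0 := by
      have h2 : HasDerivAt (fun z => q * v z) 0 z := by
        simpa [hq] using hasDerivAt_const z (0 : ℝ)
      exact (hv z).unique h2
    have : v z = G z := by linarith
    rw [this]
    have := hG z
    nlinarith [ew_pos a z]
  have hv1 : ∀ z, HasDerivAt v ((G z - v z) / q) z := by
    intro z
    have h1 := (hv z).const_mul q⁻¹
    have h2 : (fun y => q⁻¹ * (q * v y)) = v := by ext y; field_simp
    rw [h2] at h1
    exact h1.congr_deriv (by field_simp)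
  have hshift : ∀ t, 0 ≤ t → ew a (z - q * t) ≤ ew a z * Real.exp (1 / 2 * t) := by
    intro t ht
    have h1 := ew_shift a z (-(q * t))
    rw [← sub_eq_add_neg] at h1
    refine h1.trans ?_
    apply mul_le_mul_of_nonneg_left _ (ew_pos _ _).le
    apply Real.exp_le_exp.mpr
    rw [abs_neg, abs_mul, abs_of_nonneg ht]; nlinarith
  -- Along the line z - q t the damped solution has derivative -e^{-t} G. The condition on |a| |q|
  -- limits the loss of weight to e^{t/2}, so the rate 1/2 survives and produces the factor 2. The
  -- sign of `q` only decides the direction of integration.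
  have key := abs_le_div_of_deriv_le (h := fun t => Real.exp (-t) * v (z - q * t))
    (h' := fun t => -(Real.exp (-t) * G (z - q * t))) (C := K * ew a z) (b := 1 / 2)
    (by norm_num) ?_ ?_ ?_
  · simp only [neg_zero, Real.exp_zero, mul_zero, sub_zero, one_mul] at key
    linarith
  · intro t _
    have h1 : HasDerivAt (fun t : ℝ => Real.exp (-t)) (Real.exp (-t) * (-1)) t :=
      ((hasDerivAt_id t).neg).exp
    have h2 : HasDerivAt (fun t : ℝ => z - q * t) (-(q * 1)) t :=
      ((hasDerivAt_id t).const_mul q).const_sub z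
    have h3 := (hv1 (z - q * t)).comp t h2
    refine (h1.mul h3).congr_deriv ?_
    simp only [Function.comp]
    field_simp
    ring
  · intro t ht
    rw [abs_neg, abs_mul, abs_of_pos (Real.exp_pos _)]
    calc Real.exp (-t) * |G (z - q * t)| ≤ Real.exp (-t) * (K * (ew a z * Real.exp (1 / 2 * t))) := by
          gcongr; exact (hG _).trans (by gcongr; exact hshift t ht)
      _ = K * ew a z * (Real.exp (-t) * Real.exp (1 / 2 * t)) := by ring
      _ = K * ew a z * Real.exp (-(1 / 2 * t)) := by rw [← Real.exp_add]; congr 2; ring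
  · have hexp : Tendsto (fun t : ℝ => (K' * ew a z) * Real.exp (-(1 / 2 * t))) atTop (𝓝 0) := by
      have := (Real.tendsto_exp_neg_atTop_nhds_zero.comp
        (tendsto_id.const_mul_atTop (by norm_num : (0:ℝ) < 1 / 2))).const_mul (K' * ew a z)
      simpa using this
    apply squeeze_zero_norm' _ hexp
    filter_upwards [eventually_ge_atTop (0 : ℝ)] with t ht
    rw [Real.norm_eq_abs, abs_mul, abs_of_pos (Real.exp_pos _)]
    have hK' : 0 ≤ K' := by
      have := (abs_nonneg _).trans (hv' 0); simpa [ew_at_zero] using this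
    calc Real.exp (-t) * |v (z - q * t)| ≤ Real.exp (-t) * (K' * (ew a z * Real.exp (1 / 2 * t))) := by
          gcongr; exact (hv' _).trans (by gcongr; exact hshift t ht)
      _ = K' * ew a z * (Real.exp (-t) * Real.exp (1 / 2 * t)) := by ring
      _ = K' * ew a z * Real.exp (-(1 / 2 * t)) := by rw [← Real.exp_add]; congr 2; ring

/-! ### The fast second-order system -/

/-- The larger root of `p² - e p - τ e = 0`. -/
noncomputable def fastP (e τ : ℝ) : ℝ := (e + Real.sqrt (e ^ 2 + 4 * (τ * e))) / 2

/-- The other root of `p² - e p - τ e = 0`, up to sign. -/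
noncomputable def fastQ (e τ : ℝ) : ℝ := fastP e τ - e

lemma fastP_ge {e τ : ℝ} (he : 0 < e) (hτ : 0 ≤ τ) : e ≤ fastP e τ := by
  unfold fastP
  have : e ≤ Real.sqrt (e ^ 2 + 4 * (τ * e)) := by
    apply Real.le_sqrt_of_sq_le; nlinarith [mul_nonneg hτ he.le]
  linarith

lemma fastP_pos {e τ : ℝ} (he : 0 < e) (hτ : 0 ≤ τ) : 0 < fastP e τ := he.trans_le (fastP_ge he hτ)

lemma fastQ_nonneg {e τ : ℝ} (he : 0 < e) (hτ : 0 ≤ τ) : 0 ≤ fastQ e τ := by unfold fastQ; linarith [fastP_ge he hτ]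

lemma fastP_mul_fastQ {e τ : ℝ} (he : 0 < e) (hτ : 0 ≤ τ) : fastP e τ * fastQ e τ = τ * e := by
  have h := Real.sq_sqrt (show 0 ≤ e ^ 2 + 4 * (τ * e) by nlinarith [mul_nonneg hτ he.le])
  unfold fastQ fastP
  nlinarith

lemma fastP_le {e τ M : ℝ} (he : 0 < e) (h1 : e ≤ M) (h2 : τ ≤ M) : fastP e τ ≤ 2 * M := by
  unfold fastP
  have : Real.sqrt (e ^ 2 + 4 * (τ * e)) ≤ 3 * M := by
    apply Real.sqrt_le_iff.mpr ⟨by linarith, ?_⟩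
    nlinarith [mul_le_mul_of_nonneg_right h2 he.le, mul_le_mul_of_nonneg_left h1 (he.le.trans h1)]
  linarith

lemma fastQ_le {e τ M : ℝ} (he : 0 < e) (h1 : e ≤ M) (h2 : τ ≤ M) : fastQ e τ ≤ 2 * M := by
  unfold fastQ; linarith [fastP_le he h1 h2]

/-- Weighted bounds for bounded solutions of `e y' = x`, `(τ x)' = y - x - G`. -/
lemma fast_bound {a e τ M K Kx Ky : ℝ} {x y G : ℝ → ℝ} (he : 0 < e) (hτ : 0 ≤ τ)
    (heM : e ≤ M) (hτM : τ ≤ M) (haM : |a| * (2 * M) ≤ 1 / 2)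
    (hy : ∀ z, HasDerivAt y (x z / e) z)
    (hx : ∀ z, HasDerivAt (fun z => τ * x z) (y z - x z - G z) z)
    (hyb : ∀ z, |y z| ≤ Ky * ew a z) (hxb : ∀ z, |x z| ≤ Kx * ew a z)
    (hG : ∀ z, |G z| ≤ K * ew a z) (z : ℝ) :
    |y z| ≤ 4 * K * ew a z ∧ |x z| ≤ 6 * K * ew a z := by
  set p := fastP e τ with hp
  set q := fastQ e τ with hq
  have hp0 : 0 < p := fastP_pos he hτ
  have hpe : e ≤ p := fastP_ge he hτ
  have hq0 : 0 ≤ q := fastQ_nonneg he hτ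
  have hpq : p * q = τ * e := fastP_mul_fastQ he hτ
  have hqd : q = p - e := rfl
  have hpM : p ≤ 2 * M := fastP_le he heM hτM
  have hqM : q ≤ 2 * M := fastQ_le he heM hτM
  have hap : |a| * |p| ≤ 1 / 2 := by
    rw [abs_of_pos hp0]; nlinarith [abs_nonneg a]
  have haq : |a| * |q| ≤ 1 / 2 := by
    rw [abs_of_nonneg hq0]; nlinarith [abs_nonneg a]
  -- Eliminating x formally gives y - e y' - τ e y'' = G, whose operator factors as (1 - p ∂)(1 + q
  -- ∂). Here v = y - p y' is the intermediate function, with q v' = G - v, so two first-order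
  -- bounds suffice and no lower bound on e or τ enters.
  set v : ℝ → ℝ := fun z => y z - p / e * x z with hv
  have hqv : ∀ z, HasDerivAt (fun z => q * v z) (G z - v z) z := by
    intro z
    have h := ((hy z).const_mul q).sub (hx z)
    have hfun : (fun z => q * v z) = fun z => q * y z - τ * x z := by
      ext w
      simp only [hv]
      have : q * (p / e) = τ := by field_simp; linarith
      linear_combination (-(x w)) * this
    rw [hfun]
    refine h.congr_deriv ?_
    simp only [hv]
    rw [hqd]
    field_simp
    ring
  have hvb : ∀ z, |v z| ≤ 2 * K * ew a z := by
    apply first_order_bound (K' := Ky + p / e * Kx) haq hqv _ hG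
    intro z
    have h1 : |v z| ≤ |y z| + p / e * |x z| := by
      simp only [hv]
      refine (abs_sub _ _).trans ?_
      rw [abs_mul, abs_of_pos (div_pos hp0 he)]
    have h2 : p / e * |x z| ≤ p / e * (Kx * ew a z) := by
      gcongr; exact hxb z
    nlinarith [hyb z]
  have hyb2 : ∀ z, |y z| ≤ 2 * (2 * K) * ew a z := by
    apply first_order_bound (q := -p) (K' := Ky) (by rwa [abs_neg]) _ hyb hvb
    intro z
    refine ((hy z).const_mul (-p)).congr_deriv ?_
    simp only [hv]
    field_simp
    ring
  refine ⟨by linarith [hyb2 z], ?_⟩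
  have hxe : x z = e / p * (y z - v z) := by
    simp only [hv]; field_simp; ring
  have hep : e / p ≤ 1 := by rw [div_le_one hp0]; exact hpe
  calc |x z| = e / p * |y z - v z| := by
        rw [hxe, abs_mul, abs_of_pos (div_pos he hp0)]
    _ ≤ 1 * (|y z| + |v z|) := by
        gcongr
        exact abs_sub _ _
    _ ≤ 6 * K * ew a z := by linarith [hyb2 z, hvb z]

/-- A function that is finite in a weighted norm and improves every bound `K` to `C + K / 2`
is bounded by `2 C`. -/
lemma absorb {w f : ℝ → ℝ} {C K₀ : ℝ} (hw : ∀ z, 0 < w z) (h₀ : ∀ z, |f z| ≤ K₀ * w z)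
    (himp : ∀ K, 0 ≤ K → (∀ z, |f z| ≤ K * w z) → ∀ z, |f z| ≤ (C + K / 2) * w z) (z : ℝ) :
    |f z| ≤ 2 * C * w z := by
  have hK0 : 0 ≤ K₀ := by
    by_contra h; push Not at h
    have := (abs_nonneg _).trans (h₀ 0); nlinarith [hw 0]
  -- Iterating K ↦ C + K / 2 converges to the fixed point 2 C, so the starting value `K₀` is
  -- forgotten and mere finiteness becomes a quantitative bound.
  have hseq : ∀ n : ℕ, 0 ≤ 2 * C + (K₀ - 2 * C) * (1 / 2) ^ n ∧
      ∀ z, |f z| ≤ (2 * C + (K₀ - 2 * C) * (1 / 2) ^ n) * w z := by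
    intro n
    induction n with
    | zero => simpa using ⟨hK0, h₀⟩
    | succ n ih =>
      have h := himp _ ih.1 ih.2
      have heq : C + (2 * C + (K₀ - 2 * C) * (1 / 2) ^ n) / 2 =
        2 * C + (K₀ - 2 * C) * (1 / 2) ^ (n + 1) := by rw [pow_succ]; ring
      rw [heq] at h
      refine ⟨?_, h⟩
      by_contra hc; push Not at hc
      have := (abs_nonneg _).trans (h 0); nlinarith [hw 0]
  have hlim : Tendsto (fun n : ℕ => (2 * C + (K₀ - 2 * C) * (1 / 2 : ℝ) ^ n) * w z) atTop
      (𝓝 ((2 * C + (K₀ - 2 * C) * 0) * w z)) :=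
    (((tendsto_pow_atTop_nhds_zero_of_lt_one (by norm_num) (by norm_num)).const_mul _).const_add
      _).mul_const _
  have := ge_of_tendsto' hlim (fun n => (hseq n).2 z)
  simpa using this

/-! ### The slow equation -/

/-- The integrating factor removes the weight and compensates the integrable error M e^{-bz} in the
coefficient. If ± h d reached a level above the claimed constant, its derivative there would be
negative, because a < a₁; hence the level is never crossed. -/
lemma slow_bound_right {a a₁ b M K : ℝ} {d A F : ℝ → ℝ} (ha : a < a₁) (hb : 0 < b) (hM : 0 ≤ M)
    (hd : ∀ z, 0 ≤ z → HasDerivAt d (A z * d z + F z) z)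
    (hA : ∀ z, 0 ≤ z → A z ≤ -a₁ + M * Real.exp (-(b * z)))
    (hF : ∀ z, 0 ≤ z → |F z| ≤ K * Real.exp (-(a * z))) {z : ℝ} (hz : 0 ≤ z) :
    |d z| ≤ Real.exp (M / b) * (|d 0| + K / (a₁ - a)) * Real.exp (-(a * z)) := by
  have hK : 0 ≤ K := by
    have := (abs_nonneg _).trans (hF 0 le_rfl); simpa using this
  -- integrating factor
  set h : ℝ → ℝ := fun z => Real.exp (a * z + M / b * Real.exp (-(b * z))) with hh
  have hh' : ∀ z, HasDerivAt h (h z * (a - M * Real.exp (-(b * z)))) z := by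
    intro z
    have h1 : HasDerivAt (fun t : ℝ => Real.exp (-(b * t))) (Real.exp (-(b * z)) * (-(b * 1))) z :=
      (((hasDerivAt_id z).const_mul b).neg).exp
    have h2 := (((hasDerivAt_id z).const_mul a).add (h1.const_mul (M / b))).exp
    refine h2.congr_deriv ?_
    simp only [hh, id, Pi.add_apply]
    field_simp
    ring
  have hhpos : ∀ z, 0 < h z := fun z => Real.exp_pos _
  have hhle : ∀ z, 0 ≤ z → h z ≤ Real.exp (a * z) * Real.exp (M / b) := by
    intro z hz
    rw [← Real.exp_add]
    apply Real.exp_le_exp.mpr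
    have : Real.exp (-(b * z)) ≤ 1 := Real.exp_le_one_iff.mpr (by nlinarith)
    have hMb : 0 ≤ M / b := by positivity
    nlinarith
  set C := Real.exp (M / b) * (|d 0| + K / (a₁ - a)) with hC
  have hpos : 0 < a₁ - a := by linarith
  have hE : 1 ≤ Real.exp (M / b) := Real.one_le_exp (by positivity)
  suffices H : ∀ σ : ℝ, (σ = 1 ∨ σ = -1) → σ * (h z * d z) ≤ C by
    have h1 := H 1 (Or.inl rfl)
    have h2 := H (-1) (Or.inr rfl)
    have h3 : |d z| * h z ≤ C := by
      rw [← abs_of_pos (hhpos z), ← abs_mul, abs_le]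
      constructor <;> linarith
    have h4 : Real.exp (a * z) ≤ h z := by
      apply Real.exp_le_exp.mpr
      have : 0 ≤ M / b * Real.exp (-(b * z)) := by positivity
      linarith
    have h5 : |d z| * Real.exp (a * z) ≤ C :=
      (mul_le_mul_of_nonneg_left h4 (abs_nonneg _)).trans h3
    rw [Real.exp_neg, ← div_eq_mul_inv, le_div_iff₀ (Real.exp_pos _)]
    exact h5
  intro σ hσ
  have hσ2 : |σ| = 1 := by rcases hσ with rfl | rfl <;> simp
  have hσ3 : σ * σ = 1 := by rcases hσ with rfl | rfl <;> norm_num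
  -- The slack `η` makes the derivative strictly negative at a crossing, as the boundary comparison
  -- requires.
  apply le_of_forall_pos_le_add
  intro η hη
  have hcont : ContinuousOn (fun z => σ * (h z * d z)) (Set.Icc 0 z) := by
    intro t ht
    exact (((hh' t).mul (hd t ht.1)).const_mul σ).continuousAt.continuousWithinAt
  refine image_le_of_deriv_right_lt_deriv_boundary' (f := fun z => σ * (h z * d z))
    (f' := fun z => σ * (h z * (a - M * Real.exp (-(b * z))) * d z + h z * (A z * d z + F z)))
    (B := fun _ => C + η) (B' := fun _ => 0) (a := 0) (b := z) hcont ?_ ?_ ?_ ?_ ?_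
    (Set.right_mem_Icc.mpr hz)
  · intro t ht
    exact (((hh' t).mul (hd t ht.1)).const_mul σ).hasDerivWithinAt
  · have h0 : h 0 = Real.exp (M / b) := by simp [hh]
    simp only [h0, hC]
    have : σ * (Real.exp (M / b) * d 0) ≤ Real.exp (M / b) * |d 0| := by
      calc σ * (Real.exp (M / b) * d 0) ≤ |σ * (Real.exp (M / b) * d 0)| := le_abs_self _
        _ = Real.exp (M / b) * |d 0| := by
          rw [abs_mul, hσ2, abs_mul, abs_of_pos (Real.exp_pos _)]; ring
    have h2 : 0 ≤ Real.exp (M / b) * (K / (a₁ - a)) := by positivity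
    nlinarith
  · exact continuousOn_const
  · intro t _
    exact hasDerivWithinAt_const _ _ _
  · intro t ht heq
    have hCeq : σ * (h t * d t) = C + η := heq
    have hA' := hA t ht.1
    have hF' : σ * (h t * F t) ≤ Real.exp (M / b) * K := by
      calc σ * (h t * F t) ≤ |σ * (h t * F t)| := le_abs_self _
        _ = h t * |F t| := by rw [abs_mul, hσ2, abs_mul, abs_of_pos (hhpos t)]; ring
        _ ≤ (Real.exp (a * t) * Real.exp (M / b)) * (K * Real.exp (-(a * t))) := by
          gcongr
          · exact hhle t ht.1
          · exact hF t ht.1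
        _ = Real.exp (M / b) * K * (Real.exp (a * t) * Real.exp (-(a * t))) := by ring
        _ = Real.exp (M / b) * K := by rw [← Real.exp_add]; simp
    have hC2 : Real.exp (M / b) * K ≤ (a₁ - a) * C := by
      have : (a₁ - a) * C = Real.exp (M / b) * (|d 0| * (a₁ - a) + K) := by
        rw [hC]; field_simp
      rw [this]
      have := mul_nonneg (abs_nonneg (d 0)) hpos.le
      gcongr
      linarith
    have hC0 : 0 ≤ C := by positivity
    have e1 : σ * (h t * (a - M * Real.exp (-(b * t))) * d t + h t * (A t * d t + F t))
        = (a - M * Real.exp (-(b * t)) + A t) * (C + η) + σ * (h t * F t) := by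
      rw [← hCeq]; ring
    rw [e1]
    have e2 : (a - M * Real.exp (-(b * t)) + A t) * (C + η) ≤ (a - a₁) * (C + η) := by
      apply mul_le_mul_of_nonneg_right _ (by linarith)
      linarith
    nlinarith

/-- Bounds for a scalar linear equation whose coefficient is close to `∓ a₁` at `± ∞`. -/
lemma slow_bound {a a₁ b M K : ℝ} {d A F : ℝ → ℝ} (ha : a < a₁) (hb : 0 < b) (hM : 0 ≤ M)
    (hd : ∀ z, HasDerivAt d (A z * d z + F z) z)
    (hA : ∀ z, 0 ≤ z → A z ≤ -a₁ + M * ew b z) (hA' : ∀ z, z ≤ 0 → a₁ - M * ew b z ≤ A z)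
    (hF : ∀ z, |F z| ≤ K * ew a z) (z : ℝ) :
    |d z| ≤ Real.exp (M / b) * (|d 0| + K / (a₁ - a)) * ew a z := by
  rcases le_total 0 z with hz | hz
  · rw [ew_of_nonneg a hz]
    refine slow_bound_right ha hb hM (fun z _ => hd z) (A := A) (F := F) ?_ ?_ hz
    · intro z hz; rw [← ew_of_nonneg b hz]; exact hA z hz
    · intro z hz; rw [← ew_of_nonneg a hz]; exact hF z
  · have h := slow_bound_right (d := fun z => d (-z)) (A := fun z => -A (-z))
      (F := fun z => -F (-z)) (K := K) ha hb hM ?_ ?_ ?_ (neg_nonneg.mpr hz)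
    · rw [ew_of_nonpos a hz]
      simpa using h
    · intro t _
      refine ((hd (-t)).comp t (hasDerivAt_neg t)).congr_deriv ?_
      ring
    · intro t ht
      have := hA' (-t) (by linarith)
      rw [ew_neg_arg, ew_of_nonneg b ht] at this
      linarith
    · intro t ht
      have := hF (-t)
      rw [ew_neg_arg, ew_of_nonneg a ht] at this
      simpa using this

/-- A function vanishing at `± ∞` inherits the decay of its derivative. -/
lemma bound_of_deriv_bound {a K : ℝ} {f f' : ℝ → ℝ} (ha : 0 < a)
    (hf : ∀ z, HasDerivAt f (f' z) z) (hf' : ∀ z, |f' z| ≤ K * ew a z)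
    (hl : Tendsto f atBot (𝓝 0)) (hr : Tendsto f atTop (𝓝 0)) (z : ℝ) :
    |f z| ≤ K / a * ew a z := by
  rcases le_total 0 z with hz | hz
  · have := abs_le_div_of_deriv_le (h := fun t => f (z + t)) (h' := fun t => f' (z + t))
      (C := K * ew a z) ha ?_ ?_ ?_
    · simp only [add_zero] at this
      rw [div_mul_eq_mul_div]; exact this
    · intro t _
      exact (hf (z + t)).comp_const_add z t
    · intro t ht
      refine (hf' _).trans (le_of_eq ?_)
      rw [ew_of_nonneg a hz, ew_of_nonneg a (add_nonneg hz ht), mul_assoc, ← Real.exp_add]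
      congr 2; ring
    · exact hr.comp (tendsto_atTop_add_const_left _ _ tendsto_id)
  · have := abs_le_div_of_deriv_le (h := fun t => f (z - t)) (h' := fun t => -f' (z - t))
      (C := K * ew a z) ha ?_ ?_ ?_
    · simp only [sub_zero] at this
      rw [div_mul_eq_mul_div]; exact this
    · intro t _
      exact (hf (z - t)).comp_const_sub z t
    · intro t ht
      rw [abs_neg]
      refine (hf' _).trans (le_of_eq ?_)
      rw [ew_of_nonpos a hz, ew_of_nonpos a (by linarith : z - t ≤ 0), mul_assoc, ← Real.exp_add]
      congr 2; ring
    · exact hl.comp (tendsto_atBot_add_const_left _ z tendsto_neg_atTop_atBot |>.congr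
        (fun t => by simp [sub_eq_add_neg]))

end IonShock

namespace IonShock

/-! ### Families of functions with uniformly decaying derivatives -/

/-- Uniform bounds `|f_i^{(k)}(z)| ≤ C_k e^{-a|z|}` for `k ≤ n`. -/
def DecB {ι : Type*} (a : ℝ) : ℕ → (ι → ℝ → ℝ) → Prop
  | 0, f => ∃ C, ∀ i z, |f i z| ≤ C * ew a z
  | n + 1, f => (∃ C, ∀ i z, |f i z| ≤ C * ew a z) ∧ DecB a n (fun i => deriv (f i))

/-- A family of smooth functions whose derivatives up to order `n` are bounded by multiples of
`e^{-a|z|}`, uniformly in the index. -/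
def Dec {ι : Type*} (a : ℝ) (n : ℕ) (f : ι → ℝ → ℝ) : Prop :=
  (∀ i, ContDiff ℝ ∞ (f i)) ∧ DecB a n f

/-- A bounded family of constants. -/
def Bd {ι : Type*} (c : ι → ℝ) : Prop := ∃ C, ∀ i, |c i| ≤ C

variable {ι : Type*} {a b : ℝ} {n : ℕ} {f g : ι → ℝ → ℝ} {c c' : ι → ℝ}

lemma contDiff_deriv {f : ℝ → ℝ} (h : ContDiff ℝ ∞ f) : ContDiff ℝ ∞ (deriv f) :=
  (contDiff_infty_iff_deriv.mp h).2

lemma contDiff_hasDerivAt {f : ℝ → ℝ} (h : ContDiff ℝ ∞ f) (z : ℝ) :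
    HasDerivAt f (deriv f z) z :=
  ((contDiff_infty_iff_deriv.mp h).1 z).hasDerivAt

lemma Bd.const (r : ℝ) : Bd (fun _ : ι => r) := ⟨|r|, fun _ => le_rfl⟩

lemma Bd.neg (h : Bd c) : Bd (fun i => -c i) := by
  obtain ⟨C, hC⟩ := h
  exact ⟨C, fun i => by rw [abs_neg]; exact hC i⟩

lemma Bd.mul (h : Bd c) (h' : Bd c') : Bd (fun i => c i * c' i) := by
  obtain ⟨C, hC⟩ := h
  obtain ⟨C', hC'⟩ := h'
  exact ⟨C * C', fun i => by
    rw [abs_mul]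
    exact mul_le_mul (hC i) (hC' i) (abs_nonneg _) ((abs_nonneg _).trans (hC i))⟩

lemma Dec.smooth (h : Dec a n f) (i : ι) : ContDiff ℝ ∞ (f i) := h.1 i

lemma DecB.bound (h : DecB a n f) : ∃ C, ∀ i z, |f i z| ≤ C * ew a z := by
  cases n with
  | zero => exact h
  | succ n => exact h.1

lemma Dec.bound (h : Dec a n f) : ∃ C, ∀ i z, |f i z| ≤ C * ew a z := h.2.bound

lemma Dec.bound' (h : Dec a n f) : ∃ C, 0 < C ∧ ∀ i z, |f i z| ≤ C * ew a z := by
  obtain ⟨C, hC⟩ := h.bound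
  refine ⟨|C| + 1, by positivity, fun i z => (hC i z).trans ?_⟩
  have := ew_pos a z
  gcongr
  linarith [le_abs_self C]

lemma dec_zero (hs : ∀ i, ContDiff ℝ ∞ (f i)) {C : ℝ} (h : ∀ i z, |f i z| ≤ C * ew a z) :
    Dec a 0 f := ⟨hs, C, h⟩

lemma Dec.deriv (h : Dec a (n + 1) f) : Dec a n (fun i => deriv (f i)) :=
  ⟨fun i => contDiff_deriv (h.1 i), h.2.2⟩

lemma dec_succ (h : Dec a 0 f) (h' : Dec a n (fun i => _root_.deriv (f i))) :
    Dec a (n + 1) f := ⟨h.1, h.2, h'.2⟩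

lemma Dec.pred (h : Dec a (n + 1) f) : Dec a n f := by
  induction n generalizing f with
  | zero => exact ⟨h.1, h.2.1⟩
  | succ n ih => exact dec_succ ⟨h.1, h.2.1⟩ (ih h.deriv)

lemma Dec.mono (h : Dec a n f) (hab : b ≤ a) : Dec b n f := by
  have h0 : ∀ {f : ι → ℝ → ℝ}, (∃ C, ∀ i z, |f i z| ≤ C * ew a z) →
      ∃ C, ∀ i z, |f i z| ≤ C * ew b z := by
    rintro f ⟨C, hC⟩
    refine ⟨|C|, fun i z => (hC i z).trans ?_⟩
    have := ew_anti hab z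
    have := ew_pos a z
    exact mul_le_mul (le_abs_self _) (ew_anti hab z) this.le (abs_nonneg _)
  induction n generalizing f with
  | zero => exact ⟨h.1, h0 h.2⟩
  | succ n ih => exact dec_succ ⟨h.1, h0 h.2.1⟩ (ih h.deriv)

lemma Dec.add (hf : Dec a n f) (hg : Dec a n g) : Dec a n (fun i z => f i z + g i z) := by
  have h0 : ∀ {f g : ι → ℝ → ℝ} {n : ℕ}, Dec a n f → Dec a n g →
      Dec a 0 (fun i z => f i z + g i z) := by
    intro f g n hf hg
    obtain ⟨C, hC⟩ := hf.bound
    obtain ⟨C', hC'⟩ := hg.bound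
    refine ⟨fun i => (hf.1 i).add (hg.1 i), C + C', fun i z => (abs_add_le _ _).trans ?_⟩
    rw [add_mul]
    exact add_le_add (hC i z) (hC' i z)
  induction n generalizing f g with
  | zero => exact h0 hf hg
  | succ n ih =>
    refine dec_succ (h0 hf hg) ?_
    have := ih hf.deriv hg.deriv
    convert this using 3 with i z
    exact ((contDiff_hasDerivAt (hf.1 i) z).add (contDiff_hasDerivAt (hg.1 i) z)).deriv

lemma Dec.mul (hf : Dec a n f) (hg : Dec b n g) : Dec (a + b) n (fun i z => f i z * g i z) := by
  have h0 : ∀ {f g : ι → ℝ → ℝ} {n : ℕ}, Dec a n f → Dec b n g →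
      Dec (a + b) 0 (fun i z => f i z * g i z) := by
    intro f g n hf hg
    obtain ⟨C, hC⟩ := hf.bound
    obtain ⟨C', hC'⟩ := hg.bound
    refine ⟨fun i => (hf.1 i).mul (hg.1 i), C * C', fun i z => ?_⟩
    rw [abs_mul, ← ew_mul]
    calc |f i z| * |g i z| ≤ (C * ew a z) * (C' * ew b z) :=
          mul_le_mul (hC i z) (hC' i z) (abs_nonneg _) ((abs_nonneg _).trans (hC i z))
      _ = C * C' * (ew a z * ew b z) := by ring
  induction n generalizing f g with
  | zero => exact h0 hf hg
  | succ n ih =>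
    refine dec_succ (h0 hf hg) ?_
    have := (ih hf.deriv hg.pred).add (ih hf.pred hg.deriv)
    convert this using 3 with i z
    exact ((contDiff_hasDerivAt (hf.1 i) z).mul (contDiff_hasDerivAt (hg.1 i) z)).deriv

lemma Dec.mul_bdd (hf : Dec a n f) (hg : Dec 0 n g) : Dec a n (fun i z => f i z * g i z) := by
  simpa using hf.mul hg

lemma Dec.bdd_mul (hf : Dec 0 n f) (hg : Dec a n g) : Dec a n (fun i z => f i z * g i z) := by
  simpa using hf.mul hg

lemma dec_const (hc : Bd c) : Dec 0 n (fun i _ => c i) := by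
  induction n generalizing c with
  | zero =>
    obtain ⟨C, hC⟩ := hc
    exact ⟨fun i => contDiff_const, C, fun i z => by rw [ew_zero, mul_one]; exact hC i⟩
  | succ n ih =>
    obtain ⟨C, hC⟩ := hc
    refine dec_succ ⟨fun i => contDiff_const, C, fun i z => by
      rw [ew_zero, mul_one]; exact hC i⟩ ?_
    simp only [deriv_const']
    exact ih (Bd.const 0)

lemma Dec.smul (hc : Bd c) (hf : Dec a n f) : Dec a n (fun i z => c i * f i z) :=
  (dec_const hc).bdd_mul hf

lemma Dec.neg (hf : Dec a n f) : Dec a n (fun i z => -f i z) := by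
  simpa using hf.smul (Bd.const (-1))

lemma Dec.sub (hf : Dec a n f) (hg : Dec a n g) : Dec a n (fun i z => f i z - g i z) := by
  simpa only [sub_eq_add_neg] using hf.add hg.neg

lemma Dec.const_sub (hc : Bd c) (hf : Dec 0 n f) : Dec 0 n (fun i z => c i - f i z) :=
  (dec_const hc).sub hf

lemma Dec.inv (hf : Dec 0 n f) {r : ℝ} (hr : 0 < r) (h : ∀ i z, r ≤ f i z) :
    Dec 0 n (fun i z => (f i z)⁻¹) := by
  have hne : ∀ i z, f i z ≠ 0 := fun i z => (hr.trans_le (h i z)).ne'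
  have hs : ∀ i, ContDiff ℝ ∞ (fun z => (f i z)⁻¹) := fun i => (hf.1 i).inv (hne i)
  have h0 : Dec 0 0 (fun i z => (f i z)⁻¹) := by
    refine ⟨hs, r⁻¹, fun i z => ?_⟩
    rw [ew_zero, mul_one, abs_inv, abs_of_pos (hr.trans_le (h i z))]
    exact inv_anti₀ hr (h i z)
  induction n with
  | zero => exact h0
  | succ n ih =>
    refine dec_succ h0 ?_
    have hi := ih hf.pred
    have := ((hf.deriv.mul_bdd hi).mul_bdd hi).neg
    convert this using 3 with i z
    refine ((contDiff_hasDerivAt (hf.1 i) z).fun_inv (hne i z)).deriv.trans ?_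
    field_simp

lemma Dec.congr (hf : Dec a n f) (h : ∀ i z, g i z = f i z) : Dec a n g := by
  have : g = f := by ext i z; exact h i z
  rwa [this]

lemma Dec.iteratedDeriv_bound (hf : Dec a n f) :
    ∃ C, ∀ i z, |iteratedDeriv n (f i) z| ≤ C * ew a z := by
  induction n generalizing f with
  | zero => simpa using hf.bound
  | succ n ih => simpa only [iteratedDeriv_succ'] using ih hf.deriv

lemma Dec.reindex {κ : Type*} (hf : Dec a n f) (r : κ → ι) : Dec a n (fun i => f (r i)) := by
  induction n generalizing f with
  | zero =>
    obtain ⟨C, hC⟩ := hf.bound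
    exact ⟨fun i => hf.1 _, C, fun i z => hC _ _⟩
  | succ n ih =>
    obtain ⟨C, hC⟩ := hf.bound
    exact dec_succ ⟨fun i => hf.1 _, C, fun i z => hC _ _⟩ (ih hf.deriv)

/-- A function whose derivative decays and which vanishes at `± ∞` decays. -/
lemma dec_of_deriv (ha : 0 < a) (hs : ∀ i, ContDiff ℝ ∞ (f i))
    (hd : Dec a n (fun i => deriv (f i))) (hl : ∀ i, Tendsto (f i) atBot (𝓝 0))
    (hr : ∀ i, Tendsto (f i) atTop (𝓝 0)) : Dec a (n + 1) f := by
  obtain ⟨C, hC⟩ := hd.bound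
  exact dec_succ (dec_zero hs (C := C / a) fun i z =>
    bound_of_deriv_bound ha (contDiff_hasDerivAt (hs i)) (hC i) (hl i) (hr i) z) hd

/-! ### Uniform bounds for linear systems -/

/-- Uniform bounds for all derivatives of solutions of the fast linear system
`e y' = x`, `(τ x)' = y - x - h - β x - γ y` with small coefficients `β`, `γ`. -/
lemma fast_dec {e τ : ι → ℝ} {M : ℝ} {x y h β γ : ι → ℝ → ℝ}
    (he : ∀ i, 0 < e i) (hτ : ∀ i, 0 ≤ τ i) (heM : ∀ i, e i ≤ M) (hτM : ∀ i, τ i ≤ M)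
    (haM : |a| * (2 * M) ≤ 1 / 2) (hβ : Dec 0 n β) (hγ : Dec 0 n γ)
    (hβB : ∀ i z, |β i z| ≤ 1 / 24) (hγB : ∀ i z, |γ i z| ≤ 1 / 24) (hh : Dec a n h)
    (hxs : ∀ i, ContDiff ℝ ∞ (x i)) (hys : ∀ i, ContDiff ℝ ∞ (y i))
    (hy : ∀ i z, deriv (y i) z = x i z / e i)
    (hx : ∀ i z, τ i * deriv (x i) z =
      y i z - x i z - (h i z + (β i z * x i z + γ i z * y i z)))
    (hqx : ∀ i, Dec a n (fun _ : Unit => x i)) (hqy : ∀ i, Dec a n (fun _ : Unit => y i)) :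
    Dec a n x ∧ Dec a n y := by
  have base : ∀ {n : ℕ} {x y h : ι → ℝ → ℝ}, Dec a n h →
      (∀ i, ContDiff ℝ ∞ (x i)) → (∀ i, ContDiff ℝ ∞ (y i)) →
      (∀ i z, deriv (y i) z = x i z / e i) →
      (∀ i z, τ i * deriv (x i) z =
        y i z - x i z - (h i z + (β i z * x i z + γ i z * y i z))) →
      (∀ i, Dec a n (fun _ : Unit => x i)) → (∀ i, Dec a n (fun _ : Unit => y i)) →
      Dec a 0 x ∧ Dec a 0 y := by
    intro n x y h hh hxs hys hy hx hqx hqy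
    obtain ⟨H, hH0, hH⟩ := hh.bound'
    have key : ∀ i z, |x i z| ≤ 2 * (6 * H) * ew a z ∧ |y i z| ≤ 2 * (6 * H) * ew a z := by
      intro i
      obtain ⟨Kx, hKx0, hKx⟩ := (hqx i).bound'
      obtain ⟨Ky, hKy0, hKy⟩ := (hqy i).bound'
      -- The coefficients are at most 1/24, so the two small terms add K / 12 to the source.
      -- `fast_bound` multiplies the source by at most 6, which leaves exactly the K / 2 that
      -- `absorb` tolerates.
      have imp : ∀ K : ℝ, 0 ≤ K → (∀ z, |(max |x i z| |y i z|)| ≤ K * ew a z) →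
          ∀ z, |(max |x i z| |y i z|)| ≤ (6 * H + K / 2) * ew a z := by
        intro K hK hb z
        have hbx : ∀ z, |x i z| ≤ K * ew a z := fun z =>
          ((le_max_left _ _).trans (le_abs_self _)).trans (hb z)
        have hby : ∀ z, |y i z| ≤ K * ew a z := fun z =>
          ((le_max_right _ _).trans (le_abs_self _)).trans (hb z)
        have hG : ∀ z, |h i z + (β i z * x i z + γ i z * y i z)| ≤
            (H + K / 12) * ew a z := by
          intro z
          have e1 : |β i z * x i z| ≤ 1 / 24 * (K * ew a z) := by
            rw [abs_mul]; exact mul_le_mul (hβB i z) (hbx z) (abs_nonneg _) (by norm_num)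
          have e2 : |γ i z * y i z| ≤ 1 / 24 * (K * ew a z) := by
            rw [abs_mul]; exact mul_le_mul (hγB i z) (hby z) (abs_nonneg _) (by norm_num)
          have e3 := abs_add_le (β i z * x i z) (γ i z * y i z)
          have e4 := abs_add_le (h i z) (β i z * x i z + γ i z * y i z)
          linarith [hH i z]
        have := fast_bound (he i) (hτ i) (heM i) (hτM i) haM
          (fun z => by rw [← hy i z]; exact contDiff_hasDerivAt (hys i) z)
          (fun z => by rw [← hx i z]; exact (contDiff_hasDerivAt (hxs i) z).const_mul (τ i))
          (hKy ()) (hKx ()) hG z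
        have hw := ew_pos a z
        have hKw : 0 ≤ K * ew a z := by positivity
        have hHw : 0 ≤ H * ew a z := by positivity
        rw [abs_of_nonneg ((abs_nonneg _).trans (le_max_left _ _))]
        apply max_le
        · exact this.2.trans (by linarith)
        · exact this.1.trans (by linarith)
      have := absorb (fun z => ew_pos a z) (K₀ := Kx + Ky) (fun z => by
        rw [abs_of_nonneg ((abs_nonneg _).trans (le_max_left _ _))]
        have h1 := hKx () z
        have h2 := hKy () z
        have hw := ew_pos a z
        apply max_le <;> nlinarith [mul_pos hKx0 hw, mul_pos hKy0 hw]) imp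
      intro z
      have h1 := this z
      rw [abs_of_nonneg ((abs_nonneg _).trans (le_max_left _ _))] at h1
      exact ⟨(le_max_left _ _).trans h1, (le_max_right _ _).trans h1⟩
    exact ⟨dec_zero hxs fun i z => (key i z).1, dec_zero hys fun i z => (key i z).2⟩
  induction n generalizing x y h with
  | zero => exact base hh hxs hys hy hx hqx hqy
  | succ n ih =>
    have ihxy := ih hβ.pred hγ.pred hh.pred hxs hys hy hx (fun i => (hqx i).pred)
      (fun i => (hqy i).pred)
    have h0 := base hh hxs hys hy hx hqx hqy
    -- The differentiated system has the same form and the same β, γ; the terms in β' and γ' go into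
    -- the source and are controlled at the previous order.
    have hstep := ih (x := fun i => deriv (x i)) (y := fun i => deriv (y i))
      (h := fun i z => deriv (h i) z + (deriv (β i) z * x i z + deriv (γ i) z * y i z))
      hβ.pred hγ.pred
      (hh.deriv.add ((hβ.deriv.bdd_mul ihxy.1).add (hγ.deriv.bdd_mul ihxy.2)))
      (fun i => contDiff_deriv (hxs i)) (fun i => contDiff_deriv (hys i)) ?_ ?_
      (fun i => (hqx i).deriv) (fun i => (hqy i).deriv)
    · exact ⟨dec_succ h0.1 hstep.1, dec_succ h0.2 hstep.2⟩
    · intro i z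
      have : deriv (y i) = fun z => x i z / e i := by ext z; exact hy i z
      rw [this]
      simp
    · intro i z
      have e1 : (fun z => τ i * deriv (x i) z) = fun z =>
        y i z - x i z - (h i z + (β i z * x i z + γ i z * y i z)) := by ext z; exact hx i z
      have d1 := ((contDiff_hasDerivAt (contDiff_deriv (hxs i)) z).const_mul (τ i))
      rw [e1] at d1
      have dx := contDiff_hasDerivAt (hxs i) z
      have dy := contDiff_hasDerivAt (hys i) z
      have d2 := ((dy.fun_sub dx).fun_sub ((contDiff_hasDerivAt (hh.1 i) z).fun_add
        (((contDiff_hasDerivAt (hβ.1 i) z).fun_mul dx).fun_add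
          ((contDiff_hasDerivAt (hγ.1 i) z).fun_mul dy))))
      rw [d1.unique d2]
      ring

end IonShock

/-! ### Uniform bounds for the linearised KdV-Burgers equation. -/

namespace IonShock

/-- Bound for solutions of `E - e E' = h`, in the class `Dec`. -/
lemma resolvent_dec {ι : Type*} {a M : ℝ} {n : ℕ} {e : ι → ℝ} {E h : ι → ℝ → ℝ}
    (he : ∀ i, 0 < e i) (heM : ∀ i, e i ≤ M) (haM : |a| * (2 * M) ≤ 1 / 2)
    (hh : Dec a n h) (hE : ∀ i, ContDiff ℝ ∞ (E i))
    (heq : ∀ i z, E i z - e i * deriv (E i) z = h i z)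
    (hq : ∀ i, Dec a (n + 1) (fun _ : Unit => E i)) : Dec a n E := by
  -- Nonnegativity of `M` is read off from some index, so the empty family is treated apart.
  rcases isEmpty_or_nonempty ι with hι | ⟨⟨i₀⟩⟩
  · have h0 : (fun i => E i) = h := by ext i; exact hι.elim i
    have : E = h := h0
    rwa [this]
  have hM : 0 ≤ M := (he i₀).le.trans (heM i₀)
  have hz : Dec 0 n (fun (_ : ι) (_ : ℝ) => (0 : ℝ)) := dec_const (Bd.const 0)
  -- For τ = 0 the fast system degenerates to x = e E' and y - x = h, which is the resolvent
  -- equation.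
  refine (fast_dec (e := e) (τ := fun _ => 0) (x := fun i z => e i * deriv (E i) z) (y := E)
    (β := fun _ _ => 0) (γ := fun _ _ => 0) (h := h) he (fun _ => le_rfl) heM (fun _ => hM)
    haM hz hz (by simp) (by simp) hh (fun i => contDiff_const.mul (contDiff_deriv (hE i))) hE
    ?_ ?_ ?_ ?_).2
  · intro i z; have := (he i).ne'; field_simp
  · intro i z; simp only [zero_mul, add_zero, ← heq i z]; ring
  · intro i; exact (hq i).deriv.smul (Bd.const (e i))
  · intro i; exact (hq i).pred

/-- The second derivative is a singular perturbation, but a solution of finite weighted size does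
not see the fast growing mode: D' - e D'' = A D + R bounds D', and its derivative bounds D'', in
terms of D with constants independent of e. Then e D'' is a small source in the slow equation and is
absorbed. Higher derivatives follow by inverting 1 - e ∂ again. -/
lemma linear_kdv_dec {a a₁ b M A₀ A₁ : ℝ} (ha : 0 ≤ a) (ha₁ : a < a₁) (hb : 0 < b) (hM : 0 ≤ M)
    (hA₀ : 0 ≤ A₀) (hA₁ : 0 ≤ A₁) :
    ∃ e₀ > 0, ∀ {ι : Type} (e : ι → ℝ) (D A R : ι → ℝ → ℝ), (∀ i, 0 < e i) → (∀ i, e i ≤ e₀) →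
      (∀ n, Dec 0 n A) → (∀ i z, |A i z| ≤ A₀) → (∀ i z, |deriv (A i) z| ≤ A₁) →
      (∀ i z, 0 ≤ z → A i z ≤ -a₁ + M * ew b z) → (∀ i z, z ≤ 0 → a₁ - M * ew b z ≤ A i z) →
      (∀ n, Dec a n R) →
      (∀ i z, deriv (D i) z = A i z * D i z + e i * deriv (deriv (D i)) z + R i z) →
      Bd (fun i => D i 0) → (∀ i n, Dec a n (fun _ : Unit => D i)) → ∀ n, Dec a n D := by
  set Cs : ℝ := Real.exp (M / b) / (a₁ - a) with hCs
  have ha1a : 0 < a₁ - a := by linarith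
  have hCs0 : 0 < Cs := by positivity
  -- `Q` dominates the factor with which D re-enters its own bound through e D''. The second
  -- threshold for e ensures e Q ≤ 1/2, the condition for absorption.
  set Q : ℝ := Cs * (4 * (A₁ + A₀ * (4 * A₀))) with hQ
  have hQ0 : 0 ≤ Q := by positivity
  refine ⟨min (1 / (4 * (a + 1))) (1 / (2 * (Q + 1))), by positivity, ?_⟩
  intro ι e D A R he hee hA hAb hAb' hAr hAl hR hD hD0 hq
  set e₀ := min (1 / (4 * (a + 1))) (1 / (2 * (Q + 1))) with he₀
  have hae : |a| * (2 * e₀) ≤ 1 / 2 := by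
    have h1 : e₀ ≤ 1 / (4 * (a + 1)) := min_le_left _ _
    rw [le_div_iff₀ (by positivity)] at h1
    rw [abs_of_nonneg ha]
    have : 0 < e₀ := by positivity
    nlinarith
  have heQ : ∀ i, e i * Q ≤ 1 / 2 := by
    intro i
    have h1 : e i ≤ 1 / (2 * (Q + 1)) := (hee i).trans (min_le_right _ _)
    rw [le_div_iff₀ (by positivity)] at h1
    nlinarith [he i]
  have hDs : ∀ i, ContDiff ℝ ∞ (D i) := fun i => (hq i 0).1 ()
  have hEs : ∀ i, ContDiff ℝ ∞ (deriv (D i)) := fun i => contDiff_deriv (hDs i)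
  have hEs' : ∀ i, ContDiff ℝ ∞ (deriv (deriv (D i))) := fun i => contDiff_deriv (hEs i)
  have hE' : ∀ i z, deriv (D i) z - e i * deriv (deriv (D i)) z = A i z * D i z + R i z := by
    intro i z; linarith [hD i z]
  have hfo : ∀ {i : ι} {E h : ℝ → ℝ} {K : ℝ}, ContDiff ℝ ∞ E →
      (∀ z, E z - e i * deriv E z = h z) → Dec a 0 (fun _ : Unit => E) →
      (∀ z, |h z| ≤ K * ew a z) → ∀ z, |E z| ≤ 2 * K * ew a z := by
    intro i E h K hEs hEe hEq hh
    obtain ⟨K', hK'⟩ := hEq.bound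
    refine first_order_bound (q := -e i) ?_ ?_ (hK' ()) hh
    · rw [abs_neg, abs_of_pos (he i)]
      have := hee i
      nlinarith [abs_nonneg a]
    · intro z
      refine ((contDiff_hasDerivAt hEs z).const_mul (-e i)).congr_deriv ?_
      linarith [hEe z]
  have h0 : Dec a 0 D := by
    obtain ⟨R0, hR00, hR0⟩ := (hR 0).bound'
    obtain ⟨R1, hR10, hR1⟩ := (hR 1).deriv.bound'
    obtain ⟨D0, hD0⟩ := hD0
    refine dec_zero hDs (C := 2 * (Real.exp (M / b) * D0 + Cs * (R0 + e₀ * (4 * (A₀ * (4 * R0) + R1)))))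
      fun i => ?_
    obtain ⟨K₀, hK₀⟩ := (hq i 0).bound
    refine absorb (fun z => ew_pos a z) (hK₀ ()) ?_
    intro K hK hDK
    have b1 : ∀ z, |deriv (D i) z| ≤ 2 * (A₀ * K + R0) * ew a z := by
      refine hfo (hEs i) (hE' i) (hq i 1).deriv ?_
      intro z
      calc |A i z * D i z + R i z| ≤ |A i z| * |D i z| + |R i z| := by
            rw [← abs_mul]; exact abs_add_le _ _
        _ ≤ A₀ * (K * ew a z) + R0 * ew a z := by
            have := mul_le_mul (hAb i z) (hDK z) (abs_nonneg _) hA₀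
            linarith [hR0 i z]
        _ = _ := by ring
    have b2 : ∀ z, |deriv (deriv (D i)) z| ≤
        2 * (A₁ * K + A₀ * (2 * (A₀ * K + R0)) + R1) * ew a z := by
      refine hfo (i := i) (h := fun z => deriv (A i) z * D i z + A i z * deriv (D i) z
        + deriv (R i) z) (hEs' i) ?_ (hq i 2).deriv.deriv ?_
      · intro z
        have e1 : (fun z => deriv (D i) z - e i * deriv (deriv (D i)) z) =
          fun z => A i z * D i z + R i z := by ext z; exact hE' i z
        have d1 := (contDiff_hasDerivAt (hEs i) z).fun_sub
          ((contDiff_hasDerivAt (hEs' i) z).const_mul (e i))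
        rw [e1] at d1
        exact d1.unique (((contDiff_hasDerivAt ((hA 0).1 i) z).fun_mul
          (contDiff_hasDerivAt (hDs i) z)).fun_add (contDiff_hasDerivAt ((hR 0).1 i) z))
      · intro z
        have t1 := mul_le_mul (hAb' i z) (hDK z) (abs_nonneg _) hA₁
        have t2 := mul_le_mul (hAb i z) (b1 z) (abs_nonneg _) hA₀
        calc _ ≤ |deriv (A i) z * D i z + A i z * deriv (D i) z| + |deriv (R i) z| :=
              abs_add_le _ _
          _ ≤ |deriv (A i) z| * |D i z| + |A i z| * |deriv (D i) z| + |deriv (R i) z| := by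
              rw [← abs_mul, ← abs_mul]; gcongr; exact abs_add_le _ _
          _ ≤ A₁ * (K * ew a z) + A₀ * (2 * (A₀ * K + R0) * ew a z) + R1 * ew a z := by
              linarith [hR1 i z]
          _ = _ := by ring
    have b3 : ∀ z, |e i * deriv (deriv (D i)) z + R i z| ≤
        (e i * (2 * (A₁ * K + A₀ * (2 * (A₀ * K + R0)) + R1)) + R0) * ew a z := by
      intro z
      have t := mul_le_mul_of_nonneg_left (b2 z) (he i).le
      calc _ ≤ |e i * deriv (deriv (D i)) z| + |R i z| := abs_add_le _ _
        _ ≤ e i * (2 * (A₁ * K + A₀ * (2 * (A₀ * K + R0)) + R1) * ew a z) + R0 * ew a z := by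
            rw [abs_mul, abs_of_pos (he i)]; linarith [hR0 i z]
        _ = _ := by ring
    intro z
    refine (slow_bound ha₁ hb hM (F := fun z => e i * deriv (deriv (D i)) z + R i z)
      (fun z => (contDiff_hasDerivAt (hDs i) z).congr_deriv (by rw [hD i z]; ring))
      (hAr i) (hAl i) b3 z).trans ?_
    apply mul_le_mul_of_nonneg_right _ (ew_pos a z).le
    have s1 : Real.exp (M / b) * (|D i 0| +
        (e i * (2 * (A₁ * K + A₀ * (2 * (A₀ * K + R0)) + R1)) + R0) / (a₁ - a)) =
        Real.exp (M / b) * |D i 0| +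
        Cs * (e i * (2 * (A₁ * K + A₀ * (2 * (A₀ * K + R0)) + R1)) + R0) := by
      rw [hCs]; ring
    rw [s1]
    have s2 : Real.exp (M / b) * |D i 0| ≤ Real.exp (M / b) * D0 := by
      have := hD0 i; gcongr
    have s3 : Cs * (e i * (2 * (A₁ * K + A₀ * (2 * (A₀ * K))))) ≤ K / 2 := by
      have : Cs * (e i * (2 * (A₁ * K + A₀ * (2 * (A₀ * K))))) ≤ (e i * Q) * K := by
        rw [hQ]
        have h1 : 0 ≤ Cs * e i * K := mul_nonneg (mul_nonneg hCs0.le (he i).le) hK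
        have h2 : 0 ≤ 2 * A₁ + A₀ * (12 * A₀) := by positivity
        nlinarith [mul_nonneg h1 h2]
      nlinarith [heQ i]
    have s4 : Cs * (e i * (2 * (A₀ * (2 * R0) + R1)) + R0) ≤
        Cs * (R0 + e₀ * (4 * (A₀ * (4 * R0) + R1))) := by
      apply mul_le_mul_of_nonneg_left _ hCs0.le
      have h1 : 0 ≤ A₀ * R0 := by positivity
      have h2 : e i * (2 * (A₀ * (2 * R0) + R1)) ≤ e₀ * (4 * (A₀ * (4 * R0) + R1)) := by
        apply mul_le_mul (hee i) _ (by positivity) ((he i).le.trans (hee i))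
        nlinarith
      linarith
    nlinarith
  intro n
  induction n with
  | zero => exact h0
  | succ n ih =>
    refine dec_succ h0 (resolvent_dec he hee hae (((hA n).bdd_mul ih).add (hR n)) hEs hE' ?_)
    exact fun i => (hq i (n + 2)).deriv

end IonShock

namespace IonShock

/-! ### The normalised travelling-wave system -/

/-- The small quadratic part of the slow vector field. -/
noncomputable def slowPert (k e σ g x y : ℝ) : ℝ :=
  -(g * (k * g * (1 - g))) + (-2 * g + σ * g ^ 2) * x + (1 - σ * g) ^ 2 * (e / 2) * y ^ 2

/-- The small quadratic part of the source of the fast equations. -/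
noncomputable def fastPert (k e σ τ g x y : ℝ) : ℝ :=
  slowPert k e σ g x y + (g + τ * x) * y

/-- Normalised travelling-wave system. For `σ = τ = 0` it is the KdV-Burgers equation
`g' = k g (1 - g) + e g''`, with `y = g'` and `x = e g''`. -/
structure IsFrontSys (k e σ τ : ℝ) (g x y : ℝ → ℝ) : Prop where
  hg : ∀ z, HasDerivAt g (k * g z * (1 - g z) + x z + σ * slowPert k e σ (g z) (x z) (y z)) z
  hy : ∀ z, HasDerivAt y (x z / e) z
  hx : ∀ z, HasDerivAt (fun z => τ * x z)
    (y z - x z - (k * g z * (1 - g z) + σ * fastPert k e σ τ (g z) (x z) (y z))) z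

/-- Bootstrap, since every derivative is polynomial in the unknowns. In the degenerate case τ = σ =
0 the third equation is algebraic and returns x from g and y. -/
lemma IsFrontSys.smooth {k e σ τ : ℝ} {g x y : ℝ → ℝ} (h : IsFrontSys k e σ τ g x y)
    (hτ : 0 < τ ∨ (τ = 0 ∧ σ = 0)) :
    ContDiff ℝ ∞ g ∧ ContDiff ℝ ∞ x ∧ ContDiff ℝ ∞ y := by
  have hg' : deriv g = fun z => k * g z * (1 - g z) + x z + σ * slowPert k e σ (g z) (x z) (y z) := by
    ext z; exact (h.hg z).deriv
  have hy' : deriv y = fun z => x z / e := by ext z; exact (h.hy z).deriv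
  have dg : Differentiable ℝ g := fun z => (h.hg z).differentiableAt
  have dy : Differentiable ℝ y := fun z => (h.hy z).differentiableAt
  have succ : ∀ {n : ℕ} {f : ℝ → ℝ}, Differentiable ℝ f → ContDiff ℝ n (deriv f) →
      ContDiff ℝ (n + 1 : ℕ) f := by
    intro n f h1 h2
    have := contDiff_succ_iff_deriv (𝕜 := ℝ) (n := (n : WithTop ℕ∞)) (f := f)
    push_cast
    exact this.mpr ⟨h1, by simp, h2⟩
  have all : ∀ n : ℕ, ContDiff ℝ n g ∧ ContDiff ℝ n x ∧ ContDiff ℝ n y := by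
    rcases hτ with hτ | ⟨rfl, rfl⟩
    · have hx' : ∀ z, HasDerivAt x ((y z - x z -
          (k * g z * (1 - g z) + σ * fastPert k e σ τ (g z) (x z) (y z))) / τ) z := by
        intro z
        have h1 := (h.hx z).const_mul τ⁻¹
        have h2 : (fun y => τ⁻¹ * (τ * x y)) = x := by ext y; field_simp
        rw [h2] at h1
        exact h1.congr_deriv (by field_simp)
      have dx : Differentiable ℝ x := fun z => (hx' z).differentiableAt
      have hxd : deriv x = fun z => (y z - x z -
          (k * g z * (1 - g z) + σ * fastPert k e σ τ (g z) (x z) (y z))) / τ := by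
        ext z; exact (hx' z).deriv
      intro n
      induction n with
      | zero => exact ⟨contDiff_zero.mpr dg.continuous, contDiff_zero.mpr dx.continuous,
          contDiff_zero.mpr dy.continuous⟩
      | succ n ih =>
        obtain ⟨ig, ix, iy⟩ := ih
        refine ⟨succ dg ?_, succ dx ?_, succ dy ?_⟩
        · rw [hg']; unfold slowPert; fun_prop
        · rw [hxd]; unfold fastPert slowPert; fun_prop
        · rw [hy']; fun_prop
    · have hxe : x = fun z => y z - k * g z * (1 - g z) := by
        ext z
        have h2 : HasDerivAt (fun z => 0 * x z) 0 z := by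
          simpa using hasDerivAt_const z (0 : ℝ)
        have := (h.hx z).unique h2
        linarith
      intro n
      have hx_of : ∀ n : ℕ, ContDiff ℝ n g → ContDiff ℝ n y → ContDiff ℝ n x := by
        intro n h1 h2; rw [hxe]; fun_prop
      suffices H : ContDiff ℝ n g ∧ ContDiff ℝ n y from ⟨H.1, hx_of n H.1 H.2, H.2⟩
      induction n with
      | zero => exact ⟨contDiff_zero.mpr dg.continuous, contDiff_zero.mpr dy.continuous⟩
      | succ n ih =>
        obtain ⟨ig, iy⟩ := ih
        have ix := hx_of n ig iy
        refine ⟨succ dg ?_, succ dy ?_⟩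
        · rw [hg']; unfold slowPert; fun_prop
        · rw [hy']; fun_prop
  exact ⟨contDiff_infty.mpr fun n => (all n).1, contDiff_infty.mpr fun n => (all n).2.1,
    contDiff_infty.mpr fun n => (all n).2.2⟩

section

variable {ι : Type*} {a : ℝ} {n : ℕ} {k e σ τ : ι → ℝ} {g x y : ι → ℝ → ℝ}

/-- A front does not decay, but the logistic product does, and its derivative k (1 - 2 g) g'
inherits the decay of g'. This gains one order in the inductions below. -/
lemma dec_logistic (hk : Bd k) (hq0 : Dec a 0 (fun i z => k i * g i z * (1 - g i z)))
    (hg : Dec 0 0 g) (hg' : Dec a n (fun i => deriv (g i))) (ha : 0 ≤ a) :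
    Dec 0 (n + 1) g ∧ Dec a (n + 1) (fun i z => k i * g i z * (1 - g i z)) := by
  have h1 : Dec 0 (n + 1) g := dec_succ hg (hg'.mono ha)
  refine ⟨h1, dec_succ hq0 ?_⟩
  have := ((dec_const (n := n) (Bd.const 1)).sub (h1.pred.smul (Bd.const 2))).bdd_mul (hg'.smul hk)
  refine this.congr fun i z => ?_
  have d := contDiff_hasDerivAt (hg.1 i) z
  rw [((d.const_mul (k i)).fun_mul (d.const_sub 1)).deriv]
  ring

lemma dec_slowPert (he : Bd e) (hσ : Bd σ) (ha : 0 ≤ a) (hg : Dec 0 n g)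
    (hq : Dec a n (fun i z => k i * g i z * (1 - g i z))) (hx : Dec a n x) (hy : Dec a n y) :
    Dec a n (fun i z => slowPert (k i) (e i) (σ i) (g i z) (x i z) (y i z)) := by
  have hn : Dec 0 n (fun i z => 1 - σ i * g i z) := (dec_const (Bd.const 1)).sub (hg.smul hσ)
  have t1 := (hg.bdd_mul hq).neg
  have t2 := ((hg.smul (Bd.const (-2))).add ((hg.mul_bdd hg).smul hσ)).bdd_mul hx
  have t3 := ((hn.mul_bdd hn).mul_bdd (dec_const (he.mul (Bd.const (1 / 2))))).bdd_mul
    ((hy.mono ha).bdd_mul hy)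
  refine ((t1.add t2).add t3).congr fun i z => ?_
  simp only [slowPert]; ring

lemma dec_fastPert (he : Bd e) (hσ : Bd σ) (hτ : Bd τ) (ha : 0 ≤ a) (hg : Dec 0 n g)
    (hq : Dec a n (fun i z => k i * g i z * (1 - g i z))) (hx : Dec a n x) (hy : Dec a n y) :
    Dec a n (fun i z => fastPert (k i) (e i) (σ i) (τ i) (g i z) (x i z) (y i z)) :=
  (dec_slowPert he hσ ha hg hq hx hy).add ((hg.add ((hx.mono ha).smul hτ)).bdd_mul hy)

lemma dec_front_deriv (he : Bd e) (hσ : Bd σ) (ha : 0 ≤ a)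
    (hsys : ∀ i, IsFrontSys (k i) (e i) (σ i) (τ i) (g i) (x i) (y i)) (hg : Dec 0 n g)
    (hq : Dec a n (fun i z => k i * g i z * (1 - g i z))) (hx : Dec a n x) (hy : Dec a n y) :
    Dec a n (fun i => deriv (g i)) := by
  refine ((hq.add hx).add ((dec_slowPert he hσ ha hg hq hx hy).smul hσ)).congr fun i z => ?_
  rw [((hsys i).hg z).deriv]

/-- Qualitative decay of all derivatives of a single solution. -/
lemma front_dec_single {k e σ τ : ℝ} {g x y : ℝ → ℝ} (hsys : IsFrontSys k e σ τ g x y)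
    (hτ : 0 < τ ∨ (τ = 0 ∧ σ = 0)) (ha : 0 ≤ a) (hg : Dec 0 0 (fun _ : Unit => g))
    (hq : Dec a 0 (fun (_ : Unit) z => k * g z * (1 - g z)))
    (hx : Dec a 0 (fun _ : Unit => x)) (hy : Dec a 0 (fun _ : Unit => y)) (n : ℕ) :
    Dec a n (fun _ : Unit => x) ∧ Dec a n (fun _ : Unit => y) ∧
      Dec a n (fun _ : Unit => deriv g) ∧ Dec 0 n (fun _ : Unit => g) ∧
      Dec a n (fun (_ : Unit) z => k * g z * (1 - g z)) := by
  induction n with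
  | zero =>
    exact ⟨hx, hy, dec_front_deriv (Bd.const _) (Bd.const _) ha (fun _ => hsys)
      hg hq hx hy, hg, hq⟩
  | succ n ih =>
    obtain ⟨ix, iy, ig', ig, iq⟩ := ih
    obtain ⟨jg, jq⟩ := dec_logistic (Bd.const _) hq hg ig' ha
    have jy : Dec a (n + 1) (fun _ : Unit => y) := by
      refine dec_succ hy ((ix.smul (Bd.const (1 / e))).congr fun _ z => ?_)
      rw [(hsys.hy z).deriv]; ring
    have jx : Dec a (n + 1) (fun _ : Unit => x) := by
      rcases hτ with hτ | ⟨rfl, rfl⟩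
      · refine dec_succ hx ((((iy.sub ix).sub (iq.add ((dec_fastPert (Bd.const e)
          (Bd.const σ) (Bd.const τ) ha ig iq ix iy).smul (Bd.const σ)))).smul
          (Bd.const (1 / τ))).congr fun _ z => ?_)
        have h1 := (contDiff_hasDerivAt (hx.1 ()) z).const_mul τ
        have h2 := h1.unique (hsys.hx z)
        field_simp
        linarith
      · refine (jy.sub jq).congr fun _ z => ?_
        have h2 : HasDerivAt (fun z => 0 * x z) 0 z := by
          simpa using hasDerivAt_const z (0 : ℝ)
        have := (hsys.hx z).unique h2
        linarith
    exact ⟨jx, jy, dec_front_deriv (Bd.const _) (Bd.const _) ha (fun _ => hsys)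
      jg jq jx jy, jg, jq⟩

/-- Uniform decay of all derivatives of a family of solutions. -/
lemma front_dec {M : ℝ} (hk : Bd k) (heB : Bd e) (hσB : Bd σ) (hτB : Bd τ) (ha : 0 ≤ a)
    (he : ∀ i, 0 < e i) (heM : ∀ i, e i ≤ M) (hτM : ∀ i, τ i ≤ M)
    (haM : |a| * (2 * M) ≤ 1 / 2)
    (hsys : ∀ i, IsFrontSys (k i) (e i) (σ i) (τ i) (g i) (x i) (y i))
    (hτ : ∀ i, 0 < τ i ∨ (τ i = 0 ∧ σ i = 0))
    (hg : Dec 0 0 g) (hq : Dec a 0 (fun i z => k i * g i z * (1 - g i z)))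
    (hx : Dec a 0 x) (hy : Dec a 0 y)
    (hβ : ∀ i z, |-2 * (σ i * g i z) + (σ i * g i z) ^ 2 + σ i * τ i * y i z| ≤ 1 / 24)
    (hγ : ∀ i z, |(1 - σ i * g i z) ^ 2 * (σ i * e i) * y i z + σ i * (g i z + τ i * x i z)| ≤ 1 / 24)
    (n : ℕ) :
    Dec a n x ∧ Dec a n y ∧ Dec a n (fun i => deriv (g i)) ∧ Dec 0 n g ∧
      Dec a n (fun i z => k i * g i z * (1 - g i z)) := by
  have single := fun i => front_dec_single (a := a) (hsys i) (hτ i) ha (hg.reindex (fun _ => i))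
    (hq.reindex (fun _ => i)) (hx.reindex (fun _ => i)) (hy.reindex (fun _ => i))
  induction n with
  | zero => exact ⟨hx, hy, dec_front_deriv heB hσB ha hsys hg hq hx hy, hg, hq⟩
  | succ n ih =>
    obtain ⟨ix, iy, ig', ig, iq⟩ := ih
    obtain ⟨jg, jq⟩ := dec_logistic hk hq hg ig' ha
    have hN : Dec 0 n (fun i z => 1 - σ i * g i z) := (dec_const (Bd.const 1)).sub (ig.smul hσB)
    -- The pair (x', y') solves the fast system again: β and γ collect what multiplies x' and y' in
    -- the differentiated σ-terms, and the rest is a multiple of g', already controlled. The bounds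
    -- `single`, which may depend on the index, only supply the finiteness that absorption needs.
    have hxy := fast_dec (a := a) (n := n) (M := M) (e := e) (τ := τ)
      (x := fun i => deriv (x i)) (y := fun i => deriv (y i))
      (β := fun i z => -2 * (σ i * g i z) + (σ i * g i z) ^ 2 + σ i * τ i * y i z)
      (γ := fun i z => (1 - σ i * g i z) ^ 2 * (σ i * e i) * y i z + σ i * (g i z + τ i * x i z))
      (h := fun i z => ((1 - σ i * g i z) * (k i * (1 - 2 * g i z))
        - σ i * (k i * g i z * (1 - g i z)) - 2 * (1 - σ i * g i z) * σ i * x i z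
        - (1 - σ i * g i z) * (σ i ^ 2 * e i) * (y i z * y i z) + σ i * y i z) * deriv (g i) z)
      he (fun i => by rcases hτ i with h | h <;> linarith) heM hτM haM ?_ ?_ hβ hγ ?_
      (fun i => contDiff_deriv (hx.1 i)) (fun i => contDiff_deriv (hy.1 i)) ?_ ?_
      (fun i => (single i (n + 1)).1.deriv) (fun i => (single i (n + 1)).2.1.deriv)
    · have jx := dec_succ hx hxy.1
      have jy := dec_succ hy hxy.2
      exact ⟨jx, jy, dec_front_deriv heB hσB ha hsys jg jq jx jy, jg, jq⟩
    · refine (((ig.smul hσB).smul (Bd.const (-2))).add (((ig.smul hσB).mul_bdd (ig.smul hσB)))).add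
        ((iy.mono ha).smul (hσB.mul hτB)) |>.congr fun i z => by ring
    · refine ((((hN.mul_bdd hN).mul_bdd (dec_const (hσB.mul heB))).mul_bdd (iy.mono ha)).add
        ((ig.add ((ix.mono ha).smul hτB)).smul hσB)).congr fun i z => by ring
    · have t1 := hN.mul_bdd (((dec_const (n := n) (Bd.const 1)).sub (ig.smul (Bd.const 2))).smul hk)
      have t2 := (iq.mono ha).smul hσB
      have t3 := ((hN.smul (Bd.const 2)).mul_bdd (dec_const hσB)).mul_bdd (ix.mono ha)
      have t4 := (hN.mul_bdd (dec_const ((hσB.mul hσB).mul heB))).mul_bdd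
        ((iy.mono ha).mul_bdd (iy.mono ha))
      have t5 := (iy.mono ha).smul hσB
      exact (((((t1.sub t2).sub t3).sub t4).add t5).bdd_mul ig').congr fun i z => by ring
    · intro i z
      have : deriv (y i) = fun z => x i z / e i := by ext z; exact ((hsys i).hy z).deriv
      rw [this]
      simp
    · intro i z
      have dg := contDiff_hasDerivAt (hg.1 i) z
      have dx := contDiff_hasDerivAt (hx.1 i) z
      have dy := contDiff_hasDerivAt (hy.1 i) z
      have e1 : (fun z => τ i * deriv (x i) z) = fun z => y i z - x i z -
          (k i * g i z * (1 - g i z) + σ i * fastPert (k i) (e i) (σ i) (τ i) (g i z) (x i z) (y i z)) := by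
        ext z
        exact ((contDiff_hasDerivAt (hx.1 i) z).const_mul (τ i)).unique ((hsys i).hx z)
      have d1 := ((contDiff_hasDerivAt (contDiff_deriv (hx.1 i)) z).const_mul (τ i))
      rw [e1] at d1
      unfold fastPert slowPert at d1
      have dn := (dg.const_mul (σ i)).const_sub 1
      have dQ := (dg.const_mul (k i)).fun_mul (dg.const_sub 1)
      have p1 := (dg.fun_mul dQ).fun_neg
      have p2 := ((dg.const_mul (-2)).fun_add ((dg.fun_pow 2).const_mul (σ i))).fun_mul dx
      have p3 := ((dn.fun_pow 2).mul_const (e i / 2)).fun_mul (dy.fun_pow 2)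
      have p4 := (dg.fun_add (dx.const_mul (τ i))).fun_mul dy
      have d2 := (dy.fun_sub dx).fun_sub (dQ.fun_add ((((p1.fun_add p2).fun_add p3).fun_add p4).const_mul (σ i)))
      rw [d1.unique d2]
      simp only [Nat.cast_ofNat, Nat.add_one_sub_one, pow_one]
      ring

end

end IonShock

/-! ### Lipschitz bounds for the nonlinearities and uniqueness of bounded fronts. -/

namespace IonShock

/-- Compactness of the ball in all seven variables. Treating the parameters as coordinates makes the
Lipschitz constant uniform in them. -/
lemma exists_lipschitz_of_contDiff {f : ℝ × ℝ × ℝ × ℝ × ℝ × ℝ × ℝ → ℝ} (hf : ContDiff ℝ 1 f)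
    (K : ℝ) : ∃ L, 0 ≤ L ∧ ∀ k e σ τ g x y g' x' y' : ℝ, |k| ≤ K → |e| ≤ K → |σ| ≤ K → |τ| ≤ K →
      |g| ≤ K → |x| ≤ K → |y| ≤ K → |g'| ≤ K → |x'| ≤ K → |y'| ≤ K →
      |f (k, e, σ, τ, g, x, y) - f (k, e, σ, τ, g', x', y')| ≤
        L * (|g - g'| + |x - x'| + |y - y'|) := by
  obtain ⟨L, hL⟩ := (hf.locallyLipschitz.locallyLipschitzOn
    (s := Metric.closedBall 0 K)).exists_lipschitzOnWith_of_compact (isCompact_closedBall 0 K)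
  refine ⟨L, L.2, ?_⟩
  intro k e σ τ g x y g' x' y' hk he hσ hτ hg hx hy hg' hx' hy'
  have mem : ∀ g x y : ℝ, |g| ≤ K → |x| ≤ K → |y| ≤ K →
      (k, e, σ, τ, g, x, y) ∈ Metric.closedBall (0 : ℝ × ℝ × ℝ × ℝ × ℝ × ℝ × ℝ) K := by
    intro g x y hg hx hy
    rw [mem_closedBall_zero_iff]
    simp only [Prod.norm_def, Real.norm_eq_abs, sup_le_iff]
    exact ⟨hk, he, hσ, hτ, hg, hx, hy⟩
  have h := hL.dist_le_mul _ (mem g x y hg hx hy) _ (mem g' x' y' hg' hx' hy')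
  rw [Real.dist_eq] at h
  refine h.trans (mul_le_mul_of_nonneg_left ?_ L.2)
  simp only [Prod.dist_eq, dist_self, Real.dist_eq]
  have h1 := abs_nonneg (g - g')
  have h2 := abs_nonneg (x - x')
  have h3 := abs_nonneg (y - y')
  simp only [sup_le_iff]
  refine ⟨?_, ?_, ?_, ?_, ?_, ?_, ?_⟩ <;> linarith

/-- Uniform Lipschitz constants for the nonlinear perturbations on bounded sets. -/
lemma exists_lipschitz_pert (K : ℝ) : ∃ L, 0 ≤ L ∧ ∀ k e σ τ g x y g' x' y' : ℝ,
    |k| ≤ K → |e| ≤ K → |σ| ≤ K → |τ| ≤ K →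
    |g| ≤ K → |x| ≤ K → |y| ≤ K → |g'| ≤ K → |x'| ≤ K → |y'| ≤ K →
    |slowPert k e σ g x y - slowPert k e σ g' x' y'| ≤ L * (|g - g'| + |x - x'| + |y - y'|) ∧
    |fastPert k e σ τ g x y - fastPert k e σ τ g' x' y'| ≤
      L * (|g - g'| + |x - x'| + |y - y'|) := by
  obtain ⟨L₁, hL₁, h₁⟩ := exists_lipschitz_of_contDiff
    (f := fun v => slowPert v.1 v.2.1 v.2.2.1 v.2.2.2.2.1 v.2.2.2.2.2.1 v.2.2.2.2.2.2)
    (by unfold slowPert; fun_prop) K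
  obtain ⟨L₂, hL₂, h₂⟩ := exists_lipschitz_of_contDiff
    (f := fun v => fastPert v.1 v.2.1 v.2.2.1 v.2.2.2.1 v.2.2.2.2.1 v.2.2.2.2.2.1 v.2.2.2.2.2.2)
    (by unfold fastPert slowPert; fun_prop) K
  refine ⟨L₁ + L₂, by positivity, ?_⟩
  intro k e σ τ g x y g' x' y' hk he hσ hτ hg hx hy hg' hx' hy'
  have hs : 0 ≤ |g - g'| + |x - x'| + |y - y'| := by positivity
  constructor
  · refine (h₁ k e σ τ g x y g' x' y' hk he hσ hτ hg hx hy hg' hx' hy').trans ?_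
    nlinarith
  · refine (h₂ k e σ τ g x y g' x' y' hk he hσ hτ hg hx hy hg' hx' hy').trans ?_
    nlinarith

lemma logistic_sub_le {k g g' K : ℝ} (hk : |k| ≤ K) (hg : |g| ≤ K) (hg' : |g'| ≤ K) :
    |k * g * (1 - g) - k * g' * (1 - g')| ≤ K * (1 + 2 * K) * |g - g'| := by
  have hK : 0 ≤ K := (abs_nonneg _).trans hk
  have : k * g * (1 - g) - k * g' * (1 - g') = k * (1 - g - g') * (g - g') := by ring
  rw [this, abs_mul, abs_mul]
  have h1 : |1 - g - g'| ≤ 1 + 2 * K := by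
    have e1 := abs_sub (1 - g) g'
    have e2 := abs_sub 1 g
    rw [abs_one] at e2
    linarith
  gcongr

/-- A function vanishing at the origin whose derivative grows at most like `e^{η|z|}`. -/
lemma growth_bound {η C : ℝ} (hη : 0 < η) {f f' : ℝ → ℝ} (hf : ∀ z, HasDerivAt f (f' z) z)
    (h0 : f 0 = 0) (hb : ∀ z, |f' z| ≤ C * ew (-η) z) (z : ℝ) : |f z| ≤ C / η * ew (-η) z := by
  have hC : 0 ≤ C := by
    have := (abs_nonneg _).trans (hb 0); simpa [ew_at_zero] using this
  have right : ∀ {f f' : ℝ → ℝ}, (∀ z, HasDerivAt f (f' z) z) → f 0 = 0 →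
      (∀ z, f' z ≤ C * ew (-η) z) → ∀ z, 0 ≤ z → f z ≤ C / η * Real.exp (η * z) := by
    intro f f' hf h0 hb z hz
    have hder : ∀ t, HasDerivAt (fun t => f t - C / η * Real.exp (η * t))
        (f' t - C * Real.exp (η * t)) t := by
      intro t
      have h1 : HasDerivAt (fun t : ℝ => Real.exp (η * t)) (Real.exp (η * t) * (η * 1)) t :=
        ((hasDerivAt_id t).const_mul η).exp
      exact ((hf t).sub (h1.const_mul (C / η))).congr_deriv (by field_simp)
    have hanti : AntitoneOn (fun t => f t - C / η * Real.exp (η * t)) (Set.Ici 0) := by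
      apply antitoneOn_of_deriv_nonpos (convex_Ici 0)
      · exact fun t _ => (hder t).continuousAt.continuousWithinAt
      · exact fun t _ => (hder t).differentiableAt.differentiableWithinAt
      · intro t ht
        rw [interior_Ici] at ht
        rw [(hder t).deriv]
        have := hb t
        rw [ew_of_nonneg _ (le_of_lt ht)] at this
        simp only [neg_mul, neg_neg] at this
        linarith
    have := hanti (Set.mem_Ici.mpr le_rfl) (Set.mem_Ici.mpr hz) hz
    simp only [h0, mul_zero, Real.exp_zero] at this
    have : 0 ≤ C / η := by positivity
    linarith
  have both : ∀ {f f' : ℝ → ℝ}, (∀ z, HasDerivAt f (f' z) z) → f 0 = 0 →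
      (∀ z, |f' z| ≤ C * ew (-η) z) → ∀ z, 0 ≤ z → |f z| ≤ C / η * Real.exp (η * z) := by
    intro f f' hf h0 hb z hz
    rw [abs_le]
    constructor
    · have := right (f := fun z => -f z) (fun z => (hf z).neg) (by simp [h0])
        (fun z => by linarith [(abs_le.mp (hb z)).1]) z hz
      linarith
    · exact right hf h0 (fun z => (abs_le.mp (hb z)).2) z hz
  rcases le_total 0 z with hz | hz
  · rw [ew_of_nonneg _ hz]
    simpa using both hf h0 hb z hz
  · rw [ew_of_nonpos _ hz]
    have := both (f := fun z => f (-z)) (f' := fun z => f' (-z) * -1)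
      (fun z => (hf (-z)).comp z (hasDerivAt_neg z)) (by simp [h0])
      (fun z => by
        rw [abs_mul, abs_neg, abs_one, mul_one, ← ew_neg_arg]; exact hb (-z)) (-z) (by linarith)
    simpa using this

set_option maxHeartbeats 800000 in
/-- Bounded solutions of the travelling-wave system are determined by `g 0`. -/
lemma front_unique {K : ℝ} (hK : 1 ≤ K) : ∃ M > 0, ∀ k e σ τ : ℝ, |k| ≤ K → 0 < e → e ≤ M →
    0 ≤ σ → σ ≤ M → 0 ≤ τ → τ ≤ M → ∀ g x y g' x' y' : ℝ → ℝ,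
    IsFrontSys k e σ τ g x y → IsFrontSys k e σ τ g' x' y' →
    (∀ z, |g z| ≤ K) → (∀ z, |x z| ≤ K) → (∀ z, |y z| ≤ K) →
    (∀ z, |g' z| ≤ K) → (∀ z, |x' z| ≤ K) → (∀ z, |y' z| ≤ K) → g 0 = g' 0 →
    ∀ z, g z = g' z ∧ x z = x' z ∧ y z = y' z := by
  obtain ⟨L, hL0, hL⟩ := exists_lipschitz_pert K
  have hK0 : 0 ≤ K := by linarith
  set Q := K * (1 + 2 * K) with hQ
  have hQ0 : 0 ≤ Q := by positivity
  set H := Q + L with hH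
  have hH0 : 0 ≤ H := by positivity
  -- `S` bounds the growth rate of the slow difference after the fast differences have been
  -- eliminated. With η = 2 S, integration returns half of the assumed bound.
  set S := Q + 12 * H + L * (1 + 24 * H) + 1 with hS
  have hS0 : 0 < S := by positivity
  set η := 2 * S with hη
  refine ⟨min 1 (min (1 / (4 * η)) (1 / (24 * (L + 1)))), by positivity, ?_⟩
  intro k e σ τ hk he heM hσ hσM hτ hτM g x y g' x' y' h h' bg bx bY bg' bx' bY' h0
  set M := min 1 (min (1 / (4 * η)) (1 / (24 * (L + 1)))) with hM
  have hM1 : M ≤ 1 := min_le_left _ _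
  have hMη : |(-η)| * (2 * M) ≤ 1 / 2 := by
    have h1 : M ≤ 1 / (4 * η) := (min_le_right _ _).trans (min_le_left _ _)
    rw [le_div_iff₀ (by positivity)] at h1
    rw [abs_neg, abs_of_pos (by positivity)]
    linarith
  have hσL : 24 * (σ * L) ≤ 1 := by
    have h1 : σ ≤ 1 / (24 * (L + 1)) := hσM.trans ((min_le_right _ _).trans (min_le_right _ _))
    rw [le_div_iff₀ (by positivity)] at h1
    nlinarith
  have hσ1 : σ ≤ 1 := hσM.trans hM1
  have lip := fun z => hL k e σ τ (g z) (x z) (y z) (g' z) (x' z) (y' z) hk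
    (by rw [abs_of_pos he]; linarith) (by rw [abs_of_nonneg hσ]; linarith)
    (by rw [abs_of_nonneg hτ]; linarith) (bg z) (bx z) (bY z) (bg' z) (bx' z) (bY' z)
  have lq := fun z => logistic_sub_le hk (bg z) (bg' z)
  have hw1 : ∀ z, 1 ≤ ew (-η) z := fun z => by
    have := ew_anti (show -η ≤ 0 by linarith) z
    rwa [ew_zero] at this
  -- No decay of the differences is needed: bounded functions have finite norm for the growing
  -- weight e^{η|z|}, and the smallness of `M` keeps the fast estimates valid at this growth rate.
  have qual : ∀ {u v : ℝ → ℝ}, (∀ z, |u z| ≤ K) → (∀ z, |v z| ≤ K) →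
      ∀ z, |u z - v z| ≤ 2 * K * ew (-η) z := by
    intro u v hu hv z
    have h1 := abs_sub (u z) (v z)
    nlinarith [hu z, hv z, hw1 z]
  -- the fast components are controlled by the slow one
  have fast : ∀ D, 0 ≤ D → (∀ z, |g z - g' z| ≤ D * ew (-η) z) →
      ∀ z, |(max |x z - x' z| |y z - y' z|)| ≤ 2 * (6 * (H * D)) * ew (-η) z := by
    intro D hD hDg
    refine absorb (fun z => ew_pos _ z) (K₀ := 2 * K) ?_ ?_
    · intro z
      rw [abs_of_nonneg ((abs_nonneg _).trans (le_max_left _ _))]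
      exact max_le (qual bx bx' z) (qual bY bY' z)
    · intro J hJ hb z
      have hbx : ∀ z, |x z - x' z| ≤ J * ew (-η) z := fun z =>
        ((le_max_left _ _).trans (le_abs_self _)).trans (hb z)
      have hby : ∀ z, |y z - y' z| ≤ J * ew (-η) z := fun z =>
        ((le_max_right _ _).trans (le_abs_self _)).trans (hb z)
      have := fast_bound (a := -η) he hτ heM hτM hMη
        (x := fun z => x z - x' z) (y := fun z => y z - y' z)
        (G := fun z => (k * g z * (1 - g z) + σ * fastPert k e σ τ (g z) (x z) (y z))
          - (k * g' z * (1 - g' z) + σ * fastPert k e σ τ (g' z) (x' z) (y' z)))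
        (Ky := 2 * K) (Kx := 2 * K) (K := H * D + 2 * (σ * L) * J)
        (fun z => ((h.hy z).fun_sub (h'.hy z)).congr_deriv (by ring))
        (fun z => by
          have := (h.hx z).fun_sub (h'.hx z)
          simp only [← mul_sub] at this
          exact this.congr_deriv (by ring))
        (qual bY bY') (qual bx bx') (fun z => by
          have t1 := lq z
          have t2 := mul_le_mul_of_nonneg_left (lip z).2 hσ
          have t3 := hDg z
          have t4 := hbx z
          have t5 := hby z
          have hw := ew_pos (-η) z
          have e1 : (k * g z * (1 - g z) + σ * fastPert k e σ τ (g z) (x z) (y z))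
            - (k * g' z * (1 - g' z) + σ * fastPert k e σ τ (g' z) (x' z) (y' z)) =
            (k * g z * (1 - g z) - k * g' z * (1 - g' z)) +
            σ * (fastPert k e σ τ (g z) (x z) (y z) - fastPert k e σ τ (g' z) (x' z) (y' z)) := by
            ring
          rw [e1]
          refine (abs_add_le _ _).trans ?_
          rw [abs_mul σ, abs_of_nonneg hσ]
          calc _ ≤ Q * |g z - g' z| + σ * (L * (|g z - g' z| + |x z - x' z| + |y z - y' z|)) := by
                linarith
            _ ≤ Q * (D * ew (-η) z) + σ * (L * (D * ew (-η) z + J * ew (-η) z + J * ew (-η) z)) := by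
                gcongr
            _ ≤ Q * (D * ew (-η) z) + 1 * (L * (D * ew (-η) z)) +
                  σ * (L * (J * ew (-η) z + J * ew (-η) z)) := by
                have e2 : σ * (L * (D * ew (-η) z)) ≤ 1 * (L * (D * ew (-η) z)) := by gcongr
                have e3 : σ * (L * (D * ew (-η) z + J * ew (-η) z + J * ew (-η) z)) =
                  σ * (L * (D * ew (-η) z)) + σ * (L * (J * ew (-η) z + J * ew (-η) z)) := by ring
                linarith
            _ = _ := by rw [hH]; ring) z
      have hw := ew_pos (-η) z
      rw [abs_of_nonneg ((abs_nonneg _).trans (le_max_left _ _))]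
      have hHD : 0 ≤ H * D := by positivity
      have f1 : 6 * (H * D + 2 * (σ * L) * J) ≤ 6 * (H * D) + J / 2 := by nlinarith
      have f2 : 4 * (H * D + 2 * (σ * L) * J) ≤ 6 * (H * D) + J / 2 := by
        have : 0 ≤ (σ * L) * J := by positivity
        nlinarith
      exact max_le (this.2.trans (by gcongr)) (this.1.trans (by gcongr))
  -- Each bound D improves to D / 2 because the difference vanishes at the origin; absorption with
  -- constant zero then forces equality.
  have slow : ∀ z, |g z - g' z| ≤ 2 * 0 * ew (-η) z := by
    refine absorb (fun z => ew_pos _ z) (qual bg bg') ?_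
    intro D hD hDg z
    have hf := fast D hD hDg
    have hder : ∀ z, HasDerivAt (fun z => g z - g' z)
        ((k * g z * (1 - g z) + x z + σ * slowPert k e σ (g z) (x z) (y z)) -
          (k * g' z * (1 - g' z) + x' z + σ * slowPert k e σ (g' z) (x' z) (y' z))) z :=
      fun z => (h.hg z).fun_sub (h'.hg z)
    have := growth_bound (η := η) (C := S * D) (by positivity) hder (by simp [h0]) (fun z => by
      have t1 := lq z
      have t2 := mul_le_mul_of_nonneg_left (lip z).1 hσ
      have t3 := hDg z
      have t4 : |x z - x' z| ≤ 12 * (H * D) * ew (-η) z :=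
        ((le_max_left _ _).trans (le_abs_self _)).trans ((hf z).trans (le_of_eq (by ring)))
      have t5 : |y z - y' z| ≤ 12 * (H * D) * ew (-η) z :=
        ((le_max_right _ _).trans (le_abs_self _)).trans ((hf z).trans (le_of_eq (by ring)))
      have hw := ew_pos (-η) z
      have e1 : (k * g z * (1 - g z) + x z + σ * slowPert k e σ (g z) (x z) (y z)) -
          (k * g' z * (1 - g' z) + x' z + σ * slowPert k e σ (g' z) (x' z) (y' z)) =
          (k * g z * (1 - g z) - k * g' z * (1 - g' z)) + ((x z - x' z) +
          σ * (slowPert k e σ (g z) (x z) (y z) - slowPert k e σ (g' z) (x' z) (y' z))) := by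
        ring
      rw [e1]
      refine (abs_add_le _ _).trans ?_
      have e2 := abs_add_le (x z - x' z)
        (σ * (slowPert k e σ (g z) (x z) (y z) - slowPert k e σ (g' z) (x' z) (y' z)))
      rw [abs_mul σ, abs_of_nonneg hσ] at e2
      calc _ ≤ Q * |g z - g' z| + (|x z - x' z| +
              σ * (L * (|g z - g' z| + |x z - x' z| + |y z - y' z|))) := by linarith
        _ ≤ Q * (D * ew (-η) z) + (12 * (H * D) * ew (-η) z + 1 * (L * (D * ew (-η) z +
              12 * (H * D) * ew (-η) z + 12 * (H * D) * ew (-η) z))) := by gcongr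
        _ ≤ S * D * ew (-η) z := by
              have e3 : 0 ≤ D * ew (-η) z := by positivity
              have e4 : S * D * ew (-η) z = Q * (D * ew (-η) z) + (12 * (H * D) * ew (-η) z +
                1 * (L * (D * ew (-η) z + 12 * (H * D) * ew (-η) z +
                12 * (H * D) * ew (-η) z))) + D * ew (-η) z := by rw [hS]; ring
              linarith) z
    refine this.trans (le_of_eq ?_)
    rw [hη]
    field_simp
    ring
  have hg0 : ∀ z, g z - g' z = 0 := fun z => by
    have := slow z
    simp only [mul_zero, zero_mul] at this
    exact abs_nonpos_iff.mp this
  intro z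
  have hf := fast 0 le_rfl (fun z => by simp [hg0 z]) z
  simp only [mul_zero, zero_mul] at hf
  have hmax := (le_abs_self _).trans hf
  have h1 := abs_nonpos_iff.mp ((le_max_left _ _).trans hmax)
  have h2 := abs_nonpos_iff.mp ((le_max_right _ _).trans hmax)
  exact ⟨by linarith [hg0 z], by linarith, by linarith⟩

end IonShock

namespace IonShock

/-! ### A fixed-point theorem in weighted spaces -/

/-- A map contracting a ball of weighted continuous functions into itself has a fixed point. -/
lemma exists_weighted_fixedPoint {κ : Type} [Fintype κ] [Nonempty κ] {a ρ : ℝ} (hρ : 0 < ρ)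
    (Θ : (κ → ℝ → ℝ) → κ → ℝ → ℝ)
    (hmap : ∀ f : κ → ℝ → ℝ, (∀ j, Continuous (f j)) → (∀ j z, |f j z| ≤ ρ * ew a z) →
      (∀ j, Continuous (Θ f j)) ∧ ∀ j z, |Θ f j z| ≤ ρ * ew a z)
    (hcon : ∀ f f' : κ → ℝ → ℝ, (∀ j, Continuous (f j)) → (∀ j z, |f j z| ≤ ρ * ew a z) →
      (∀ j, Continuous (f' j)) → (∀ j z, |f' j z| ≤ ρ * ew a z) → ∀ Δ, 0 ≤ Δ →
      (∀ j z, |f j z - f' j z| ≤ Δ * ew a z) →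
      ∀ j z, |Θ f j z - Θ f' j z| ≤ Δ / 2 * ew a z) :
    ∃ f : κ → ℝ → ℝ, (∀ j, Continuous (f j)) ∧ (∀ j z, |f j z| ≤ ρ * ew a z) ∧ Θ f = f := by
  let X := {φ : κ → BoundedContinuousFunction ℝ ℝ // φ ∈ Metric.closedBall 0 ρ}
  have : CompleteSpace X := (Metric.isClosed_closedBall.isComplete).completeSpace_coe
  have : Nonempty X := ⟨⟨0, Metric.mem_closedBall_self hρ.le⟩⟩
  let dec : X → κ → ℝ → ℝ := fun φ j z => ew a z * φ.1 j z
  have hdc : ∀ φ j, Continuous (dec φ j) := fun φ j => (continuous_ew a).mul (φ.1 j).continuous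
  have hdb : ∀ φ j z, |dec φ j z| ≤ ρ * ew a z := by
    intro φ j z
    have h1 : ‖φ.1‖ ≤ ρ := mem_closedBall_zero_iff.mp φ.2
    have h2 : |φ.1 j z| ≤ ρ := ((φ.1 j).norm_coe_le_norm z).trans ((norm_le_pi_norm φ.1 j).trans h1)
    simp only [dec]
    rw [abs_mul, abs_of_pos (ew_pos a z), mul_comm]
    exact mul_le_mul_of_nonneg_right h2 (ew_pos a z).le
  have hq : ∀ (u : ℝ) (r z : ℝ), |u| ≤ r * ew a z → |(ew a z)⁻¹ * u| ≤ r := by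
    intro u r z h
    have hw := ew_pos a z
    rw [abs_mul, abs_of_pos (inv_pos.mpr hw), ← div_eq_inv_mul, div_le_iff₀ hw]
    exact h
  let enc : X → κ → BoundedContinuousFunction ℝ ℝ := fun φ j =>
    BoundedContinuousFunction.ofNormedAddCommGroup (fun z => (ew a z)⁻¹ * Θ (dec φ) j z)
      (((continuous_ew a).inv₀ (fun z => (ew_pos a z).ne')).mul
        ((hmap (dec φ) (hdc φ) (hdb φ)).1 j)) ρ
      (fun z => hq _ _ _ ((hmap (dec φ) (hdc φ) (hdb φ)).2 j z))
  have henc : ∀ φ j z, enc φ j z = (ew a z)⁻¹ * Θ (dec φ) j z := fun φ j z => rfl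
  let T : X → X := fun φ => ⟨enc φ, by
    rw [mem_closedBall_zero_iff, pi_norm_le_iff_of_nonneg hρ.le]
    intro j
    rw [BoundedContinuousFunction.norm_le hρ.le]
    intro z
    rw [henc]
    exact hq _ _ _ ((hmap (dec φ) (hdc φ) (hdb φ)).2 j z)⟩
  have hT : ContractingWith (1 / 2) T := by
    refine ⟨by rw [← NNReal.coe_lt_coe]; norm_num, LipschitzWith.of_dist_le_mul ?_⟩
    intro φ ψ
    have hd : (0 : ℝ) ≤ dist φ ψ := dist_nonneg
    have hc : ((1 / 2 : NNReal) : ℝ) = 1 / 2 := by norm_num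
    rw [hc]
    change dist (enc φ) (enc ψ) ≤ _
    rw [dist_pi_le_iff (by positivity)]
    intro j
    rw [BoundedContinuousFunction.dist_le (by positivity)]
    intro z
    rw [Real.dist_eq, henc, henc, ← mul_sub]
    apply hq
    refine (hcon _ _ (hdc φ) (hdb φ) (hdc ψ) (hdb ψ) (dist φ ψ) hd ?_ j z).trans (le_of_eq (by ring))
    intro j z
    simp only [dec]
    rw [← mul_sub, abs_mul, abs_of_pos (ew_pos a z), mul_comm]
    refine mul_le_mul_of_nonneg_right ?_ (ew_pos a z).le
    rw [← Real.dist_eq]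
    exact ((φ.1 j).dist_coe_le_dist z).trans (dist_le_pi_dist φ.1 ψ.1 j)
  let φ := ContractingWith.fixedPoint T hT
  have hφ : T φ = φ := hT.fixedPoint_isFixedPt
  refine ⟨dec φ, hdc φ, hdb φ, ?_⟩
  ext j z
  have h1 : enc φ j z = φ.1 j z := by
    have : (T φ).1 = φ.1 := by rw [hφ]
    exact congrArg (fun u => u j z) this
  rw [henc] at h1
  have hw := (ew_pos a z).ne'
  simp only [dec, ← h1]
  field_simp

/-! ### Resolvents of the derivative -/

/-- The resolvent `(1 - p ∂)⁻¹`. -/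
noncomputable def resolv (p : ℝ) (f : ℝ → ℝ) (z : ℝ) : ℝ :=
  ∫ t in Set.Ioi (0 : ℝ), Real.exp (-t) * f (z + p * t)

section resolv
variable {a p K : ℝ} {f f' g : ℝ → ℝ}

lemma integrableOn_resolv (hf : Continuous f) (hb : ∀ z, |f z| ≤ K) (z : ℝ) :
    IntegrableOn (fun t => Real.exp (-t) * f (z + p * t)) (Set.Ioi 0) := by
  refine Integrable.mono' ((integrableOn_exp_neg_Ioi 0).mul_const K) ?_ ?_
  · have : Continuous fun t => Real.exp (-t) * f (z + p * t) := by fun_prop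
    exact this.aestronglyMeasurable
  · filter_upwards with t
    rw [Real.norm_eq_abs, abs_mul, abs_of_pos (Real.exp_pos _)]
    gcongr
    exact hb _

lemma weighted_le (ha : 0 ≤ a) (hb : ∀ z, |f z| ≤ K * ew a z) (z : ℝ) : |f z| ≤ K := by
  have hK : 0 ≤ K := by
    have := (abs_nonneg _).trans (hb 0); simpa [ew_at_zero] using this
  exact (hb z).trans (mul_le_of_le_one_right hK (ew_le_one ha z))

lemma resolv_bound (ha : 0 ≤ a) (hap : a * |p| ≤ 1 / 2)
    (hb : ∀ z, |f z| ≤ K * ew a z) (z : ℝ) : |resolv p f z| ≤ 2 * K * ew a z := by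
  have hK : 0 ≤ K := by
    have := (abs_nonneg _).trans (hb 0); simpa [ew_at_zero] using this
  have hint : IntegrableOn (fun t => K * ew a z * Real.exp (-(1 / 2) * t)) (Set.Ioi 0) :=
    (integrableOn_exp_mul_Ioi (by norm_num) 0).const_mul _
  have h1 : |resolv p f z| ≤ ∫ t in Set.Ioi (0 : ℝ), K * ew a z * Real.exp (-(1 / 2) * t) := by
    unfold resolv
    rw [← Real.norm_eq_abs]
    refine norm_integral_le_of_norm_le hint ?_
    filter_upwards [ae_restrict_mem measurableSet_Ioi] with t ht
    have ht0 : 0 ≤ t := le_of_lt ht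
    rw [Real.norm_eq_abs, abs_mul, abs_of_pos (Real.exp_pos _)]
    have h2 : ew a (z + p * t) ≤ ew a z * Real.exp (1 / 2 * t) := by
      refine (ew_shift a z (p * t)).trans ?_
      apply mul_le_mul_of_nonneg_left _ (ew_pos a z).le
      apply Real.exp_le_exp.mpr
      rw [abs_mul, abs_of_nonneg ha, abs_of_nonneg ht0]
      nlinarith
    calc Real.exp (-t) * |f (z + p * t)| ≤ Real.exp (-t) * (K * (ew a z * Real.exp (1 / 2 * t))) := by
          gcongr; exact (hb _).trans (by gcongr)
      _ = K * ew a z * (Real.exp (-t) * Real.exp (1 / 2 * t)) := by ring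
      _ = _ := by rw [← Real.exp_add]; congr 2; ring
  refine h1.trans (le_of_eq ?_)
  rw [integral_const_mul, integral_exp_mul_Ioi (by norm_num)]
  simp
  ring

lemma continuous_resolv (hf : Continuous f) (hb : ∀ z, |f z| ≤ K) : Continuous (resolv p f) := by
  unfold resolv
  refine continuous_of_dominated (bound := fun t => Real.exp (-t) * K) ?_ ?_
    ((integrableOn_exp_neg_Ioi 0).mul_const K) ?_
  · intro z; exact (integrableOn_resolv hf hb z).aestronglyMeasurable
  · intro z
    filter_upwards with t
    rw [Real.norm_eq_abs, abs_mul, abs_of_pos (Real.exp_pos _)]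
    gcongr
    exact hb _
  · filter_upwards with t
    fun_prop

lemma resolv_sub {K' : ℝ} (hf : Continuous f) (hb : ∀ z, |f z| ≤ K) (hg : Continuous g)
    (hb' : ∀ z, |g z| ≤ K') (z : ℝ) :
    resolv p (fun z => f z - g z) z = resolv p f z - resolv p g z := by
  unfold resolv
  rw [← integral_sub (integrableOn_resolv hf hb z) (integrableOn_resolv hg hb' z)]
  congr 1; ext t; ring

lemma resolv_const_mul (c : ℝ) (z : ℝ) :
    resolv p (fun z => c * f z) z = c * resolv p f z := by
  unfold resolv
  rw [← integral_const_mul]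
  congr 1; ext t; ring

lemma hasDerivAt_resolv {K' : ℝ} (hf : ∀ z, HasDerivAt f (f' z) z) (hf' : Continuous f')
    (hb : ∀ z, |f z| ≤ K) (hb' : ∀ z, |f' z| ≤ K') (z : ℝ) :
    HasDerivAt (resolv p f) (resolv p f' z) z := by
  have hfc : Continuous f := continuous_iff_continuousAt.mpr fun z => (hf z).continuousAt
  refine (hasDerivAt_integral_of_dominated_loc_of_deriv_le (s := Set.univ)
    (F := fun z t => Real.exp (-t) * f (z + p * t))
    (F' := fun z t => Real.exp (-t) * f' (z + p * t))
    (bound := fun t => Real.exp (-t) * K') Filter.univ_mem ?_ (integrableOn_resolv hfc hb z) ?_ ?_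
    ((integrableOn_exp_neg_Ioi 0).mul_const K') ?_).2
  · filter_upwards with y
    exact (integrableOn_resolv hfc hb y).aestronglyMeasurable
  · exact (integrableOn_resolv hf' hb' z).aestronglyMeasurable
  · filter_upwards with t y _
    rw [Real.norm_eq_abs, abs_mul, abs_of_pos (Real.exp_pos _)]
    gcongr
    exact hb' _
  · filter_upwards with t y _
    exact ((hf (y + p * t)).comp_add_const y (p * t)).const_mul _

/-- The fundamental theorem of calculus on the half-line, applied to e^{-t} f(z + p t). -/
lemma resolv_deriv {K' : ℝ} (hf : ∀ z, HasDerivAt f (f' z) z) (hf' : Continuous f')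
    (hb : ∀ z, |f z| ≤ K) (hb' : ∀ z, |f' z| ≤ K') (z : ℝ) :
    p * resolv p f' z = resolv p f z - f z := by
  have hfc : Continuous f := continuous_iff_continuousAt.mpr fun z => (hf z).continuousAt
  have i1 := integrableOn_resolv (p := p) hfc hb z
  have i2 := integrableOn_resolv (p := p) hf' hb' z
  have hd : ∀ t ∈ Set.Ici (0 : ℝ), HasDerivAt (fun t => Real.exp (-t) * f (z + p * t))
      (p * (Real.exp (-t) * f' (z + p * t)) - Real.exp (-t) * f (z + p * t)) t := by
    intro t _
    have h1 : HasDerivAt (fun t : ℝ => Real.exp (-t)) (Real.exp (-t) * (-1)) t :=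
      ((hasDerivAt_id t).neg).exp
    have h2 : HasDerivAt (fun t : ℝ => z + p * t) (p * 1) t :=
      ((hasDerivAt_id t).const_mul p).const_add z
    refine (h1.mul ((hf (z + p * t)).comp t h2)).congr_deriv ?_
    simp only [Function.comp]
    ring
  have hlim : Tendsto (fun t => Real.exp (-t) * f (z + p * t)) atTop (𝓝 0) := by
    have hexp : Tendsto (fun t : ℝ => Real.exp (-t) * K) atTop (𝓝 0) := by
      simpa using Real.tendsto_exp_neg_atTop_nhds_zero.mul_const K
    refine squeeze_zero_norm' ?_ hexp
    filter_upwards with t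
    rw [Real.norm_eq_abs, abs_mul, abs_of_pos (Real.exp_pos _)]
    gcongr
    exact hb _
  have := integral_Ioi_of_hasDerivAt_of_tendsto' hd ((i2.const_mul p).sub i1) hlim
  rw [integral_sub (i2.const_mul p) i1, integral_const_mul] at this
  unfold resolv
  simp only [mul_zero, add_zero, neg_zero, Real.exp_zero, one_mul] at this
  linarith

/-- The resolvent solves `u - p u' = f`. -/
lemma hasDerivAt_mul_resolv (ha : 0 < a) (hf : Continuous f)
    (hb : ∀ z, |f z| ≤ K * ew a z) (z : ℝ) :
    HasDerivAt (fun z => p * resolv p f z) (resolv p f z - f z) z := by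
  have hK : 0 ≤ K := by
    have := (abs_nonneg _).trans (hb 0); simpa [ew_at_zero] using this
  have hbK := weighted_le ha.le hb
  -- a bounded primitive of `f`
  set F : ℝ → ℝ := fun z => ∫ t in (0 : ℝ)..z, f t with hF
  have hFd : ∀ z, HasDerivAt F (f z) z := fun z =>
    intervalIntegral.integral_hasDerivAt_right (hf.intervalIntegrable _ _)
      (hf.stronglyMeasurableAtFilter _ _) hf.continuousAt
  have int1 : ∀ z : ℝ, 0 ≤ z → ∫ t in (0 : ℝ)..z, K * Real.exp (-a * t) ≤ K / a := by
    intro z hz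
    have h0 : -a ≠ 0 := by linarith
    rw [intervalIntegral.integral_const_mul, intervalIntegral.integral_comp_mul_left _ h0]
    simp only [mul_zero, integral_exp, Real.exp_zero, smul_eq_mul]
    have he := Real.exp_pos (-a * z)
    have : K * ((-a)⁻¹ * (Real.exp (-a * z) - 1)) = K / a - K * Real.exp (-a * z) / a := by
      field_simp; ring
    rw [this]
    have : 0 ≤ K * Real.exp (-a * z) / a := by positivity
    linarith
  have hFb : ∀ z, |F z| ≤ K / a := by
    intro z
    rcases le_total 0 z with hz | hz
    · rw [hF, ← Real.norm_eq_abs]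
      refine (intervalIntegral.norm_integral_le_of_norm_le hz
        (g := fun t => K * Real.exp (-a * t)) ?_ ?_).trans (int1 z hz)
      · refine Filter.Eventually.of_forall ?_
        intro t ht
        have := hb t
        rw [ew_of_nonneg a ht.1.le] at this
        simpa using this
      · exact (by fun_prop : Continuous fun t => K * Real.exp (-a * t)).intervalIntegrable _ _
    · have h1 : F z = -∫ t in (0 : ℝ)..(-z), f (-t) := by
        rw [intervalIntegral.integral_comp_neg, neg_zero, neg_neg, hF]
        exact intervalIntegral.integral_symm _ _
      rw [h1, abs_neg, ← Real.norm_eq_abs]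
      refine (intervalIntegral.norm_integral_le_of_norm_le (by linarith)
        (g := fun t => K * Real.exp (-a * t)) ?_ ?_).trans (int1 (-z) (by linarith))
      · refine Filter.Eventually.of_forall ?_
        intro t ht
        have := hb (-t)
        rw [ew_neg_arg, ew_of_nonneg a ht.1.le] at this
        simpa using this
      · exact (by fun_prop : Continuous fun t => K * Real.exp (-a * t)).intervalIntegrable _ _
  -- `f` is only continuous, so its resolvent cannot be differentiated under the integral. The
  -- identity moves the question to the primitive, which is bounded because `f` decays, and it holds
  -- for p = 0 as well.
  have e1 : (fun z => p * resolv p f z) = fun z => resolv p F z - F z := by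
    ext z; exact resolv_deriv hFd hf hFb hbK z
  rw [e1]
  exact (hasDerivAt_resolv hFd hf hFb hbK z).sub (hFd z)

end resolv

end IonShock

namespace IonShock

/-! ### The logistic front -/

/-- The solution of `g' = k g (1 - g)` with `g 0 = μ`. -/
noncomputable def logistic (k μ z : ℝ) : ℝ := (1 + (1 - μ) / μ * Real.exp (-(k * z)))⁻¹

section logistic
variable {k μ μ₀ a : ℝ}

lemma logistic_zero (hμ : 0 < μ) : logistic k μ 0 = μ := by
  unfold logistic; simp; field_simp; ring

lemma logistic_pos (hμ : 0 < μ) (hμ1 : μ < 1) (z : ℝ) : 0 < logistic k μ z := by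
  unfold logistic
  have : 0 < 1 - μ := by linarith
  positivity

lemma logistic_lt_one (hμ : 0 < μ) (hμ1 : μ < 1) (z : ℝ) : logistic k μ z < 1 := by
  unfold logistic
  have : 0 < 1 - μ := by linarith
  apply inv_lt_one_of_one_lt₀
  have : 0 < (1 - μ) / μ * Real.exp (-(k * z)) := by positivity
  linarith

lemma one_sub_logistic (hμ : 0 < μ) (hμ1 : μ < 1) (z : ℝ) :
    1 - logistic k μ z = logistic k μ z * ((1 - μ) / μ * Real.exp (-(k * z))) := by
  unfold logistic
  have : 0 < 1 - μ := by linarith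
  have : 0 < 1 + (1 - μ) / μ * Real.exp (-(k * z)) := by positivity
  field_simp
  ring

lemma hasDerivAt_logistic (hμ : 0 < μ) (hμ1 : μ < 1) (z : ℝ) :
    HasDerivAt (logistic k μ) (k * logistic k μ z * (1 - logistic k μ z)) z := by
  have h1 : HasDerivAt (fun t : ℝ => Real.exp (-(k * t))) (Real.exp (-(k * z)) * (-(k * 1))) z :=
    (((hasDerivAt_id z).const_mul k).neg).exp
  have : 0 < 1 - μ := by linarith
  have hp : 1 + (1 - μ) / μ * Real.exp (-(k * z)) ≠ 0 := by positivity
  have h2 := (((h1.const_mul ((1 - μ) / μ)).const_add 1).fun_inv hp)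
  rw [one_sub_logistic hμ hμ1]
  refine h2.congr_deriv ?_
  unfold logistic
  field_simp

lemma one_sub_logistic_le (hμ₀ : 0 < μ₀) (hμ : μ₀ ≤ μ) (hμ1 : μ < 1) (hak : a ≤ k) {z : ℝ} (hz : 0 ≤ z) :
    1 - logistic k μ z ≤ 1 / μ₀ * ew a z := by
  have hμ' : 0 < μ := hμ₀.trans_le hμ
  rw [one_sub_logistic hμ' hμ1, ew_of_nonneg a hz]
  have h1 := logistic_lt_one (k := k) hμ' hμ1 z
  have h2 := logistic_pos (k := k) hμ' hμ1 z
  have h3 : (1 - μ) / μ ≤ 1 / μ₀ := by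
    apply div_le_div₀ (by norm_num) (by linarith) hμ₀ hμ
  have h4 : Real.exp (-(k * z)) ≤ Real.exp (-(a * z)) := Real.exp_le_exp.mpr (by nlinarith)
  have h5 : 0 ≤ (1 - μ) / μ := div_nonneg (by linarith) hμ'.le
  calc _ ≤ 1 * ((1 - μ) / μ * Real.exp (-(k * z))) := by gcongr
    _ ≤ _ := by rw [one_mul]; gcongr

lemma logistic_le (hμ₀ : 0 < μ₀) (hμ : 0 < μ) (hμ1 : μ ≤ 1 - μ₀) (hak : a ≤ k) {z : ℝ} (hz : z ≤ 0) :
    logistic k μ z ≤ 1 / μ₀ * ew a z := by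
  have hμ1' : μ < 1 := by linarith
  rw [ew_of_nonpos a hz]
  have h0 := one_sub_logistic (k := k) hμ hμ1' z
  have h1 := logistic_lt_one (k := k) hμ hμ1' z
  have h2 := logistic_pos (k := k) hμ hμ1' z
  have h4 : Real.exp (k * z) ≤ Real.exp (a * z) := Real.exp_le_exp.mpr (by nlinarith)
  have h6 : Real.exp (-(k * z)) * Real.exp (k * z) = 1 := by rw [← Real.exp_add]; simp
  have hpos : 0 < 1 - μ := by linarith
  have e : logistic k μ z = (1 - logistic k μ z) * (μ / (1 - μ)) * Real.exp (k * z) := by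
    rw [h0]
    have : logistic k μ z * ((1 - μ) / μ * Real.exp (-(k * z))) * (μ / (1 - μ)) * Real.exp (k * z)
      = logistic k μ z * (Real.exp (-(k * z)) * Real.exp (k * z)) := by field_simp
    rw [this, h6, mul_one]
  have h3 : μ / (1 - μ) ≤ 1 / μ₀ := by
    apply div_le_div₀ (by norm_num) (by linarith) hμ₀ (by linarith)
  have h5 : 0 ≤ μ / (1 - μ) := div_nonneg hμ.le (by linarith)
  rw [e]
  calc _ ≤ 1 * (μ / (1 - μ)) * Real.exp (k * z) := by gcongr; linarith
    _ ≤ _ := by rw [one_mul]; gcongr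

lemma logistic_prod_le (hμ₀ : 0 < μ₀) (hμ : μ₀ ≤ μ) (hμ1 : μ ≤ 1 - μ₀) (hak : a ≤ k) (z : ℝ) :
    logistic k μ z * (1 - logistic k μ z) ≤ 1 / μ₀ * ew a z := by
  have hμ' : 0 < μ := hμ₀.trans_le hμ
  have hμ1' : μ < 1 := by linarith
  have h1 := logistic_lt_one (k := k) hμ' hμ1' z
  have h2 := logistic_pos (k := k) hμ' hμ1' z
  rcases le_total 0 z with hz | hz
  · have := one_sub_logistic_le hμ₀ hμ hμ1' hak hz
    nlinarith
  · have := logistic_le hμ₀ hμ' hμ1 hak hz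
    nlinarith

end logistic

/-- The solution operator of `d' = k (1 - 2 g₀) d + F`, `d 0 = 0`, at the logistic front `g₀`. -/
noncomputable def slowSol (k μ : ℝ) (F : ℝ → ℝ) (z : ℝ) : ℝ :=
  logistic k μ z * (1 - logistic k μ z) *
    ∫ t in (0 : ℝ)..z, F t / (logistic k μ t * (1 - logistic k μ t))

section slow
variable {k μ μ₀ a a₁ K : ℝ} {F F' : ℝ → ℝ}

lemma continuous_logistic (hμ : 0 < μ) (hμ1 : μ < 1) : Continuous (logistic k μ) :=
  continuous_iff_continuousAt.mpr fun z => (hasDerivAt_logistic hμ hμ1 z).continuousAt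

lemma logistic_prod_ne (hμ : 0 < μ) (hμ1 : μ < 1) (z : ℝ) :
    logistic k μ z * (1 - logistic k μ z) ≠ 0 :=
  mul_ne_zero (logistic_pos hμ hμ1 z).ne' (by linarith [logistic_lt_one (k := k) hμ hμ1 z])

lemma continuous_slow_integrand (hμ : 0 < μ) (hμ1 : μ < 1) (hF : Continuous F) :
    Continuous fun t => F t / (logistic k μ t * (1 - logistic k μ t)) :=
  hF.div ((continuous_logistic hμ hμ1).mul (continuous_const.sub (continuous_logistic hμ hμ1)))
    (logistic_prod_ne hμ hμ1)

lemma slowSol_zero : slowSol k μ F 0 = 0 := by simp [slowSol]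

lemma slowSol_sub (hμ : 0 < μ) (hμ1 : μ < 1) (hF : Continuous F) (hF' : Continuous F') (z : ℝ) :
    slowSol k μ (fun z => F z - F' z) z = slowSol k μ F z - slowSol k μ F' z := by
  unfold slowSol
  rw [← mul_sub, ← intervalIntegral.integral_sub
    ((continuous_slow_integrand hμ hμ1 hF).intervalIntegrable _ _)
    ((continuous_slow_integrand hμ hμ1 hF').intervalIntegrable _ _)]
  congr 2; ext t; ring

lemma hasDerivAt_slowSol (hμ : 0 < μ) (hμ1 : μ < 1) (hF : Continuous F) (z : ℝ) :
    HasDerivAt (slowSol k μ F) (k * (1 - 2 * logistic k μ z) * slowSol k μ F z + F z) z := by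
  have hc := continuous_slow_integrand (k := k) hμ hμ1 hF
  have h1 := intervalIntegral.integral_hasDerivAt_right (hc.intervalIntegrable 0 z)
    (hc.stronglyMeasurableAtFilter _ _) hc.continuousAt
  have hg := hasDerivAt_logistic (k := k) hμ hμ1 z
  have h2 := (hg.fun_mul (hg.const_sub 1)).fun_mul h1
  refine h2.congr_deriv ?_
  have := logistic_prod_ne (k := k) hμ hμ1 z
  have e : logistic k μ z * (1 - logistic k μ z) *
    (F z / (logistic k μ z * (1 - logistic k μ z))) = F z := mul_div_cancel₀ _ this
  rw [e]
  unfold slowSol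
  ring

/-- The coefficient k (1 - 2 g₀) differs from its limits -k and k by 2 k times a logistic tail. With
k ≤ 3 and tails at most e^{-a₁|z|} / μ₀ this gives the constant 6 / μ₀ in `slow_bound`. -/
lemma slowSol_bound (ha : a < a₁) (ha₁ : 0 < a₁) (hk : a₁ ≤ k) (hk3 : k ≤ 3) (hμ₀ : 0 < μ₀)
    (hμ : μ₀ ≤ μ) (hμ1 : μ ≤ 1 - μ₀) (hF : Continuous F) (hb : ∀ z, |F z| ≤ K * ew a z) (z : ℝ) :
    |slowSol k μ F z| ≤ Real.exp (6 / μ₀ / a₁) / (a₁ - a) * K * ew a z := by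
  have hμ' : 0 < μ := hμ₀.trans_le hμ
  have hμ1' : μ < 1 := by linarith
  have := slow_bound (b := a₁) (M := 6 / μ₀) ha ha₁ (by positivity)
    (hasDerivAt_slowSol (k := k) hμ' hμ1' hF) ?_ ?_ hb z
  · rw [slowSol_zero, abs_zero, zero_add] at this
    refine this.trans (le_of_eq (by ring))
  · intro z hz
    have h := one_sub_logistic_le hμ₀ hμ hμ1' hk hz
    have h1 := logistic_lt_one (k := k) hμ' hμ1' z
    have e : (6 : ℝ) / μ₀ = 6 * (1 / μ₀) := by ring
    rw [e]
    nlinarith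
  · intro z hz
    have h := logistic_le hμ₀ hμ' hμ1 hk hz
    have h1 := logistic_pos (k := k) hμ' hμ1' z
    have e : (6 : ℝ) / μ₀ = 6 * (1 / μ₀) := by ring
    rw [e]
    nlinarith

end slow

/-- Bounds for the solution operator of the fast linear system. -/
lemma fast_op_bound {a e τ M σ K₁ K₁' K₂ : ℝ} {h₁ h₁' h₂ : ℝ → ℝ} (ha : 0 < a) (he : 0 < e)
    (hτ : 0 ≤ τ) (heM : e ≤ M) (hτM : τ ≤ M) (haM : a * (2 * M) ≤ 1 / 2) (hσ : 0 ≤ σ)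
    (hd : ∀ z, HasDerivAt h₁ (h₁' z) z) (hc' : Continuous h₁') (hc₂ : Continuous h₂)
    (hb : ∀ z, |h₁ z| ≤ K₁ * ew a z) (hb' : ∀ z, |h₁' z| ≤ K₁' * ew a z)
    (hb₂ : ∀ z, |h₂ z| ≤ K₂ * ew a z) (z : ℝ) :
    |resolv (fastP e τ) (resolv (-fastQ e τ) fun z => h₁ z + σ * h₂ z) z| ≤
        4 * (K₁ + σ * K₂) * ew a z ∧
    |e / fastP e τ * (resolv (fastP e τ) (resolv (-fastQ e τ) fun z => h₁ z + σ * h₂ z) z -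
        resolv (-fastQ e τ) (fun z => h₁ z + σ * h₂ z) z)| ≤
      (4 * e * K₁' + 6 * σ * K₂) * ew a z := by
  set p := fastP e τ with hp
  set q := fastQ e τ with hq
  have hp0 : 0 < p := fastP_pos he hτ
  have hpe : e ≤ p := fastP_ge he hτ
  have hq0 : 0 ≤ q := fastQ_nonneg he hτ
  have hap : a * |p| ≤ 1 / 2 := by
    have := fastP_le he heM hτM
    rw [abs_of_pos hp0]; nlinarith
  have haq : a * |(-q)| ≤ 1 / 2 := by
    have := fastQ_le he heM hτM
    rw [abs_neg, abs_of_nonneg hq0]; nlinarith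
  have hc₁ : Continuous h₁ := continuous_iff_continuousAt.mpr fun z => (hd z).continuousAt
  have hw : ∀ {f : ℝ → ℝ} {K : ℝ}, (∀ z, |f z| ≤ K * ew a z) → ∀ z, |f z| ≤ K :=
    fun h => weighted_le ha.le h
  -- the two parts of the source
  have b₁ : ∀ z, |resolv (-q) h₁ z| ≤ 2 * K₁ * ew a z := resolv_bound ha.le haq hb
  have b₂ : ∀ z, |resolv (-q) h₂ z| ≤ 2 * K₂ * ew a z := resolv_bound ha.le haq hb₂
  have c₁ : Continuous (resolv (-q) h₁) := continuous_resolv hc₁ (hw hb)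
  have c₂ : Continuous (resolv (-q) h₂) := continuous_resolv hc₂ (hw hb₂)
  have split : ∀ {p : ℝ} {f g : ℝ → ℝ} {K K' : ℝ}, Continuous f → Continuous g →
      (∀ z, |f z| ≤ K) → (∀ z, |g z| ≤ K') → (resolv p fun z => f z + σ * g z) =
      fun z => resolv p f z + σ * resolv p g z := by
    intro p f g K K' hf hg hfb hgb
    ext z
    have hg' : ∀ z, |(-σ) * g z| ≤ σ * K' := fun z => by
      rw [abs_mul, abs_neg, abs_of_nonneg hσ]; have := hgb z; gcongr
    have := resolv_sub (p := p) (g := fun z => (-σ) * g z) hf hfb (continuous_const.mul hg) hg' z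
    rw [resolv_const_mul] at this
    have e : (fun z => f z + σ * g z) = fun z => f z - -σ * g z := by ext z; ring
    rw [e, this]; ring
  have s1 : (resolv (-q) fun z => h₁ z + σ * h₂ z) =
      fun z => resolv (-q) h₁ z + σ * resolv (-q) h₂ z := split hc₁ hc₂ (hw hb) (hw hb₂)
  have s2 : resolv p (resolv (-q) fun z => h₁ z + σ * h₂ z) =
      fun z => resolv p (resolv (-q) h₁) z + σ * resolv p (resolv (-q) h₂) z := by
    rw [s1]; exact split c₁ c₂ (hw b₁) (hw b₂)
  have bb₁ : |resolv p (resolv (-q) h₁) z| ≤ 2 * (2 * K₁) * ew a z := resolv_bound ha.le hap b₁ z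
  have bb₂ : |resolv p (resolv (-q) h₂) z| ≤ 2 * (2 * K₂) * ew a z := resolv_bound ha.le hap b₂ z
  have hep : e / p ≤ 1 := by rw [div_le_one hp0]; exact hpe
  have hep0 : 0 < e / p := div_pos he hp0
  have hσt : ∀ {u K : ℝ}, |u| ≤ K → |σ * u| ≤ σ * K := fun h => by
    rw [abs_mul, abs_of_nonneg hσ]; gcongr
  constructor
  · rw [s2]
    have := abs_add_le (resolv p (resolv (-q) h₁) z) (σ * resolv p (resolv (-q) h₂) z)
    have := hσt bb₂
    refine (abs_add_le _ _).trans ?_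
    linarith
  · rw [s2, s1]
    -- the regular part is small
    have hd2 := hasDerivAt_resolv (p := -q) hd hc' (hw hb) (hw hb')
    have c1' : Continuous (resolv (-q) h₁') := continuous_resolv hc' (hw hb')
    have b1' : ∀ z, |resolv (-q) h₁' z| ≤ 2 * K₁' * ew a z := resolv_bound ha.le haq hb'
    have key := resolv_deriv (p := p) hd2 c1' (hw b₁) (hw b1') z
    have bb1' : |resolv p (resolv (-q) h₁') z| ≤ 2 * (2 * K₁') * ew a z :=
      resolv_bound ha.le hap b1' z
    -- On the differentiable part of the source, resolvent minus identity equals p times the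
    -- resolvent of the derivative, and the prefactor e / p leaves e. On the other part there is no
    -- such gain, but it carries σ.
    have e1 : e / p * (resolv p (resolv (-q) h₁) z + σ * resolv p (resolv (-q) h₂) z -
        (resolv (-q) h₁ z + σ * resolv (-q) h₂ z)) =
        e * resolv p (resolv (-q) h₁') z +
          e / p * (σ * (resolv p (resolv (-q) h₂) z - resolv (-q) h₂ z)) := by
      have : e * resolv p (resolv (-q) h₁') z = e / p * (p * resolv p (resolv (-q) h₁') z) := by
        field_simp
      rw [this, key]; ring
    rw [e1]
    have t1 : |e * resolv p (resolv (-q) h₁') z| ≤ e * (2 * (2 * K₁') * ew a z) := by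
      rw [abs_mul, abs_of_pos he]; gcongr
    have t2 : |e / p * (σ * (resolv p (resolv (-q) h₂) z - resolv (-q) h₂ z))| ≤
        1 * (σ * (6 * K₂ * ew a z)) := by
      rw [abs_mul, abs_of_pos hep0]
      have : |resolv p (resolv (-q) h₂) z - resolv (-q) h₂ z| ≤ 6 * K₂ * ew a z := by
        refine (abs_sub _ _).trans ?_
        linarith [b₂ z]
      exact mul_le_mul hep (hσt this) (abs_nonneg _) (by norm_num)
    refine (abs_add_le _ _).trans ?_
    linarith

end IonShock

namespace IonShock

/-! ### Existence of fronts -/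

/-- The constant in the bound for `slowSol`. -/
noncomputable def slowConst (μ₀ a a₁ : ℝ) : ℝ := Real.exp (6 / μ₀ / a₁) / (a₁ - a)

/-- Perturbation of the logistic front. -/
noncomputable def pertFront (k μ : ℝ) (F : ℝ → ℝ) (z : ℝ) : ℝ := logistic k μ z + slowSol k μ F z

/-- The parameter range for the existence theorem. -/
structure FrontRange (μ₀ a a₁ k μ : ℝ) : Prop where
  ha : 0 < a
  haa : a < a₁
  hk : a₁ ≤ k
  hk3 : k ≤ 3
  hμ₀ : 0 < μ₀
  hμ : μ₀ ≤ μ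
  hμ1 : μ ≤ 1 - μ₀

section
variable {k μ μ₀ a a₁ ρ K : ℝ} {F F' : ℝ → ℝ}

lemma slowConst_pos (haa : a < a₁) : 0 < slowConst μ₀ a a₁ := by
  have : 0 < a₁ - a := by linarith
  unfold slowConst; positivity

lemma FrontRange.slow (R : FrontRange μ₀ a a₁ k μ) (hF : Continuous F)
    (hb : ∀ z, |F z| ≤ K * ew a z) (z : ℝ) :
    |slowSol k μ F z| ≤ slowConst μ₀ a a₁ * K * ew a z :=
  slowSol_bound R.haa (R.ha.trans R.haa) R.hk R.hk3 R.hμ₀ R.hμ R.hμ1 hF hb z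

lemma FrontRange.pos (R : FrontRange μ₀ a a₁ k μ) : 0 < μ := R.hμ₀.trans_le R.hμ

lemma FrontRange.lt_one (R : FrontRange μ₀ a a₁ k μ) : μ < 1 := by linarith [R.hμ1, R.hμ₀]

lemma FrontRange.hasDerivAt (R : FrontRange μ₀ a a₁ k μ) (hF : Continuous F) (z : ℝ) :
    HasDerivAt (pertFront k μ F) (k * logistic k μ z * (1 - logistic k μ z) +
      (k * (1 - 2 * logistic k μ z) * slowSol k μ F z + F z)) z :=
  (hasDerivAt_logistic R.pos R.lt_one z).add (hasDerivAt_slowSol R.pos R.lt_one hF z)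

/-- The condition on the product of `slowConst` and `ρ` keeps the correction below half the weight,
so the perturbed front stays bounded by 3/2 and its logistic product decays with a constant
depending on `μ₀` alone. -/
lemma FrontRange.bounds (R : FrontRange μ₀ a a₁ k μ) (hρ1 : ρ ≤ 1)
    (hρ : slowConst μ₀ a a₁ * ρ ≤ 1 / 2) (hF : Continuous F) (hb : ∀ z, |F z| ≤ ρ * ew a z) (z : ℝ) :
    |slowSol k μ F z| ≤ 1 / 2 * ew a z ∧ |pertFront k μ F z| ≤ 3 / 2 ∧
    |1 - 2 * logistic k μ z| ≤ 1 ∧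
    |k * logistic k μ z * (1 - logistic k μ z) +
      (k * (1 - 2 * logistic k μ z) * slowSol k μ F z + F z)| ≤ (3 / μ₀ + 3) * ew a z ∧
    |k * pertFront k μ F z * (1 - pertFront k μ F z)| ≤ (3 / μ₀ + 5) * ew a z := by
  have hk0 : 0 < k := (R.ha.trans R.haa).trans_le R.hk
  have hk3 := R.hk3
  have w0 := ew_pos a z
  have w1 := ew_le_one R.ha.le z
  have hd : |slowSol k μ F z| ≤ 1 / 2 * ew a z := by
    refine (R.slow hF hb z).trans ?_
    gcongr
  have l0 := logistic_pos (k := k) R.pos R.lt_one z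
  have l1 := logistic_lt_one (k := k) R.pos R.lt_one z
  have h1 : |1 - 2 * logistic k μ z| ≤ 1 := by rw [abs_le]; constructor <;> linarith
  have hq : |k * logistic k μ z * (1 - logistic k μ z)| ≤ 3 / μ₀ * ew a z := by
    have := logistic_prod_le R.hμ₀ R.hμ R.hμ1 (R.haa.le.trans R.hk) z
    have h0 : 0 ≤ logistic k μ z * (1 - logistic k μ z) := mul_nonneg l0.le (by linarith)
    rw [mul_assoc, abs_mul, abs_of_pos hk0, abs_of_nonneg h0]
    calc k * (logistic k μ z * (1 - logistic k μ z)) ≤ 3 * (1 / μ₀ * ew a z) := by gcongr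
      _ = _ := by ring
  have hl : |k * (1 - 2 * logistic k μ z) * slowSol k μ F z| ≤ 3 / 2 * ew a z := by
    rw [abs_mul, abs_mul, abs_of_pos hk0]
    calc k * |1 - 2 * logistic k μ z| * |slowSol k μ F z| ≤ 3 * 1 * (1 / 2 * ew a z) := by gcongr
      _ = _ := by ring
  have hF1 : |F z| ≤ 1 * ew a z := (hb z).trans (by gcongr)
  have hd2 : |k * slowSol k μ F z ^ 2| ≤ 3 / 4 * ew a z := by
    rw [abs_mul, abs_of_pos hk0, abs_pow]
    have h2 : |slowSol k μ F z| ^ 2 ≤ (1 / 2 * ew a z) ^ 2 := by gcongr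
    have h3 : ew a z ^ 2 ≤ ew a z := by rw [sq]; exact mul_le_of_le_one_left w0.le w1
    calc k * |slowSol k μ F z| ^ 2 ≤ 3 * (1 / 2 * ew a z) ^ 2 := by gcongr
      _ = 3 / 4 * ew a z ^ 2 := by ring
      _ ≤ _ := by gcongr
  refine ⟨hd, ?_, h1, ?_, ?_⟩
  · have : |logistic k μ z| ≤ 1 := by rw [abs_of_pos l0]; exact l1.le
    have := abs_add_le (logistic k μ z) (slowSol k μ F z)
    unfold pertFront
    linarith
  · have e1 := abs_add_le (k * logistic k μ z * (1 - logistic k μ z))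
      (k * (1 - 2 * logistic k μ z) * slowSol k μ F z + F z)
    have e2 := abs_add_le (k * (1 - 2 * logistic k μ z) * slowSol k μ F z) (F z)
    have e3 : (3 / μ₀ + 3) * ew a z = 3 / μ₀ * ew a z + 3 * ew a z := by ring
    linarith
  · have e : k * pertFront k μ F z * (1 - pertFront k μ F z) =
        k * logistic k μ z * (1 - logistic k μ z) + k * (1 - 2 * logistic k μ z) * slowSol k μ F z
          - k * slowSol k μ F z ^ 2 := by unfold pertFront; ring
    rw [e]
    have e1 := abs_sub (k * logistic k μ z * (1 - logistic k μ z) +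
      k * (1 - 2 * logistic k μ z) * slowSol k μ F z) (k * slowSol k μ F z ^ 2)
    have e2 := abs_add_le (k * logistic k μ z * (1 - logistic k μ z))
      (k * (1 - 2 * logistic k μ z) * slowSol k μ F z)
    have e3 : (3 / μ₀ + 5) * ew a z = 3 / μ₀ * ew a z + 5 * ew a z := by ring
    linarith

/-- Derivative of the logistic nonlinearity along a perturbed front. -/
noncomputable def pertSlope (k μ : ℝ) (F : ℝ → ℝ) (z : ℝ) : ℝ :=
  k * (1 - 2 * pertFront k μ F z) * (k * logistic k μ z * (1 - logistic k μ z) +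
      (k * (1 - 2 * logistic k μ z) * slowSol k μ F z + F z))

lemma FrontRange.hasDerivAt_logistic (R : FrontRange μ₀ a a₁ k μ) (hF : Continuous F) (z : ℝ) :
    HasDerivAt (fun z => k * pertFront k μ F z * (1 - pertFront k μ F z))
      (pertSlope k μ F z) z := by
  have h := R.hasDerivAt hF z
  refine ((h.const_mul k).fun_mul (h.const_sub 1)).congr_deriv ?_
  unfold pertSlope; ring

lemma FrontRange.continuous (R : FrontRange μ₀ a a₁ k μ) (hF : Continuous F) :
    Continuous (slowSol k μ F) ∧ Continuous (pertFront k μ F) ∧ Continuous (pertSlope k μ F) := by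
  have h1 : Continuous (slowSol k μ F) :=
    continuous_iff_continuousAt.mpr fun z => (hasDerivAt_slowSol R.pos R.lt_one hF z).continuousAt
  have h2 := continuous_logistic (k := k) R.pos R.lt_one
  have h3 : Continuous (pertFront k μ F) := h2.add h1
  exact ⟨h1, h3, by unfold pertSlope; fun_prop⟩

lemma FrontRange.slope_bound (R : FrontRange μ₀ a a₁ k μ) (hρ1 : ρ ≤ 1)
    (hρ : slowConst μ₀ a a₁ * ρ ≤ 1 / 2) (hF : Continuous F) (hb : ∀ z, |F z| ≤ ρ * ew a z) (z : ℝ) :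
    |pertSlope k μ F z| ≤ 12 * (3 / μ₀ + 3) * ew a z := by
  have hk0 : 0 < k := (R.ha.trans R.haa).trans_le R.hk
  obtain ⟨-, h2, -, h3, -⟩ := R.bounds hρ1 hρ hF hb z
  have h4 : |1 - 2 * pertFront k μ F z| ≤ 4 := by
    have := abs_le.mp h2; rw [abs_le]; constructor <;> linarith
  unfold pertSlope
  rw [abs_mul, abs_mul, abs_of_pos hk0]
  have hk3 := R.hk3
  calc _ ≤ 3 * 4 * ((3 / μ₀ + 3) * ew a z) := by gcongr
    _ = _ := by ring

lemma FrontRange.sub_bounds (R : FrontRange μ₀ a a₁ k μ) (hρ1 : ρ ≤ 1)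
    (hρ : slowConst μ₀ a a₁ * ρ ≤ 1 / 2) (hF : Continuous F) (hb : ∀ z, |F z| ≤ ρ * ew a z)
    (hF' : Continuous F') (hb' : ∀ z, |F' z| ≤ ρ * ew a z) {Δ : ℝ}
    (hd : ∀ z, |F z - F' z| ≤ Δ * ew a z) (z : ℝ) :
    |slowSol k μ F z - slowSol k μ F' z| ≤ slowConst μ₀ a a₁ * Δ * ew a z ∧
    |k * pertFront k μ F z * (1 - pertFront k μ F z) -
      k * pertFront k μ F' z * (1 - pertFront k μ F' z)| ≤
      12 * slowConst μ₀ a a₁ * Δ * ew a z ∧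
    |pertSlope k μ F z - pertSlope k μ F' z| ≤
      (12 * (3 * slowConst μ₀ a a₁ + 1) + 6 * slowConst μ₀ a a₁ * (3 / μ₀ + 3)) * Δ * ew a z ∧
    |k * slowSol k μ F z ^ 2 - k * slowSol k μ F' z ^ 2| ≤
      6 * slowConst μ₀ a a₁ ^ 2 * ρ * Δ * ew a z := by
  set Cs := slowConst μ₀ a a₁
  have hCs : 0 < Cs := slowConst_pos R.haa
  have hk0 : 0 < k := (R.ha.trans R.haa).trans_le R.hk
  have hk3 := R.hk3
  have w0 := ew_pos a z
  have w1 := ew_le_one R.ha.le z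
  have hρ0 : 0 ≤ ρ := by
    have := (abs_nonneg _).trans (hb 0); simpa [ew_at_zero] using this
  have hΔ0 : 0 ≤ Δ := by
    have := (abs_nonneg _).trans (hd 0); simpa [ew_at_zero] using this
  have hs : |slowSol k μ F z - slowSol k μ F' z| ≤ Cs * Δ * ew a z := by
    rw [← slowSol_sub R.pos R.lt_one hF hF']
    exact R.slow (hF.sub hF') hd z
  obtain ⟨a1, a2, a3, a4, -⟩ := R.bounds hρ1 hρ hF hb z
  obtain ⟨b1, b2, -, b4, -⟩ := R.bounds hρ1 hρ hF' hb' z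
  have e1 : pertFront k μ F z - pertFront k μ F' z = slowSol k μ F z - slowSol k μ F' z := by
    unfold pertFront; ring
  refine ⟨hs, ?_, ?_, ?_⟩
  · have e : k * pertFront k μ F z * (1 - pertFront k μ F z) -
        k * pertFront k μ F' z * (1 - pertFront k μ F' z) =
        k * (1 - pertFront k μ F z - pertFront k μ F' z) *
          (slowSol k μ F z - slowSol k μ F' z) := by rw [← e1]; ring
    rw [e, abs_mul, abs_mul, abs_of_pos hk0]
    have h4 : |1 - pertFront k μ F z - pertFront k μ F' z| ≤ 4 := by
      have := abs_le.mp a2; have := abs_le.mp b2; rw [abs_le]; constructor <;> linarith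
    calc _ ≤ 3 * 4 * (Cs * Δ * ew a z) := by gcongr
      _ = _ := by ring
  · set g' := k * logistic k μ z * (1 - logistic k μ z) +
      (k * (1 - 2 * logistic k μ z) * slowSol k μ F z + F z) with hg'
    set g'' := k * logistic k μ z * (1 - logistic k μ z) +
      (k * (1 - 2 * logistic k μ z) * slowSol k μ F' z + F' z) with hg''
    have e : pertSlope k μ F z - pertSlope k μ F' z =
        k * (1 - 2 * pertFront k μ F z) * (g' - g'')
          - 2 * k * (slowSol k μ F z - slowSol k μ F' z) * g'' := by
      rw [← e1]; unfold pertSlope; rw [← hg', ← hg'']; ring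
    have h4 : |1 - 2 * pertFront k μ F z| ≤ 4 := by
      have := abs_le.mp a2; rw [abs_le]; constructor <;> linarith
    have h5 : |g' - g''| ≤ (3 * Cs + 1) * Δ * ew a z := by
      have e : g' - g'' = k * (1 - 2 * logistic k μ z) * (slowSol k μ F z - slowSol k μ F' z) +
        (F z - F' z) := by rw [hg', hg'']; ring
      rw [e]
      refine (abs_add_le _ _).trans ?_
      rw [abs_mul, abs_mul, abs_of_pos hk0]
      calc _ ≤ 3 * 1 * (Cs * Δ * ew a z) + Δ * ew a z := by gcongr; exact hd z
        _ = _ := by ring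
    have h6 : |g''| ≤ 3 / μ₀ + 3 := by
      refine b4.trans (mul_le_of_le_one_right ?_ w1)
      have := R.hμ₀; positivity
    rw [e]
    refine (abs_sub _ _).trans ?_
    rw [abs_mul, abs_mul, abs_mul, abs_mul, abs_mul, abs_of_pos hk0, abs_two]
    calc _ ≤ 3 * 4 * ((3 * Cs + 1) * Δ * ew a z) + 2 * 3 * (Cs * Δ * ew a z) * (3 / μ₀ + 3) := by gcongr
      _ = _ := by ring
  · have e : k * slowSol k μ F z ^ 2 - k * slowSol k μ F' z ^ 2 =
        k * (slowSol k μ F z + slowSol k μ F' z) * (slowSol k μ F z - slowSol k μ F' z) := by ring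
    have h1 : |slowSol k μ F z + slowSol k μ F' z| ≤ 2 * Cs * ρ := by
      have c1 := R.slow hF hb z
      have c2 := R.slow hF' hb' z
      have c3 : Cs * ρ * ew a z ≤ Cs * ρ := mul_le_of_le_one_right (by positivity) w1
      have := abs_add_le (slowSol k μ F z) (slowSol k μ F' z)
      linarith
    rw [e, abs_mul, abs_mul, abs_of_pos hk0]
    calc _ ≤ 3 * (2 * Cs * ρ) * (Cs * Δ * ew a z) := by gcongr
      _ = _ := by ring

end

end IonShock

namespace IonShock

/-- Bounds for the nonlinear perturbations that gain the decay of their arguments. -/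
lemma pert_bound {k e σ τ g x y K L w K₁ X Y : ℝ}
    (hL : 0 ≤ L) (h : ∀ k e σ τ g x y g' x' y' : ℝ, |k| ≤ K → |e| ≤ K → |σ| ≤ K → |τ| ≤ K →
    |g| ≤ K → |x| ≤ K → |y| ≤ K → |g'| ≤ K → |x'| ≤ K → |y'| ≤ K →
    |slowPert k e σ g x y - slowPert k e σ g' x' y'| ≤ L * (|g - g'| + |x - x'| + |y - y'|) ∧
    |fastPert k e σ τ g x y - fastPert k e σ τ g' x' y'| ≤
      L * (|g - g'| + |x - x'| + |y - y'|))
    (hK : 0 ≤ K) (hk : |k| ≤ K) (he : |e| ≤ K) (hσ : |σ| ≤ K) (hτ : |τ| ≤ K) (hgK : |g| ≤ K)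
    (hxK : |x| ≤ K) (hyK : |y| ≤ K) (hg : |g| ≤ 3 / 2) (hx : |x| ≤ X * w) (hy : |y| ≤ Y * w)
    (hq : |k * g * (1 - g)| ≤ K₁ * w) :
    |slowPert k e σ g x y| ≤ (L * (X + Y) + 2 * K₁) * w ∧
    |fastPert k e σ τ g x y| ≤ (L * (X + Y) + 2 * K₁) * w := by
  -- Comparison with the point (g, 0, 0), where both perturbations reduce to the decaying term -g ·
  -- k g (1 - g). The Lipschitz bound then costs only |x| + |y|.
  obtain ⟨h1, h2⟩ := h k e σ τ g x y g 0 0 hk he hσ hτ hgK hxK hyK hgK (by simpa) (by simpa)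
  simp only [sub_self, abs_zero, sub_zero, zero_add] at h1 h2
  have h3 : |g * (k * g * (1 - g))| ≤ 2 * (K₁ * w) := by
    rw [abs_mul]; gcongr; linarith
  have e1 : slowPert k e σ g 0 0 = -(g * (k * g * (1 - g))) := by unfold slowPert; ring
  have e2 : fastPert k e σ τ g 0 0 = -(g * (k * g * (1 - g))) := by unfold fastPert slowPert; ring
  rw [e1] at h1
  rw [e2] at h2
  have h4 : L * (|x| + |y|) ≤ L * (X * w + Y * w) := by gcongr
  have a3 := abs_le.mp h3
  have a1 := abs_le.mp h1
  have a2 := abs_le.mp h2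
  have e3 : (L * (X + Y) + 2 * K₁) * w = L * (X * w + Y * w) + 2 * (K₁ * w) := by ring
  rw [e3]
  constructor <;> rw [abs_le] <;> constructor <;> linarith

/-- The right-hand side of the fast equations along a perturbed front. -/
noncomputable def fastSource (k e σ τ μ : ℝ) (F x y : ℝ → ℝ) (z : ℝ) : ℝ :=
  k * pertFront k μ F z * (1 - pertFront k μ F z) +
    σ * fastPert k e σ τ (pertFront k μ F z) (x z) (y z)

/-- The solution `y` of the fast equations. -/
noncomputable def fastY (k e σ τ μ : ℝ) (F x y : ℝ → ℝ) : ℝ → ℝ :=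
  resolv (fastP e τ) (resolv (-fastQ e τ) (fastSource k e σ τ μ F x y))

/-- The solution `x` of the fast equations. -/
noncomputable def fastX (k e σ τ μ : ℝ) (F x y : ℝ → ℝ) (z : ℝ) : ℝ :=
  e / fastP e τ * (fastY k e σ τ μ F x y z - resolv (-fastQ e τ) (fastSource k e σ τ μ F x y) z)

/-- The map whose fixed points are fronts. -/
noncomputable def frontMap (k e σ τ μ Λ : ℝ) (f : Fin 3 → ℝ → ℝ) : Fin 3 → ℝ → ℝ :=
  ![fun z => fastX k e σ τ μ (f 0) (f 1) (fun z => Λ * f 2 z) z - k * slowSol k μ (f 0) z ^ 2 +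
      σ * slowPert k e σ (pertFront k μ (f 0) z) (f 1 z) (Λ * f 2 z),
    fastX k e σ τ μ (f 0) (f 1) (fun z => Λ * f 2 z),
    fun z => Λ⁻¹ * fastY k e σ τ μ (f 0) (f 1) (fun z => Λ * f 2 z) z]

/-- At a fixed point `f 0` is the source F of the linearised slow equation, `f 1` is x and `Λ * f 2`
is y. For g = g₀ + d one has k g (1 - g) = k g₀ (1 - g₀) + k (1 - 2 g₀) d - k d², which explains the
quadratic term of the map. The fast equations come from the two resolvent identities and p q = τ e.
-/
lemma isFrontSys_of_frontMap {k e σ τ μ μ₀ a a₁ Λ K : ℝ} (R : FrontRange μ₀ a a₁ k μ)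
    (he : 0 < e) (hτ : 0 ≤ τ) (hΛ : 0 < Λ)
    {f : Fin 3 → ℝ → ℝ} (hf : frontMap k e σ τ μ Λ f = f) (hc : ∀ j, Continuous (f j))
    (hv : ∀ z, |resolv (-fastQ e τ) (fastSource k e σ τ μ (f 0) (f 1) fun z => Λ * f 2 z) z|
      ≤ K * ew a z)
    (hs : ∀ z, |fastSource k e σ τ μ (f 0) (f 1) (fun z => Λ * f 2 z) z| ≤ K * ew a z) :
    IsFrontSys k e σ τ (pertFront k μ (f 0)) (f 1) (fun z => Λ * f 2 z) := by
  obtain ⟨c1, c2, -⟩ := R.continuous (hc 0)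
  set S := fastSource k e σ τ μ (f 0) (f 1) fun z => Λ * f 2 z with hS
  have hSc : Continuous S := by
    have h1 := hc 1
    have h2 := hc 2
    rw [hS]; unfold fastSource fastPert slowPert; fun_prop
  have hS_eq : ∀ z, S z = k * pertFront k μ (f 0) z * (1 - pertFront k μ (f 0) z) +
    σ * fastPert k e σ τ (pertFront k μ (f 0) z) (f 1 z) (Λ * f 2 z) := fun z => rfl
  set p := fastP e τ with hp
  set q := fastQ e τ with hq
  have hp0 : 0 < p := fastP_pos he hτ
  have hpq : p * q = τ * e := fastP_mul_fastQ he hτ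
  have hqe : q = p - e := rfl
  have hvc : Continuous (resolv (-q) S) := continuous_resolv hSc (weighted_le R.ha.le hs)
  set v := resolv (-q) S with hv'
  set Y := resolv p v with hY
  have f0 : ∀ z, f 0 z = e / p * (Y z - v z) - k * slowSol k μ (f 0) z ^ 2 +
      σ * slowPert k e σ (pertFront k μ (f 0) z) (f 1 z) (Λ * f 2 z) := by
    intro z; conv_lhs => rw [← hf]
    rfl
  have f1 : ∀ z, f 1 z = e / p * (Y z - v z) := by
    intro z; conv_lhs => rw [← hf]
    rfl
  have f2 : ∀ z, Λ * f 2 z = Y z := by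
    intro z
    have : f 2 z = Λ⁻¹ * Y z := by
      conv_lhs => rw [← hf]
      rfl
    rw [this]; field_simp
  have dY : ∀ z, HasDerivAt Y ((Y z - v z) / p) z := by
    intro z
    have h1 := (hasDerivAt_mul_resolv (p := p) R.ha hvc hv z).const_mul p⁻¹
    have h2 : (fun z => p⁻¹ * (p * resolv p v z)) = Y := by ext z; field_simp; rfl
    rw [h2] at h1
    exact h1.congr_deriv (by field_simp; rfl)
  have dv : ∀ z, HasDerivAt (fun z => -q * v z) (v z - S z) z := fun z =>
    hasDerivAt_mul_resolv (p := -q) R.ha hSc hs z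
  have ey : (fun z => Λ * f 2 z) = Y := by ext z; exact f2 z
  refine ⟨fun z => ?_, fun z => ?_, fun z => ?_⟩
  · refine (R.hasDerivAt (hc 0) z).congr_deriv ?_
    rw [f0 z, ← f1 z]; unfold pertFront; ring
  · rw [ey, f1 z]
    refine (dY z).congr_deriv ?_
    field_simp
  · have e1 : (fun z => τ * f 1 z) = fun z => q * Y z + -q * v z := by
      ext z
      have : τ = p * q / e := by rw [hpq]; field_simp
      rw [f1 z, this]; field_simp; ring
    rw [e1]
    refine (((dY z).const_mul q).fun_add (dv z)).congr_deriv ?_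
    rw [← hS_eq z, f2 z, f1 z, hqe]
    field_simp
    ring

set_option maxHeartbeats 800000 in
/-- Existence of fronts close to the logistic front. -/
lemma exists_front {μ₀ a a₁ : ℝ} (ha : 0 < a) (haa : a < a₁) (hμ₀ : 0 < μ₀) :
    ∃ M₀ > 0, ∃ C, ∀ k e σ τ μ, a₁ ≤ k → k ≤ 3 → 0 < e → e ≤ M₀ → 0 ≤ σ → σ ≤ M₀ →
      0 ≤ τ → τ ≤ M₀ → μ₀ ≤ μ → μ ≤ 1 - μ₀ → ∃ g x y, IsFrontSys k e σ τ g x y ∧ g 0 = μ ∧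
        Continuous x ∧ ∀ z, |g z - logistic k μ z| ≤ C * ew a z ∧ |x z| ≤ C * ew a z ∧
          |y z| ≤ C * ew a z ∧ |g z| ≤ 3 / 2 := by
  set Cs := slowConst μ₀ a a₁ with hCs
  have hCs0 : 0 < Cs := slowConst_pos haa
  set K₁ := 3 / μ₀ + 5 with hK₁
  set K₁' := 12 * (3 / μ₀ + 3) with hK₁'
  -- With this radius both Cs ρ and Cs² ρ are small, so the quadratic term k d² is at most ρ / 8 on
  -- the ball and has Lipschitz constant at most 1/4.
  set ρ := 1 / (24 * (1 + Cs) ^ 2) with hρ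
  set Y₀ := 4 * K₁ + 4 with hY₀
  -- The component y is not small: `Y₀` bounds its size, and its dependence on the slow correction
  -- has no small factor. Measuring it in units of `Λ` puts it into the ball of radius ρ and makes
  -- this dependence contract.
  set Λ := Y₀ / ρ with hΛ
  have hK₁0 : 5 ≤ K₁ := by rw [hK₁]; have : 0 < 3 / μ₀ := by positivity
                           linarith
  have hK₁'0 : 0 < K₁' := by rw [hK₁']; positivity
  have hρ0 : 0 < ρ := by rw [hρ]; positivity
  have hρ' : ρ * (24 * (1 + Cs) ^ 2) = 1 := by rw [hρ]; field_simp
  have hρ1 : ρ ≤ 1 / 24 := by nlinarith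
  have hρC : Cs * ρ ≤ 1 / 48 := by
    have : ρ * (24 * (1 + Cs) ^ 2) = 24 * ρ + 48 * (Cs * ρ) + 24 * (ρ * Cs ^ 2) := by ring
    have : 0 ≤ ρ * Cs ^ 2 := by positivity
    linarith
  have hρC2 : Cs ^ 2 * ρ ≤ 1 / 24 := by
    have : ρ * (24 * (1 + Cs) ^ 2) = 24 * ρ + 48 * (Cs * ρ) + 24 * (Cs ^ 2 * ρ) := by ring
    have : 0 ≤ Cs * ρ := by positivity
    linarith
  have hY₀0 : 24 ≤ Y₀ := by rw [hY₀]; linarith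
  have hΛ0 : 0 < Λ := by rw [hΛ]; positivity
  have hΛρ : Λ * ρ = Y₀ := by rw [hΛ]; field_simp
  have hΛC : 8 * (12 * Cs + 1) ≤ Λ := by
    rw [hΛ, le_div_iff₀ hρ0]
    have : 8 * (12 * Cs + 1) * ρ = 96 * (Cs * ρ) + 8 * ρ := by ring
    linarith
  obtain ⟨L, hL, hLip⟩ := exists_lipschitz_pert (Y₀ + 3)
  set K₂ := L * (ρ + Y₀) + 2 * K₁ with hK₂
  set L' := L * (Cs + 1 + Λ) with hL'
  set C₂ := 12 * (3 * Cs + 1) + 6 * Cs * (3 / μ₀ + 3) with hC₂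
  have hK₂0 : 0 < K₂ := by rw [hK₂]; positivity
  have hL'0 : 0 ≤ L' := by rw [hL']; positivity
  have hC₂0 : 0 < C₂ := by rw [hC₂]; positivity
  -- Everything that has to be beaten by the small parameters is summed, so that a single threshold
  -- serves all estimates.
  set S := 1 + a + K₁' + K₂ + C₂ + L' with hS
  have hS0 : 0 < S := by rw [hS]; positivity
  set M₀ := ρ / (32 * S) with hM₀
  have hM₀0 : 0 < M₀ := by rw [hM₀]; positivity
  have small : ∀ t s, 0 ≤ t → t ≤ M₀ → s ≤ S → t * s ≤ ρ / 32 := by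
    intro t s ht htM hsS
    calc t * s ≤ t * S := by gcongr
      _ ≤ M₀ * S := by gcongr
      _ = ρ / 32 := by rw [hM₀]; field_simp
  have sS : 1 ≤ S ∧ a ≤ S ∧ K₁' ≤ S ∧ K₂ ≤ S ∧ C₂ ≤ S ∧ L' ≤ S := by
    refine ⟨?_, ?_, ?_, ?_, ?_, ?_⟩ <;> rw [hS] <;> linarith
  have hM₀1 : M₀ ≤ 1 := by have := small M₀ 1 hM₀0.le le_rfl sS.1; linarith
  refine ⟨M₀, hM₀0, Y₀ + 1, ?_⟩
  intro k e σ τ μ hk hk3 he heM hσ hσM hτ hτM hμ hμ1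
  have R : FrontRange μ₀ a a₁ k μ := ⟨ha, haa, hk, hk3, hμ₀, hμ, hμ1⟩
  have haM : a * (2 * M₀) ≤ 1 / 2 := by
    have := small M₀ a hM₀0.le le_rfl sS.2.1; linarith
  have hk0 : 0 < k := (ha.trans haa).trans_le hk
  have kK : |k| ≤ Y₀ + 3 := by rw [abs_of_pos hk0]; linarith
  have eK : |e| ≤ Y₀ + 3 := by rw [abs_of_pos he]; linarith
  have σK : |σ| ≤ Y₀ + 3 := by rw [abs_of_nonneg hσ]; linarith
  have τK : |τ| ≤ Y₀ + 3 := by rw [abs_of_nonneg hτ]; linarith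
  have w1 := fun z => ew_le_one ha.le z
  have w0 := fun z => ew_pos a z
  have hρ1' : ρ ≤ 1 := by linarith
  have hρC' : slowConst μ₀ a a₁ * ρ ≤ 1 / 2 := by rw [← hCs]; linarith
  have eq1 := small e K₁' he.le heM sS.2.2.1
  have eq2 := small σ K₂ hσ hσM sS.2.2.2.1
  have eq3 := small e C₂ he.le heM sS.2.2.2.2.1
  have eq4 := small σ L' hσ hσM sS.2.2.2.2.2
  -- bounds on arguments
  have hy : ∀ {f : ℝ → ℝ}, (∀ z, |f z| ≤ ρ * ew a z) → ∀ z, |Λ * f z| ≤ Y₀ * ew a z := by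
    intro f hf z
    rw [abs_mul, abs_of_pos hΛ0, ← hΛρ, mul_assoc]
    exact mul_le_mul_of_nonneg_left (hf z) hΛ0.le
  have box : ∀ {f : Fin 3 → ℝ → ℝ}, (∀ j, Continuous (f j)) → (∀ j z, |f j z| ≤ ρ * ew a z) →
      ∀ z, |pertFront k μ (f 0) z| ≤ Y₀ + 3 ∧ |f 1 z| ≤ Y₀ + 3 ∧ |Λ * f 2 z| ≤ Y₀ + 3 := by
    intro f hc hb z
    refine ⟨?_, ?_, ?_⟩
    · have := (R.bounds hρ1' hρC' (hc 0) (hb 0) z).2.1; linarith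
    · have := weighted_le ha.le (hb 1) z; linarith
    · have := weighted_le ha.le (hy (hb 2)) z; linarith
  have pert : ∀ {f : Fin 3 → ℝ → ℝ}, (∀ j, Continuous (f j)) → (∀ j z, |f j z| ≤ ρ * ew a z) →
      ∀ z, |slowPert k e σ (pertFront k μ (f 0) z) (f 1 z) (Λ * f 2 z)| ≤ K₂ * ew a z ∧
      |fastPert k e σ τ (pertFront k μ (f 0) z) (f 1 z) (Λ * f 2 z)| ≤ K₂ * ew a z := by
    intro f hc hb z
    obtain ⟨b1, b2, b3⟩ := box hc hb z
    have B := R.bounds hρ1' hρC' (hc 0) (hb 0) z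
    exact pert_bound hL hLip (by linarith) kK eK σK τK b1 b2 b3 B.2.1 (hb 1 z) (hy (hb 2) z)
      B.2.2.2.2
  have contP : ∀ {f : Fin 3 → ℝ → ℝ}, (∀ j, Continuous (f j)) → (∀ j z, |f j z| ≤ ρ * ew a z) →
      Continuous (fun z => fastPert k e σ τ (pertFront k μ (f 0) z) (f 1 z) (Λ * f 2 z)) := by
    intro f hc hb
    have h1 := (R.continuous (hc 0)).2.1
    have h2 := hc 1
    have h3 := hc 2
    unfold fastPert slowPert; fun_prop
  have contS : ∀ {f : Fin 3 → ℝ → ℝ}, (∀ j, Continuous (f j)) → (∀ j z, |f j z| ≤ ρ * ew a z) →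
      Continuous (fastSource k e σ τ μ (f 0) (f 1) fun z => Λ * f 2 z) := by
    intro f hc hb
    have h1 := (R.continuous (hc 0)).2.1
    exact ((continuous_const.mul h1).mul (continuous_const.sub h1)).add
      (continuous_const.mul (contP hc hb))
  have bS : ∀ {f : Fin 3 → ℝ → ℝ}, (∀ j, Continuous (f j)) → (∀ j z, |f j z| ≤ ρ * ew a z) →
      ∀ z, |fastSource k e σ τ μ (f 0) (f 1) (fun z => Λ * f 2 z) z| ≤ (K₁ + 1) * ew a z := by
    intro f hc hb z
    have B := R.bounds hρ1' hρC' (hc 0) (hb 0) z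
    have P := (pert hc hb z).2
    unfold fastSource
    refine (abs_add_le _ _).trans ?_
    have h1 : |σ * fastPert k e σ τ (pertFront k μ (f 0) z) (f 1 z) (Λ * f 2 z)| ≤ 1 * ew a z := by
      rw [abs_mul, abs_of_nonneg hσ]
      calc _ ≤ σ * (K₂ * ew a z) := by gcongr
        _ = σ * K₂ * ew a z := by ring
        _ ≤ _ := by have := w0 z; gcongr; linarith
    have := B.2.2.2.2
    have e1 : (K₁ + 1) * ew a z = K₁ * ew a z + 1 * ew a z := by ring
    linarith
  have haq : a * |(-fastQ e τ)| ≤ 1 / 2 := by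
    rw [abs_neg, abs_of_nonneg (fastQ_nonneg he hτ)]
    have := mul_le_mul_of_nonneg_left (fastQ_le he heM hτM) ha.le
    linarith
  have hap : a * |fastP e τ| ≤ 1 / 2 := by
    rw [abs_of_pos (fastP_pos he hτ)]
    have := mul_le_mul_of_nonneg_left (fastP_le he heM hτM) ha.le
    linarith
  have bv : ∀ {f : Fin 3 → ℝ → ℝ}, (∀ j, Continuous (f j)) → (∀ j z, |f j z| ≤ ρ * ew a z) →
      ∀ z, |resolv (-fastQ e τ) (fastSource k e σ τ μ (f 0) (f 1) fun z => Λ * f 2 z) z| ≤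
        2 * (K₁ + 1) * ew a z := fun hc hb => resolv_bound ha.le haq (bS hc hb)
  have cv : ∀ {f : Fin 3 → ℝ → ℝ}, (∀ j, Continuous (f j)) → (∀ j z, |f j z| ≤ ρ * ew a z) →
      Continuous (resolv (-fastQ e τ) (fastSource k e σ τ μ (f 0) (f 1) fun z => Λ * f 2 z)) :=
    fun hc hb => continuous_resolv (contS hc hb) (weighted_le ha.le (bS hc hb))
  have bY' : ∀ {f : Fin 3 → ℝ → ℝ}, (∀ j, Continuous (f j)) → (∀ j z, |f j z| ≤ ρ * ew a z) →
      ∀ z, |fastY k e σ τ μ (f 0) (f 1) (fun z => Λ * f 2 z) z| ≤ 2 * (2 * (K₁ + 1)) * ew a z :=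
    fun hc hb => resolv_bound ha.le hap (bv hc hb)
  have cY : ∀ {f : Fin 3 → ℝ → ℝ}, (∀ j, Continuous (f j)) → (∀ j z, |f j z| ≤ ρ * ew a z) →
      Continuous (fastY k e σ τ μ (f 0) (f 1) fun z => Λ * f 2 z) :=
    fun hc hb => continuous_resolv (cv hc hb) (weighted_le ha.le (bv hc hb))
  have cX : ∀ {f : Fin 3 → ℝ → ℝ}, (∀ j, Continuous (f j)) → (∀ j z, |f j z| ≤ ρ * ew a z) →
      Continuous (fastX k e σ τ μ (f 0) (f 1) fun z => Λ * f 2 z) :=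
    fun hc hb => continuous_const.mul ((cY hc hb).sub (cv hc hb))
  have bX : ∀ {f : Fin 3 → ℝ → ℝ}, (∀ j, Continuous (f j)) → (∀ j z, |f j z| ≤ ρ * ew a z) →
      ∀ z, |fastX k e σ τ μ (f 0) (f 1) (fun z => Λ * f 2 z) z| ≤ 10 * (ρ / 32) * ew a z := by
    intro f hc hb z
    -- The source itself is not small, but x is: the logistic part contributes e times its slope,
    -- and the perturbation contributes σ.
    have := (fast_op_bound ha he hτ heM hτM haM hσ (R.hasDerivAt_logistic (hc 0))
      (R.continuous (hc 0)).2.2 (contP hc hb)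
      (fun z => (R.bounds hρ1' hρC' (hc 0) (hb 0) z).2.2.2.2)
      (R.slope_bound hρ1' hρC' (hc 0) (hb 0)) (fun z => (pert hc hb z).2) z).2
    refine this.trans ?_
    have := w0 z
    gcongr
    linarith
  have b3 : ∀ {A B C : ℝ}, |A - B + C| ≤ |A| + |B| + |C| := fun {A B C} =>
    (abs_add_le _ _).trans (by gcongr; exact abs_sub _ _)
  have hmap : ∀ f : Fin 3 → ℝ → ℝ, (∀ j, Continuous (f j)) → (∀ j z, |f j z| ≤ ρ * ew a z) →
      (∀ j, Continuous (frontMap k e σ τ μ Λ f j)) ∧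
        ∀ j z, |frontMap k e σ τ μ Λ f j z| ≤ ρ * ew a z := by
    intro f hc hb
    have hcg := (R.continuous (hc 0)).2.1
    have hcs := (R.continuous (hc 0)).1
    have h1 := hc 1
    have h2 := hc 2
    have hX := cX hc hb
    have hY := cY hc hb
    refine ⟨fun j => ?_, fun j z => ?_⟩
    · fin_cases j
      · have hP : Continuous fun z =>
            slowPert k e σ (pertFront k μ (f 0) z) (f 1 z) (Λ * f 2 z) := by
          unfold slowPert; fun_prop
        exact (hX.sub (continuous_const.mul (hcs.pow 2))).add (continuous_const.mul hP)
      · exact hX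
      · exact continuous_const.mul hY
    · have w := w0 z
      fin_cases j
      · change |fastX k e σ τ μ (f 0) (f 1) (fun z => Λ * f 2 z) z - k * slowSol k μ (f 0) z ^ 2 +
          σ * slowPert k e σ (pertFront k μ (f 0) z) (f 1 z) (Λ * f 2 z)| ≤ _
        refine b3.trans ?_
        have t1 := bX hc hb z
        have t2 : |k * slowSol k μ (f 0) z ^ 2| ≤ ρ / 8 * ew a z := by
          have s1 := R.slow (hc 0) (hb 0) z
          rw [← hCs] at s1
          rw [abs_mul, abs_of_pos hk0, abs_pow]
          have s2 : ew a z ^ 2 ≤ ew a z := by rw [sq]; exact mul_le_of_le_one_left w.le (w1 z)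
          calc k * |slowSol k μ (f 0) z| ^ 2 ≤ 3 * (Cs * ρ * ew a z) ^ 2 := by gcongr
            _ = 3 * ρ * (Cs ^ 2 * ρ) * ew a z ^ 2 := by ring
            _ ≤ 3 * ρ * (1 / 24) * ew a z := by gcongr
            _ = _ := by ring
        have t3 : |σ * slowPert k e σ (pertFront k μ (f 0) z) (f 1 z) (Λ * f 2 z)| ≤
            ρ / 32 * ew a z := by
          rw [abs_mul, abs_of_nonneg hσ]
          calc _ ≤ σ * (K₂ * ew a z) := by gcongr; exact (pert hc hb z).1
            _ = σ * K₂ * ew a z := by ring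
            _ ≤ _ := by gcongr
        have e1 : ρ * ew a z = 10 * (ρ / 32) * ew a z + ρ / 8 * ew a z + ρ / 32 * ew a z
          + 17 / 32 * (ρ * ew a z) := by ring
        have : 0 ≤ ρ * ew a z := by positivity
        linarith
      · refine (bX hc hb z).trans ?_
        gcongr
        linarith
      · change |Λ⁻¹ * fastY k e σ τ μ (f 0) (f 1) (fun z => Λ * f 2 z) z| ≤ _
        rw [abs_mul, abs_of_pos (inv_pos.mpr hΛ0), ← div_eq_inv_mul, div_le_iff₀ hΛ0]
        refine (bY' hc hb z).trans (le_of_eq ?_)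
        have : ρ * ew a z * Λ = Λ * ρ * ew a z := by ring
        rw [this, hΛρ, hY₀]; ring
  have hcon : ∀ f f' : Fin 3 → ℝ → ℝ, (∀ j, Continuous (f j)) →
      (∀ j z, |f j z| ≤ ρ * ew a z) → (∀ j, Continuous (f' j)) →
      (∀ j z, |f' j z| ≤ ρ * ew a z) → ∀ Δ, 0 ≤ Δ → (∀ j z, |f j z - f' j z| ≤ Δ * ew a z) →
      ∀ j z, |frontMap k e σ τ μ Λ f j z - frontMap k e σ τ μ Λ f' j z| ≤ Δ / 2 * ew a z := by
    intro f f' hc hb hc' hb' Δ hΔ hd j z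
    have w := w0 z
    have sb := R.sub_bounds hρ1' hρC' (hc 0) (hb 0) (hc' 0) (hb' 0) (hd 0)
    simp only [← hCs] at sb
    have dP : ∀ z, |slowPert k e σ (pertFront k μ (f 0) z) (f 1 z) (Λ * f 2 z) -
        slowPert k e σ (pertFront k μ (f' 0) z) (f' 1 z) (Λ * f' 2 z)| ≤ L' * Δ * ew a z ∧
        |fastPert k e σ τ (pertFront k μ (f 0) z) (f 1 z) (Λ * f 2 z) -
        fastPert k e σ τ (pertFront k μ (f' 0) z) (f' 1 z) (Λ * f' 2 z)| ≤ L' * Δ * ew a z := by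
      intro z
      obtain ⟨a1, a2, a3⟩ := box hc hb z
      obtain ⟨b1, b2, b3⟩ := box hc' hb' z
      have h := hLip k e σ τ _ _ _ _ _ _ kK eK σK τK a1 a2 a3 b1 b2 b3
      have s1 : |pertFront k μ (f 0) z - pertFront k μ (f' 0) z| ≤ Cs * Δ * ew a z := by
        have e1 : pertFront k μ (f 0) z - pertFront k μ (f' 0) z =
          slowSol k μ (f 0) z - slowSol k μ (f' 0) z := by unfold pertFront; ring
        rw [e1]; exact (sb z).1
      have s2 : |Λ * f 2 z - Λ * f' 2 z| ≤ Λ * (Δ * ew a z) := by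
        rw [← mul_sub, abs_mul, abs_of_pos hΛ0]; gcongr; exact hd 2 z
      have s3 : L * (|pertFront k μ (f 0) z - pertFront k μ (f' 0) z| + |f 1 z - f' 1 z| +
          |Λ * f 2 z - Λ * f' 2 z|) ≤ L' * Δ * ew a z := by
        calc _ ≤ L * (Cs * Δ * ew a z + Δ * ew a z + Λ * (Δ * ew a z)) := by
              gcongr; exact hd 1 z
          _ = _ := by rw [hL']; ring
      exact ⟨h.1.trans s3, h.2.trans s3⟩
    have opd := fun z => fast_op_bound ha he hτ heM hτM haM hσ
      (fun z => (R.hasDerivAt_logistic (hc 0) z).fun_sub (R.hasDerivAt_logistic (hc' 0) z))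
      ((R.continuous (hc 0)).2.2.sub (R.continuous (hc' 0)).2.2)
      (((contP hc hb).fun_sub (contP hc' hb'))) (fun z => (sb z).2.1) (fun z => (sb z).2.2.1)
      (fun z => (dP z).2) z
    have eS : (fun z => (k * pertFront k μ (f 0) z * (1 - pertFront k μ (f 0) z) -
        k * pertFront k μ (f' 0) z * (1 - pertFront k μ (f' 0) z)) + σ *
        (fastPert k e σ τ (pertFront k μ (f 0) z) (f 1 z) (Λ * f 2 z) -
        fastPert k e σ τ (pertFront k μ (f' 0) z) (f' 1 z) (Λ * f' 2 z))) =
        fun z => fastSource k e σ τ μ (f 0) (f 1) (fun z => Λ * f 2 z) z -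
          fastSource k e σ τ μ (f' 0) (f' 1) (fun z => Λ * f' 2 z) z := by
      ext z; unfold fastSource; ring
    have ev : (resolv (-fastQ e τ) fun z =>
        fastSource k e σ τ μ (f 0) (f 1) (fun z => Λ * f 2 z) z -
          fastSource k e σ τ μ (f' 0) (f' 1) (fun z => Λ * f' 2 z) z) =
        fun z => resolv (-fastQ e τ) (fastSource k e σ τ μ (f 0) (f 1) fun z => Λ * f 2 z) z -
          resolv (-fastQ e τ) (fastSource k e σ τ μ (f' 0) (f' 1) fun z => Λ * f' 2 z) z := by
      ext z
      exact resolv_sub (contS hc hb) (weighted_le ha.le (bS hc hb)) (contS hc' hb')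
        (weighted_le ha.le (bS hc' hb')) z
    have eY : ∀ z, resolv (fastP e τ) (resolv (-fastQ e τ) fun z =>
        fastSource k e σ τ μ (f 0) (f 1) (fun z => Λ * f 2 z) z -
          fastSource k e σ τ μ (f' 0) (f' 1) (fun z => Λ * f' 2 z) z) z =
        fastY k e σ τ μ (f 0) (f 1) (fun z => Λ * f 2 z) z -
          fastY k e σ τ μ (f' 0) (f' 1) (fun z => Λ * f' 2 z) z := by
      intro z
      rw [ev]
      exact resolv_sub (cv hc hb) (weighted_le ha.le (bv hc hb)) (cv hc' hb')
        (weighted_le ha.le (bv hc' hb')) z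
    rw [eS] at opd
    have dY : ∀ z, |fastY k e σ τ μ (f 0) (f 1) (fun z => Λ * f 2 z) z -
        fastY k e σ τ μ (f' 0) (f' 1) (fun z => Λ * f' 2 z) z| ≤ Λ * (Δ / 2) * ew a z := by
      intro z
      rw [← eY z]
      refine (opd z).1.trans (mul_le_mul_of_nonneg_right ?_ (w0 z).le)
      have : σ * (L' * Δ) ≤ Δ := by
        rw [← mul_assoc]; exact mul_le_of_le_one_left hΔ (by linarith)
      have : 8 * (12 * Cs + 1) * Δ ≤ Λ * Δ := by gcongr
      linarith
    have dX : ∀ z, |fastX k e σ τ μ (f 0) (f 1) (fun z => Λ * f 2 z) z -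
        fastX k e σ τ μ (f' 0) (f' 1) (fun z => Λ * f' 2 z) z| ≤ Δ / 8 * ew a z := by
      intro z
      have h := (opd z).2
      rw [eY, ev] at h
      have e1 : fastX k e σ τ μ (f 0) (f 1) (fun z => Λ * f 2 z) z -
        fastX k e σ τ μ (f' 0) (f' 1) (fun z => Λ * f' 2 z) z = e / fastP e τ *
        (fastY k e σ τ μ (f 0) (f 1) (fun z => Λ * f 2 z) z -
          fastY k e σ τ μ (f' 0) (f' 1) (fun z => Λ * f' 2 z) z -
          (resolv (-fastQ e τ) (fastSource k e σ τ μ (f 0) (f 1) fun z => Λ * f 2 z) z -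
          resolv (-fastQ e τ) (fastSource k e σ τ μ (f' 0) (f' 1) fun z => Λ * f' 2 z) z)) := by
        unfold fastX; ring
      rw [e1]
      refine h.trans ?_
      have := w0 z
      gcongr
      have h1 : e * (C₂ * Δ) ≤ 1 / 32 * Δ := by
        rw [← mul_assoc]; gcongr; linarith
      have h2 : σ * (L' * Δ) ≤ 1 / 768 * Δ := by
        rw [← mul_assoc]; gcongr; linarith
      have h3 : e * (C₂ * Δ) ≤ 1 / 768 * Δ := by
        rw [← mul_assoc]; gcongr; linarith
      linarith
    fin_cases j
    · change |(fastX k e σ τ μ (f 0) (f 1) (fun z => Λ * f 2 z) z - k * slowSol k μ (f 0) z ^ 2 +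
          σ * slowPert k e σ (pertFront k μ (f 0) z) (f 1 z) (Λ * f 2 z)) -
          (fastX k e σ τ μ (f' 0) (f' 1) (fun z => Λ * f' 2 z) z - k * slowSol k μ (f' 0) z ^ 2 +
          σ * slowPert k e σ (pertFront k μ (f' 0) z) (f' 1 z) (Λ * f' 2 z))| ≤ _
      have e1 : (fastX k e σ τ μ (f 0) (f 1) (fun z => Λ * f 2 z) z - k * slowSol k μ (f 0) z ^ 2 +
          σ * slowPert k e σ (pertFront k μ (f 0) z) (f 1 z) (Λ * f 2 z)) -
          (fastX k e σ τ μ (f' 0) (f' 1) (fun z => Λ * f' 2 z) z - k * slowSol k μ (f' 0) z ^ 2 +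
          σ * slowPert k e σ (pertFront k μ (f' 0) z) (f' 1 z) (Λ * f' 2 z)) =
          (fastX k e σ τ μ (f 0) (f 1) (fun z => Λ * f 2 z) z -
            fastX k e σ τ μ (f' 0) (f' 1) (fun z => Λ * f' 2 z) z) -
          (k * slowSol k μ (f 0) z ^ 2 - k * slowSol k μ (f' 0) z ^ 2) +
          σ * (slowPert k e σ (pertFront k μ (f 0) z) (f 1 z) (Λ * f 2 z) -
            slowPert k e σ (pertFront k μ (f' 0) z) (f' 1 z) (Λ * f' 2 z)) := by ring
      rw [e1]
      refine b3.trans ?_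
      have t1 := dX z
      have t2 := (sb z).2.2.2
      have t2' : 6 * Cs ^ 2 * ρ * Δ * ew a z ≤ 1 / 4 * Δ * ew a z := by
        gcongr; linarith
      have t3 : |σ * (slowPert k e σ (pertFront k μ (f 0) z) (f 1 z) (Λ * f 2 z) -
            slowPert k e σ (pertFront k μ (f' 0) z) (f' 1 z) (Λ * f' 2 z))| ≤ 1 / 8 * Δ * ew a z := by
        rw [abs_mul, abs_of_nonneg hσ]
        calc _ ≤ σ * (L' * Δ * ew a z) := by gcongr; exact (dP z).1
          _ = σ * L' * Δ * ew a z := by ring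
          _ ≤ _ := by gcongr; linarith
      have e2 : Δ / 2 * ew a z = Δ / 8 * ew a z + 1 / 4 * Δ * ew a z + 1 / 8 * Δ * ew a z := by ring
      linarith
    · refine (dX z).trans ?_
      gcongr
      norm_num
    · change |Λ⁻¹ * fastY k e σ τ μ (f 0) (f 1) (fun z => Λ * f 2 z) z -
        Λ⁻¹ * fastY k e σ τ μ (f' 0) (f' 1) (fun z => Λ * f' 2 z) z| ≤ _
      rw [← mul_sub, abs_mul, abs_of_pos (inv_pos.mpr hΛ0), ← div_eq_inv_mul, div_le_iff₀ hΛ0]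
      refine (dY z).trans (le_of_eq (by ring))
  obtain ⟨f, hc, hb, hf⟩ := exists_weighted_fixedPoint (a := a) hρ0 (frontMap k e σ τ μ Λ) hmap hcon
  · refine ⟨pertFront k μ (f 0), f 1, fun z => Λ * f 2 z, ?_, ?_, hc 1, fun z => ⟨?_, ?_, ?_, ?_⟩⟩
    · refine isFrontSys_of_frontMap (K := 2 * (K₁ + 1)) R he hτ hΛ0 hf hc (bv hc hb) fun z =>
        (bS hc hb z).trans ?_
      have := w0 z
      gcongr
      linarith
    · simp [pertFront, slowSol_zero, logistic_zero R.pos]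
    · have e1 : pertFront k μ (f 0) z - logistic k μ z = slowSol k μ (f 0) z := by
        unfold pertFront; ring
      rw [e1]
      refine (R.bounds hρ1' hρC' (hc 0) (hb 0) z).1.trans ?_
      have := w0 z
      gcongr
      linarith
    · refine (hb 1 z).trans ?_
      have := w0 z
      gcongr
      linarith
    · refine (hy (hb 2) z).trans ?_
      have := w0 z
      gcongr
      linarith
    · exact (R.bounds hρ1' hρC' (hc 0) (hb 0) z).2.1

end IonShock

namespace IonShock

/-! ### Limits of functions and of their derivatives -/

section limits
variable {f f' f'' : ℝ → ℝ} {l κ c z₀ : ℝ}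

lemma linear_growth (hf : ∀ z, HasDerivAt f (f' z) z) (h : ∀ z, z₀ ≤ z → c ≤ f' z) {z : ℝ}
    (hz : z₀ ≤ z) : f z₀ + c * (z - z₀) ≤ f z := by
  have hm : MonotoneOn (fun t => f t - c * t) (Set.Ici z₀) := by
    have hd : ∀ t, HasDerivAt (fun t => f t - c * t) (f' t - c) t := fun t =>
      ((hf t).sub ((hasDerivAt_id t).const_mul c)).congr_deriv (by ring)
    apply monotoneOn_of_deriv_nonneg (convex_Ici z₀)
    · exact fun t _ => (hd t).continuousAt.continuousWithinAt
    · exact fun t _ => (hd t).differentiableAt.differentiableWithinAt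
    · intro t ht
      rw [interior_Ici] at ht
      rw [(hd t).deriv]
      linarith [h t (le_of_lt ht)]
  have := hm (Set.mem_Ici.mpr le_rfl) (Set.mem_Ici.mpr hz) hz
  simp only at this
  linarith

lemma tendsto_atTop_of_deriv_ge (hc : 0 < c) (hf : ∀ z, HasDerivAt f (f' z) z)
    (h : ∀ z, z₀ ≤ z → c ≤ f' z) : Tendsto f atTop atTop := by
  refine tendsto_atTop_mono' atTop (f₁ := fun z => c * z + (f z₀ - c * z₀)) ?_ ?_
  · filter_upwards [eventually_ge_atTop z₀] with z hz
    have := linear_growth hf h hz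
    linarith
  · exact tendsto_atTop_add_const_right _ _ (tendsto_id.const_mul_atTop hc)

/-- Mean value theorem on [z, z + 1]; the increments of a convergent function tend to zero. -/
lemma exists_seq_deriv (hf : ∀ z, HasDerivAt f (f' z) z) (hl : Tendsto f atTop (𝓝 l)) :
    ∃ ξ : ℝ → ℝ, (∀ z, z < ξ z ∧ ξ z < z + 1) ∧ Tendsto (fun z => f' (ξ z)) atTop (𝓝 0) := by
  have h : ∀ z, ∃ w, (z < w ∧ w < z + 1) ∧ f' w = f (z + 1) - f z := by
    intro z
    obtain ⟨w, hw, hw'⟩ := exists_hasDerivAt_eq_slope f f' (show z < z + 1 by linarith)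
      (fun t _ => (hf t).continuousAt.continuousWithinAt) (fun t _ => hf t)
    exact ⟨w, hw, by rw [hw']; simp⟩
  choose ξ h1 h2 using h
  refine ⟨ξ, h1, ?_⟩
  simp only [h2]
  have := (hl.comp (tendsto_atTop_add_const_right atTop (1 : ℝ) tendsto_id)).sub hl
  simpa using this

lemma tendsto_of_between {ξ : ℝ → ℝ} (h : ∀ z, z < ξ z ∧ ξ z < z + 1) : Tendsto ξ atTop atTop :=
  tendsto_atTop_mono (fun z => (h z).1.le) tendsto_id

lemma deriv_limit_eq_zero (hf : ∀ z, HasDerivAt f (f' z) z) (hl : Tendsto f atTop (𝓝 l))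
    (hd : Tendsto f' atTop (𝓝 κ)) : κ = 0 := by
  obtain ⟨ξ, h1, h2⟩ := exists_seq_deriv hf hl
  exact tendsto_nhds_unique (hd.comp (tendsto_of_between h1)) h2

/-- The first derivative tends to zero along points at distance less than one from z, and a
vanishing second derivative makes its variation over that distance negligible. -/
lemma tendsto_deriv_zero (hf : ∀ z, HasDerivAt f (f' z) z) (hf' : ∀ z, HasDerivAt f' (f'' z) z)
    (hl : Tendsto f atTop (𝓝 l)) (hd : Tendsto f'' atTop (𝓝 0)) : Tendsto f' atTop (𝓝 0) := by
  obtain ⟨ξ, h1, h2⟩ := exists_seq_deriv hf hl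
  have h3 : Tendsto (fun z => f' z - f' (ξ z)) atTop (𝓝 0) := by
    rw [Metric.tendsto_atTop]
    intro η hη
    obtain ⟨N, hN⟩ := (Metric.tendsto_atTop.mp hd) (η / 2) (by linarith)
    refine ⟨N, fun z hz => ?_⟩
    have := (convex_Ici N).norm_image_sub_le_of_norm_hasDerivWithin_le (f := f') (f' := f'')
      (C := η / 2) (x := ξ z) (y := z) (fun t _ => (hf' t).hasDerivWithinAt)
      (fun t ht => by
        have := hN t ht
        rw [Real.dist_eq, sub_zero] at this
        exact this.le)
      (by have := (h1 z).1; exact Set.mem_Ici.mpr (by linarith)) hz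
    have hz1 : ‖z - ξ z‖ ≤ 1 := by
      have := h1 z
      rw [Real.norm_eq_abs, abs_le]
      constructor <;> linarith
    rw [dist_zero_right]
    have : η / 2 * ‖z - ξ z‖ ≤ η / 2 * 1 := by gcongr
    linarith
  have := h3.add h2
  simpa using this

lemma hasDerivAt_reflect (hf : ∀ z, HasDerivAt f (f' z) z) (z : ℝ) :
    HasDerivAt (fun z => f (-z)) (-f' (-z)) z :=
  ((hf (-z)).comp z (hasDerivAt_neg z)).congr_deriv (by ring)

lemma tendsto_deriv_zero_atBot (hf : ∀ z, HasDerivAt f (f' z) z)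
    (hf' : ∀ z, HasDerivAt f' (f'' z) z)
    (hl : Tendsto f atBot (𝓝 l)) (hd : Tendsto f'' atBot (𝓝 0)) : Tendsto f' atBot (𝓝 0) := by
  have h := tendsto_deriv_zero (f := fun z => f (-z)) (f' := fun z => -f' (-z))
    (f'' := fun z => f'' (-z)) (hasDerivAt_reflect hf)
    (fun z => (hasDerivAt_reflect hf' z).fun_neg.congr_deriv (by ring))
    (hl.comp tendsto_neg_atTop_atBot) (hd.comp tendsto_neg_atTop_atBot)
  have := (h.comp tendsto_neg_atBot_atTop).neg
  simpa [Function.comp_def] using this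

lemma deriv_limit_eq_zero_atBot (hf : ∀ z, HasDerivAt f (f' z) z) (hl : Tendsto f atBot (𝓝 l))
    (hd : Tendsto f' atBot (𝓝 κ)) : κ = 0 := by
  have h := deriv_limit_eq_zero (f := fun z => f (-z)) (f' := fun z => -f' (-z))
    (hasDerivAt_reflect hf) (hl.comp tendsto_neg_atTop_atBot)
    (hd.comp tendsto_neg_atTop_atBot).neg
  linarith

lemma exists_max_of_limits {r w : ℝ} (hf : Continuous f) (hl : Tendsto f atBot (𝓝 l))
    (hr : Tendsto f atTop (𝓝 r)) (h1 : l < f w) (h2 : r < f w) : ∃ z, ∀ t, f t ≤ f z := by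
  refine hf.exists_forall_ge' w ?_
  rw [cocompact_eq_atBot_atTop, eventually_sup]
  exact ⟨(hl.eventually_lt_const h1).mono fun _ h => h.le,
    (hr.eventually_lt_const h2).mono fun _ h => h.le⟩

lemma exists_min_of_limits {r w : ℝ} (hf : Continuous f) (hl : Tendsto f atBot (𝓝 l))
    (hr : Tendsto f atTop (𝓝 r)) (h1 : f w < l) (h2 : f w < r) : ∃ z, ∀ t, f z ≤ f t := by
  obtain ⟨z, hz⟩ := exists_max_of_limits (f := fun t => -f t) (w := w) hf.neg hl.neg hr.neg
    (by linarith) (by linarith)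
  exact ⟨z, fun t => by linarith [hz t]⟩

lemma deriv_zero_of_max {z : ℝ} (hf : ∀ z, HasDerivAt f (f' z) z) (h : ∀ t, f t ≤ f z) : f' z = 0 :=
  IsLocalMax.hasDerivAt_eq_zero (Eventually.of_forall h) (hf z)

lemma deriv_zero_of_min {z : ℝ} (hf : ∀ z, HasDerivAt f (f' z) z) (h : ∀ t, f z ≤ f t) : f' z = 0 :=
  IsLocalMin.hasDerivAt_eq_zero (Eventually.of_forall h) (hf z)

lemma exists_bound_of_limits {r : ℝ} (hf : Continuous f) (hl : Tendsto f atBot (𝓝 l))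
    (hr : Tendsto f atTop (𝓝 r)) : ∃ K, ∀ z, |f z| ≤ K := by
  by_cases h : ∃ w, max |l| |r| < |f w|
  · obtain ⟨w, hw⟩ := h
    obtain ⟨z, hz⟩ := exists_max_of_limits (f := fun t => |f t|) (w := w) hf.abs hl.abs hr.abs
      ((le_max_left _ _).trans_lt hw) ((le_max_right _ _).trans_lt hw)
    exact ⟨|f z|, hz⟩
  · push Not at h
    exact ⟨_, h⟩

end limits

/-! ### KdV-Burgers fronts -/

/-- A positive drift would send e g' - g to infinity. As g is bounded, g' would eventually exceed 1,
and g could not stay bounded. -/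
lemma drift_nonpos {e κ K : ℝ} {g g' h : ℝ → ℝ} (he : 0 < e) (hg : ∀ z, HasDerivAt g (g' z) z)
    (hv : ∀ z, HasDerivAt (fun z => e * g' z - g z) (κ - h z) z) (hh : Tendsto h atTop (𝓝 0))
    (hb : ∀ z, |g z| ≤ K) : κ ≤ 0 := by
  by_contra hκ
  push Not at hκ
  obtain ⟨N, hN⟩ := eventually_atTop.mp (hh.eventually_lt_const (show 0 < κ / 2 by linarith))
  have h1 := tendsto_atTop_of_deriv_ge (c := κ / 2) (z₀ := N) (by linarith) hv
    (fun z hz => by have := hN z hz; linarith)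
  obtain ⟨N', hN'⟩ := eventually_atTop.mp (h1.eventually_ge_atTop (K + e))
  have h2 := tendsto_atTop_of_deriv_ge (c := 1) (z₀ := N') one_pos hg (fun z hz => by
    have h3 := hN' z hz
    have h4 := abs_le.mp (hb z)
    have : e * 1 ≤ e * g' z := by linarith
    exact le_of_mul_le_mul_left this he)
  obtain ⟨z, hz⟩ := (h2.eventually_gt_atTop K).exists
  linarith [(abs_le.mp (hb z)).2]

/-- First integral of the KdV-Burgers equation. -/
lemma kdv_first_integral {k e : ℝ} {g : ℝ → ℝ} (he : 0 < e) (hs : ContDiff ℝ ∞ g)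
    (h : ∀ z, k * (1 - 2 * g z) * deriv g z - deriv (deriv g) z + e * deriv (deriv (deriv g)) z = 0)
    (hl : Tendsto g atBot (𝓝 0)) (hr : Tendsto g atTop (𝓝 1)) (z : ℝ) :
    deriv g z = k * g z * (1 - g z) + e * deriv (deriv g) z := by
  have d0 := contDiff_hasDerivAt hs
  have d1 := contDiff_hasDerivAt (contDiff_deriv hs)
  have d2 := contDiff_hasDerivAt (contDiff_deriv (contDiff_deriv hs))
  have hd : ∀ z, HasDerivAt (fun z => k * g z * (1 - g z) - deriv g z + e * deriv (deriv g) z) 0 z := by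
    intro z
    refine ((((d0 z).const_mul k).fun_mul ((d0 z).const_sub 1)).fun_sub (d1 z)).fun_add
      ((d2 z).const_mul e) |>.congr_deriv ?_
    rw [← h z]; ring
  have hc : ∀ z, k * g z * (1 - g z) - deriv g z + e * deriv (deriv g) z =
      k * g 0 * (1 - g 0) - deriv g 0 + e * deriv (deriv g) 0 := fun z =>
    is_const_of_deriv_eq_zero (fun z => (hd z).differentiableAt) (fun z => (hd z).deriv) z 0
  set κ := k * g 0 * (1 - g 0) - deriv g 0 + e * deriv (deriv g) 0 with hκ
  obtain ⟨K, hK⟩ := exists_bound_of_limits hs.continuous hl hr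
  have hh : Tendsto (fun z => k * g z * (1 - g z)) atTop (𝓝 0) := by
    have := (hr.const_mul k).mul (hr.const_sub 1)
    simpa using this
  have hv : ∀ z, HasDerivAt (fun z => e * deriv g z - g z) (κ - k * g z * (1 - g z)) z := fun z =>
    (((d1 z).const_mul e).fun_sub (d0 z)).congr_deriv (by rw [← hc z]; ring)
  -- The constant of integration is excluded from both signs. No behaviour of g' or g'' at infinity
  -- is assumed.
  have h1 := drift_nonpos he d0 hv hh hK
  have h2 := drift_nonpos (κ := -κ) (g := fun z => -g z) (g' := fun z => -deriv g z)
    (h := fun z => -(k * g z * (1 - g z))) (K := K) he (fun z => (d0 z).neg)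
    (fun z => (hv z).fun_neg.congr_deriv (by ring) |>.congr_of_eventuallyEq
      (Eventually.of_forall fun z => by simp only; ring)) (by simpa using hh.neg)
    (fun z => by rw [abs_neg]; exact hK z)
  have := hc z
  linarith

/-- The KdV-Burgers equation as a front system. -/
lemma isFrontSys_kdv {k e : ℝ} {g : ℝ → ℝ} (he : 0 < e) (hs : ContDiff ℝ ∞ g)
    (h : ∀ z, deriv g z = k * g z * (1 - g z) + e * deriv (deriv g) z) :
    IsFrontSys k e 0 0 g (fun z => e * deriv (deriv g) z) (deriv g) := by
  have d0 := contDiff_hasDerivAt hs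
  have d1 := contDiff_hasDerivAt (contDiff_deriv hs)
  refine ⟨fun z => (d0 z).congr_deriv ?_, fun z => (d1 z).congr_deriv (by field_simp), fun z => ?_⟩
  · rw [h z]; ring
  · simp only [zero_mul, add_zero]
    exact (hasDerivAt_const z (0 : ℝ)).congr_deriv (by rw [h z]; ring)

lemma IsFrontSys.kdv_eq {k e : ℝ} {g x y : ℝ → ℝ} (h : IsFrontSys k e 0 0 g x y) (z : ℝ) :
    x z = y z - k * g z * (1 - g z) ∧ HasDerivAt g (y z) z := by
  have h2 : HasDerivAt (fun z => 0 * x z) 0 z := by simpa using hasDerivAt_const z (0 : ℝ)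
  have h3 := (h.hx z).unique h2
  have h4 : x z = y z - k * g z * (1 - g z) := by linarith
  exact ⟨h4, (h.hg z).congr_deriv (by rw [h4]; ring)⟩

/-- A-priori bounds for KdV-Burgers fronts. -/
lemma IsFrontSys.kdv_bounds {k e : ℝ} {g x y : ℝ → ℝ} (hk : 0 < k) (he : 0 < e)
    (h : IsFrontSys k e 0 0 g x y) (hl : Tendsto g atBot (𝓝 0)) (hr : Tendsto g atTop (𝓝 1)) (z : ℝ) :
    |g z| ≤ 3 / 2 ∧ |x z| ≤ 8 * k ∧ |y z| ≤ 4 * k := by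
  have hx := fun z => (h.kdv_eq z).1
  have hg := fun z => (h.kdv_eq z).2
  have hc : Continuous g := continuous_iff_continuousAt.mpr fun z => (hg z).continuousAt
  -- a Lyapunov function
  set V : ℝ → ℝ := fun z => e / 2 * y z ^ 2 + k / 2 * g z ^ 2 - k / 3 * g z ^ 3 with hV
  have hVd : ∀ z, HasDerivAt V (y z ^ 2) z := by
    intro z
    refine (((((h.hy z).fun_pow 2).const_mul (e / 2)).fun_add (((hg z).fun_pow 2).const_mul (k / 2))).fun_sub
      (((hg z).fun_pow 3).const_mul (k / 3))).congr_deriv ?_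
    rw [hx z]
    simp only [Nat.cast_ofNat, Nat.add_one_sub_one, pow_one]
    field_simp
    ring
  have hVm : Monotone V := by
    apply monotone_of_deriv_nonneg (fun z => (hVd z).differentiableAt)
    intro z; rw [(hVd z).deriv]; positivity
  have bg : ∀ z, -1 ≤ g z ∧ g z ≤ 3 / 2 := by
    intro z
    constructor
    · by_contra hz
      push Not at hz
      obtain ⟨w, hw⟩ := exists_min_of_limits (w := z) hc hl hr (by linarith) (by linarith)
      have hyw := deriv_zero_of_min hg hw
      have hgw : g w < -1 := (hw z).trans_lt hz
      obtain ⟨ξ, h1, h2⟩ := exists_seq_deriv hg hr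
      have hξ := tendsto_of_between h1
      have h3 := hr.comp hξ
      have h4 : Tendsto (fun z => V (ξ z)) atTop (𝓝 (e / 2 * 0 ^ 2 + k / 2 * 1 ^ 2 - k / 3 * 1 ^ 3)) :=
        (((h2.pow 2).const_mul _).add ((h3.pow 2).const_mul _)).sub ((h3.pow 3).const_mul _)
      -- At the minimum of g only the potential part of V remains, and it is at most the value k / 6
      -- at the right end, which is approached along points where g' tends to zero. A cubic
      -- inequality then excludes g < -1.
      have h5 : V w ≤ e / 2 * 0 ^ 2 + k / 2 * 1 ^ 2 - k / 3 * 1 ^ 3 := by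
        refine ge_of_tendsto h4 ?_
        filter_upwards [hξ.eventually_ge_atTop w] with t ht using hVm ht
      simp only [hV, hyw] at h5
      have h6 : k * (3 * g w ^ 2 - 2 * g w ^ 3) ≤ k * 1 := by linarith
      have h7 := le_of_mul_le_mul_left h6 hk
      nlinarith [sq_nonneg (g w), mul_pos (show 0 < -1 - g w by linarith) (show 0 < -1 - g w by linarith)]
    · by_contra hz
      push Not at hz
      obtain ⟨w, hw⟩ := exists_max_of_limits (w := z) hc hl hr (by linarith) (by linarith)
      have hyw := deriv_zero_of_max hg hw
      have hgw : 3 / 2 < g w := hz.trans_le (hw z)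
      -- At the left end it suffices that the kinetic part is nonnegative and the potential part
      -- tends to zero. Hence V ≥ 0 at the maximum of g, which forbids g > 3/2.
      have h4 : Tendsto (fun z => k / 2 * g z ^ 2 - k / 3 * g z ^ 3) atBot
          (𝓝 (k / 2 * 0 ^ 2 - k / 3 * 0 ^ 3)) :=
        ((hl.pow 2).const_mul _).sub ((hl.pow 3).const_mul _)
      have h5 : k / 2 * 0 ^ 2 - k / 3 * 0 ^ 3 ≤ V w := by
        refine le_of_tendsto h4 ?_
        filter_upwards [eventually_le_atBot w] with t ht
        have := hVm ht
        have : 0 ≤ e / 2 * y t ^ 2 := by positivity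
        simp only [hV] at *
        linarith
      simp only [hV, hyw] at h5
      have h6 : k * 0 ≤ k * (g w ^ 2 * (3 - 2 * g w)) := by linarith
      have h7 := le_of_mul_le_mul_left h6 hk
      have : 0 < g w ^ 2 := by positivity
      nlinarith
  have bg' : ∀ z, |g z| ≤ 3 / 2 := fun z => abs_le.mpr ⟨by linarith [(bg z).1], (bg z).2⟩
  have bq : ∀ z, |k * g z * (1 - g z)| ≤ 15 / 4 * k := by
    intro z
    have h1 : |1 - g z| ≤ 5 / 2 := abs_le.mpr ⟨by linarith [(bg z).2], by linarith [bg z]⟩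
    rw [abs_mul, abs_mul, abs_of_pos hk]
    calc k * |g z| * |1 - g z| ≤ k * (3 / 2) * (5 / 2) := by gcongr; exact bg' z
      _ = _ := by ring
  -- In y' = (y - q) / e an excess of y over sup q is amplified forwards, so it would persist and
  -- drive g to infinity. The resulting bound does not involve e.
  have hyle : ∀ {g y q : ℝ → ℝ} {H B : ℝ}, 0 ≤ H → (∀ z, HasDerivAt g (y z) z) →
      (∀ z, HasDerivAt y ((y z - q z) / e) z) → (∀ z, q z ≤ H) → (∀ z, g z ≤ B) → ∀ z, y z ≤ H := by
    intro g y q H B hH hg hy hq hB z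
    by_contra hz
    push Not at hz
    have hm : Monotone (fun t => Real.exp (-(t / e)) * (y t - H)) := by
      have hd : ∀ t, HasDerivAt (fun t => Real.exp (-(t / e)) * (y t - H))
          (Real.exp (-(t / e)) * ((H - q t) / e)) t := by
        intro t
        have h1 : HasDerivAt (fun t : ℝ => Real.exp (-(t / e))) (Real.exp (-(t / e)) * (-(1 / e))) t :=
          (((hasDerivAt_id t).div_const e).neg).exp
        exact (h1.mul ((hy t).sub_const H)).congr_deriv (by ring)
      apply monotone_of_deriv_nonneg (fun t => (hd t).differentiableAt)
      intro t
      rw [(hd t).deriv]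
      have := hq t
      have : 0 ≤ H - q t := by linarith
      positivity
    have h1 : ∀ t, z ≤ t → y z - H ≤ y t := by
      intro t ht
      have h2 := hm ht
      simp only at h2
      have h3 : Real.exp (-(t / e)) ≤ Real.exp (-(z / e)) := by
        apply Real.exp_le_exp.mpr
        have : z / e ≤ t / e := by gcongr
        linarith
      have h4 : Real.exp (-(t / e)) * (y z - H) ≤ Real.exp (-(t / e)) * (y t - H) := by
        refine le_trans ?_ h2
        have : 0 ≤ y z - H := by linarith
        gcongr
      have := le_of_mul_le_mul_left h4 (Real.exp_pos _)
      linarith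
    have h2 := tendsto_atTop_of_deriv_ge (c := y z - H) (z₀ := z) (by linarith) hg h1
    obtain ⟨t, ht⟩ := (h2.eventually_gt_atTop B).exists
    linarith [hB t]
  have by' : ∀ z, |y z| ≤ 15 / 4 * k := by
    intro z
    rw [abs_le]
    constructor
    · have := hyle (g := fun z => -g z) (y := fun z => -y z) (q := fun z => -(k * g z * (1 - g z)))
        (H := 15 / 4 * k) (B := 3 / 2) (by positivity) (fun z => (hg z).neg)
        (fun z => (h.hy z).neg.congr_deriv (by rw [hx z]; ring))
        (fun z => by linarith [(abs_le.mp (bq z)).1]) (fun z => by linarith [(bg z).1]) z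
      linarith
    · exact hyle (q := fun z => k * g z * (1 - g z)) (by positivity) hg
        (fun z => (h.hy z).congr_deriv (by rw [hx z])) (fun z => (abs_le.mp (bq z)).2)
        (fun z => (bg z).2) z
  refine ⟨bg' z, ?_, (by' z).trans (by linarith)⟩
  rw [hx z]
  refine (abs_sub _ _).trans ?_
  linarith [by' z, bq z]

end IonShock

namespace IonShock

section
variable {c b d e r : ℝ} {f : ℝ → ℝ}

lemma IsKdVBurgersFront.limits (h : IsKdVBurgersFront c b d e r f) (hr : r ≠ 0) :
    Tendsto (fun z => f z / r) atBot (𝓝 0) ∧ Tendsto (fun z => f z / r) atTop (𝓝 1) := by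
  have h1 := h.left.div_const r
  have h2 := h.right.div_const r
  rw [zero_div] at h1
  rw [div_self hr] at h2
  exact ⟨h1, h2⟩

/-- Dividing by the far-field value normalises the limits to 0 and 1. The relation r = -(c / b) is
what turns the quadratic term into the logistic one. -/
lemma IsKdVBurgersFront.toFrontSys (h : IsKdVBurgersFront c b d e r f) (hc : 0 < c) (hb : 0 < b)
    (hd : 0 < d) (he : 0 < e) (hr : r = -(c / b)) :
    IsFrontSys (c / d) (e / d) 0 0 (fun z => f z / r)
      (fun z => e / d * deriv (deriv fun z => f z / r) z) (deriv fun z => f z / r) := by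
  have hr0 : r ≠ 0 := by rw [hr]; exact neg_ne_zero.mpr (by positivity)
  have hs : ContDiff ℝ ∞ (fun z => f z / r) := h.smooth.div_const r
  have e1 : deriv (fun z => f z / r) = fun z => deriv f z / r := by ext z; simp
  have e2 : deriv (fun z => deriv f z / r) = fun z => deriv (deriv f) z / r := by ext z; simp
  have e3 : deriv (fun z => deriv (deriv f) z / r) = fun z => deriv (deriv (deriv f)) z / r := by
    ext z; simp
  refine isFrontSys_kdv (by positivity) hs (kdv_first_integral (by positivity) hs (fun z => ?_)
    (h.limits hr0).1 (h.limits hr0).2)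
  have h1 := h.eqn z
  simp only [iteratedDeriv_succ, iteratedDeriv_zero] at h1
  rw [e1, e2, e3]
  simp only
  have hbr : c = -(b * r) := by rw [hr]; field_simp
  have : c / d * (1 - 2 * (f z / r)) * (deriv f z / r) - deriv (deriv f) z / r +
      e / d * (deriv (deriv (deriv f)) z / r) = (c * deriv f z + 2 * b * f z * deriv f z -
        d * deriv (deriv f) z + e * deriv (deriv (deriv f)) z) / (d * r) := by
    have h2 : c / d * (1 - 2 * (f z / r)) * (deriv f z / r) =
        (c * deriv f z - 2 * (c * f z / r) * deriv f z) / (d * r) := by field_simp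
    have h3 : c * f z / r = -(b * f z) := by
      rw [hbr]; field_simp
    rw [h2, h3]; field_simp; ring
  rw [this, h1, zero_div]

end

lemma isKdVBurgersFront_of_frontSys {k e b d : ℝ} {g x y : ℝ → ℝ} (hd : 0 < d) (he : 0 < e)
    (hb : 0 < b) (h : IsFrontSys k e 0 0 g x y) (hl : Tendsto g atBot (𝓝 0))
    (hr : Tendsto g atTop (𝓝 1)) :
    IsKdVBurgersFront (d * k) b d (d * e) (-(d * k / b)) (fun z => -(d * k / b) * g z) := by
  obtain ⟨sg, -, -⟩ := h.smooth (Or.inr ⟨rfl, rfl⟩)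
  have hg := fun z => (h.kdv_eq z).2
  have hx := fun z => (h.kdv_eq z).1
  set r := -(d * k / b) with hr'
  have e1 : deriv (fun z => r * g z) = fun z => r * y z := by
    ext z; exact ((hg z).const_mul r).deriv
  have e2 : deriv (fun z => r * y z) = fun z => r * (x z / e) := by
    ext z; exact ((h.hy z).const_mul r).deriv
  have e3 : ∀ z, deriv (fun z => r * (x z / e)) z = r * ((x z / e - k * (1 - 2 * g z) * y z) / e) := by
    intro z
    have h1 : (fun z => r * (x z / e)) = fun z => r * ((y z - k * g z * (1 - g z)) / e) := by
      ext z; rw [hx z]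
    rw [h1]
    have h2 := ((((h.hy z).fun_sub (((hg z).const_mul k).fun_mul ((hg z).const_sub 1))).div_const e).const_mul r)
    rw [h2.deriv]
    ring
  refine ⟨contDiff_const.mul sg, fun z => ?_, by simpa using hl.const_mul r, by simpa using hr.const_mul r⟩
  simp only [iteratedDeriv_succ, iteratedDeriv_zero]
  rw [e1, e2, e3]
  have h1 : b * r = -(d * k) := by rw [hr']; field_simp
  have h2 : 2 * b * (r * g z) = -(2 * d * k * g z) := by
    calc 2 * b * (r * g z) = 2 * (b * r) * g z := by ring
      _ = _ := by rw [h1]; ring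
  rw [h2]
  field_simp
  ring

/-- Uniqueness of KdV-Burgers fronts with given value at the origin. -/
lemma kdv_front_unique : ∃ M > 0, ∀ (c b d e r : ℝ) (f f' : ℝ → ℝ), 0 < c → 0 < b → 0 < d → 0 < e →
    r = -(c / b) → c / d ≤ 3 → e / d ≤ M → IsKdVBurgersFront c b d e r f →
    IsKdVBurgersFront c b d e r f' → f 0 = f' 0 → f = f' := by
  -- The a priori bounds are 3/2, 8 k and 4 k with k ≤ 3, hence 24.
  obtain ⟨M, hM, H⟩ := front_unique (K := 24) (by norm_num)
  refine ⟨M, hM, ?_⟩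
  intro c b d e r f f' hc hb hd he hr hk heM h h' h0
  have hr0 : r ≠ 0 := by rw [hr]; exact neg_ne_zero.mpr (by positivity)
  have hk0 : 0 < c / d := by positivity
  have s := h.toFrontSys hc hb hd he hr
  have s' := h'.toFrontSys hc hb hd he hr
  have B := s.kdv_bounds hk0 (by positivity) (h.limits hr0).1 (h.limits hr0).2
  have B' := s'.kdv_bounds hk0 (by positivity) (h'.limits hr0).1 (h'.limits hr0).2
  have := H (c / d) (e / d) 0 0 (by rw [abs_of_pos hk0]; linarith) (by positivity) heM le_rfl hM.le
    le_rfl hM.le _ _ _ _ _ _ s s' (fun z => (B z).1.trans (by norm_num))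
    (fun z => (B z).2.1.trans (by linarith)) (fun z => (B z).2.2.trans (by linarith))
    (fun z => (B' z).1.trans (by norm_num))
    (fun z => (B' z).2.1.trans (by linarith)) (fun z => (B' z).2.2.trans (by linarith))
    (by simp only [h0])
  ext z
  have h1 := (this z).1
  field_simp at h1
  exact h1

end IonShock

namespace IonShock

/-! ### Shock profiles from front systems -/

/-- The amplitude of the modified density profile. -/
noncomputable def amp (T ε : ℝ) : ℝ := (2 * soundSpeed T - ε) / (T + 1)

/-- The shock strength `1 - n₊`. -/
noncomputable def strength (T ε : ℝ) : ℝ := ε * amp T ε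

/-- The slope parameter of the shock profile. -/
noncomputable def slope (T ε : ℝ) : ℝ := (2 * soundSpeed T - ε) / shockSpeed T ε

section
variable {T ε δ : ℝ}

lemma soundSpeed_sq (hT : 0 ≤ T) : soundSpeed T ^ 2 = T + 1 := Real.sq_sqrt (by linarith)

lemma one_le_soundSpeed (hT : 0 ≤ T) : 1 ≤ soundSpeed T := by
  unfold soundSpeed; rw [Real.one_le_sqrt]; linarith

lemma one_sub_strength (hT : 0 ≤ T) : 1 - strength T ε = nPlus T ε := by
  have h := soundSpeed_sq hT
  unfold strength amp nPlus shockSpeed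
  have : T + 1 ≠ 0 := by linarith
  field_simp
  rw [← h]; ring

/-- The shock profile attached to a solution of the front system. -/
noncomputable def shockTriple (T ε : ℝ) (g x : ℝ → ℝ) : Triple where
  n := fun z => 1 - strength T ε * g z
  u := fun z => shockSpeed T ε * (1 - 1 / (1 - strength T ε * g z))
  φ := fun z => Real.log (1 - strength T ε * g z - strength T ε * (ε * shockSpeed T ε) * x z)

lemma slope_mul (hs : shockSpeed T ε ≠ 0) : slope T ε * shockSpeed T ε = 2 * soundSpeed T - ε := by
  unfold slope; field_simp

lemma strength_mul (hT : 0 ≤ T) : strength T ε * (T + 1) = ε * (2 * soundSpeed T - ε) := by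
  have : T + 1 ≠ 0 := by linarith
  unfold strength amp; field_simp

/-- The third front equation is the differentiated relation e^φ = 1 - σ (g + τ x) with φ' = -σ y;
the slow nonlinearity cancels against g'. -/
lemma hasDerivAt_shock_potential {k e σ τ : ℝ} {g x y : ℝ → ℝ} (h : IsFrontSys k e σ τ g x y)
    (hφ : ∀ z, 0 < 1 - σ * g z - σ * τ * x z) (z : ℝ) :
    HasDerivAt (fun z => Real.log (1 - σ * g z - σ * τ * x z)) (-(σ * y z)) z := by
  have e1 : (fun z => 1 - σ * g z - σ * τ * x z) = fun z => 1 - σ * g z - σ * (τ * x z) := by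
    ext z; ring
  have h1 := (((h.hg z).const_mul σ).const_sub 1).fun_sub ((h.hx z).const_mul σ)
  rw [← e1] at h1
  refine (h1.log (hφ z).ne').congr_deriv ?_
  rw [div_eq_iff (hφ z).ne']
  unfold fastPert
  ring

/-- The velocity is chosen so that n u = s (n - 1), which is conservation of mass, and the Poisson
equation becomes e y' = x. Given the fast equation for τ x', the momentum equation reduces to an
algebraic identity by means of σ (T + 1) = ε s k and s² = (T + 1)(1 - σ). -/
lemma isShockProfile_of_frontSys (hT : 0 ≤ T) (hε : 0 < ε) (hδ : 0 < δ) (hs : 0 < shockSpeed T ε)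
    {g x y : ℝ → ℝ}
    (h : IsFrontSys (slope T ε) (δ / shockSpeed T ε) (strength T ε) (ε * shockSpeed T ε) g x y)
    (hn : ∀ z, 0 < 1 - strength T ε * g z)
    (hφ : ∀ z, 0 < 1 - strength T ε * g z - strength T ε * (ε * shockSpeed T ε) * x z)
    (hl : Tendsto g atBot (𝓝 0)) (hr : Tendsto g atTop (𝓝 1))
    (hxl : Tendsto x atBot (𝓝 0)) (hxr : Tendsto x atTop (𝓝 0)) :
    IsShockProfile T ε δ (shockTriple T ε g x) := by
  set s := shockSpeed T ε with hs'
  set σ := strength T ε with hσ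
  have hτ : 0 < ε * s := by positivity
  obtain ⟨sg, sx, sy⟩ := h.smooth (Or.inl hτ)
  have hnp : 0 < nPlus T ε := by
    have : 0 < T + 1 := by linarith
    unfold nPlus; positivity
  have hk : slope T ε * s = 2 * soundSpeed T - ε := slope_mul hs.ne'
  have hσT : σ * (T + 1) = ε * (2 * soundSpeed T - ε) := strength_mul hT
  set k := slope T ε with hk'
  have sn : ContDiff ℝ ∞ fun z => 1 - σ * g z := contDiff_const.sub (contDiff_const.mul sg)
  have sw : ContDiff ℝ ∞ fun z => 1 - σ * g z - σ * (ε * s) * x z :=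
    sn.sub (contDiff_const.mul sx)
  have ln : ∀ {F : Filter ℝ} {l : ℝ}, Tendsto g F (𝓝 l) →
      Tendsto (fun z => 1 - σ * g z) F (𝓝 (1 - σ * l)) := fun h => (h.const_mul σ).const_sub 1
  have lφ : ∀ {F : Filter ℝ} {l : ℝ}, 0 < 1 - σ * l → Tendsto g F (𝓝 l) → Tendsto x F (𝓝 0) →
      Tendsto (fun z => Real.log (1 - σ * g z - σ * (ε * s) * x z)) F (𝓝 (Real.log (1 - σ * l))) := by
    intro F l hl h1 h2
    have h3 := (ln h1).sub (h2.const_mul (σ * (ε * s)))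
    rw [mul_zero, sub_zero] at h3
    exact (Real.continuousAt_log hl.ne').tendsto.comp h3
  have lu : ∀ {F : Filter ℝ} {l : ℝ}, 0 < 1 - σ * l → Tendsto g F (𝓝 l) →
      Tendsto (fun z => s * (1 - 1 / (1 - σ * g z))) F (𝓝 (s * (1 - 1 / (1 - σ * l)))) :=
    fun hl h1 => ((tendsto_const_nhds.div (ln h1) hl.ne').const_sub 1).const_mul s
  have h1σ : 1 - σ * 1 = nPlus T ε := by rw [mul_one, hσ, one_sub_strength hT]
  -- derivatives
  have dg := h.hg
  have dn : ∀ z, HasDerivAt (fun z => 1 - σ * g z) (-(σ * (k * g z * (1 - g z) + x z +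
      σ * slowPert k (δ / s) σ (g z) (x z) (y z)))) z := fun z =>
    ((dg z).const_mul σ).const_sub 1
  have dφ := hasDerivAt_shock_potential h hφ
  have enu : ∀ z, (1 - σ * g z) * (s * (1 - 1 / (1 - σ * g z))) = s * ((1 - σ * g z) - 1) := by
    intro z; have := (hn z).ne'; field_simp
  have enu2 : ∀ z, (1 - σ * g z) * (s * (1 - 1 / (1 - σ * g z))) ^ 2 + T * (1 - σ * g z) =
      s ^ 2 * ((1 - σ * g z) - 2 + 1 / (1 - σ * g z)) + T * (1 - σ * g z) := by
    intro z; have := (hn z).ne'; field_simp; ring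
  have du : ∀ z, HasDerivAt (fun z => s * (1 - 1 / (1 - σ * g z)))
      (-(σ * s) * (k * (g z * (1 - g z) * (1 / (1 - σ * g z))) + x z + σ * (δ / s / 2) * y z ^ 2)) z := by
    intro z
    have h0 := (hn z).ne'
    have h1 := (((dn z).fun_inv h0).const_sub 1).const_mul s
    simp only [one_div]
    refine h1.congr_deriv ?_
    unfold slowPert
    field_simp
    ring
  have du' : deriv (fun z => s * (1 - 1 / (1 - σ * g z))) = fun z =>
      -(σ * s) * (k * (g z * (1 - g z) * (1 / (1 - σ * g z))) + x z + σ * (δ / s / 2) * y z ^ 2) := by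
    ext z; exact (du z).deriv
  refine ⟨sn, ?_, ?_, hn, ?_, ?_, ?_, ?_, ?_, ?_, ?_, ?_, ?_⟩
  · exact contDiff_const.mul (contDiff_const.sub (contDiff_const.div sn fun z => (hn z).ne'))
  · exact sw.log fun z => (hφ z).ne'
  · intro z
    simp only [shockTriple, ← hs', ← hσ, enu]
    rw [(dn z).deriv, (((dn z).sub_const 1).const_mul s).deriv]
    ring
  · intro z
    have h0 := (hn z).ne'
    simp only [shockTriple, ← hs', ← hσ, enu, enu2]
    simp only [iteratedDeriv_succ, iteratedDeriv_zero]
    rw [du', (((dn z).sub_const 1).const_mul s).deriv, (dφ z).deriv]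
    have dinv : HasDerivAt (fun z => 1 / (1 - σ * g z)) (-(-(σ * (k * g z * (1 - g z) + x z +
      σ * slowPert k (δ / s) σ (g z) (x z) (y z)))) / (1 - σ * g z) ^ 2) z := by
      simp only [one_div]; exact (dn z).fun_inv h0
    rw [(((((dn z).sub_const 2).fun_add dinv).const_mul (s ^ 2)).fun_add ((dn z).const_mul T)).deriv]
    have dx := contDiff_hasDerivAt sx z
    have dx' : ε * s * deriv x z = _ := ((dx.const_mul (ε * s)).unique (h.hx z))
    have dlog := ((dg z).fun_mul ((dg z).const_sub 1)).fun_mul dinv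
    rw [((((dlog.const_mul k).fun_add dx).fun_add
      (((h.hy z).fun_pow 2).const_mul (σ * (δ / s / 2)))).const_mul (-(σ * s))).deriv]
    simp only [Nat.cast_ofNat, Nat.add_one_sub_one, pow_one]
    set G := k * g z * (1 - g z) + x z + σ * slowPert k (δ / s) σ (g z) (x z) (y z) with hG
    have hfp : fastPert k (δ / s) σ (ε * s) (g z) (x z) (y z) =
      slowPert k (δ / s) σ (g z) (x z) (y z) + (g z + ε * s * x z) * y z := rfl
    have dx2 : ε * s * deriv x z = y z - G - σ * (g z + ε * s * x z) * y z := by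
      rw [dx', hfp, hG]; ring
    -- The viscous term contains x' only in the combination ε s x' = τ x', which the fast equation
    -- replaces without dividing by τ.
    have e1 : ∀ a b : ℝ, ε * (-(σ * s) * (a + deriv x z + b)) =
        -σ * (ε * s * a + ε * s * deriv x z + ε * s * b) := fun a b => by ring
    rw [e1, dx2]
    have hT' : T * σ = ε * (s * k) - σ := by
      have : s * k = 2 * soundSpeed T - ε := by rw [mul_comm]; exact hk
      rw [this]; linarith
    have hs2 : s ^ 2 = (T + 1) * (1 - σ) := by
      have : T + 1 ≠ 0 := by linarith
      rw [hσ, one_sub_strength hT, nPlus, ← hs']; field_simp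
    have hks : ε * (s * k) = σ * (T + 1) := by linarith
    have e2 : ε * s * (k * ((G * (1 - g z) + g z * -G) * (1 / (1 - σ * g z)) +
        g z * (1 - g z) * (-(-(σ * G)) / (1 - σ * g z) ^ 2))) = σ * (T + 1) *
        ((G * (1 - g z) + g z * -G) * (1 / (1 - σ * g z)) +
        g z * (1 - g z) * (-(-(σ * G)) / (1 - σ * g z) ^ 2)) := by rw [← hks]; ring
    rw [e2]
    have e3 : s ^ 2 * (-(σ * G) + -(-(σ * G)) / (1 - σ * g z) ^ 2) = (T + 1) * (1 - σ) *
      (-(σ * G) + -(-(σ * G)) / (1 - σ * g z) ^ 2) := by rw [hs2]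
    have e4 : -s * (s * -(σ * G)) = (T + 1) * (1 - σ) * (σ * G) := by rw [← hs2]; ring
    rw [e3, e4]
    have e5 : ε * s * (σ * (δ / s / 2) * (2 * y z * (x z / (δ / s)))) = ε * s * (σ * (y z * x z)) := by
      field_simp
    rw [e5]
    field_simp
    ring
  · intro z
    simp only [shockTriple, ← hs', ← hσ]
    rw [Real.exp_log (hφ z)]
    simp only [iteratedDeriv_succ, iteratedDeriv_zero]
    have e1 : deriv (fun z => Real.log (1 - σ * g z - σ * (ε * s) * x z)) = fun z => -(σ * y z) := by
      ext z; exact (dφ z).deriv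
    rw [e1, (((h.hy z).const_mul σ).fun_neg).deriv]
    field_simp
    ring
  · have := ln hl
    rw [mul_zero, sub_zero] at this
    exact this
  · have := lu (by simp) hl
    rw [mul_zero, sub_zero, div_one, sub_self, mul_zero] at this
    exact this
  · have := lφ (by simp) hl hxl
    rw [mul_zero, sub_zero, Real.log_one] at this
    exact this
  · have := ln hr; rw [h1σ] at this; exact this
  · have := lu (by rw [h1σ]; exact hnp) hr
    rw [h1σ] at this; exact this
  · have := lφ (by rw [h1σ]; exact hnp) hr hxr
    rw [h1σ] at this; exact this

end

end IonShock

namespace IonShock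

/-! ### First integrals of the shock profile equations -/

/-- The integrated travelling-wave equations in terms of the specific volume `v = 1 / n`. -/
structure IsReducedProfile (c s ε δ : ℝ) (v v' φ φ' : ℝ → ℝ) : Prop where
  hv : ∀ z, HasDerivAt v (v' z) z
  hφ : ∀ z, HasDerivAt φ (φ' z) z
  hφ' : ∀ z, HasDerivAt φ' ((Real.exp (φ z) - 1 / v z) / (ε * δ)) z
  pos : ∀ z, 0 < v z
  eqn : ∀ z, -(ε * s * v' z) = -(s ^ 2 * (1 - v z)) + (c ^ 2 - 1) * (1 / v z - 1) +
    (Real.exp (φ z) - 1) - ε * δ / 2 * φ' z ^ 2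
  left_v : Tendsto v atBot (𝓝 1)
  left_φ : Tendsto φ atBot (𝓝 0)
  right_v : Tendsto v atTop (𝓝 (c ^ 2 / s ^ 2))
  right_φ : Tendsto φ atTop (𝓝 (-Real.log (c ^ 2 / s ^ 2)))
  left_v' : Tendsto v' atBot (𝓝 0)
  right_v' : Tendsto v' atTop (𝓝 0)
  left_φ' : Tendsto φ' atBot (𝓝 0)
  right_φ' : Tendsto φ' atTop (𝓝 0)

lemma eq_limit_of_deriv_zero {F : ℝ → ℝ} {l : ℝ} (hd : ∀ z, HasDerivAt F 0 z)
    (hl : Tendsto F atBot (𝓝 l)) (z : ℝ) : F z = l := by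
  have hc : ∀ w, F w = F z := fun w =>
    is_const_of_deriv_eq_zero (fun z => (hd z).differentiableAt) (fun z => (hd z).deriv) w z
  have : Tendsto F atBot (𝓝 (F z)) := by
    rw [show F = fun _ => F z from funext hc]; exact tendsto_const_nhds
  exact tendsto_nhds_unique this hl

/-- By the Poisson equation n φ' is the derivative of e^φ - ε δ φ'² / 2, so momentum is a
conservation law like mass. Its constant is found at -∞: φ' vanishes there because φ'' does, the
integrated equation then shows that u' has a limit, and this limit must be zero because u converges.
-/
lemma IsShockProfile.reduce {T ε δ : ℝ} {p : Triple} (hT : 0 ≤ T) (hε : 0 < ε) (hδ : 0 < δ)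
    (hs : 0 < shockSpeed T ε) (h : IsShockProfile T ε δ p) :
    (∀ z, p.u z = shockSpeed T ε * (1 - 1 / p.n z)) ∧
    IsReducedProfile (soundSpeed T) (shockSpeed T ε) ε δ (fun z => 1 / p.n z)
      (deriv fun z => 1 / p.n z) p.φ (deriv p.φ) := by
  set s := shockSpeed T ε with hs'
  have hn := fun z => (h.density_pos z)
  have dn := contDiff_hasDerivAt h.smooth_n
  have du := contDiff_hasDerivAt h.smooth_u
  have du' := contDiff_hasDerivAt (contDiff_deriv h.smooth_u)
  have dφ := contDiff_hasDerivAt h.smooth_φ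
  have dφ' := contDiff_hasDerivAt (contDiff_deriv h.smooth_φ)
  have dnu : ∀ z, HasDerivAt (fun y => p.n y * p.u y) (deriv (fun y => p.n y * p.u y) z) z :=
    contDiff_hasDerivAt (h.smooth_n.mul h.smooth_u)
  have dnu2 : ∀ z, HasDerivAt (fun y => p.n y * p.u y ^ 2 + T * p.n y)
      (deriv (fun y => p.n y * p.u y ^ 2 + T * p.n y) z) z :=
    contDiff_hasDerivAt ((h.smooth_n.mul (h.smooth_u.pow 2)).add (contDiff_const.mul h.smooth_n))
  have hpois : ∀ z, deriv (deriv p.φ) z = (Real.exp (p.φ z) - p.n z) / (ε * δ) := by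
    intro z
    have := h.poisson z
    simp only [iteratedDeriv_succ, iteratedDeriv_zero] at this
    rw [eq_div_iff (by positivity)]
    linarith
  have hnp : 0 < nPlus T ε := by
    have : 0 < T + 1 := by linarith
    unfold nPlus; positivity
  -- conservation of mass
  have mass : ∀ z, p.n z * p.u z = s * (p.n z - 1) := by
    intro z
    have h1 := eq_limit_of_deriv_zero (F := fun z => -s * p.n z + p.n z * p.u z) (l := -s * 1 + 1 * 0)
      (fun z => ((((dn z).const_mul (-s)).fun_add (dnu z)).congr_deriv (h.mass z)))
      ((h.left_n.const_mul (-s)).add (h.left_n.mul h.left_u)) z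
    linarith
  have hu : ∀ z, p.u z = s * (1 - 1 / p.n z) := by
    intro z
    have := mass z
    have := (hn z).ne'
    field_simp
    linarith
  -- the potential
  have lφ' : Tendsto (deriv p.φ) atBot (𝓝 0) := by
    refine tendsto_deriv_zero_atBot dφ dφ' h.left_φ ?_
    have h1 := ((Real.continuous_exp.tendsto _).comp h.left_φ).sub h.left_n
    rw [Real.exp_zero, sub_self] at h1
    have h2 := h1.div_const (ε * δ)
    rw [zero_div] at h2
    exact h2.congr fun z => (hpois z).symm
  have rφ' : Tendsto (deriv p.φ) atTop (𝓝 0) := by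
    refine tendsto_deriv_zero dφ dφ' h.right_φ ?_
    have h1 := ((Real.continuous_exp.tendsto _).comp h.right_φ).sub h.right_n
    rw [phiPlus, Real.exp_log hnp, sub_self] at h1
    have h2 := h1.div_const (ε * δ)
    rw [zero_div] at h2
    exact h2.congr fun z => (hpois z).symm
  -- conservation of momentum
  set F : ℝ → ℝ := fun z => -s * (p.n z * p.u z) + (p.n z * p.u z ^ 2 + T * p.n z) -
    ε * deriv p.u z + Real.exp (p.φ z) - ε * δ / 2 * deriv p.φ z ^ 2 with hF
  have dF : ∀ z, HasDerivAt F 0 z := by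
    intro z
    refine ((((((dnu z).const_mul (-s)).fun_add (dnu2 z)).fun_sub ((du' z).const_mul ε)).fun_add
      (dφ z).exp).fun_sub (((dφ' z).fun_pow 2).const_mul (ε * δ / 2))).congr_deriv ?_
    have h1 := h.momentum z
    simp only [iteratedDeriv_succ, iteratedDeriv_zero] at h1
    rw [h1, hpois z]
    simp only [Nat.cast_ofNat, Nat.add_one_sub_one, pow_one]
    field_simp
    ring
  have hκ : ∀ z, F z = F 0 := fun z =>
    is_const_of_deriv_eq_zero (fun z => (dF z).differentiableAt) (fun z => (dF z).deriv) z 0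
  have hu' : ∀ z, deriv p.u z = (-s * (p.n z * p.u z) + (p.n z * p.u z ^ 2 + T * p.n z) +
      Real.exp (p.φ z) - ε * δ / 2 * deriv p.φ z ^ 2 - F 0) / ε := by
    intro z
    rw [eq_div_iff hε.ne', ← hκ z, hF]
    ring
  have lim : ∀ {L : Filter ℝ} {a b f : ℝ}, Tendsto p.n L (𝓝 a) → Tendsto p.u L (𝓝 b) →
      Tendsto p.φ L (𝓝 f) → Tendsto (deriv p.φ) L (𝓝 0) → Tendsto (deriv p.u) L
        (𝓝 ((-s * (a * b) + (a * b ^ 2 + T * a) + Real.exp f - ε * δ / 2 * 0 ^ 2 - F 0) / ε)) := by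
    intro L a b f ha hb hf hf'
    rw [show deriv p.u = _ from funext hu']
    exact ((((((ha.mul hb).const_mul (-s)).add ((ha.mul (hb.pow 2)).add (ha.const_mul T))).add
      ((Real.continuous_exp.tendsto _).comp hf)).sub ((hf'.pow 2).const_mul _)).sub_const _).div_const ε
  have l1 := lim h.left_n h.left_u h.left_φ lφ'
  have l2 := lim h.right_n h.right_u h.right_φ rφ'
  have z1 := deriv_limit_eq_zero_atBot du h.left_u l1
  have z2 := deriv_limit_eq_zero du h.right_u l2
  rw [z2] at l2
  have hF0 : F 0 = T + 1 := by
    rw [Real.exp_zero] at z1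
    field_simp at z1
    linarith
  rw [z1] at l1
  have hv : ∀ z, (1 : ℝ) / p.n z = 1 - p.u z / s := by
    intro z; rw [hu z]; field_simp; ring
  have hvf : (fun z => 1 / p.n z) = fun z => 1 - p.u z / s := funext hv
  have dv : ∀ z, HasDerivAt (fun z => 1 / p.n z) (-(deriv p.u z / s)) z := by
    intro z
    rw [hvf]
    exact ((du z).div_const s).const_sub 1
  have hv' : deriv (fun z => 1 / p.n z) = fun z => -(deriv p.u z / s) := funext fun z => (dv z).deriv
  have hc := soundSpeed_sq hT
  have hV : soundSpeed T ^ 2 / s ^ 2 = 1 / nPlus T ε := by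
    rw [hc, nPlus, ← hs']; field_simp
  refine ⟨hu, ⟨fun z => (dv z).congr_deriv (by rw [hv']), dφ,
    fun z => (dφ' z).congr_deriv (by rw [hpois z]; simp), fun z => one_div_pos.mpr (hn z), ?_, ?_,
    h.left_φ, ?_, ?_, ?_, ?_, lφ', rφ'⟩⟩
  · intro z
    have h1 := hκ z
    rw [hF0, hF] at h1
    simp only [hu] at h1
    rw [hv', hc]
    have h0 := (hn z).ne'
    have e1 : -(ε * s * -(deriv p.u z / s)) = ε * deriv p.u z := by field_simp
    have e2 : -s * (p.n z * (s * (1 - 1 / p.n z))) + (p.n z * (s * (1 - 1 / p.n z)) ^ 2 + T * p.n z) =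
      -(s ^ 2 * (1 - 1 / p.n z)) + T * p.n z := by field_simp; ring
    rw [e2] at h1
    rw [e1, one_div_one_div]
    linarith
  · have := (tendsto_const_nhds (x := (1 : ℝ))).div h.left_n one_ne_zero
    rw [div_one] at this
    exact this
  · rw [hV]
    exact tendsto_const_nhds.div h.right_n hnp.ne'
  · rw [hV, one_div, Real.log_inv, neg_neg]
    exact h.right_φ
  · rw [hv']
    have := (l1.div_const s).neg
    rw [zero_div, neg_zero] at this
    exact this
  · rw [hv']
    have := (l2.div_const s).neg
    rw [zero_div, neg_zero] at this
    exact this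

end IonShock

namespace IonShock

/-! ### A-priori bounds for shock profiles -/

/-- If the second derivative were negative, the point would be a local maximum too, so f would be
locally constant and the second derivative zero. -/
lemma second_deriv_nonneg_of_min {f f' : ℝ → ℝ} {f'' z : ℝ} (hf : ∀ z, HasDerivAt f (f' z) z)
    (hf' : HasDerivAt f' f'' z) (h : IsLocalMin f z) : 0 ≤ f'' := by
  by_contra hlt
  push Not at hlt
  have e1 : deriv f = f' := funext fun z => (hf z).deriv
  have hmax : IsLocalMax f z := isLocalMax_of_deriv_deriv_neg (by rw [e1, hf'.deriv]; exact hlt)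
    (by rw [e1]; exact h.hasDerivAt_eq_zero (hf z)) (hf z).continuousAt
  have hc : f =ᶠ[𝓝 z] fun _ => f z := by
    filter_upwards [h, hmax] with w h1 h2 using le_antisymm h2 h1
  have h1 := hc.deriv
  have h2 : deriv (deriv f) z = deriv (deriv fun _ => f z) z := h1.deriv_eq
  rw [e1, hf'.deriv] at h2
  simp at h2
  linarith

lemma second_deriv_nonpos_of_max {f f' : ℝ → ℝ} {f'' z : ℝ} (hf : ∀ z, HasDerivAt f (f' z) z)
    (hf' : HasDerivAt f' f'' z) (h : IsLocalMax f z) : f'' ≤ 0 := by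
  have := second_deriv_nonneg_of_min (f := fun z => -f z) (fun z => (hf z).neg) hf'.neg h.neg
  linarith

/-- Range of the shock speed. -/
structure SmallShock (c s ε : ℝ) : Prop where
  hc : 1 ≤ c
  hε : 0 < ε
  hε4 : ε ≤ 1 / 4
  hs : s = c - ε

section
variable {c s ε δ : ℝ}

lemma SmallShock.s_pos (S : SmallShock c s ε) : 0 < s := by linarith [S.hc, S.hε4, S.hs]

lemma SmallShock.s_ge (S : SmallShock c s ε) : 3 / 4 * c ≤ s := by linarith [S.hc, S.hε4, S.hs]

lemma SmallShock.s_lt (S : SmallShock c s ε) : s < c := by linarith [S.hε, S.hs]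

lemma SmallShock.vol_plus (S : SmallShock c s ε) :
    1 < c ^ 2 / s ^ 2 ∧ c ^ 2 / s ^ 2 ≤ 1 + 4 * ε ∧ c ^ 2 / s ^ 2 ≤ 2 := by
  have h0 := S.s_pos
  have h1 := S.s_ge
  have h2 := S.s_lt
  have hc := S.hc
  have hε := S.hε
  have h3 : c ^ 2 / s ^ 2 ≤ 1 + 4 * ε := by
    rw [div_le_iff₀ (by positivity)]
    have e1 : c ^ 2 = s ^ 2 + ε * (2 * c - ε) := by rw [S.hs]; ring
    have e2 : 2 * c - ε ≤ 4 * s ^ 2 := by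
      have : 9 / 16 * c ^ 2 ≤ s ^ 2 := by
        have := mul_le_mul h1 h1 (by positivity) h0.le
        nlinarith
      nlinarith
    rw [e1]
    have := mul_le_mul_of_nonneg_left e2 hε.le
    linarith
  refine ⟨?_, h3, by linarith [S.hε4]⟩
  rw [lt_div_iff₀ (by positivity), one_mul]
  exact pow_lt_pow_left₀ h2 h0.le (by norm_num)

/-- Total variation of the Lyapunov function along the shock. -/
noncomputable def lyapPlus (c s : ℝ) : ℝ :=
  s ^ 2 / 2 * ((c ^ 2 / s ^ 2) ^ 2 - 1) - c ^ 2 * Real.log (c ^ 2 / s ^ 2)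

/-- Both sides vanish at 1, and the derivative of their difference is (x - 1)² (1 - 1 / x²) / 2 ≥ 0.
The cubic order is what makes the total dissipation of a weak shock O(ε³). -/
lemma cubic_log_bound {x : ℝ} (hx : 1 ≤ x) : (x - 1 / x) / 2 - Real.log x ≤ (x - 1) ^ 3 / 6 := by
  have hd : ∀ t ∈ Set.Ioi (0 : ℝ), HasDerivAt
      (fun t : ℝ => (t - 1) ^ 3 / 6 - (t - t⁻¹) / 2 + Real.log t)
      ((t - 1) ^ 2 / 2 - (1 + 1 / t ^ 2) / 2 + 1 / t) t := by
    intro t ht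
    have ht0 : t ≠ 0 := (ne_of_gt ht)
    have h1 := ((((hasDerivAt_id t).sub_const 1).fun_pow 3).div_const 6)
    have h2 := ((hasDerivAt_id t).fun_sub (hasDerivAt_inv ht0)).div_const 2
    refine ((h1.fun_sub h2).fun_add (Real.hasDerivAt_log ht0)).congr_deriv ?_
    simp only [id, Nat.cast_ofNat, Nat.add_one_sub_one]
    field_simp
    ring
  have hm : MonotoneOn (fun t : ℝ => (t - 1) ^ 3 / 6 - (t - t⁻¹) / 2 + Real.log t) (Set.Ici 1) := by
    apply monotoneOn_of_deriv_nonneg (convex_Ici 1)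
    · exact fun t ht => (hd t (Set.mem_Ioi.mpr (lt_of_lt_of_le one_pos (Set.mem_Ici.mp ht)))).continuousAt.continuousWithinAt
    · intro t ht
      rw [interior_Ici] at ht
      exact (hd t (Set.mem_Ioi.mpr (one_pos.trans (Set.mem_Ioi.mp ht)))).differentiableAt.differentiableWithinAt
    · intro t ht
      rw [interior_Ici] at ht
      have ht1 : 1 < t := ht
      have ht0 : 0 < t := one_pos.trans ht1
      rw [(hd t ht0).deriv]
      have e1 : (t - 1) ^ 2 / 2 - (1 + 1 / t ^ 2) / 2 + 1 / t = (t - 1) ^ 2 / 2 * (1 - 1 / t ^ 2) := by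
        field_simp; ring
      rw [e1]
      have : 1 / t ^ 2 ≤ 1 := by
        rw [div_le_one (by positivity)]
        exact one_le_pow₀ ht1.le
      have : 0 ≤ 1 - 1 / t ^ 2 := by linarith
      positivity
  have := hm (Set.mem_Ici.mpr le_rfl) (Set.mem_Ici.mpr hx) hx
  simp only [sub_self, inv_one, Real.log_one] at this
  rw [one_div]
  linarith

/-- With x = c² / s² ≤ 1 + 4 ε the quantity is c² times the left side of `cubic_log_bound`, and 64 /
6 < 11. -/
lemma SmallShock.lyapPlus_le (S : SmallShock c s ε) : lyapPlus c s ≤ 11 * c ^ 2 * ε ^ 3 := by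
  obtain ⟨h1, h2, -⟩ := S.vol_plus
  have h0 := S.s_pos
  have hc := S.hc
  have hε := S.hε
  set x := c ^ 2 / s ^ 2 with hx
  have hsx : s ^ 2 = c ^ 2 / x := by rw [hx]; field_simp
  have hx0 : 0 < x := one_pos.trans h1
  have e1 : lyapPlus c s = c ^ 2 * ((x - 1 / x) / 2 - Real.log x) := by
    unfold lyapPlus; rw [← hx, hsx]; field_simp
  rw [e1]
  have e2 := cubic_log_bound h1.le
  have e3 : (x - 1) ^ 3 ≤ (4 * ε) ^ 3 := pow_le_pow_left₀ (by linarith) (by linarith) 3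
  have e4 : (x - 1 / x) / 2 - Real.log x ≤ 11 * ε ^ 3 := by
    have : (4 * ε) ^ 3 = 64 * ε ^ 3 := by ring
    have : 0 < ε ^ 3 := by positivity
    linarith
  calc c ^ 2 * ((x - 1 / x) / 2 - Real.log x) ≤ c ^ 2 * (11 * ε ^ 3) := by gcongr
    _ = _ := by ring

variable {v v' φ φ' : ℝ → ℝ}

/-- A Lyapunov function for the shock profile equations. -/
noncomputable def lyap (c s ε : ℝ) (v v' φ : ℝ → ℝ) (z : ℝ) : ℝ :=
  s ^ 2 / 2 * (v z ^ 2 - 1) - (c ^ 2 - 1) * Real.log (v z) + φ z + ε * s * v z * v' z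

/-- In the differentiated first integral the Poisson equation collapses e^φ φ' - ε δ φ' φ'' to φ' /
v. -/
lemma IsReducedProfile.hasDerivAt_v' (h : IsReducedProfile c s ε δ v v' φ φ') (hε : 0 < ε)
    (hδ : 0 < δ) (hs : 0 < s) (z : ℝ) :
    HasDerivAt v' (-(s ^ 2 * v' z - (c ^ 2 - 1) * v' z / v z ^ 2 + φ' z / v z) / (ε * s)) z := by
  have e1 : v' = fun z => -(-(s ^ 2 * (1 - v z)) + (c ^ 2 - 1) * (1 / v z - 1) +
    (Real.exp (φ z) - 1) - ε * δ / 2 * φ' z ^ 2) / (ε * s) := by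
    ext z; rw [← h.eqn z]; field_simp
  have h0 := (h.pos z).ne'
  have d1 : HasDerivAt (fun z => 1 / v z) (-v' z / v z ^ 2) z := by
    simp only [one_div]; exact (h.hv z).fun_inv h0
  have d2 := (((((((h.hv z).const_sub 1).const_mul (s ^ 2)).fun_neg).fun_add
    ((d1.sub_const 1).const_mul (c ^ 2 - 1))).fun_add ((h.hφ z).exp.sub_const 1)).fun_sub
    (((h.hφ' z).fun_pow 2).const_mul (ε * δ / 2))).fun_neg.div_const (ε * s)
  rw [← e1] at d2
  refine d2.congr_deriv ?_
  simp only [Nat.cast_ofNat, Nat.add_one_sub_one, pow_one]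
  field_simp
  ring

/-- Multiplying the equation for v'' by v makes every term an exact derivative except the viscous
one, which leaves the dissipation. The field enters only through φ, so nothing here depends on δ. -/
lemma IsReducedProfile.hasDerivAt_lyap (h : IsReducedProfile c s ε δ v v' φ φ') (hε : 0 < ε)
    (hδ : 0 < δ) (hs : 0 < s) (z : ℝ) :
    HasDerivAt (lyap c s ε v v' φ) (ε * s * v' z ^ 2) z := by
  have h0 := (h.pos z).ne'
  have d1 := (((((h.hv z).fun_pow 2).sub_const 1).const_mul (s ^ 2 / 2)).fun_sub
    (((h.hv z).log h0).const_mul (c ^ 2 - 1))).fun_add (h.hφ z) |>.fun_add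
    (((h.hv z).const_mul (ε * s)).fun_mul (h.hasDerivAt_v' hε hδ hs z))
  refine d1.congr_deriv ?_
  simp only [Nat.cast_ofNat, Nat.add_one_sub_one, pow_one]
  field_simp
  ring

lemma IsReducedProfile.lyap_bounds (h : IsReducedProfile c s ε δ v v' φ φ') (S : SmallShock c s ε)
    (hδ : 0 < δ) (z : ℝ) : 0 ≤ lyap c s ε v v' φ z ∧ lyap c s ε v v' φ z ≤ lyapPlus c s := by
  have hs := S.s_pos
  have hε := S.hε
  have hV := S.vol_plus
  have hm : Monotone (lyap c s ε v v' φ) := by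
    apply monotone_of_deriv_nonneg
      (fun z => (h.hasDerivAt_lyap hε hδ hs z).differentiableAt)
    intro z; rw [(h.hasDerivAt_lyap hε hδ hs z).deriv]; positivity
  have lim : ∀ {L : Filter ℝ} {a b : ℝ}, 0 < a → Tendsto v L (𝓝 a) → Tendsto φ L (𝓝 b) →
      Tendsto v' L (𝓝 0) → Tendsto (lyap c s ε v v' φ) L
        (𝓝 (s ^ 2 / 2 * (a ^ 2 - 1) - (c ^ 2 - 1) * Real.log a + b + ε * s * a * 0)) := by
    intro L a b ha h1 h2 h3
    exact (((((h1.pow 2).sub_const 1).const_mul _).sub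
      (((Real.continuousAt_log ha.ne').tendsto.comp h1).const_mul _)).add h2).add
      ((h1.const_mul _).mul h3)
  have l1 := lim one_pos h.left_v h.left_φ h.left_v'
  have l2 := lim (by linarith [hV.1]) h.right_v h.right_φ h.right_v'
  constructor
  · have := hm.le_of_tendsto l1 z
    rw [Real.log_one] at this
    linarith
  · have := hm.ge_of_tendsto l2 z
    unfold lyapPlus
    linarith

/-- Comparison principle for the potential, from below. -/
lemma IsReducedProfile.potential_ge (h : IsReducedProfile c s ε δ v v' φ φ') (S : SmallShock c s ε)
    (hδ : 0 < δ) {K : ℝ} (hK : c ^ 2 / s ^ 2 ≤ K) (hv : ∀ z, v z ≤ K) (z : ℝ) :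
    -Real.log K ≤ φ z := by
  have hε := S.hε
  by_contra hlt
  push Not at hlt
  have hV := S.vol_plus
  have hK1 : 0 < Real.log K := Real.log_pos (by linarith)
  have hK2 : Real.log (c ^ 2 / s ^ 2) ≤ Real.log K := Real.log_le_log (by linarith) hK
  have hcφ : Continuous φ := continuous_iff_continuousAt.mpr fun z => (h.hφ z).continuousAt
  obtain ⟨w, hw⟩ := exists_min_of_limits (w := z) hcφ h.left_φ h.right_φ (by linarith) (by linarith)
  have h2 := second_deriv_nonneg_of_min h.hφ (h.hφ' w) (Eventually.of_forall hw)
  have h3 : 0 ≤ Real.exp (φ w) - 1 / v w := by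
    by_contra h4
    push Not at h4
    have := div_neg_of_neg_of_pos h4 (show 0 < ε * δ by positivity)
    linarith
  have h4 : 1 / K ≤ 1 / v w := one_div_le_one_div_of_le (h.pos w) (hv w)
  have h5 : Real.exp (φ w) < 1 / K := by
    rw [one_div, ← Real.exp_log (show 0 < K by linarith), ← Real.exp_neg]
    exact Real.exp_lt_exp.mpr ((hw z).trans_lt hlt)
  linarith

/-- Comparison principle for the potential, from above. -/
lemma IsReducedProfile.potential_le (h : IsReducedProfile c s ε δ v v' φ φ') (S : SmallShock c s ε)
    (hδ : 0 < δ) {K : ℝ} (hK0 : 0 < K) (hK : K ≤ 1) (hv : ∀ z, K ≤ v z) (z : ℝ) :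
    φ z ≤ -Real.log K := by
  have hε := S.hε
  by_contra hlt
  push Not at hlt
  have hV := S.vol_plus
  have hK1 : Real.log K ≤ 0 := Real.log_nonpos hK0.le hK
  have hK2 : 0 < Real.log (c ^ 2 / s ^ 2) := Real.log_pos hV.1
  have hcφ : Continuous φ := continuous_iff_continuousAt.mpr fun z => (h.hφ z).continuousAt
  obtain ⟨w, hw⟩ := exists_max_of_limits (w := z) hcφ h.left_φ h.right_φ (by linarith) (by linarith)
  have h2 := second_deriv_nonpos_of_max h.hφ (h.hφ' w) (Eventually.of_forall hw)
  have h3 : Real.exp (φ w) - 1 / v w ≤ 0 := by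
    by_contra h4
    push Not at h4
    have := div_pos h4 (show 0 < ε * δ by positivity)
    linarith
  have h4 : 1 / v w ≤ 1 / K := one_div_le_one_div_of_le hK0 (hv w)
  have h5 : 1 / K < Real.exp (φ w) := by
    rw [one_div, ← Real.exp_log hK0, ← Real.exp_neg]
    exact Real.exp_lt_exp.mpr (hlt.trans_le (hw z))
  linarith

/-- The density does not undershoot. -/
lemma IsReducedProfile.vol_le (h : IsReducedProfile c s ε δ v v' φ φ') (S : SmallShock c s ε)
    (hδ : 0 < δ) (z : ℝ) : v z ≤ c ^ 2 / s ^ 2 := by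
  by_contra hlt
  push Not at hlt
  have hV := S.vol_plus
  have hs := S.s_pos
  have hcv : Continuous v := continuous_iff_continuousAt.mpr fun z => (h.hv z).continuousAt
  obtain ⟨w, hw⟩ := exists_max_of_limits (w := z) hcv h.left_v h.right_v (by linarith) hlt
  have h1 := deriv_zero_of_max h.hv hw
  have h2 : c ^ 2 / s ^ 2 < v w := hlt.trans_le (hw z)
  have h3 := h.potential_ge S hδ h2.le hw w
  -- At the maximum, φ ≥ -log v makes the Lyapunov function at least s² (v² - 1) / 2 - c² log v.
  -- This increases for v > c / s and equals `lyapPlus` at v = c² / s², so a larger v is impossible.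
  have h4 := (h.lyap_bounds S hδ w).2
  unfold lyap lyapPlus at h4
  rw [h1, mul_zero, add_zero] at h4
  set x := c ^ 2 / s ^ 2 with hx
  have hx0 : 0 < x := by linarith
  have h5 : Real.log (v w) - Real.log x ≤ v w / x - 1 := by
    rw [← Real.log_div (by linarith) (by linarith)]
    exact Real.log_le_sub_one_of_pos (div_pos (by linarith) hx0)
  have hcx : c ^ 2 = s ^ 2 * x := by rw [hx]; field_simp
  have h6 : s ^ 2 * x * (v w / x - 1) = s ^ 2 * (v w - x) := by field_simp
  have h7 : s ^ 2 * x * (Real.log (v w) - Real.log x) ≤ s ^ 2 * (v w - x) := by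
    rw [← h6]; gcongr
  have h8 : s ^ 2 / 2 * (v w ^ 2 - x ^ 2) ≤ s ^ 2 * (v w - x) := by
    rw [hcx] at h4
    linarith
  have h9 : s ^ 2 * (v w - x) * ((v w + x) / 2 - 1) ≤ 0 := by
    have : s ^ 2 * (v w - x) * ((v w + x) / 2 - 1) = s ^ 2 / 2 * (v w ^ 2 - x ^ 2) - s ^ 2 * (v w - x) := by
      ring
    linarith
  have h10 : 0 < s ^ 2 * (v w - x) * ((v w + x) / 2 - 1) := by
    have : 0 < v w - x := by linarith
    have : 0 < (v w + x) / 2 - 1 := by linarith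
    positivity
  linarith

/-- The specific volume varies slowly. -/
lemma IsReducedProfile.vol_sub_le (h : IsReducedProfile c s ε δ v v' φ φ') (S : SmallShock c s ε)
    (hδ : 0 < δ) {a b : ℝ} (hab : a ≤ b) : |v b - v a| ≤ 8 * c * ε + ε / 2 * (b - a) := by
  have hs := S.s_pos
  have hs2 := S.s_ge
  have hε := S.hε
  have hc := S.hc
  -- Young's inequality |v'| ≤ v'² / (2 ε) + ε / 2 bounds the variation of v by the dissipation;
  -- dividing an O(ε³) quantity by ε² leaves O(ε).
  have hW : (lyap c s ε v v' φ b - lyap c s ε v v' φ a) / (2 * ε ^ 2 * s) ≤ 8 * c * ε := by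
    rw [div_le_iff₀ (by positivity)]
    have h1 := (h.lyap_bounds S hδ b).2
    have h2 := (h.lyap_bounds S hδ a).1
    have h3 := S.lyapPlus_le
    have h4 : 11 * c ^ 2 * ε ^ 3 ≤ 16 * c * ε ^ 3 * s := by
      have : 16 * c * ε ^ 3 * (3 / 4 * c) ≤ 16 * c * ε ^ 3 * s := by gcongr
      have : 0 ≤ c ^ 2 * ε ^ 3 := by positivity
      linarith
    have h5 : 8 * c * ε * (2 * ε ^ 2 * s) = 16 * c * ε ^ 3 * s := by ring
    linarith
  have key : ∀ σ : ℝ, σ = 1 ∨ σ = -1 → σ * (v b - v a) ≤ 8 * c * ε + ε / 2 * (b - a) := by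
    intro σ hσ
    have hσ2 : σ ^ 2 = 1 := by rcases hσ with rfl | rfl <;> norm_num
    have hd : ∀ t, HasDerivAt (fun t => lyap c s ε v v' φ t / (2 * ε ^ 2 * s) + ε / 2 * t - σ * v t)
        (ε * s * v' t ^ 2 / (2 * ε ^ 2 * s) + ε / 2 * 1 - σ * v' t) t := fun t =>
      (((h.hasDerivAt_lyap hε hδ hs t).div_const _).fun_add
        ((hasDerivAt_id t).const_mul (ε / 2))).fun_sub ((h.hv t).const_mul σ)
    have hm : Monotone fun t => lyap c s ε v v' φ t / (2 * ε ^ 2 * s) + ε / 2 * t - σ * v t := by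
      apply monotone_of_deriv_nonneg (fun t => (hd t).differentiableAt)
      intro t
      rw [(hd t).deriv]
      have e1 : ε * s * v' t ^ 2 / (2 * ε ^ 2 * s) + ε / 2 * 1 - σ * v' t =
          (v' t - σ * ε) ^ 2 / (2 * ε) := by
        have : (v' t - σ * ε) ^ 2 = v' t ^ 2 - 2 * σ * ε * v' t + σ ^ 2 * ε ^ 2 := by ring
        rw [this, hσ2]
        field_simp
        ring
      rw [e1]; positivity
    have h1 := hm hab
    simp only at h1
    have e1 : (lyap c s ε v v' φ b - lyap c s ε v v' φ a) / (2 * ε ^ 2 * s) =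
      lyap c s ε v v' φ b / (2 * ε ^ 2 * s) - lyap c s ε v v' φ a / (2 * ε ^ 2 * s) := sub_div _ _ _
    rw [e1] at hW
    linarith
  rw [abs_le]
  constructor
  · have := key (-1) (Or.inr rfl); linarith
  · have := key 1 (Or.inl rfl); linarith

end

end IonShock

/-! ### Lower bound for the specific volume and bounds for the electric field. -/

namespace IonShock

section
variable {c s ε δ : ℝ} {v v' φ φ' : ℝ → ℝ}

/-- A crude upper bound for the density. -/
noncomputable def crudeBound (c : ℝ) : ℝ :=
  2 * (c ^ 2 / 2 + 1 + 2) + Real.exp (c ^ 2 / 2 + 1 + 1 / 2)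

lemma crudeBound_ge (c : ℝ) : 6 ≤ crudeBound c := by
  unfold crudeBound
  have := Real.exp_pos (c ^ 2 / 2 + 1 + 1 / 2)
  nlinarith [sq_nonneg c]

/-- At the minimum of v the Lyapunov function bounds φ from above. Since v varies by at most 9 c ε
over a unit distance, too small a minimum would push the density above `crudeBound` on a whole
neighbourhood. The Poisson equation would then make φ so concave that it could not stay above -1 at
distance one. -/
lemma IsReducedProfile.vol_ge_crude (h : IsReducedProfile c s ε δ v v' φ φ') (S : SmallShock c s ε)
    (hδ : 0 < δ) (hεδ : ε * δ ≤ 1) (hsm : 9 * c * ε ≤ 1 / (2 * crudeBound c)) (z : ℝ) :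
    1 / (2 * crudeBound c) ≤ v z := by
  by_contra hlt
  push Not at hlt
  set N := crudeBound c with hN
  have hN6 : 6 ≤ N := crudeBound_ge c
  have hε := S.hε
  have hc := S.hc
  have hs := S.s_pos
  have hV := S.vol_plus
  have hm : 1 / (2 * N) ≤ 1 / 12 := one_div_le_one_div_of_le (by norm_num) (by linarith)
  have hcv : Continuous v := continuous_iff_continuousAt.mpr fun z => (h.hv z).continuousAt
  have hcφ : Continuous φ := continuous_iff_continuousAt.mpr fun z => (h.hφ z).continuousAt
  obtain ⟨w, hw⟩ := exists_min_of_limits (w := z) hcv h.left_v h.right_v (by linarith) (by linarith)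
  have h1 := deriv_zero_of_min h.hv hw
  have hVw : v w < 1 / (2 * N) := (hw z).trans_lt hlt
  have hφw : φ w ≤ c ^ 2 / 2 + 1 := by
    have h2 := (h.lyap_bounds S hδ w).2
    have h3 := S.lyapPlus_le
    unfold lyap at h2
    rw [h1, mul_zero, add_zero] at h2
    have h4 : Real.log (v w) ≤ 0 := Real.log_nonpos (h.pos w).le (by linarith)
    have h5 : (c ^ 2 - 1) * Real.log (v w) ≤ 0 :=
      mul_nonpos_of_nonneg_of_nonpos (by linarith [one_le_pow₀ hc (n := 2)]) h4
    have h6 : s ^ 2 ≤ c ^ 2 := pow_le_pow_left₀ hs.le S.s_lt.le 2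
    have h7 : 0 ≤ s ^ 2 / 2 * v w ^ 2 := by positivity
    have h8 : 11 * c ^ 2 * ε ^ 3 ≤ 1 := by
      have h9 : c * ε ≤ 1 / 12 := by linarith
      have h10 : (c * ε) ^ 2 ≤ (1 / 12) ^ 2 := pow_le_pow_left₀ (by positivity) h9 2
      have h11 : ε ≤ 1 / 4 := S.hε4
      calc 11 * c ^ 2 * ε ^ 3 = 11 * (c * ε) ^ 2 * ε := by ring
        _ ≤ 11 * (1 / 12) ^ 2 * (1 / 4) := by gcongr
        _ ≤ 1 := by norm_num
    linarith
  set K := c ^ 2 / 2 + 1 with hK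
  have hK0 : 1 ≤ K := by rw [hK]; nlinarith [sq_nonneg c]
  have hεc : ε ≤ c * ε := le_mul_of_one_le_left hε.le hc
  have hnear : ∀ t ∈ Set.Icc (w - 1) (w + 1), N < 1 / v t := by
    intro t ht
    have h2 : |v t - v w| ≤ 9 * c * ε := by
      rcases le_total w t with hwt | hwt
      · have h3 := h.vol_sub_le S hδ hwt
        have : ε / 2 * (t - w) ≤ ε / 2 * 1 := by gcongr; linarith [ht.2]
        linarith
      · have h3 := h.vol_sub_le S hδ hwt
        rw [abs_sub_comm]
        have : ε / 2 * (w - t) ≤ ε / 2 * 1 := by gcongr; linarith [ht.1]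
        linarith
    rw [lt_div_iff₀ (h.pos t)]
    have h4 : v t < 1 / (2 * N) + 1 / (2 * N) := by linarith [(abs_le.mp h2).2]
    have h5 : N * v t < N * (1 / (2 * N) + 1 / (2 * N)) := by gcongr
    have h6 : N * (1 / (2 * N) + 1 / (2 * N)) = 1 := by field_simp; norm_num
    linarith
  -- comparison with a parabola
  set ψ : ℝ → ℝ := fun t => φ t + ((K + 2) * (t - w) ^ 2 - (K + 1 / 2)) with hψ
  have dψ : ∀ t, HasDerivAt ψ (φ' t + 2 * (K + 2) * (t - w)) t := by
    intro t
    refine ((h.hφ t).fun_add (((((hasDerivAt_id t).sub_const w).fun_pow 2).const_mul (K + 2)).sub_const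
      (K + 1 / 2))).congr_deriv ?_
    simp only [id, Nat.cast_ofNat, Nat.add_one_sub_one, pow_one]
    ring
  have dψ' : ∀ t, HasDerivAt (fun t => φ' t + 2 * (K + 2) * (t - w))
      ((Real.exp (φ t) - 1 / v t) / (ε * δ) + 2 * (K + 2)) t := by
    intro t
    exact ((h.hφ' t).fun_add (((hasDerivAt_id t).sub_const w).const_mul (2 * (K + 2)))).congr_deriv
      (by ring)
  obtain ⟨t, ht, hmin⟩ := isCompact_Icc.exists_isMinOn (s := Set.Icc (w - 1) (w + 1))
    ⟨w, by constructor <;> linarith⟩ (fun t _ => (dψ t).continuousAt.continuousWithinAt)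
  -- At the centre ψ ≤ -1/2, while at the ends φ ≥ -1 gives ψ ≥ 1/2, so the minimum is interior. The
  -- value N = 2 (K + 2) + e^{K + 1/2} is chosen to make ψ'' negative there.
  have hle : ψ t ≤ -(1 / 2) := by
    have : ψ t ≤ ψ w := hmin (by constructor <;> linarith : w ∈ Set.Icc (w - 1) (w + 1))
    have h2 : ψ w = φ w - (K + 1 / 2) := by simp only [hψ]; ring
    linarith
  have hφlow : ∀ t, -1 ≤ φ t := by
    intro t
    have h2 := h.potential_ge S hδ le_rfl (h.vol_le S hδ) t
    have h3 := Real.log_le_sub_one_of_pos (show 0 < c ^ 2 / s ^ 2 by linarith)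
    linarith
  have hint : t ∈ Set.Ioo (w - 1) (w + 1) := by
    refine ⟨lt_of_le_of_ne ht.1 ?_, lt_of_le_of_ne ht.2 ?_⟩
    · intro heq
      have h2 : ψ t = φ t + 3 / 2 := by simp only [hψ]; rw [← heq]; ring
      linarith [hφlow t]
    · intro heq
      have h2 : ψ t = φ t + 3 / 2 := by simp only [hψ]; rw [heq]; ring
      linarith [hφlow t]
  have hloc : IsLocalMin ψ t := hmin.isLocalMin (Icc_mem_nhds hint.1 hint.2)
  have h2 := second_deriv_nonneg_of_min dψ (dψ' t) hloc
  have h3 : φ t ≤ K + 1 / 2 := by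
    have h4 : ψ t = φ t + ((K + 2) * (t - w) ^ 2 - (K + 1 / 2)) := rfl
    have : 0 ≤ (K + 2) * (t - w) ^ 2 := by positivity
    linarith
  have h4 := Real.exp_le_exp.mpr h3
  have h5 := hnear t ht
  have h6 : Real.exp (φ t) - 1 / v t < -(2 * (K + 2)) := by
    have : N = 2 * (K + 2) + Real.exp (K + 1 / 2) := rfl
    linarith
  have hp : 0 < ε * δ := by positivity
  have h7 : (Real.exp (φ t) - 1 / v t) / (ε * δ) < -(2 * (K + 2)) := by
    rw [div_lt_iff₀ hp]
    have := mul_le_mul_of_nonneg_left hεδ (show 0 ≤ 2 * (K + 2) by positivity)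
    linarith
  linarith

/-- Constant in the bound of the electric energy. -/
noncomputable def energyConst (c M : ℝ) : ℝ := 19 * c ^ 2 + 4 * (M + 4) + 2 * (M + 4) ^ 2

/-- Constant in the bound of the electric field. -/
noncomputable def fieldConst (c M : ℝ) : ℝ := 2 * M ^ 2 * (32 * c ^ 2 + energyConst c M)

/-- Eliminating v' between the Lyapunov function and the first integral expresses v times the
electric energy by quantities quadratic in 1 - v and e^φ - 1, up to a term of favourable sign and
the O(ε³) of the Lyapunov function. The comparison principles bound e^φ - 1 by a multiple of η + ε.
-/
lemma IsReducedProfile.energy_bound (h : IsReducedProfile c s ε δ v v' φ φ') (S : SmallShock c s ε)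
    (hδ : 0 < δ) {η M : ℝ} (hη : 0 ≤ η) (hM : 1 ≤ M * (1 - η)) (hM1 : 1 ≤ M)
    (hv : ∀ z, 1 - η ≤ v z) (z : ℝ) :
    |1 - v z| ≤ 4 * (η + ε) ∧ 1 ≤ M * v z ∧
      ε * δ / 2 * φ' z ^ 2 ≤ M * (energyConst c M * (η + ε) ^ 2) := by
  have hε := S.hε
  have hc := S.hc
  have hs := S.s_pos
  have hV := S.vol_plus
  set κ := η + ε with hκ
  have hκ0 : 0 < κ := by linarith
  have hη1 : 0 < 1 - η := by
    by_contra hle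
    push Not at hle
    have := mul_nonpos_of_nonneg_of_nonpos (show 0 ≤ M by linarith) hle
    linarith
  have h1 : |1 - v z| ≤ 4 * κ := by
    have := h.vol_le S hδ z
    rw [abs_le]; constructor <;> linarith [hv z]
  have hMv : 1 ≤ M * v z := hM.trans (by have := hv z; gcongr)
  refine ⟨h1, hMv, ?_⟩
  have hv0 := h.pos z
  set E := Real.exp (φ z) with hE
  have hE0 : 0 < E := Real.exp_pos _
  have hE1 : E - 1 ≤ M * η := by
    have h2 := h.potential_le S hδ hη1 (by linarith) hv z
    have h3 : E ≤ 1 / (1 - η) := by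
      rw [one_div, ← Real.exp_log hη1, ← Real.exp_neg]
      exact Real.exp_le_exp.mpr h2
    have h4 : 1 / (1 - η) ≤ 1 + M * η := by
      rw [div_le_iff₀ hη1]
      have := mul_le_mul_of_nonneg_right hM hη
      linarith
    linarith
  have hE2 : 1 / (c ^ 2 / s ^ 2) ≤ E := by
    have h2 := h.potential_ge S hδ le_rfl (h.vol_le S hδ) z
    rw [one_div, ← Real.exp_log (show 0 < c ^ 2 / s ^ 2 by linarith), ← Real.exp_neg]
    exact Real.exp_le_exp.mpr h2
  set x := c ^ 2 / s ^ 2 with hx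
  have hx1 : 1 - 4 * ε ≤ 1 / x := by
    rw [le_div_iff₀ (by linarith)]
    have h3 : (1 - 4 * ε) * x ≤ (1 - 4 * ε) * (1 + 4 * ε) :=
      mul_le_mul_of_nonneg_left hV.2.1 (by linarith [S.hε4])
    have h4 : (1 - 4 * ε) * (1 + 4 * ε) = 1 - 16 * ε ^ 2 := by ring
    have : 0 ≤ ε ^ 2 := by positivity
    linarith
  have hx2 : 1 / 2 ≤ 1 / x := one_div_le_one_div_of_le (by linarith) hV.2.2
  have hE3 : |E - 1| ≤ (M + 4) * κ := by
    have e1 : (M + 4) * κ = M * η + M * ε + 4 * η + 4 * ε := by rw [hκ]; ring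
    have : 0 ≤ M * η := by positivity
    have : 0 ≤ M * ε := by positivity
    rw [e1, abs_le]; constructor <;> linarith
  have hE4 : E - 1 - φ z ≤ 2 * ((M + 4) * κ) ^ 2 := by
    have h2 := Real.one_sub_inv_le_log_of_pos hE0
    rw [hE, Real.log_exp, ← hE] at h2
    have h3 : E - 1 - φ z ≤ (E - 1) ^ 2 * E⁻¹ := by
      have : (E - 1) ^ 2 * E⁻¹ = E - 1 - (1 - E⁻¹) := by field_simp
      linarith
    have h4 : E⁻¹ ≤ 2 := by
      rw [inv_le_comm₀ hE0 (by norm_num)]; linarith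
    have h5 : (E - 1) ^ 2 ≤ ((M + 4) * κ) ^ 2 := by
      rw [← sq_abs (E - 1)]; gcongr
    calc E - 1 - φ z ≤ (E - 1) ^ 2 * E⁻¹ := h3
      _ ≤ ((M + 4) * κ) ^ 2 * 2 := by gcongr
      _ = _ := by ring
  have hW := (h.lyap_bounds S hδ z).2.trans S.lyapPlus_le
  -- The grouping isolates log v + 1 - v ≤ 0, whose coefficient c² - 1 is nonnegative, and e^φ - 1 -
  -- φ, which is of second order.
  have heq : v z * (ε * δ / 2 * φ' z ^ 2) = lyap c s ε v v' φ z + s ^ 2 / 2 * (1 - v z) ^ 2 +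
      (c ^ 2 - 1) * (Real.log (v z) + 1 - v z) + (v z - 1) * (E - 1) + (E - 1 - φ z) := by
    have h2 := h.eqn z
    have h3 : ε * δ / 2 * φ' z ^ 2 = ε * s * v' z - (s ^ 2 * (1 - v z)) + (c ^ 2 - 1) * (1 / v z - 1) +
      (E - 1) := by linarith
    rw [h3]
    unfold lyap
    field_simp
    ring
  have h2 : (c ^ 2 - 1) * (Real.log (v z) + 1 - v z) ≤ 0 := by
    have := Real.log_le_sub_one_of_pos hv0
    exact mul_nonpos_of_nonneg_of_nonpos (by linarith [one_le_pow₀ hc (n := 2)]) (by linarith)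
  have h3 : (1 - v z) ^ 2 ≤ (4 * κ) ^ 2 := by rw [← sq_abs (1 - v z)]; gcongr
  have h4 : s ^ 2 / 2 * (1 - v z) ^ 2 ≤ c ^ 2 / 2 * (4 * κ) ^ 2 := by
    have := S.s_lt
    gcongr
  have h5 : (v z - 1) * (E - 1) ≤ 4 * κ * ((M + 4) * κ) := by
    refine (le_abs_self _).trans ?_
    rw [abs_mul, abs_sub_comm]
    gcongr
  have h6 : 11 * c ^ 2 * ε ^ 3 ≤ 11 * c ^ 2 * κ ^ 2 := by
    have : ε ^ 3 ≤ κ ^ 2 := by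
      have h7 : ε ^ 2 ≤ κ ^ 2 := pow_le_pow_left₀ hε.le (by linarith) 2
      have h8 : ε ^ 3 = ε ^ 2 * ε := by ring
      have h9 : ε ^ 2 * ε ≤ ε ^ 2 := mul_le_of_le_one_right (by positivity) (by linarith [S.hε4])
      linarith
    gcongr
  have h7 : v z * (ε * δ / 2 * φ' z ^ 2) ≤ energyConst c M * κ ^ 2 := by
    rw [heq]
    have : energyConst c M * κ ^ 2 = 11 * c ^ 2 * κ ^ 2 + c ^ 2 / 2 * (4 * κ) ^ 2 +
      4 * κ * ((M + 4) * κ) + 2 * ((M + 4) * κ) ^ 2 := by unfold energyConst; ring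
    linarith
  have h8 : 0 ≤ ε * δ / 2 * φ' z ^ 2 := by positivity
  calc ε * δ / 2 * φ' z ^ 2 = 1 * (ε * δ / 2 * φ' z ^ 2) := by ring
    _ ≤ M * v z * (ε * δ / 2 * φ' z ^ 2) := by gcongr
    _ = M * (v z * (ε * δ / 2 * φ' z ^ 2)) := by ring
    _ ≤ _ := by gcongr

/-- At an extremum of φ' one has e^φ = 1 / v, and the sign of φ''' compares φ' with -v' / v. There
the first integral makes ε s v' quadratic in η + ε. Reading φ' off the energy bound directly would
cost a negative power of δ; this argument does not. -/
lemma IsReducedProfile.field_bound (h : IsReducedProfile c s ε δ v v' φ φ') (S : SmallShock c s ε)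
    (hδ : 0 < δ) {η M : ℝ} (hη : 0 ≤ η) (hM : 1 ≤ M * (1 - η)) (hM1 : 1 ≤ M)
    (hv : ∀ z, 1 - η ≤ v z) (z : ℝ) : |φ' z| ≤ fieldConst c M * (η + ε) ^ 2 / ε := by
  have hε := S.hε
  have hc := S.hc
  have hs := S.s_pos
  have hsg := S.s_ge
  have hV := S.vol_plus
  set κ := η + ε with hκ
  have hκ0 : 0 < κ := by linarith
  have hC2 : 0 < energyConst c M := by unfold energyConst; positivity
  set B := fieldConst c M * κ ^ 2 / ε with hB
  have hB0 : 0 < B := by rw [hB]; unfold fieldConst; positivity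
  -- at critical points of the field
  have crit : ∀ w, Real.exp (φ w) = 1 / v w → |v' w / v w| ≤ B := by
    intro w hw
    obtain ⟨h1, h2, h3⟩ := h.energy_bound S hδ hη hM hM1 hv w
    have hv0 := h.pos w
    have hv1 : v w ≤ 2 := (h.vol_le S hδ w).trans hV.2.2
    have h4 := h.eqn w
    rw [hw] at h4
    have h5 : ε * s * v' w = ε * δ / 2 * φ' w ^ 2 - (1 - v w) * (c ^ 2 - s ^ 2 * v w) * (1 / v w) := by
      have : (1 - v w) * (c ^ 2 - s ^ 2 * v w) * (1 / v w) = -(s ^ 2 * (1 - v w)) +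
        (c ^ 2 - 1) * (1 / v w - 1) + (1 / v w - 1) := by field_simp; ring
      linarith
    have h6 : |c ^ 2 - s ^ 2 * v w| ≤ 8 * c ^ 2 * κ := by
      have e1 : c ^ 2 - s ^ 2 * v w = c ^ 2 * (1 - v w) + ε * (2 * c - ε) * v w := by rw [S.hs]; ring
      rw [e1]
      refine (abs_add_le _ _).trans ?_
      have e2 : |ε * (2 * c - ε) * v w| ≤ ε * (2 * c) * 2 := by
        rw [abs_of_nonneg (mul_nonneg (mul_nonneg hε.le (by linarith [S.hε4])) hv0.le)]
        gcongr
        linarith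
      have e3 : |c ^ 2 * (1 - v w)| ≤ c ^ 2 * (4 * κ) := by
        rw [abs_mul, abs_of_nonneg (by positivity)]; gcongr
      have e4 : ε * (2 * c) * 2 ≤ 4 * c ^ 2 * κ := by
        have : ε * c ≤ κ * c ^ 2 := by
          have : c ≤ c ^ 2 := le_self_pow₀ hc two_ne_zero
          have : ε ≤ κ := by linarith
          gcongr
        linarith
      linarith
    have h7 : 1 / v w ≤ M := by rw [div_le_iff₀ hv0]; exact h2
    have h8 : |ε * s * v' w| ≤ M * (32 * c ^ 2 + energyConst c M) * κ ^ 2 := by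
      rw [h5]
      refine (abs_sub _ _).trans ?_
      rw [abs_of_nonneg (show 0 ≤ ε * δ / 2 * φ' w ^ 2 by positivity), abs_mul, abs_mul,
        abs_of_pos (one_div_pos.mpr hv0)]
      calc _ ≤ M * (energyConst c M * κ ^ 2) + 4 * κ * (8 * c ^ 2 * κ) * M := by gcongr
        _ = _ := by ring
    have h9 : |v' w / v w| = |ε * s * v' w| * (1 / v w) / (ε * s) := by
      rw [abs_div, abs_mul, abs_of_pos hv0, abs_of_pos (show 0 < ε * s by positivity)]
      field_simp
    rw [h9, hB, div_le_div_iff₀ (by positivity) hε]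
    have h10 : |ε * s * v' w| * (1 / v w) ≤ M * (32 * c ^ 2 + energyConst c M) * κ ^ 2 * M := by gcongr
    have h11 : (1 : ℝ) ≤ 2 * s := by linarith
    calc |ε * s * v' w| * (1 / v w) * ε ≤ M * (32 * c ^ 2 + energyConst c M) * κ ^ 2 * M * ε := by gcongr
      _ = M * (32 * c ^ 2 + energyConst c M) * κ ^ 2 * M * ε * 1 := by ring
      _ ≤ M * (32 * c ^ 2 + energyConst c M) * κ ^ 2 * M * ε * (2 * s) := by gcongr
      _ = _ := by unfold fieldConst; ring
  have hcφ' : Continuous φ' := continuous_iff_continuousAt.mpr fun z => (h.hφ' z).continuousAt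
  have hp : 0 < ε * δ := by positivity
  have d2 : ∀ w, HasDerivAt (fun t => (Real.exp (φ t) - 1 / v t) / (ε * δ))
      ((Real.exp (φ w) * φ' w + v' w / v w ^ 2) / (ε * δ)) w := by
    intro w
    have d1 : HasDerivAt (fun z => 1 / v z) (-v' w / v w ^ 2) w := by
      simp only [one_div]; exact (h.hv w).fun_inv (h.pos w).ne'
    exact (((h.hφ w).exp.fun_sub d1).div_const (ε * δ)).congr_deriv (by ring)
  have crit' : ∀ w, (Real.exp (φ w) - 1 / v w) / (ε * δ) = 0 → Real.exp (φ w) = 1 / v w := by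
    intro w hw
    rcases div_eq_zero_iff.mp hw with h1 | h1
    · linarith
    · exact absurd h1 hp.ne'
  have num : ∀ w, Real.exp (φ w) = 1 / v w →
      (Real.exp (φ w) * φ' w + v' w / v w ^ 2) / (ε * δ) * (ε * δ * v w) = φ' w + v' w / v w := by
    intro w hw
    have := (h.pos w).ne'
    rw [hw]; field_simp
  rw [abs_le]
  constructor
  · by_contra hlt
    push Not at hlt
    obtain ⟨w, hw⟩ := exists_min_of_limits (w := z) hcφ' h.left_φ' h.right_φ' (by linarith) (by linarith)
    have h1 := crit' w (deriv_zero_of_min (f' := fun t => (Real.exp (φ t) - 1 / v t) / (ε * δ)) h.hφ' hw)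
    have h2 := second_deriv_nonneg_of_min (f' := fun t => (Real.exp (φ t) - 1 / v t) / (ε * δ))
      h.hφ' (d2 w) (Eventually.of_forall hw)
    have h3 := mul_nonneg h2 (mul_pos hp (h.pos w)).le
    rw [num w h1] at h3
    have := (abs_le.mp (crit w h1)).2
    linarith [hw z]
  · by_contra hlt
    push Not at hlt
    obtain ⟨w, hw⟩ := exists_max_of_limits (w := z) hcφ' h.left_φ' h.right_φ' (by linarith) (by linarith)
    have h1 := crit' w (deriv_zero_of_max (f' := fun t => (Real.exp (φ t) - 1 / v t) / (ε * δ)) h.hφ' hw)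
    have h2 := second_deriv_nonpos_of_max (f' := fun t => (Real.exp (φ t) - 1 / v t) / (ε * δ))
      h.hφ' (d2 w) (Eventually.of_forall hw)
    have h3 := mul_nonpos_of_nonpos_of_nonneg h2 (mul_pos hp (h.pos w)).le
    rw [num w h1] at h3
    have := (abs_le.mp (crit w h1)).1
    linarith [hw z]

end

end IonShock

/-! ### The overshoot of the density and the final a priori bounds. -/

namespace IonShock

section
variable {c s ε δ : ℝ} {v v' φ φ' : ℝ → ℝ}

/-- A momentum-type functional controlling the overshoot of the density. -/
lemma IsReducedProfile.momentum_deriv_le (h : IsReducedProfile c s ε δ v v' φ φ')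
    (S : SmallShock c s ε) (hδ : 0 < δ) (z : ℝ) (hv1 : v z ≤ 1) : ∃ d,
    HasDerivAt (fun z => ε * s / 2 * v z ^ 2 + ε * δ * (φ' z * Real.exp (-φ z))) d z ∧
      d ≤ lyapPlus c s - c ^ 2 / 2 * (1 - v z) ^ 2 := by
  have hε := S.hε
  have hc := S.hc
  have hs := S.s_pos
  have hv0 := h.pos z
  have d1 := ((((h.hv z).fun_pow 2).const_mul (ε * s / 2)).fun_add
    (((h.hφ' z).fun_mul (h.hφ z).fun_neg.exp).const_mul (ε * δ)))
  refine ⟨_, d1, ?_⟩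
  simp only [Nat.cast_ofNat, Nat.add_one_sub_one, pow_one]
  have hW := (h.lyap_bounds S hδ z).2
  unfold lyap at hW
  have hEE : Real.exp (φ z) * Real.exp (-φ z) = 1 := by rw [← Real.exp_add]; simp
  have e1 : ε * s / 2 * (2 * v z * v' z) + ε * δ * ((Real.exp (φ z) - 1 / v z) / (ε * δ) *
      Real.exp (-φ z) + φ' z * (Real.exp (-φ z) * -φ' z)) = ε * s * v z * v' z +
      (1 - Real.exp (-φ z) / v z) - ε * δ * (φ' z ^ 2 * Real.exp (-φ z)) := by
    have e2 : (1 : ℝ) - Real.exp (-φ z) / v z =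
      Real.exp (φ z) * Real.exp (-φ z) - Real.exp (-φ z) / v z := by rw [hEE]
    rw [e2]; field_simp; ring
  rw [e1]
  have h1 : 0 ≤ ε * δ * (φ' z ^ 2 * Real.exp (-φ z)) := by positivity
  -- With q = e^{-φ} / v, the inequality log q ≤ q - 1 replaces 1 - q by φ + log v, which the
  -- Lyapunov function controls.
  have hq : 0 < Real.exp (-φ z) / v z := by positivity
  have h2 := Real.log_le_sub_one_of_pos hq
  rw [Real.log_div (Real.exp_pos _).ne' hv0.ne', Real.log_exp] at h2
  have h3 := Real.log_le_sub_one_of_pos hv0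
  have h4 : c ^ 2 * Real.log (v z) ≤ c ^ 2 * (v z - 1) := by gcongr
  have h5 : c ^ 2 / 2 * (v z ^ 2 - 1) ≤ s ^ 2 / 2 * (v z ^ 2 - 1) := by
    have h6 : s ^ 2 ≤ c ^ 2 := pow_le_pow_left₀ hs.le S.s_lt.le 2
    have h7 : v z ^ 2 - 1 ≤ 0 := by have := pow_le_one₀ (n := 2) hv0.le hv1; linarith
    exact mul_le_mul_of_nonpos_right (by linarith) h7
  have h8 : c ^ 2 / 2 * (1 - v z) ^ 2 = c ^ 2 / 2 * (v z ^ 2 - 1) - c ^ 2 * (v z - 1) := by ring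
  linarith

/-- The density overshoots at most by a multiple of `ε`. -/
lemma IsReducedProfile.overshoot_le (h : IsReducedProfile c s ε δ v v' φ φ') (S : SmallShock c s ε)
    (hδ : 0 < δ) {η M : ℝ} (hη : 0 ≤ η) (hM : 1 ≤ M * (1 - η)) (hM1 : 1 ≤ M)
    (hδM : δ * fieldConst c M ≤ 1 / 128) {w : ℝ} (hw : v w = 1 - η)
    (hv : ∀ z, 1 - η ≤ v z) : η ≤ 32 * c * ε := by
  by_contra hlt
  push Not at hlt
  have hε := S.hε
  have hε4 := S.hε4
  have hc := S.hc
  have hs := S.s_pos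
  have hsc := S.s_lt
  have hV := S.vol_plus
  have hεc : ε ≤ c * ε := le_mul_of_one_le_left hε.le hc
  have hvar : ∀ t ∈ Set.Icc w (w + 1), |v t - v w| ≤ 9 * c * ε := by
    intro t ht
    have h1 := h.vol_sub_le S hδ ht.1
    have : ε / 2 * (t - w) ≤ ε / 2 * 1 := by gcongr; linarith [ht.2]
    linarith
  have hvt : ∀ t ∈ Set.Icc w (w + 1), v t ≤ 1 - η / 2 := by
    intro t ht
    have := (abs_le.mp (hvar t ht)).2
    linarith
  set J : ℝ → ℝ := fun z => ε * s / 2 * v z ^ 2 + ε * δ * (φ' z * Real.exp (-φ z)) with hJ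
  -- On the unit interval to the right of the minimum, 1 - v is at least η / 2, so `J` drops by at
  -- least c² η² / 8 - `lyapPlus`. Yet `J` can change only by O(ε²) plus (η + ε)² / 32, the latter
  -- thanks to small δ; hence η cannot be large compared with ε.
  set K := lyapPlus c s - c ^ 2 / 8 * η ^ 2 with hK
  have hd : ∀ t ∈ Set.Icc w (w + 1), ∃ d, HasDerivAt (fun t => J t - K * t) d t ∧ d ≤ 0 := by
    intro t ht
    have h1 := hvt t ht
    obtain ⟨d, hd, hd'⟩ := h.momentum_deriv_le S hδ t (by linarith)
    refine ⟨d - K * 1, hd.sub ((hasDerivAt_id t).const_mul K), ?_⟩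
    have h2 : (η / 2) ^ 2 ≤ (1 - v t) ^ 2 := pow_le_pow_left₀ (by linarith) (by linarith) 2
    have h3 : c ^ 2 / 2 * (η / 2) ^ 2 ≤ c ^ 2 / 2 * (1 - v t) ^ 2 := by gcongr
    have h4 : c ^ 2 / 2 * (η / 2) ^ 2 = c ^ 2 / 8 * η ^ 2 := by ring
    linarith
  have hanti : AntitoneOn (fun t => J t - K * t) (Set.Icc w (w + 1)) := by
    apply antitoneOn_of_deriv_nonpos (convex_Icc w (w + 1))
    · intro t ht
      obtain ⟨d, hd, -⟩ := hd t ht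
      exact hd.continuousAt.continuousWithinAt
    · intro t ht
      obtain ⟨d, hd, -⟩ := hd t (interior_subset ht)
      exact hd.differentiableAt.differentiableWithinAt
    · intro t ht
      obtain ⟨d, hd, hd'⟩ := hd t (interior_subset ht)
      rw [hd.deriv]; exact hd'
  have h1 := hanti (Set.left_mem_Icc.mpr (by linarith)) (Set.right_mem_Icc.mpr (by linarith))
    (show w ≤ w + 1 by linarith)
  simp only [hJ] at h1
  have hv2 : ∀ z, v z ≤ 2 := fun z => (h.vol_le S hδ z).trans hV.2.2
  have hE : ∀ z, Real.exp (-φ z) ≤ 2 := by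
    intro z
    have h2 := h.potential_ge S hδ le_rfl (h.vol_le S hδ) z
    have h3 : Real.exp (-φ z) ≤ Real.exp (Real.log (c ^ 2 / s ^ 2)) :=
      Real.exp_le_exp.mpr (by linarith)
    rw [Real.exp_log (by linarith)] at h3
    linarith
  have hF : ∀ z, |ε * δ * (φ' z * Real.exp (-φ z))| ≤ 1 / 64 * (η + ε) ^ 2 := by
    intro z
    have h2 := h.field_bound S hδ hη hM hM1 hv z
    rw [abs_mul, abs_mul (φ' z), abs_of_pos (Real.exp_pos _), abs_of_pos (show 0 < ε * δ by positivity)]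
    calc ε * δ * (|φ' z| * Real.exp (-φ z)) ≤
        ε * δ * (fieldConst c M * (η + ε) ^ 2 / ε * 2) := by
          have := (abs_nonneg _).trans h2
          gcongr
          exact hE z
      _ = 2 * (δ * fieldConst c M) * (η + ε) ^ 2 := by field_simp
      _ ≤ 2 * (1 / 128) * (η + ε) ^ 2 := by gcongr
      _ = _ := by ring
  have h2 := abs_le.mp (hF (w + 1))
  have h3 := abs_le.mp (hF w)
  have h4 : |ε * s / 2 * v (w + 1) ^ 2 - ε * s / 2 * v w ^ 2| ≤ 18 * c ^ 2 * ε ^ 2 := by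
    have e1 : ε * s / 2 * v (w + 1) ^ 2 - ε * s / 2 * v w ^ 2 =
      ε * s / 2 * ((v (w + 1) - v w) * (v (w + 1) + v w)) := by ring
    have e2 : |v (w + 1) + v w| ≤ 4 := by
      rw [abs_of_pos (add_pos (h.pos _) (h.pos _))]; linarith [hv2 w, hv2 (w + 1)]
    rw [e1, abs_mul, abs_mul, abs_of_pos (show 0 < ε * s / 2 by positivity)]
    calc _ ≤ ε * c / 2 * (9 * c * ε * 4) := by
          gcongr; exact hvar _ (Set.right_mem_Icc.mpr (by linarith))
      _ = _ := by ring
  have h5 := abs_le.mp h4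
  have h6 := S.lyapPlus_le
  have h7 : 11 * c ^ 2 * ε ^ 3 ≤ 3 * (c ^ 2 * ε ^ 2) := by
    calc 11 * c ^ 2 * ε ^ 3 = 11 * c ^ 2 * ε ^ 2 * ε := by ring
      _ ≤ 11 * c ^ 2 * ε ^ 2 * (1 / 4) := by gcongr
      _ ≤ _ := by have : 0 ≤ c ^ 2 * ε ^ 2 := by positivity
                  linarith
  have h8 : (η + ε) ^ 2 ≤ 2 * η ^ 2 + 2 * ε ^ 2 := by nlinarith [sq_nonneg (η - ε)]
  have hc2 : 1 ≤ c ^ 2 := one_le_pow₀ hc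
  have h9 : ε ^ 2 ≤ c ^ 2 * ε ^ 2 := le_mul_of_one_le_left (by positivity) hc2
  have h10 : η ^ 2 ≤ c ^ 2 * η ^ 2 := le_mul_of_one_le_left (by positivity) hc2
  have h11 : c ^ 2 * η ^ 2 ≤ c ^ 2 * (32 * ε) ^ 2 := by
    have e1 : c ^ 2 * (32 * ε) ^ 2 = 1024 * (c ^ 2 * ε ^ 2) := by ring
    have : 0 ≤ c ^ 2 * ε ^ 2 := by positivity
    rw [e1]
    linarith
  have h12 : (32 * ε) ^ 2 < η ^ 2 := pow_lt_pow_left₀ (by linarith) (by linarith) (by norm_num)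
  have : c ^ 2 * (32 * ε) ^ 2 < c ^ 2 * η ^ 2 := by gcongr
  linarith

/-- Bootstrap: the crude lower bound fixes the constants M and F, and with them the admissible δ.
The overshoot estimate then gives η = O(ε), and the energy and field bounds with η + ε = O(ε)
conclude. -/
lemma exists_shock_apriori {c : ℝ} (hc : 1 ≤ c) : ∃ ε₁ > 0, ∃ δ₁ > 0, ∃ C > 0,
    ∀ s ε δ v v' φ φ', SmallShock c s ε → ε ≤ ε₁ → 0 < δ → δ ≤ δ₁ →
    IsReducedProfile c s ε δ v v' φ φ' → ∀ z, |1 - v z| ≤ C * ε ∧ |φ' z| ≤ C * ε := by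
  set N := crudeBound c with hN
  have hN6 : 6 ≤ N := crudeBound_ge c
  set M := 2 * N with hM
  have hM1 : 1 ≤ M := by linarith
  set F := fieldConst c M with hF
  have hF0 : 0 < F := by rw [hF]; unfold fieldConst energyConst; positivity
  refine ⟨1 / (2 * N) / (9 * c), by positivity, min 1 (1 / (128 * F)), by positivity,
    132 * c + F * (33 * c) ^ 2, by positivity, ?_⟩
  intro s ε δ v v' φ φ' S hε₁ hδ hδ₁ h
  have hε := S.hε
  have hsm : 9 * c * ε ≤ 1 / (2 * N) := by
    rw [le_div_iff₀ (by positivity)] at hε₁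
    linarith
  have hδ1 : δ ≤ 1 := hδ₁.trans (min_le_left _ _)
  have hδF : δ * F ≤ 1 / 128 := by
    have := hδ₁.trans (min_le_right _ _)
    rw [le_div_iff₀ (by positivity)] at this
    linarith
  have hεδ : ε * δ ≤ 1 := mul_le_one₀ (by linarith [S.hε4]) hδ.le hδ1
  have hlow := h.vol_ge_crude S hδ hεδ hsm
  have key : ∃ η, 0 ≤ η ∧ η ≤ 32 * c * ε ∧ 1 ≤ M * (1 - η) ∧ ∀ z, 1 - η ≤ v z := by
    by_cases hall : ∀ z, 1 ≤ v z
    · exact ⟨0, le_rfl, by positivity, by simpa using hM1, by simpa using hall⟩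
    · push Not at hall
      obtain ⟨z, hz⟩ := hall
      have hV := S.vol_plus
      have hcv : Continuous v := continuous_iff_continuousAt.mpr fun z => (h.hv z).continuousAt
      obtain ⟨w, hw⟩ := exists_min_of_limits (w := z) hcv h.left_v h.right_v hz (by linarith)
      have hη : 0 ≤ 1 - v w := by linarith [hw z]
      have e1 : 1 - (1 - v w) = v w := by ring
      have hMw : 1 ≤ M * (1 - (1 - v w)) := by
        rw [e1]
        have := hlow w
        rw [div_le_iff₀ (by positivity)] at this
        linarith
      have hvw : ∀ z, 1 - (1 - v w) ≤ v z := by rw [e1]; exact hw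
      exact ⟨1 - v w, hη, h.overshoot_le S hδ hη hMw hM1 hδF e1.symm hvw, hMw, hvw⟩
  obtain ⟨η, hη, hηε, hMη, hv⟩ := key
  intro z
  have hεc : ε ≤ c * ε := le_mul_of_one_le_left hε.le hc
  have hκ : η + ε ≤ 33 * c * ε := by linarith
  constructor
  · refine (h.energy_bound S hδ hη hMη hM1 hv z).1.trans ?_
    have : 0 ≤ F * (33 * c) ^ 2 * ε := by positivity
    have e1 : (132 * c + F * (33 * c) ^ 2) * ε = 4 * (33 * c * ε) + F * (33 * c) ^ 2 * ε := by ring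
    linarith
  · refine (h.field_bound S hδ hη hMη hM1 hv z).trans ?_
    rw [div_le_iff₀ hε]
    calc F * (η + ε) ^ 2 ≤ F * (33 * c * ε) ^ 2 := by gcongr
      _ = F * (33 * c) ^ 2 * ε * ε := by ring
      _ ≤ (132 * c + F * (33 * c) ^ 2) * ε * ε := by gcongr; linarith

end

end IonShock

namespace IonShock

/-! ### Uniqueness of shock profiles -/

/-- Bounds on `g` and `y` control `x`. -/
lemma IsFrontSys.x_bound {B : ℝ} (hB : 1 ≤ B) : ∃ M₁ > 0, ∃ X, ∀ k e σ τ K₀ g x y,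
    IsFrontSys k e σ τ g x y → |k| ≤ 3 → 0 < e → e ≤ M₁ → 0 ≤ σ → σ ≤ M₁ → 0 ≤ τ → τ ≤ M₁ →
    (∀ z, |g z| ≤ B) → (∀ z, |y z| ≤ B) → (∀ z, |x z| ≤ K₀) → ∀ z, |x z| ≤ X := by
  set P := 3 * B * (1 + B) with hP
  set Q := 2 * B + B ^ 2 + B with hQ
  set R := B * P + (1 + B) ^ 2 * B ^ 2 + B ^ 2 with hR
  have hP0 : 0 < P := by positivity
  have hQ0 : 0 < Q := by positivity
  have hR0 : 0 < R := by positivity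
  refine ⟨min 1 (1 / (12 * Q)), by positivity, 2 * (6 * (P + R)), ?_⟩
  intro k e σ τ K₀ g x y h hk he heM hσ hσM hτ hτM hg hy hx z
  have he1 : e ≤ 1 := heM.trans (min_le_left _ _)
  have hσ1 : σ ≤ 1 := hσM.trans (min_le_left _ _)
  have hτ1 : τ ≤ 1 := hτM.trans (min_le_left _ _)
  have hσQ : σ * Q ≤ 1 / 12 := by
    have := hσM.trans (min_le_right _ _)
    rw [le_div_iff₀ (by positivity)] at this
    linarith
  have hq : ∀ z, |k * g z * (1 - g z)| ≤ P := by
    intro z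
    have h1 : |1 - g z| ≤ 1 + B := by
      have := abs_sub 1 (g z); rw [abs_one] at this; linarith [hg z]
    rw [abs_mul, abs_mul]
    calc |k| * |g z| * |1 - g z| ≤ 3 * B * (1 + B) := by gcongr; exact hg z
      _ = _ := rfl
  have hG : ∀ K, 0 ≤ K → (∀ z, |x z| ≤ K) → ∀ z,
      |k * g z * (1 - g z) + σ * fastPert k e σ τ (g z) (x z) (y z)| ≤ (P + R) + K / 12 := by
    intro K hK hxK z
    have e1 : fastPert k e σ τ (g z) (x z) (y z) = -(g z * (k * g z * (1 - g z))) +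
        (-2 * g z + σ * g z ^ 2 + τ * y z) * x z + (1 - σ * g z) ^ 2 * (e / 2) * y z ^ 2 +
        g z * y z := by unfold fastPert slowPert; ring
    have hB0 : 0 ≤ B := by linarith
    have t1 : |(-(g z * (k * g z * (1 - g z))))| ≤ B * P := by
      rw [abs_neg, abs_mul]; gcongr; exacts [hg z, hq z]
    have t2 : |(-2 * g z + σ * g z ^ 2 + τ * y z) * x z| ≤ Q * K := by
      rw [abs_mul]
      have : |(-2 * g z + σ * g z ^ 2 + τ * y z)| ≤ Q := by
        have a1 := abs_add_le (-2 * g z + σ * g z ^ 2) (τ * y z)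
        have a2 := abs_add_le (-2 * g z) (σ * g z ^ 2)
        have a3 : |(-2 * g z)| ≤ 2 * B := by
          rw [abs_mul, abs_neg, abs_two]; gcongr; exact hg z
        have a4 : |σ * g z ^ 2| ≤ 1 * B ^ 2 := by
          rw [abs_mul, abs_of_nonneg hσ, abs_pow]; gcongr; exact hg z
        have a5 : |τ * y z| ≤ 1 * B := by
          rw [abs_mul, abs_of_nonneg hτ]; gcongr; exact hy z
        rw [hQ]; linarith
      gcongr
      exact hxK z
    have t3 : |(1 - σ * g z) ^ 2 * (e / 2) * y z ^ 2| ≤ (1 + B) ^ 2 * B ^ 2 := by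
      have a1 : |1 - σ * g z| ≤ 1 + B := by
        have a2 := abs_sub 1 (σ * g z)
        have a4 : |σ * g z| ≤ 1 * B := by
          rw [abs_mul, abs_of_nonneg hσ]; gcongr; exact hg z
        rw [abs_one] at a2; linarith
      rw [abs_mul, abs_mul, abs_pow, abs_pow, abs_of_pos (show 0 < e / 2 by positivity)]
      calc |1 - σ * g z| ^ 2 * (e / 2) * |y z| ^ 2 ≤ (1 + B) ^ 2 * 1 * B ^ 2 := by
            gcongr
            · linarith
            · exact hy z
        _ = _ := by ring
    have t4 : |g z * y z| ≤ B ^ 2 := by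
      rw [abs_mul, sq]; gcongr; exacts [hg z, hy z]
    have t5 : |fastPert k e σ τ (g z) (x z) (y z)| ≤ R + Q * K := by
      rw [e1]
      refine (abs_add_le _ _).trans ?_
      have a1 := abs_add_le (-(g z * (k * g z * (1 - g z))) +
        (-2 * g z + σ * g z ^ 2 + τ * y z) * x z) ((1 - σ * g z) ^ 2 * (e / 2) * y z ^ 2)
      have a2 := abs_add_le (-(g z * (k * g z * (1 - g z))))
        ((-2 * g z + σ * g z ^ 2 + τ * y z) * x z)
      rw [hR]
      linarith
    refine (abs_add_le _ _).trans ?_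
    rw [abs_mul σ, abs_of_nonneg hσ]
    have t6 : σ * |fastPert k e σ τ (g z) (x z) (y z)| ≤ R + 1 / 12 * K := by
      calc _ ≤ σ * (R + Q * K) := by gcongr
        _ = σ * R + σ * Q * K := by ring
        _ ≤ 1 * R + 1 / 12 * K := by gcongr
        _ = _ := by ring
    linarith [hq z]
  have hx' := h.hx
  -- Only finiteness of x is assumed through `K₀`. For a shock profile x carries the factor 1 / (σ ε
  -- s), so a uniform bound is not available beforehand; absorption forgets `K₀`.
  have := absorb (w := fun _ => 1) (f := x) (C := 6 * (P + R)) (K₀ := K₀) (fun _ => one_pos)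
    (by simpa using hx) (fun K hK hxK z => by
      have h1 := (fast_bound (a := 0) (M := 1) (K := P + R + K / 12) (Ky := B) (Kx := K) he hτ he1 hτ1
        (by norm_num) h.hy h.hx (by simpa [ew_zero] using hy) (by simpa [ew_zero] using hxK)
        (by simpa [ew_zero] using hG K hK (by simpa using hxK)) z).2
      rw [ew_zero] at h1
      linarith) z
  linarith

/-- A shock profile solves the front system. -/
lemma IsReducedProfile.toFrontSys {c s ε δ σ k : ℝ} {v v' φ φ' : ℝ → ℝ}
    (h : IsReducedProfile c s ε δ v v' φ φ') (hε : 0 < ε) (hδ : 0 < δ) (hs : 0 < s)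
    (hσ : 0 < σ) (hσ1 : c ^ 2 * (1 - σ) = s ^ 2) (hk : k * (ε * s) = c ^ 2 * σ) :
    IsFrontSys k (δ / s) σ (ε * s) (fun z => (1 - 1 / v z) / σ)
      (fun z => (1 / v z - Real.exp (φ z)) / (σ * (ε * s))) (fun z => -φ' z / σ) := by
  have dn : ∀ z, HasDerivAt (fun z => 1 / v z) (-v' z / v z ^ 2) z := fun z => by
    simp only [one_div]; exact (h.hv z).fun_inv (h.pos z).ne'
  have dg : ∀ z, HasDerivAt (fun z => (1 - 1 / v z) / σ) (v' z / v z ^ 2 / σ) z := fun z =>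
    (((dn z).const_sub 1).div_const σ).congr_deriv (by ring)
  have hg' : ∀ z, v' z / v z ^ 2 / σ = k * ((1 - 1 / v z) / σ) * (1 - (1 - 1 / v z) / σ) +
      (1 / v z - Real.exp (φ z)) / (σ * (ε * s)) + σ * slowPert k (δ / s) σ ((1 - 1 / v z) / σ)
      ((1 / v z - Real.exp (φ z)) / (σ * (ε * s))) (-φ' z / σ) := by
    intro z
    have h0 := h.pos z
    have h1 := h.eqn z
    have h2 : v' z = (s ^ 2 * (1 - v z) - (c ^ 2 - 1) * (1 / v z - 1) -
      (Real.exp (φ z) - 1) + ε * δ / 2 * φ' z ^ 2) / (ε * s) := by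
      rw [eq_div_iff (by positivity)]; linarith
    have hk' : k = c ^ 2 * σ / (ε * s) := by rw [eq_div_iff (by positivity)]; exact hk
    rw [h2, hk', ← hσ1]
    unfold slowPert
    field_simp
    ring
  refine ⟨fun z => (dg z).congr_deriv (hg' z), fun z => ?_, fun z => ?_⟩
  · refine ((h.hφ' z).fun_neg.div_const σ).congr_deriv ?_
    field_simp
    ring
  · have e1 : (fun z => ε * s * ((1 / v z - Real.exp (φ z)) / (σ * (ε * s)))) =
        fun z => (1 / v z - Real.exp (φ z)) / σ := by ext z; field_simp
    rw [e1]
    refine (((dn z).fun_sub (h.hφ z).exp).div_const σ).congr_deriv ?_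
    have h1 := hg' z
    unfold fastPert
    set S := slowPert k (δ / s) σ ((1 - 1 / v z) / σ)
      ((1 / v z - Real.exp (φ z)) / (σ * (ε * s))) (-φ' z / σ)
    set X := (1 / v z - Real.exp (φ z)) / (σ * (ε * s)) with hX
    have e2 : ε * s * X = (1 / v z - Real.exp (φ z)) / σ := by rw [hX]; field_simp
    rw [e2]
    have e3 : -φ' z / σ - X - (k * ((1 - 1 / v z) / σ) * (1 - (1 - 1 / v z) / σ) + σ *
        (S + ((1 - 1 / v z) / σ + (1 / v z - Real.exp (φ z)) / σ) * (-φ' z / σ))) =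
        -φ' z / σ - (k * ((1 - 1 / v z) / σ) * (1 - (1 - 1 / v z) / σ) + X + σ * S) -
        σ * ((1 - 1 / v z) / σ + (1 / v z - Real.exp (φ z)) / σ) * (-φ' z / σ) := by ring
    rw [e3, ← h1]
    field_simp
    ring

end IonShock

namespace IonShock

/-! ### Parameter bounds -/

section
variable {T ε : ℝ}

lemma smallShock (hT : 0 ≤ T) (hε : 0 < ε) (hε4 : ε ≤ 1 / 4) :
    SmallShock (soundSpeed T) (shockSpeed T ε) ε :=
  ⟨one_le_soundSpeed hT, hε, hε4, rfl⟩

lemma slope_bounds (hT : 0 ≤ T) (hε : 0 < ε) (hε4 : ε ≤ 1 / 4) : 2 ≤ slope T ε ∧ slope T ε ≤ 3 := by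
  have S := smallShock hT hε hε4
  have hs := S.s_pos
  have hc := S.hc
  have h1 := slope_mul hs.ne'
  have h2 := S.hs
  unfold slope
  rw [le_div_iff₀ hs, div_le_iff₀ hs]
  constructor <;> linarith

lemma amp_bounds (hT : 0 ≤ T) (hε : 0 < ε) (hε4 : ε ≤ 1 / 4) :
    1 / soundSpeed T ≤ amp T ε ∧ amp T ε ≤ 2 / soundSpeed T := by
  have hc := one_le_soundSpeed hT
  have h1 := soundSpeed_sq hT
  unfold amp
  rw [← h1, div_le_div_iff₀ (by positivity) (by positivity),
    div_le_div_iff₀ (by positivity) (by positivity)]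
  constructor
  · have : soundSpeed T * ε ≤ soundSpeed T * (1 / 4) := by gcongr
    nlinarith
  · have : 0 ≤ soundSpeed T * ε := by positivity
    nlinarith

lemma strength_pos (hT : 0 ≤ T) (hε : 0 < ε) (hε4 : ε ≤ 1 / 4) : 0 < strength T ε := by
  have h1 := (amp_bounds hT hε hε4).1
  have hc := one_le_soundSpeed hT
  have : 0 < 1 / soundSpeed T := by positivity
  exact mul_pos hε (by linarith)

lemma strength_le (hT : 0 ≤ T) (hε : 0 < ε) (hε4 : ε ≤ 1 / 4) : strength T ε ≤ 2 * ε := by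
  have h1 := (amp_bounds hT hε hε4).2
  have hc := one_le_soundSpeed hT
  have : 2 / soundSpeed T ≤ 2 := by rw [div_le_iff₀ (by positivity)]; linarith
  unfold strength
  nlinarith

lemma amp_pos (hT : 0 ≤ T) (hε : 0 < ε) (hε4 : ε ≤ 1 / 4) : 0 < amp T ε := by
  have h1 := (amp_bounds hT hε hε4).1
  have hc := one_le_soundSpeed hT
  have : 0 < 1 / soundSpeed T := by positivity
  linarith

end

/-- Weak shock profiles are determined by their density at the origin. -/
lemma shock_unique {T : ℝ} (hT : 0 ≤ T) : ∃ ε₂ > 0, ∃ δ₂ > 0, ∀ ε δ p p', 0 < ε → ε ≤ ε₂ →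
    0 < δ → δ ≤ δ₂ → IsShockProfile T ε δ p → IsShockProfile T ε δ p' → p.n 0 = p'.n 0 →
    p = p' := by
  have hc := one_le_soundSpeed hT
  set c := soundSpeed T with hc'
  obtain ⟨ε₁, hε₁, δ₁, hδ₁, C, hC, hap⟩ := exists_shock_apriori hc
  set B := max 1 (2 * C * c) with hB
  obtain ⟨M₁, hM₁, X, hX⟩ := IsFrontSys.x_bound (B := B) (le_max_left _ _)
  obtain ⟨M₂, hM₂, huniq⟩ := front_unique (K := max (max B X) 3)
    (((le_max_left _ _).trans (le_max_left _ _)).trans (le_max_left _ _))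
  set M := min M₁ M₂ with hM
  have hM0 : 0 < M := by positivity
  refine ⟨min (min ε₁ (1 / 4)) (min (1 / (2 * C)) (min (M / 2) (M / c))), by positivity,
    min δ₁ (M / 2), by positivity, ?_⟩
  intro ε δ p p' hε hεm hδ hδm hp hp' h0
  have hε₁' : ε ≤ ε₁ := hεm.trans ((min_le_left _ _).trans (min_le_left _ _))
  have hε4 : ε ≤ 1 / 4 := hεm.trans ((min_le_left _ _).trans (min_le_right _ _))
  have hεC : ε ≤ 1 / (2 * C) := hεm.trans ((min_le_right _ _).trans (min_le_left _ _))
  have hεM : ε ≤ M / 2 := hεm.trans ((min_le_right _ _).trans ((min_le_right _ _).trans (min_le_left _ _)))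
  have hεMc : ε ≤ M / c := hεm.trans ((min_le_right _ _).trans ((min_le_right _ _).trans (min_le_right _ _)))
  have hδ₁' : δ ≤ δ₁ := hδm.trans (min_le_left _ _)
  have hδM : δ ≤ M / 2 := hδm.trans (min_le_right _ _)
  have S := smallShock hT hε hε4
  have hs := S.s_pos
  have hsc := S.s_lt
  have hsg := S.s_ge
  have hσ := strength_pos hT hε hε4
  have hσM : strength T ε ≤ M := by linarith [strength_le hT hε hε4]
  have hσε : ε ≤ c * strength T ε := by
    have h1 := (amp_bounds hT hε hε4).1
    rw [div_le_iff₀ (by positivity)] at h1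
    unfold strength
    nlinarith
  have hk := slope_bounds hT hε hε4
  have hτ : 0 < ε * shockSpeed T ε := by positivity
  have hτM : ε * shockSpeed T ε ≤ M := by
    calc ε * shockSpeed T ε ≤ M / c * c := by gcongr
      _ = M := by field_simp
  have heM : δ / shockSpeed T ε ≤ M := by
    rw [div_le_iff₀ hs]
    have : M * (1 / 2) ≤ M * shockSpeed T ε := by gcongr; linarith
    linarith
  have he : 0 < δ / shockSpeed T ε := by positivity
  have hCε : C * ε ≤ 1 / 2 := by
    rw [le_div_iff₀ (by positivity)] at hεC; linarith
  have key : ∀ q, IsShockProfile T ε δ q → (∀ z, q.u z = shockSpeed T ε * (1 - 1 / q.n z)) ∧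
      ∃ g x y, IsFrontSys (slope T ε) (δ / shockSpeed T ε) (strength T ε) (ε * shockSpeed T ε) g x y ∧
      (∀ z, |g z| ≤ max (max B X) 3) ∧ (∀ z, |x z| ≤ max (max B X) 3) ∧
      (∀ z, |y z| ≤ max (max B X) 3) ∧ (∀ z, g z = (1 - q.n z) / strength T ε) ∧
      (∀ z, x z = (q.n z - Real.exp (q.φ z)) / (strength T ε * (ε * shockSpeed T ε))) := by
    intro q hq
    obtain ⟨hu, hred⟩ := hq.reduce hT hε hδ hs
    refine ⟨hu, _, _, _, hred.toFrontSys hε hδ hs hσ (k := slope T ε) ?_ ?_, ?_⟩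
    · rw [one_sub_strength hT, nPlus, soundSpeed_sq hT]
      have : T + 1 ≠ 0 := by linarith
      field_simp
    · rw [soundSpeed_sq hT, mul_comm (T + 1), strength_mul hT, ← slope_mul hs.ne']; ring
    have ha := hap _ _ _ _ _ _ _ S hε₁' hδ hδ₁' hred
    have hn : ∀ z, |(1 - 1 / (1 / q.n z)) / strength T ε| ≤ B := by
      intro z
      have h1 := (ha z).1
      have h2 := hq.density_pos z
      have h3 : 1 / 2 ≤ 1 / q.n z := by linarith [(abs_le.mp (h1.trans hCε)).2]
      have h4 : q.n z ≤ 2 := by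
        rw [div_le_div_iff₀ (by norm_num) h2] at h3; linarith
      have e1 : 1 - 1 / (1 / q.n z) = -(q.n z * (1 - 1 / q.n z)) := by field_simp; ring
      rw [abs_div, e1, abs_neg, abs_mul, abs_of_pos h2, abs_of_pos hσ, div_le_iff₀ hσ]
      calc q.n z * |1 - 1 / q.n z| ≤ 2 * (C * ε) := by gcongr
        _ ≤ 2 * (C * (c * strength T ε)) := by gcongr
        _ = 2 * C * c * strength T ε := by ring
        _ ≤ _ := by gcongr; exact le_max_right _ _
    have hy : ∀ z, |(-deriv q.φ z / strength T ε)| ≤ B := by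
      intro z
      rw [abs_div, abs_neg, abs_of_pos hσ, div_le_iff₀ hσ]
      calc |deriv q.φ z| ≤ C * ε := (ha z).2
        _ ≤ C * (c * strength T ε) := by gcongr
        _ ≤ 2 * C * c * strength T ε := by
          have : 0 ≤ C * c * strength T ε := by positivity
          linarith
        _ ≤ _ := by gcongr; exact le_max_right _ _
    have hnp : 0 < nPlus T ε := by
      have : 0 < T + 1 := by linarith
      unfold nPlus; positivity
    -- Continuity and the limits at ± ∞ give some bound for x, which the next step makes uniform.
    obtain ⟨K₀, hK₀⟩ := exists_bound_of_limits
      (f := fun z => (1 / (1 / q.n z) - Real.exp (q.φ z)) / (strength T ε * (ε * shockSpeed T ε)))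
      (l := 0) (r := 0) (by
        simp only [one_div_one_div]
        exact ((hq.smooth_n.continuous).sub
          (Real.continuous_exp.comp hq.smooth_φ.continuous)).div_const _) (by
        simp only [one_div_one_div]
        have := (hq.left_n.sub ((Real.continuous_exp.tendsto _).comp hq.left_φ)).div_const
          (strength T ε * (ε * shockSpeed T ε))
        simpa using this) (by
        simp only [one_div_one_div]
        have := (hq.right_n.sub ((Real.continuous_exp.tendsto _).comp hq.right_φ)).div_const
          (strength T ε * (ε * shockSpeed T ε))
        rw [phiPlus, Real.exp_log hnp, sub_self, zero_div] at this
        exact this)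
    have hx := hX _ _ _ _ K₀ _ _ _ (hred.toFrontSys hε hδ hs hσ (k := slope T ε) (by
        rw [one_sub_strength hT, nPlus, soundSpeed_sq hT]
        have : T + 1 ≠ 0 := by linarith
        field_simp) (by
        rw [soundSpeed_sq hT, mul_comm (T + 1), strength_mul hT, ← slope_mul hs.ne']; ring))
      (by rw [abs_of_nonneg (by linarith)]; exact hk.2) he (heM.trans (min_le_left _ _))
      hσ.le (hσM.trans (min_le_left _ _)) hτ.le (hτM.trans (min_le_left _ _)) hn hy hK₀
    refine ⟨fun z => (hn z).trans ((le_max_left _ _).trans (le_max_left _ _)),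
      fun z => (hx z).trans ((le_max_right _ _).trans (le_max_left _ _)),
      fun z => (hy z).trans ((le_max_left _ _).trans (le_max_left _ _)), fun z => ?_, fun z => ?_⟩
    · simp
    · simp
  obtain ⟨hu, g, x, y, hsys, hg, hx, hy, eg, ex⟩ := key p hp
  obtain ⟨hu', g', x', y', hsys', hg', hx', hy', eg', ex'⟩ := key p' hp'
  have H := huniq (slope T ε) _ _ _ (by
      rw [abs_of_nonneg (by linarith)]; exact hk.2.trans (le_max_right _ _)) he
    (heM.trans (min_le_right _ _)) hσ.le (hσM.trans (min_le_right _ _)) hτ.le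
    (hτM.trans (min_le_right _ _)) _ _ _ _ _ _ hsys hsys' hg hx hy hg' hx' hy'
    (by rw [eg, eg', h0])
  have en : ∀ z, p.n z = p'.n z := by
    intro z
    have h1 := (H z).1
    rw [eg, eg', div_left_inj' hσ.ne'] at h1
    linarith
  ext z
  · exact en z
  · rw [hu, hu', en]
  · have h1 := (H z).2.1
    rw [ex, ex', div_left_inj' (by positivity), en] at h1
    exact Real.exp_injective (by linarith)

end IonShock

namespace IonShock

/-! ### The family of all fronts and its differences -/

/-- The parameters of normalised fronts in a fixed range. -/
structure FrontIdx (a₁ μ₀ M : ℝ) where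
  k : ℝ
  e : ℝ
  σ : ℝ
  τ : ℝ
  μ : ℝ
  le_k : a₁ ≤ k
  k_le : k ≤ 3
  e_pos : 0 < e
  e_le : e ≤ M
  σ_nonneg : 0 ≤ σ
  σ_le : σ ≤ M
  τ_nonneg : 0 ≤ τ
  τ_le : τ ≤ M
  pos_or : 0 < τ ∨ (τ = 0 ∧ σ = 0)
  le_μ : μ₀ ≤ μ
  μ_le : μ ≤ 1 - μ₀

/-- Enlarging the range. -/
def FrontIdx.widen {a₁ μ₀ M M' : ℝ} (h : M ≤ M') (i : FrontIdx a₁ μ₀ M) : FrontIdx a₁ μ₀ M' :=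
  { i with e_le := i.e_le.trans h, σ_le := i.σ_le.trans h, τ_le := i.τ_le.trans h }

/-- A family of fronts with uniformly decaying derivatives. -/
structure FrontFamily {ι : Type*} (a : ℝ) (k e σ τ μ : ι → ℝ) (g x y : ι → ℝ → ℝ) : Prop where
  sys : ∀ i, IsFrontSys (k i) (e i) (σ i) (τ i) (g i) (x i) (y i)
  init : ∀ i, g i 0 = μ i
  dec_x : ∀ n, Dec a n x
  dec_y : ∀ n, Dec a n y
  dec_deriv : ∀ n, Dec a n fun i => deriv (g i)
  dec_g : ∀ n, Dec 0 n g
  dec_prod : ∀ n, Dec a n fun i z => k i * g i z * (1 - g i z)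
  tails : ∃ B, 0 ≤ B ∧ ∀ i z, (0 ≤ z → |1 - g i z| ≤ B * ew a z) ∧ (z ≤ 0 → |g i z| ≤ B * ew a z)
  le : ∀ i z, |g i z| ≤ 3 / 2
  small : ∀ i z, |σ i * τ i * x i z| ≤ 1 / 4

lemma FrontFamily.reindex {ι κ : Type*} {a : ℝ} {k e σ τ μ : ι → ℝ} {g x y : ι → ℝ → ℝ}
    (h : FrontFamily a k e σ τ μ g x y) (r : κ → ι) :
    FrontFamily a (fun i => k (r i)) (fun i => e (r i)) (fun i => σ (r i)) (fun i => τ (r i))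
      (fun i => μ (r i)) (fun i => g (r i)) (fun i => x (r i)) (fun i => y (r i)) where
  sys i := h.sys _
  init i := h.init _
  dec_x n := (h.dec_x n).reindex r
  dec_y n := (h.dec_y n).reindex r
  dec_deriv n := (h.dec_deriv n).reindex r
  dec_g n := (h.dec_g n).reindex r
  dec_prod n := (h.dec_prod n).reindex r
  tails := by
    obtain ⟨B, hB, H⟩ := h.tails
    exact ⟨B, hB, fun i z => H _ z⟩
  le i z := h.le _ z
  small i z := h.small _ z

section
variable {a a₁ μ₀ : ℝ}

/-- Fronts are chosen for all admissible parameters at once, so uniformity in the parameters becomes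
membership in `Dec` over the index type. The range M is shrunk until the coefficients of the
differentiated fast system stay below the 1/24 required by `front_dec`. -/
lemma exists_frontFamily (ha : 0 < a) (haa : a < a₁) (hμ₀ : 0 < μ₀) : ∃ M > 0,
    ∃ g x y : FrontIdx a₁ μ₀ M → ℝ → ℝ,
      FrontFamily a FrontIdx.k FrontIdx.e FrontIdx.σ FrontIdx.τ FrontIdx.μ g x y := by
  obtain ⟨M₀, hM₀, C, hC⟩ := exists_front ha haa hμ₀
  set C' := |C| + 1 with hC'
  have hC'0 : 0 < C' := by positivity
  have hCC : C ≤ C' := by linarith [le_abs_self C]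
  set M := min (min M₀ 1) (min (1 / (4 * a)) (1 / (24 * (8 + 8 * C')))) with hM
  have hMM₀ : M ≤ M₀ := (min_le_left _ _).trans (min_le_left _ _)
  have hM1 : M ≤ 1 := (min_le_left _ _).trans (min_le_right _ _)
  have hMa : M ≤ 1 / (4 * a) := (min_le_right _ _).trans (min_le_left _ _)
  have hMC : M ≤ 1 / (24 * (8 + 8 * C')) := (min_le_right _ _).trans (min_le_right _ _)
  have hM0 : 0 < M := by positivity
  rw [le_div_iff₀ (by positivity)] at hMa hMC
  have H : ∀ i : FrontIdx a₁ μ₀ M, _ := fun i => hC i.k i.e i.σ i.τ i.μ i.le_k i.k_le i.e_pos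
    (i.e_le.trans hMM₀) i.σ_nonneg (i.σ_le.trans hMM₀) i.τ_nonneg (i.τ_le.trans hMM₀) i.le_μ i.μ_le
  choose g x y hsys h0 hcx hb using H
  have hg : ∀ i z, |g i z| ≤ 3 / 2 := fun i z => (hb i z).2.2.2
  have hx : ∀ i z, |x i z| ≤ C' * ew a z := fun i z =>
    (hb i z).2.1.trans (mul_le_mul_of_nonneg_right hCC (ew_pos _ _).le)
  have hy : ∀ i z, |y i z| ≤ C' * ew a z := fun i z =>
    (hb i z).2.2.1.trans (mul_le_mul_of_nonneg_right hCC (ew_pos _ _).le)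
  have hd : ∀ i z, |g i z - logistic i.k i.μ z| ≤ C' * ew a z := fun i z =>
    (hb i z).1.trans (mul_le_mul_of_nonneg_right hCC (ew_pos _ _).le)
  have hx' : ∀ i z, |x i z| ≤ C' := fun i z => (hx i z).trans
    (mul_le_of_le_one_right hC'0.le (ew_le_one ha.le z))
  have hy' : ∀ i z, |y i z| ≤ C' := fun i z => (hy i z).trans
    (mul_le_of_le_one_right hC'0.le (ew_le_one ha.le z))
  have hμ1 : ∀ i : FrontIdx a₁ μ₀ M, i.μ < 1 := fun i => by linarith [i.μ_le]
  have hμ0 : ∀ i : FrontIdx a₁ μ₀ M, 0 < i.μ := fun i => by linarith [i.le_μ]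
  have tails : ∀ i z, (0 ≤ z → |1 - g i z| ≤ (1 / μ₀ + C') * ew a z) ∧
      (z ≤ 0 → |g i z| ≤ (1 / μ₀ + C') * ew a z) := by
    intro i z
    have h1 := abs_le.mp (hd i z)
    have hak : a ≤ i.k := haa.le.trans i.le_k
    have h3 := logistic_pos (k := i.k) (hμ0 i) (hμ1 i) z
    have h4 := logistic_lt_one (k := i.k) (hμ0 i) (hμ1 i) z
    have hE := (ew_pos a z)
    have : 0 ≤ 1 / μ₀ * ew a z := by positivity
    constructor
    · intro hz
      have h2 := one_sub_logistic_le hμ₀ i.le_μ (hμ1 i) hak hz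
      rw [abs_le, add_mul]; constructor <;> linarith [h1.1, h1.2]
    · intro hz
      have h2 := logistic_le hμ₀ (hμ0 i) i.μ_le hak hz
      rw [abs_le, add_mul]; constructor <;> linarith [h1.1, h1.2]
  have hB0 : 0 ≤ 1 / μ₀ + C' := by positivity
  have hbd : ∀ f : FrontIdx a₁ μ₀ M → ℝ, (∀ i, 0 ≤ f i) → (∀ i, f i ≤ 3) → Bd f :=
    fun f h0 h1 => ⟨3, fun i => by rw [abs_of_nonneg (h0 i)]; exact h1 i⟩
  have hk0 : ∀ i : FrontIdx a₁ μ₀ M, 0 ≤ i.k := fun i => by linarith [i.le_k]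
  have hsm : ∀ i, _ := fun i => (hsys i).smooth i.pos_or
  have hq : Dec a 0 (fun i z => i.k * g i z * (1 - g i z)) := by
    refine dec_zero (C := 3 * ((1 / μ₀ + C') * (5 / 2))) (fun i =>
      (contDiff_const.mul (hsm i).1).mul (contDiff_const.sub (hsm i).1)) fun i z => ?_
    have h1 := hg i z
    have h2 : |1 - g i z| ≤ 5 / 2 := by
      have := abs_sub 1 (g i z); rw [abs_one] at this; linarith
    have hE := (ew_pos a z).le
    have key : |g i z| * |1 - g i z| ≤ (1 / μ₀ + C') * (5 / 2) * ew a z := by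
      rcases le_total 0 z with hz | hz
      · calc |g i z| * |1 - g i z| ≤ (5 / 2) * ((1 / μ₀ + C') * ew a z) := by
              gcongr
              · linarith
              · exact (tails i z).1 hz
          _ = _ := by ring
      · calc |g i z| * |1 - g i z| ≤ ((1 / μ₀ + C') * ew a z) * (5 / 2) := by
              gcongr
              exact (tails i z).2 hz
          _ = _ := by ring
    rw [abs_mul, abs_mul, abs_of_nonneg (hk0 i), mul_assoc, mul_assoc]
    calc i.k * (|g i z| * |1 - g i z|) ≤ 3 * ((1 / μ₀ + C') * (5 / 2) * ew a z) := by
          gcongr; exact i.k_le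
      _ = _ := by ring
  have hσg : ∀ i z, |i.σ * g i z| ≤ M * (3 / 2) := fun i z => by
    rw [abs_mul, abs_of_nonneg i.σ_nonneg]
    exact mul_le_mul i.σ_le (hg i z) (abs_nonneg _) hM0.le
  have hMC24 : M * (8 + 8 * C') ≤ 1 / 24 := by linarith
  have hM8 : M * 8 ≤ 1 := by nlinarith
  have hστx : ∀ i z, |i.σ * i.τ * x i z| ≤ M * C' := fun i z => by
    rw [abs_mul, abs_mul, abs_of_nonneg i.σ_nonneg, abs_of_nonneg i.τ_nonneg]
    calc i.σ * i.τ * |x i z| ≤ M * 1 * C' := by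
          gcongr
          · exact i.τ_nonneg
          · exact i.σ_le
          · linarith [i.τ_le]
          · exact hx' i z
      _ = _ := by ring
  have main := fun n => front_dec (ι := FrontIdx a₁ μ₀ M) (a := a) (n := n) (M := M)
    (k := FrontIdx.k) (e := FrontIdx.e) (σ := FrontIdx.σ) (τ := FrontIdx.τ) (g := g) (x := x) (y := y)
    (hbd _ hk0 FrontIdx.k_le) (hbd _ (fun i => i.e_pos.le) (fun i => by linarith [i.e_le]))
    (hbd _ FrontIdx.σ_nonneg (fun i => by linarith [i.σ_le]))
    (hbd _ FrontIdx.τ_nonneg (fun i => by linarith [i.τ_le])) ha.le FrontIdx.e_pos FrontIdx.e_le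
    FrontIdx.τ_le (by rw [abs_of_pos ha]; linarith) hsys FrontIdx.pos_or
    (dec_zero (C := 3 / 2) (fun i => (hsm i).1) fun i z => by rw [ew_zero]; linarith [hg i z]) hq
    (dec_zero (fun i => (hsm i).2.1) hx) (dec_zero (fun i => (hsm i).2.2) hy)
    (fun i z => by
      have h1 := hσg i z
      have h2 : |i.σ * i.τ * y i z| ≤ M * C' := by
        rw [abs_mul, abs_mul, abs_of_nonneg i.σ_nonneg, abs_of_nonneg i.τ_nonneg]
        calc i.σ * i.τ * |y i z| ≤ M * 1 * C' := by
              gcongr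
              · exact i.τ_nonneg
              · exact i.σ_le
              · linarith [i.τ_le]
              · exact hy' i z
          _ = _ := by ring
      have h3 : (i.σ * g i z) ^ 2 ≤ (M * (3 / 2)) ^ 2 := by
        rw [← sq_abs]; gcongr
      have h4 : (M * (3 / 2)) ^ 2 ≤ M * 3 := by
        have : M * M ≤ M * 1 := by gcongr
        nlinarith
      have h5 := sq_nonneg (i.σ * g i z)
      have h6 : 0 < M * C' := by positivity
      rw [abs_le] at h1 h2 ⊢
      constructor <;> linarith [h1.1, h1.2, h2.1, h2.2])
    (fun i z => by
      have h1 := hσg i z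
      have h2 := hστx i z
      have h3 : (1 - i.σ * g i z) ^ 2 ≤ 2 := by
        have := abs_le.mp h1
        have h7 : |1 - i.σ * g i z| ≤ 5 / 4 := by rw [abs_le]; constructor <;> linarith
        calc (1 - i.σ * g i z) ^ 2 = |1 - i.σ * g i z| ^ 2 := (sq_abs _).symm
          _ ≤ (5 / 4) ^ 2 := by gcongr
          _ ≤ 2 := by norm_num
      have h4 : |(1 - i.σ * g i z) ^ 2 * (i.σ * i.e) * y i z| ≤ M * (2 * C') := by
        rw [abs_mul, abs_mul, abs_of_nonneg (sq_nonneg _),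
          abs_of_nonneg (mul_nonneg i.σ_nonneg i.e_pos.le)]
        calc (1 - i.σ * g i z) ^ 2 * (i.σ * i.e) * |y i z| ≤ 2 * (M * 1) * C' := by
              gcongr
              · exact mul_nonneg i.σ_nonneg i.e_pos.le
              · exact i.e_pos.le
              · exact i.σ_le
              · linarith [i.e_le]
              · exact hy' i z
          _ = _ := by ring
      have h6 : 0 < M * C' := by positivity
      have e1 : i.σ * (g i z + i.τ * x i z) = i.σ * g i z + i.σ * i.τ * x i z := by ring
      rw [e1]
      rw [abs_le] at h1 h2 h4 ⊢
      constructor <;> linarith [h1.1, h1.2, h2.1, h2.2, h4.1, h4.2])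
  exact ⟨M, hM0, g, x, y, hsys, h0, fun n => (main n).1, fun n => (main n).2.1,
    fun n => (main n).2.2.1, fun n => (main n).2.2.2.1, fun n => (main n).2.2.2.2,
    ⟨_, hB0, tails⟩, hg, fun i z => (hστx i z).trans (by linarith)⟩

end

end IonShock

namespace IonShock

section
variable {ι : Type*} {a : ℝ}

/-- A front solves the KdV-Burgers equation up to a small source. -/
lemma IsFrontSys.kdv_residual {k e σ τ k₀ e₀ ε kd ed σd τd : ℝ} {g x y : ℝ → ℝ}
    (h : IsFrontSys k e σ τ g x y) (he : 0 < e) (hg : ContDiff ℝ ∞ g) (hx : ContDiff ℝ ∞ x)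
    (hy : ContDiff ℝ ∞ y) (hk : k = k₀ + ε * kd) (hed : e = e₀ + ε * ed) (hσ : σ = ε * σd)
    (hτ : τ = ε * τd) (z : ℝ) :
    deriv g z = k₀ * g z * (1 - g z) + e₀ * deriv (deriv g) z +
      ε * (kd * (g z * (1 - g z)) + ed * deriv (deriv g) z +
        e * deriv (fun z => τd * deriv x z + σd * ((g z + τ * x z) * y z)) z +
        σd * slowPert k e σ (g z) (x z) (y z)) := by
  have hy1 : y = fun z => deriv g z + ε * (τd * deriv x z + σd * ((g z + τ * x z) * y z)) := by
    ext z
    have h1 := h.hx z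
    have h2 := ((contDiff_hasDerivAt hx z).const_mul τ).unique h1
    have h3 := (h.hg z).deriv
    unfold fastPert at h2
    rw [h3]
    have h4 : τ * deriv x z = ε * (τd * deriv x z) := by rw [hτ]; ring
    have h5 : σ * ((g z + τ * x z) * y z) = ε * (σd * ((g z + τ * x z) * y z)) := by rw [hσ]; ring
    linarith
  have hW : ContDiff ℝ ∞ fun z => τd * deriv x z + σd * ((g z + τ * x z) * y z) :=
    (contDiff_const.mul (contDiff_deriv hx)).add
      (contDiff_const.mul ((hg.add (contDiff_const.mul hx)).mul hy))
  have hy2 : deriv y z = deriv (deriv g) z +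
      ε * deriv (fun z => τd * deriv x z + σd * ((g z + τ * x z) * y z)) z := by
    conv_lhs => rw [hy1]
    exact ((contDiff_hasDerivAt (contDiff_deriv hg) z).fun_add
      ((contDiff_hasDerivAt hW z).const_mul ε)).deriv
  have hx1 : x z = e * deriv y z := by rw [(h.hy z).deriv]; field_simp
  set D := deriv (fun z => τd * deriv x z + σd * ((g z + τ * x z) * y z)) z
  have h6 := (h.hg z).deriv
  have h7 : σ * slowPert k e σ (g z) (x z) (y z) = ε * (σd * slowPert k e σ (g z) (x z) (y z)) := by
    nth_rw 1 [hσ]; ring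
  have h8 : x z = e * (deriv (deriv g) z + ε * D) := by rw [← hy2, hx1]
  rw [h7] at h6
  generalize slowPert k e σ (g z) (x z) (y z) = S at *
  rw [h6, h8, hk, hed]
  ring

/-- This is the source in the equation for difference quotients. Only the quotients `kd`, `ed`,
`σd`, `τd` and the parameters have to be bounded, since the functions involved already decay
uniformly. -/
lemma FrontFamily.residual_dec {k e σ τ μ kd ed σd τd : ι → ℝ} {g x y : ι → ℝ → ℝ}
    (h : FrontFamily a k e σ τ μ g x y) (ha : 0 ≤ a) {a₁ : ℝ} (ha₁ : 0 < a₁) (hk : ∀ i, a₁ ≤ k i)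
    (hkd : Bd kd) (hed : Bd ed) (hσd : Bd σd) (hτd : Bd τd) (he : Bd e) (hσ : Bd σ) (hτ : Bd τ)
    (n : ℕ) : Dec a n (fun i z => kd i * (g i z * (1 - g i z)) + ed i * deriv (deriv (g i)) z +
        e i * deriv (fun z => τd i * deriv (x i) z + σd i * ((g i z + τ i * x i z) * y i z)) z +
        σd i * slowPert (k i) (e i) (σ i) (g i z) (x i z) (y i z)) := by
  have hkk : Bd fun i => kd i / k i := by
    obtain ⟨K, hK⟩ := hkd
    refine ⟨K / a₁, fun i => ?_⟩
    have hki : 0 < k i := ha₁.trans_le (hk i)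
    rw [abs_div, abs_of_pos hki]
    exact div_le_div₀ ((abs_nonneg _).trans (hK i)) (hK i) ha₁ (hk i)
  have h1 : Dec a n (fun i z => kd i * (g i z * (1 - g i z))) :=
    (Dec.smul hkk (h.dec_prod n)).congr fun i z => by
      have := (ha₁.trans_le (hk i)).ne'
      field_simp
  have h2 : Dec a n (fun i z => ed i * deriv (deriv (g i)) z) :=
    Dec.smul hed (h.dec_deriv (n + 1)).deriv
  have h3 : Dec a (n + 1) (fun i z => τd i * deriv (x i) z + σd i * ((g i z + τ i * x i z) * y i z)) :=
    (Dec.smul hτd (h.dec_x (n + 1 + 1)).deriv).add (Dec.smul hσd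
      (((h.dec_g (n + 1)).add ((Dec.smul hτ (h.dec_x (n + 1))).mono ha)).bdd_mul (h.dec_y (n + 1))))
  exact ((h1.add h2).add (Dec.smul he h3.deriv)).add
    (Dec.smul hσd (dec_slowPert he hσ ha (h.dec_g n) (h.dec_prod n) (h.dec_x n) (h.dec_y n)))

/-- Both fronts have the limits 0 and 1, so their tails cancel whatever the parameters. For fixed ε
this gives the finiteness that the linear estimate absorbs. -/
lemma FrontFamily.sub_dec {k e σ τ μ k' e' σ' τ' μ' : ι → ℝ} {g x y g' x' y' : ι → ℝ → ℝ}
    (h : FrontFamily a k e σ τ μ g x y) (h' : FrontFamily a k' e' σ' τ' μ' g' x' y') (n : ℕ) :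
    Dec a n (fun i z => g i z - g' i z) := by
  obtain ⟨B, hB, H⟩ := h.tails
  obtain ⟨B', hB', H'⟩ := h'.tails
  have h0 : Dec a 0 (fun i z => g i z - g' i z) := by
    refine dec_zero (C := B + B') (fun i => ((h.dec_g 0).smooth i).sub ((h'.dec_g 0).smooth i))
      fun i z => ?_
    rw [add_mul]
    rcases le_total 0 z with hz | hz
    · have h1 := (H i z).1 hz
      have h2 := (H' i z).1 hz
      rw [abs_le] at h1 h2 ⊢
      constructor <;> linarith [h1.1, h1.2, h2.1, h2.2]
    · have h1 := (H i z).2 hz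
      have h2 := (H' i z).2 hz
      rw [abs_le] at h1 h2 ⊢
      constructor <;> linarith [h1.1, h1.2, h2.1, h2.2]
  rcases n with _ | n
  · exact h0
  · exact dec_succ h0 (((h.dec_deriv n).sub (h'.dec_deriv n)).congr fun i z =>
      ((contDiff_hasDerivAt ((h.dec_g 0).smooth i) z).fun_sub
        (contDiff_hasDerivAt ((h'.dec_g 0).smooth i) z)).deriv)

end

/-- Fronts depend on their parameters in a Lipschitz way, with exponentially decaying
differences. -/
lemma exists_frontFamily_diff {a a₁ μ₀ : ℝ} (ha : 0 < a) (haa : a < a₁) (hμ₀ : 0 < μ₀) :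
    ∃ M > 0, ∃ g x y : FrontIdx a₁ μ₀ M → ℝ → ℝ,
      FrontFamily a FrontIdx.k FrontIdx.e FrontIdx.σ FrontIdx.τ FrontIdx.μ g x y ∧
      ∀ {ι : Type} (i j : ι → FrontIdx a₁ μ₀ M) (ε : ι → ℝ), (∀ t, 0 < ε t) →
        (∀ t, (j t).σ = 0 ∧ (j t).τ = 0) → Bd (fun t => ((i t).k - (j t).k) / ε t) →
        Bd (fun t => ((i t).e - (j t).e) / ε t) → Bd (fun t => (i t).σ / ε t) →
        Bd (fun t => (i t).τ / ε t) → Bd (fun t => ((i t).μ - (j t).μ) / ε t) →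
        ∀ n, Dec a n fun t z => (g (i t) z - g (j t) z) / ε t := by
  obtain ⟨M₀, hM₀, g, x, y, h⟩ := exists_frontFamily ha haa hμ₀
  obtain ⟨B, hB, htails⟩ := h.tails
  obtain ⟨G, hG0, hG⟩ := (h.dec_deriv 0).bound'
  -- The coefficient will be k (1 - g_i - g_j) with k ≤ 3, |g| ≤ 3/2 and tails B e^{-a|z|}. The
  -- threshold `e₀` depends on bounds of the family already chosen, so the family is restricted to a
  -- smaller range afterwards.
  obtain ⟨e₀, he₀, hlin⟩ := linear_kdv_dec (a := a) (a₁ := a₁) (b := a) (M := 6 * B) (A₀ := 12)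
    (A₁ := 6 * G) ha.le haa ha (by positivity) (by norm_num) (by positivity)
  set M := min (min M₀ e₀) 1 with hM
  have hMM : M ≤ M₀ := (min_le_left _ _).trans (min_le_left _ _)
  have hMe : M ≤ e₀ := (min_le_left _ _).trans (min_le_right _ _)
  have hM1 : M ≤ 1 := min_le_right _ _
  set w := FrontIdx.widen (a₁ := a₁) (μ₀ := μ₀) hMM
  have hf : FrontFamily a (ι := FrontIdx a₁ μ₀ M) FrontIdx.k FrontIdx.e FrontIdx.σ FrontIdx.τ
    FrontIdx.μ (fun i => g (w i)) (fun i => x (w i)) (fun i => y (w i)) := h.reindex w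
  refine ⟨M, by positivity, _, _, _, hf, ?_⟩
  intro ι i j ε hε hj hk he hσ hτ hμ
  have ha₁ : 0 < a₁ := ha.trans haa
  have fi := hf.reindex i
  have fj := hf.reindex j
  have hbd : ∀ f : FrontIdx a₁ μ₀ M → ℝ, (∀ i, 0 ≤ f i) → (∀ i, f i ≤ 3) → Bd fun t => f (i t) :=
    fun f h0 h1 => ⟨3, fun t => by rw [abs_of_nonneg (h0 _)]; exact h1 _⟩
  have hbd' : Bd fun t => (j t).k := ⟨3, fun t => by
    rw [abs_of_nonneg (by linarith [(j t).le_k])]; exact (j t).k_le⟩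
  have hsub := fi.sub_dec fj
  have hjs : ∀ t, IsFrontSys (j t).k (j t).e 0 0 (g (w (j t))) (x (w (j t))) (y (w (j t))) := by
    intro t; have := fj.sys t
    simp only [(hj t).1, (hj t).2] at this
    exact this
  have dA : ∀ n, Dec 0 n fun t z => (j t).k * (1 - g (w (i t)) z - g (w (j t)) z) := fun n =>
    Dec.smul hbd' ((Dec.const_sub (Bd.const 1) (fi.dec_g n)).sub (fj.dec_g n))
  have hgi : ∀ t z, HasDerivAt (g (w (i t))) (deriv (g (w (i t))) z) z := fun t =>
    contDiff_hasDerivAt ((fi.dec_g 0).smooth t)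
  have hgj : ∀ t z, HasDerivAt (g (w (j t))) (deriv (g (w (j t))) z) z := fun t =>
    contDiff_hasDerivAt ((fj.dec_g 0).smooth t)
  have hgi' : ∀ t z, HasDerivAt (deriv (g (w (i t)))) (deriv (deriv (g (w (i t)))) z) z := fun t =>
    contDiff_hasDerivAt (contDiff_deriv ((fi.dec_g 0).smooth t))
  have hgj' : ∀ t z, HasDerivAt (deriv (g (w (j t)))) (deriv (deriv (g (w (j t)))) z) z := fun t =>
    contDiff_hasDerivAt (contDiff_deriv ((fj.dec_g 0).smooth t))
  have hD' : ∀ t, deriv (fun z => (g (w (i t)) z - g (w (j t)) z) / ε t) =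
      fun z => (deriv (g (w (i t))) z - deriv (g (w (j t))) z) / ε t := fun t => by
    ext z; exact (((hgi t z).fun_sub (hgj t z)).div_const _).deriv
  have hD'' : ∀ t z, deriv (fun z => (deriv (g (w (i t))) z - deriv (g (w (j t))) z) / ε t) z =
      (deriv (deriv (g (w (i t)))) z - deriv (deriv (g (w (j t)))) z) / ε t := fun t z =>
    (((hgi' t z).fun_sub (hgj' t z)).div_const _).deriv
  have hkj : ∀ t, 0 < (j t).k := fun t => ha₁.trans_le (j t).le_k
  -- Subtracting the two equations, the quadratic term factors through the difference. The quotient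
  -- D satisfies D' = k_j (1 - g_i - g_j) D + e_j D'' + R, whose coefficient tends to -k_j and k_j
  -- at ± ∞.
  refine hlin (fun t => (j t).e) _ (fun t z => (j t).k * (1 - g (w (i t)) z - g (w (j t)) z)) _
    (fun t => (j t).e_pos) (fun t => (j t).e_le.trans hMe) dA ?_ ?_ ?_ ?_
    (fun n => fi.residual_dec ha.le ha₁ (fun t => (i t).le_k) hk he hσ hτ
      (hbd _ (fun i => i.e_pos.le) (fun i => by linarith [i.e_le]))
      (hbd _ FrontIdx.σ_nonneg (fun i => by linarith [i.σ_le]))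
      (hbd _ FrontIdx.τ_nonneg (fun i => by linarith [i.τ_le])) n) ?_ ?_ ?_
  · intro t z
    have h1 := abs_le.mp (fi.le t z)
    have h2 := abs_le.mp (fj.le t z)
    have h3 : |1 - g (w (i t)) z - g (w (j t)) z| ≤ 4 := by
      rw [abs_le]; constructor <;> linarith [h1.1, h1.2, h2.1, h2.2]
    rw [abs_mul, abs_of_pos (hkj t)]
    calc (j t).k * _ ≤ 3 * 4 := by gcongr; exact (j t).k_le
      _ = 12 := by norm_num
  · intro t z
    have hE := ew_le_one ha.le z
    have h1 := (hG (w (i t)) z).trans (mul_le_of_le_one_right hG0.le hE)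
    have h2 := (hG (w (j t)) z).trans (mul_le_of_le_one_right hG0.le hE)
    rw [((((hgi t z).const_sub 1).fun_sub (hgj t z)).const_mul _).deriv]
    have h3 : |(-deriv (g (w (i t))) z - deriv (g (w (j t))) z)| ≤ 2 * G := by
      rw [abs_le] at h1 h2 ⊢
      constructor <;> linarith [h1.1, h1.2, h2.1, h2.2]
    rw [abs_mul, abs_of_pos (hkj t)]
    calc (j t).k * _ ≤ 3 * (2 * G) := by gcongr; exact (j t).k_le
      _ = 6 * G := by ring
  · intro t z hz
    have h1 := (abs_le.mp ((htails (w (i t)) z).1 hz)).2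
    have h2 := (abs_le.mp ((htails (w (j t)) z).1 hz)).2
    have e1 : (j t).k * (1 - g (w (i t)) z - g (w (j t)) z) =
      -(j t).k + (j t).k * ((1 - g (w (i t)) z) + (1 - g (w (j t)) z)) := by ring
    rw [e1]
    have h3 : (j t).k * ((1 - g (w (i t)) z) + (1 - g (w (j t)) z)) ≤ 3 * (2 * (B * ew a z)) := by
      have h5 : 0 ≤ B * ew a z := mul_nonneg hB (ew_pos a z).le
      calc _ ≤ (j t).k * (2 * (B * ew a z)) :=
            mul_le_mul_of_nonneg_left (by linarith) (hkj t).le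
        _ ≤ _ := mul_le_mul_of_nonneg_right (j t).k_le (by linarith)
    linarith [(j t).le_k]
  · intro t z hz
    have h1 := (abs_le.mp ((htails (w (i t)) z).2 hz)).2
    have h2 := (abs_le.mp ((htails (w (j t)) z).2 hz)).2
    have e1 : (j t).k * (1 - g (w (i t)) z - g (w (j t)) z) =
      (j t).k - (j t).k * (g (w (i t)) z + g (w (j t)) z) := by ring
    rw [e1]
    have h3 : (j t).k * (g (w (i t)) z + g (w (j t)) z) ≤ 3 * (2 * (B * ew a z)) := by
      have h5 : 0 ≤ B * ew a z := mul_nonneg hB (ew_pos a z).le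
      calc _ ≤ (j t).k * (2 * (B * ew a z)) :=
            mul_le_mul_of_nonneg_left (by linarith) (hkj t).le
        _ ≤ _ := mul_le_mul_of_nonneg_right (j t).k_le (by linarith)
    linarith [(j t).le_k]
  · intro t z
    have hε' := (hε t).ne'
    rw [hD' t, hD'' t z]
    have h1 := (fi.sys t).kdv_residual (i t).e_pos ((fi.dec_g 0).smooth t) ((fi.dec_x 0).smooth t)
      ((fi.dec_y 0).smooth t) (k₀ := (j t).k) (e₀ := (j t).e) (ε := ε t)
      (kd := ((i t).k - (j t).k) / ε t) (ed := ((i t).e - (j t).e) / ε t)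
      (σd := (i t).σ / ε t) (τd := (i t).τ / ε t) (by field_simp; ring) (by field_simp; ring)
      (by field_simp) (by field_simp) z
    have h2 : deriv (g (w (j t))) z = (j t).k * g (w (j t)) z * (1 - g (w (j t)) z) +
        (j t).e * deriv (deriv (g (w (j t)))) z := by
      have h3 := (hjs t).kdv_eq
      have h4 : deriv (g (w (j t))) = y (w (j t)) := funext fun z => (h3 z).2.deriv
      have h5 := (j t).e_pos.ne'
      rw [h4, ((hjs t).hy z).deriv, (h3 z).1]
      field_simp
      ring
    set R := _ + (i t).σ / ε t * slowPert _ _ _ _ _ _ with hR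
    beta_reduce
    rw [h1, h2]
    field_simp
    ring
  · exact hμ.imp fun K hK t => by
      have h1 := fi.init t
      have h2 := fj.init t
      beta_reduce at h1 h2 ⊢
      rw [h1, h2]; exact hK t
  · intro t n
    exact (Dec.smul (Bd.const (1 / ε t)) ((hsub n).reindex fun _ : Unit => t)).congr
      fun _ z => by ring

end IonShock

namespace IonShock

/-! ### The equations for the remainder -/

lemma IsKdVBurgersFront.first_integral {c b d e r : ℝ} {f : ℝ → ℝ}
    (h : IsKdVBurgersFront c b d e r f) (hc : 0 < c) (hb : 0 < b) (hd : 0 < d) (he : 0 < e)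
    (hr : r = -(c / b)) (z : ℝ) :
    d * deriv f z = c * f z + b * f z ^ 2 + e * iteratedDeriv 2 f z := by
  have hr0 : r ≠ 0 := by
    rw [hr]; exact (neg_neg_of_pos (div_pos hc hb)).ne
  have h1 := ((h.toFrontSys hc hb hd he hr).kdv_eq z).1
  have d1 : deriv (fun z => f z / r) = fun z => deriv f z / r := by
    ext z; exact ((contDiff_hasDerivAt h.smooth z).div_const r).deriv
  have d2 : deriv (fun z => deriv f z / r) z = deriv (deriv f) z / r :=
    ((contDiff_hasDerivAt (contDiff_deriv h.smooth) z).div_const r).deriv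
  rw [d1] at h1
  beta_reduce at h1
  rw [d2] at h1
  simp only [iteratedDeriv_succ, iteratedDeriv_zero]
  have e1 : c / d * (f z / r) * (1 - f z / r) = (c * f z + b * f z ^ 2) / (d * r) := by
    have e2 : 1 - f z / r = 1 + b * f z / c := by rw [hr]; field_simp; ring
    rw [e2]; field_simp
  rw [e1] at h1
  field_simp at h1
  linarith

lemma nPlus_sub_one {T ε : ℝ} (hT : 0 ≤ T) (hε : ε ≠ 0) :
    1 / ε * (nPlus T ε - 1) = -((2 * soundSpeed T - ε) / (T + 1)) := by
  rw [← one_sub_strength hT, strength, amp]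
  field_simp
  ring

/-- The density equation of a shock profile. -/
lemma IsShockProfile.density_eqn {T ε δ : ℝ} {p : Triple} (hT : 0 ≤ T) (hε : 0 < ε) (hδ : 0 < δ)
    (hs : 0 < shockSpeed T ε) (h : IsShockProfile T ε δ p) (z : ℝ) :
    shockSpeed T ε * ε * deriv p.n z = (T + 1) * p.n z ^ 2 * (p.n z - 1) -
      shockSpeed T ε ^ 2 * p.n z * (p.n z - 1) + ε * δ * p.n z ^ 2 * iteratedDeriv 2 p.φ z -
      ε * δ / 2 * p.n z ^ 2 * deriv p.φ z ^ 2 := by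
  have h1 := (h.reduce hT hε hδ hs).2.eqn z
  have h0 := (h.density_pos z).ne'
  have hp := h.poisson z
  have d1 : deriv (fun z => 1 / p.n z) z = -deriv p.n z / p.n z ^ 2 := by
    simp only [one_div]
    exact ((contDiff_hasDerivAt h.smooth_n z).fun_inv h0).deriv
  rw [d1, soundSpeed_sq hT, show Real.exp (p.φ z) = p.n z + ε * δ * iteratedDeriv 2 p.φ z by linarith,
    one_div_one_div] at h1
  field_simp at h1
  linarith

/-- Exact algebra: the expansion is inserted into the integrated density equation, the Poisson
equation and the mass relation, and the first integral of the modified density profile is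
subtracted. -/
lemma solvesRemainderSystem {T ε δ : ℝ} {p₁ q r p : Triple} (hT : 0 ≤ T) (hε : 0 < ε)
    (hε4 : ε ≤ 1 / 4) (hδ : 0 < δ) (hp : IsShockProfile T ε δ p)
    (hq : IsModifiedFirstOrder T ε δ p₁ q) (h : HasExpansion ε p₁ (secondOrder ε p₁ q) r p) :
    SolvesRemainderSystem T ε δ p₁ q r := by
  have S := smallShock hT hε hε4
  have hs := S.s_pos
  have hc := S.hc
  have hc0 : 0 < soundSpeed T := by linarith
  have hε0 := hε.ne'
  have en : ∀ z, p.n z = 1 + ε * q.n z + ε ^ 2 * r.n z := fun z => by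
    rw [h.n_eq, secondOrder]; field_simp; ring
  have eu : ∀ z, p.u z = ε * q.u z + ε ^ 2 * r.u z := fun z => by
    rw [h.u_eq, secondOrder]; field_simp; ring
  have eφ : ∀ z, p.φ z = ε * q.φ z + ε ^ 2 * r.φ z := fun z => by
    rw [h.φ_eq, secondOrder]; field_simp; ring
  have sn := hq.front_n.smooth
  have sφ := hq.front_φ.smooth
  have srn : ContDiff ℝ ∞ r.n := by
    rw [show r.n = fun z => (ε ^ 2)⁻¹ * (p.n z - 1 - ε * q.n z) by
      ext z; rw [en]; field_simp; ring]
    exact contDiff_const.mul ((hp.smooth_n.sub contDiff_const).sub (contDiff_const.mul sn))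
  have srφ : ContDiff ℝ ∞ r.φ := by
    rw [show r.φ = fun z => (ε ^ 2)⁻¹ * (p.φ z - ε * q.φ z) by
      ext z; rw [eφ]; field_simp; ring]
    exact contDiff_const.mul (hp.smooth_φ.sub (contDiff_const.mul sφ))
  have dn : ∀ z, deriv p.n z = ε * deriv q.n z + ε ^ 2 * deriv r.n z := fun z => by
    rw [show p.n = fun z => 1 + ε * q.n z + ε ^ 2 * r.n z from funext en]
    exact ((((contDiff_hasDerivAt sn z).const_mul ε).const_add 1).fun_add
      ((contDiff_hasDerivAt srn z).const_mul (ε ^ 2))).deriv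
  have dφ : deriv p.φ = fun z => ε * deriv q.φ z + ε ^ 2 * deriv r.φ z := by
    ext z
    rw [show p.φ = fun z => ε * q.φ z + ε ^ 2 * r.φ z from funext eφ]
    exact (((contDiff_hasDerivAt sφ z).const_mul ε).fun_add
      ((contDiff_hasDerivAt srφ z).const_mul (ε ^ 2))).deriv
  have dφ' : ∀ z, iteratedDeriv 2 p.φ z =
      ε * iteratedDeriv 2 q.φ z + ε ^ 2 * iteratedDeriv 2 r.φ z := fun z => by
    simp only [iteratedDeriv_succ, iteratedDeriv_zero]
    rw [dφ]
    exact (((contDiff_hasDerivAt (contDiff_deriv sφ) z).const_mul ε).fun_add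
      ((contDiff_hasDerivAt (contDiff_deriv srφ) z).const_mul (ε ^ 2))).deriv
  have hT1 : T + 1 = soundSpeed T ^ 2 := (soundSpeed_sq hT).symm
  refine ⟨fun z => ?_, fun z => ?_, fun z => ?_⟩
  · have h1 := hp.density_eqn hT hε hδ hs z
    have h2 := hq.front_n.first_integral (by linarith) (by linarith) hc0 hδ (nPlus_sub_one hT hε0) z
    rw [dn, en, dφ', dφ] at h1
    unfold r₁ r₂ r₃
    rw [hT1] at h1 h2 ⊢
    have hsc : shockSpeed T ε = soundSpeed T - ε := rfl
    rw [hsc] at h1 ⊢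
    set c := soundSpeed T
    -- After division by c ε³ the coefficient of n_R' is s / c = 1 - ε / c; the deficit is the term
    -- ε n_R' / c of `r₂`.
    linear_combination (norm := skip) (1 / (c * ε ^ 3)) * h1 - (1 + ε * q.n z) / (ε * c) * h2
    field_simp
    ring
  · have h1 := hp.poisson z
    rw [en, dφ', eφ, Real.exp_add] at h1
    unfold r₄ r₅ r₆
    field_simp
    linarith
  · have h1 := (hp.reduce hT hε hδ hs).1 z
    have h0 := (hp.density_pos z).ne'
    rw [en] at h0
    rw [eu, en] at h1
    have e1 : r.u z = (shockSpeed T ε * (1 - 1 / (1 + ε * q.n z + ε ^ 2 * r.n z)) - ε * q.u z) / ε ^ 2 := by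
      rw [← h1]; field_simp; ring
    rw [e1]
    field_simp
    ring

end IonShock

namespace IonShock

/-! ### Weighted norms of exponentially decaying functions -/

lemma weight_le {α : ℝ} (hα : 0 ≤ α) (z : ℝ) : weight α z ≤ Real.exp α * Real.exp (α * |z|) := by
  rw [weight, ← Real.exp_add]
  refine Real.exp_le_exp.mpr ?_
  have h : Real.sqrt (1 + |z| ^ 2) ≤ 1 + |z| := by
    rw [Real.sqrt_le_left (by positivity)]
    nlinarith [abs_nonneg z]
  nlinarith

lemma memLp_ew {b : ℝ} (hb : 0 < b) : MemLp (ew b) 2 volume := by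
  rw [memLp_two_iff_integrable_sq (continuous_ew b).aestronglyMeasurable]
  have e1 : (fun z => ew b z ^ 2) = fun z => Real.exp (-(2 * b) * |z|) := by
    ext z; rw [ew, ← Real.exp_nat_mul]; congr 1; push_cast; ring
  rw [e1]
  rw [← integrableOn_univ, ← Set.Iic_union_Ioi (a := (0 : ℝ))]
  refine IntegrableOn.union ?_ ?_
  · refine (integrableOn_exp_mul_Iic (a := 2 * b) (by positivity) 0).congr_fun (fun z hz => ?_)
      measurableSet_Iic
    rw [Set.mem_Iic] at hz
    rw [abs_of_nonpos hz]; ring_nf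
  · refine (exp_neg_integrableOn_Ioi 0 (b := 2 * b) (by positivity)).congr_fun (fun z hz => ?_)
      measurableSet_Ioi
    rw [Set.mem_Ioi] at hz
    rw [abs_of_pos hz]

/-- The weight is at most e^α e^{α|z|}, so the weighted function is dominated by a multiple of the
square integrable e^{-(a - α)|z|}. -/
lemma normL2_le {α a : ℝ} (hα : 0 ≤ α) (ha : α < a) : ∃ K, 0 ≤ K ∧ ∀ (f : ℝ → ℝ) C, 0 ≤ C →
    (∀ z, |f z| ≤ C * ew a z) → normL2 α f ≤ ENNReal.ofReal (K * C) := by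
  have hm := memLp_ew (b := a - α) (by linarith)
  refine ⟨(eLpNorm (ew (a - α)) 2 volume).toReal * Real.exp α, by positivity, fun f C hC hf => ?_⟩
  have h1 : normL2 α f ≤ eLpNorm (fun z => (C * Real.exp α) * ew (a - α) z) 2 volume := by
    refine eLpNorm_mono_real fun z => ?_
    have hw : 0 < weight α z := Real.exp_pos _
    rw [Real.norm_eq_abs, abs_mul, abs_of_pos hw]
    have e1 : Real.exp (α * |z|) * ew a z = ew (a - α) z := by
      rw [ew, ew, ← Real.exp_add]; congr 1; ring
    calc weight α z * |f z| ≤ (Real.exp α * Real.exp (α * |z|)) * (C * ew a z) := by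
          have := hf z
          have := weight_le hα z
          gcongr
      _ = C * Real.exp α * (Real.exp (α * |z|) * ew a z) := by ring
      _ = _ := by rw [e1]
  refine h1.trans (le_of_eq ?_)
  have h2 := eLpNorm_const_smul (C * Real.exp α) (ew (a - α)) 2 (volume : Measure ℝ)
  rw [show ((C * Real.exp α) • ew (a - α)) = fun z => (C * Real.exp α) * ew (a - α) z from rfl] at h2
  rw [h2, Real.enorm_eq_ofReal (by positivity), ← ENNReal.ofReal_toReal hm.eLpNorm_ne_top,
    ENNReal.toReal_ofReal ENNReal.toReal_nonneg, ← ENNReal.ofReal_mul (by positivity)]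
  congr 1
  ring

section
variable {ι : Type*} {α a : ℝ} {f g : ι → ℝ → ℝ}

lemma Dec.normL2_le (hα : 0 ≤ α) (ha : α < a) {n : ℕ} (hf : Dec a n f) :
    ∃ K, 0 ≤ K ∧ ∀ i, normL2 α (_root_.iteratedDeriv n (f i)) ≤ ENNReal.ofReal K := by
  obtain ⟨K, hK, H⟩ := IonShock.normL2_le hα ha
  obtain ⟨C, hC⟩ := hf.iteratedDeriv_bound
  refine ⟨K * |C|, by positivity, fun i => H _ _ (abs_nonneg _) fun z => (hC i z).trans ?_⟩
  exact mul_le_mul_of_nonneg_right (le_abs_self C) (ew_pos a z).le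

lemma dec_normH_le (hα : 0 ≤ α) (ha : α < a) (hf : ∀ n, Dec a n f) (k : ℕ) :
    ∃ K, 0 ≤ K ∧ ∀ i, normH α k (f i) ≤ ENNReal.ofReal K := by
  choose K hK H using fun n => (hf n).normL2_le hα ha
  refine ⟨(∑ n ∈ Finset.range (k + 1), K n ^ 2) ^ (1 / 2 : ℝ), by positivity, fun i => ?_⟩
  rw [← ENNReal.ofReal_rpow_of_nonneg (Finset.sum_nonneg fun n _ => sq_nonneg _) (by norm_num),
    ENNReal.ofReal_sum_of_nonneg fun n _ => sq_nonneg _]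
  unfold normH
  gcongr with n hn
  rw [ENNReal.ofReal_pow (hK n)]
  gcongr
  exact H n i

lemma dec_normX_le (hα : 0 ≤ α) (ha : α < a) (hf : ∀ n, Dec a n f) (hg : ∀ n, Dec a n g)
    {ε δ : ι → ℝ} (h1 : ∀ i, ε i * δ i ≤ 1) (k : ℕ) :
    ∃ K, 0 ≤ K ∧ ∀ i, normX (ε i) (δ i) α k (f i) (g i) ≤ ENNReal.ofReal K := by
  obtain ⟨K₁, hK₁, H₁⟩ := dec_normH_le hα ha hf k
  obtain ⟨K₂, hK₂, H₂⟩ := dec_normH_le hα ha hg k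
  obtain ⟨K₃, hK₃, H₃⟩ := (hg (k + 1)).normL2_le hα ha
  obtain ⟨K₄, hK₄, H₄⟩ := (hg (k + 2)).normL2_le hα ha
  refine ⟨K₁ + K₂ + K₃ + K₄, by positivity, fun i => ?_⟩
  rw [ENNReal.ofReal_add (by positivity) hK₄, ENNReal.ofReal_add (by positivity) hK₃,
    ENNReal.ofReal_add hK₁ hK₂]
  unfold normX
  have e1 : ENNReal.ofReal (Real.sqrt (ε i * δ i)) ≤ 1 := by
    rw [ENNReal.ofReal_le_one]; exact Real.sqrt_le_one.mpr (h1 i)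
  have e2 : ENNReal.ofReal (ε i * δ i) ≤ 1 := by rw [ENNReal.ofReal_le_one]; exact h1 i
  refine add_le_add (add_le_add (add_le_add (H₁ i) (H₂ i)) ?_) ?_
  · calc _ ≤ 1 * ENNReal.ofReal K₃ := by gcongr; exact H₃ i
      _ = _ := one_mul _
  · calc _ ≤ 1 * ENNReal.ofReal K₄ := by gcongr; exact H₄ i
      _ = _ := one_mul _

end

end IonShock

namespace IonShock

/-! ### Parameters of the normalised fronts -/

/-- The amplitude of the modified potential profile. -/
noncomputable def potAmp (T ε : ℝ) : ℝ := -(1 / ε * phiPlus T ε)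

section
variable {T ε δ m : ℝ}

lemma strength_le_quarter (hT : 0 ≤ T) (hε : 0 < ε) (hε8 : ε ≤ 1 / 8) : strength T ε ≤ 1 / 4 := by
  linarith [strength_le hT hε (by linarith)]

/-- These are the inequalities σ ≤ -log(1 - σ) ≤ σ / (1 - σ), divided by ε. -/
lemma potAmp_bounds (hT : 0 ≤ T) (hε : 0 < ε) (hε8 : ε ≤ 1 / 8) :
    amp T ε ≤ potAmp T ε ∧ potAmp T ε * (1 - strength T ε) ≤ amp T ε ∧
      potAmp T ε - amp T ε ≤ 8 * ε := by
  have hσ := strength_pos hT hε (by linarith)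
  have hσ4 := strength_le_quarter hT hε hε8
  have ha := amp_pos hT hε (by linarith)
  have hn : 0 < 1 - strength T ε := by linarith
  have h1 : -(Real.log (1 - strength T ε)) ≥ strength T ε := by
    linarith [Real.log_le_sub_one_of_pos hn]
  have h2 : -(Real.log (1 - strength T ε)) ≤ strength T ε / (1 - strength T ε) := by
    have := Real.one_sub_inv_le_log_of_pos hn
    have e1 : 1 - (1 - strength T ε)⁻¹ = -(strength T ε / (1 - strength T ε)) := by
      field_simp; ring
    linarith
  have e2 : potAmp T ε = -(Real.log (1 - strength T ε)) / ε := by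
    rw [potAmp, phiPlus, one_sub_strength hT]; ring
  have e3 : amp T ε = strength T ε / ε := by rw [strength]; field_simp
  have h3 : potAmp T ε * (1 - strength T ε) ≤ amp T ε := by
    rw [e2, e3, div_mul_eq_mul_div, div_le_div_iff_of_pos_right hε]
    rwa [le_div_iff₀ hn] at h2
  refine ⟨by rw [e2, e3, div_le_div_iff_of_pos_right hε]; exact h1, h3, ?_⟩
  have h4 : potAmp T ε ≤ 4 / 3 * amp T ε := by
    have h5 : 0 ≤ potAmp T ε := by
      rw [e2]; exact div_nonneg (by linarith) hε.le
    nlinarith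
  have h5 : amp T ε ≤ 2 := by
    have h1 := (amp_bounds hT hε (by linarith)).2
    have hc := one_le_soundSpeed hT
    have : 2 / soundSpeed T ≤ 2 := by rw [div_le_iff₀ (by positivity)]; linarith
    linarith
  have h6 : potAmp T ε * strength T ε ≤ (8 / 3) * (2 * ε) :=
    mul_le_mul (by linarith) (strength_le hT hε (by linarith)) hσ.le (by norm_num)
  linarith

lemma soundSpeed_mul_amp (hT : 0 ≤ T) : soundSpeed T * amp T ε = (2 * soundSpeed T - ε) / soundSpeed T := by
  have hc := one_le_soundSpeed hT
  rw [amp, ← soundSpeed_sq hT]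
  field_simp

lemma soundSpeed_mul_amp_bounds (hT : 0 ≤ T) (hε : 0 < ε) :
    2 - ε ≤ soundSpeed T * amp T ε ∧ soundSpeed T * amp T ε ≤ 2 := by
  have hc := one_le_soundSpeed hT
  rw [soundSpeed_mul_amp hT, le_div_iff₀ (by positivity), div_le_iff₀ (by positivity)]
  constructor <;> nlinarith

lemma amp_le_two (hT : 0 ≤ T) (hε : 0 < ε) (hε4 : ε ≤ 1 / 4) : amp T ε ≤ 2 := by
  have h := (soundSpeed_mul_amp_bounds hT hε).2
  have hc := one_le_soundSpeed hT
  have ha := amp_pos hT hε hε4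
  nlinarith

/-- The parameters of all profiles are admissible. -/
lemma front_params {a₁ M : ℝ} (hT : 0 ≤ T) (hm₁ : -(2 / soundSpeed T) < m) (hm₀ : m < 0)
    (ha₁ : a₁ < 2) (hM : 0 < M) : ∃ ε₀ > 0, ε₀ ≤ 1 / 8 ∧ ∃ δ₀ > 0, δ₀ ≤ 1 ∧ ∀ ε δ, 0 < ε → ε ≤ ε₀ →
      0 < δ → δ ≤ δ₀ → δ / shockSpeed T ε ≤ M ∧ δ / soundSpeed T ≤ M ∧ strength T ε ≤ M ∧
      ε * shockSpeed T ε ≤ M ∧ a₁ ≤ soundSpeed T * amp T ε ∧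
      ∀ μ₀, μ₀ = min (-m * soundSpeed T / 4) ((1 - -m * soundSpeed T / 2) / 2) →
      ∀ r, amp T ε * soundSpeed T ≤ r → r ≤ 3 →
        μ₀ ≤ -m * soundSpeed T / r ∧ -m * soundSpeed T / r ≤ 1 - μ₀ := by
  have hc := one_le_soundSpeed hT
  set c := soundSpeed T with hc'
  set θ := -m * c / 2 with hθ
  have hθ0 : 0 < θ := by have : 0 < -m * c := mul_pos (by linarith) (by linarith); linarith
  have hθ1 : θ < 1 := by
    have : -m < 2 / c := by linarith
    rw [lt_div_iff₀ (by positivity)] at this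
    linarith
  -- The bound 2 - a₁ keeps the slope, at least 2 - ε, above a₁. The bound (1 - θ) / 2 keeps the
  -- initial values 2 θ / r away from 1.
  refine ⟨min (min (1 / 8) (2 - a₁)) (min ((1 - θ) / 2) (min (M / 2) (M / c))),
    lt_min (lt_min (by norm_num) (by linarith)) (lt_min (by linarith) (by positivity)),
    (min_le_left _ _).trans (min_le_left _ _), min 1 (M / 2), by positivity, min_le_left _ _, ?_⟩
  intro ε δ hε hεm hδ hδm
  have hε8 : ε ≤ 1 / 8 := hεm.trans ((min_le_left _ _).trans (min_le_left _ _))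
  have hεa : ε ≤ 2 - a₁ := hεm.trans ((min_le_left _ _).trans (min_le_right _ _))
  have hεθ : ε ≤ (1 - θ) / 2 := hεm.trans ((min_le_right _ _).trans (min_le_left _ _))
  have hεM : ε ≤ M / 2 :=
    hεm.trans ((min_le_right _ _).trans ((min_le_right _ _).trans (min_le_left _ _)))
  have hεMc : ε ≤ M / c :=
    hεm.trans ((min_le_right _ _).trans ((min_le_right _ _).trans (min_le_right _ _)))
  have hδM : δ ≤ M / 2 := hδm.trans (min_le_right _ _)
  have S := smallShock hT hε (by linarith)
  have hs := S.s_pos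
  have hb := soundSpeed_mul_amp_bounds hT hε
  refine ⟨?_, ?_, by linarith [strength_le hT hε (by linarith)], ?_, by linarith, ?_⟩
  · rw [div_le_iff₀ hs]
    have : M * (1 / 2) ≤ M * shockSpeed T ε := by gcongr; linarith [S.s_ge]
    linarith
  · rw [div_le_iff₀ (by positivity)]
    have : M * 1 ≤ M * c := by gcongr
    linarith
  · calc ε * shockSpeed T ε ≤ M / c * c := by gcongr; exact S.s_lt.le
      _ = M := by field_simp
  · intro μ₀ hμ₀ r hr hr3
    have hr2 : 2 - ε ≤ r := by rw [mul_comm] at hr; linarith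
    have hr0 : 0 < r := by linarith
    have h1 : μ₀ ≤ θ / 2 := by rw [hμ₀]; exact (min_le_left _ _).trans (by linarith)
    have h2 : μ₀ ≤ (1 - θ) / 2 := by rw [hμ₀]; exact min_le_right _ _
    have e1 : -m * c = 2 * θ := by rw [hθ]; ring
    rw [e1, le_div_iff₀ hr0, div_le_iff₀ hr0]
    constructor
    · nlinarith
    · have h3 : (1 + θ) / 2 * (2 - ε) ≤ (1 - μ₀) * r := by
        apply mul_le_mul <;> linarith
      nlinarith

/-- One of the O(ε) parameter comparisons required by `exists_frontFamily_diff`; the quotient equals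
slope / c exactly. -/
lemma slope_sub_bound (hT : 0 ≤ T) (hε : 0 < ε) (hε4 : ε ≤ 1 / 4) :
    |(slope T ε - soundSpeed T * amp T ε) / ε| ≤ 3 := by
  have S := smallShock hT hε hε4
  have hs := S.s_pos
  have hc := S.hc
  have h1 := slope_bounds hT hε hε4
  have e1 : (slope T ε - soundSpeed T * amp T ε) / ε = slope T ε / soundSpeed T := by
    rw [soundSpeed_mul_amp hT, ← slope_mul hs.ne']
    have : soundSpeed T ≠ 0 := by linarith
    field_simp
    rw [show shockSpeed T ε = soundSpeed T - ε from rfl]; ring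
  rw [e1, abs_of_nonneg (div_nonneg (by linarith) (by linarith)), div_le_iff₀ (by linarith)]
  linarith

lemma dispersion_sub_bound (hT : 0 ≤ T) (hε : 0 < ε) (hε4 : ε ≤ 1 / 4) (hδ : 0 < δ) (hδ1 : δ ≤ 1) :
    |(δ / shockSpeed T ε - δ / soundSpeed T) / ε| ≤ 2 := by
  have S := smallShock hT hε hε4
  have hs := S.s_pos
  have hc := S.hc
  have hc0 : 0 < soundSpeed T := by linarith
  have hsg := S.s_ge
  have e1 : (δ / shockSpeed T ε - δ / soundSpeed T) / ε = δ / (shockSpeed T ε * soundSpeed T) := by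
    field_simp
    rw [show shockSpeed T ε = soundSpeed T - ε from rfl]; ring
  rw [e1, abs_of_nonneg (by positivity), div_le_iff₀ (by positivity)]
  nlinarith

lemma potAmp_pos (hT : 0 ≤ T) (hε : 0 < ε) (hε8 : ε ≤ 1 / 8) : 0 < potAmp T ε :=
  (amp_pos hT hε (by linarith)).trans_le (potAmp_bounds hT hε hε8).1

lemma soundSpeed_mul_potAmp_le (hT : 0 ≤ T) (hε : 0 < ε) (hε8 : ε ≤ 1 / 8) :
    soundSpeed T * potAmp T ε ≤ 3 := by
  have h1 := strength_le_quarter hT hε hε8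
  have hc := one_le_soundSpeed hT
  have hp := potAmp_pos hT hε hε8
  have h2 : soundSpeed T * (potAmp T ε * (1 - strength T ε)) ≤ soundSpeed T * amp T ε := by
    gcongr; exact (potAmp_bounds hT hε hε8).2.1
  have h3 : soundSpeed T * potAmp T ε * (3 / 4) ≤
      soundSpeed T * potAmp T ε * (1 - strength T ε) := by
    gcongr; linarith
  linarith [(soundSpeed_mul_amp_bounds hT hε).2]

lemma potAmp_sub_bound (hT : 0 ≤ T) (hε : 0 < ε) (hε8 : ε ≤ 1 / 8) :
    |(potAmp T ε - amp T ε) / ε| ≤ 8 := by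
  have h := potAmp_bounds hT hε hε8
  rw [abs_of_nonneg (div_nonneg (by linarith) hε.le), div_le_iff₀ hε]
  exact h.2.2

lemma potential_init_sub_bound (hT : 0 ≤ T) (hε : 0 < ε) (hε8 : ε ≤ 1 / 8) :
    |(-m / potAmp T ε - -m / amp T ε) / ε| ≤ 8 * |m| * soundSpeed T ^ 2 := by
  have h0 := amp_pos hT hε (by linarith : ε ≤ 1 / 4)
  have h1 := potAmp_pos hT hε hε8
  have hc := one_le_soundSpeed hT
  have hc0 : 0 < soundSpeed T := by linarith
  have hε0 := hε.ne'
  have e1 : (-m / potAmp T ε - -m / amp T ε) / ε =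
      m * ((potAmp T ε - amp T ε) / ε) * (1 / (potAmp T ε * amp T ε)) := by
    field_simp
    ring
  have h2 : 1 / (potAmp T ε * amp T ε) ≤ soundSpeed T ^ 2 := by
    have h3 := (amp_bounds hT hε (by linarith)).1
    have h4 := (potAmp_bounds hT hε hε8).1
    have h5 : 1 / soundSpeed T * (1 / soundSpeed T) ≤ potAmp T ε * amp T ε := by
      gcongr; linarith
    rw [div_le_iff₀ (by positivity)]
    calc (1 : ℝ) = soundSpeed T ^ 2 * (1 / soundSpeed T * (1 / soundSpeed T)) := by field_simp
      _ ≤ _ := by gcongr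
  rw [e1, abs_mul, abs_mul, abs_of_pos (show 0 < 1 / (potAmp T ε * amp T ε) by positivity)]
  calc |m| * |(potAmp T ε - amp T ε) / ε| * (1 / (potAmp T ε * amp T ε)) ≤
        |m| * 8 * soundSpeed T ^ 2 := by gcongr; exact potAmp_sub_bound hT hε hε8
    _ = _ := by ring

lemma velocity_init_sub_bound (hT : 0 ≤ T) (hε : 0 < ε) (hε4 : ε ≤ 1 / 4) :
    |(-m * soundSpeed T / slope T ε - -m / amp T ε) / ε| ≤ |m| := by
  have S := smallShock hT hε hε4
  have hs := S.s_pos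
  have hc := S.hc
  have hc0 : 0 < soundSpeed T := by linarith
  have h2 : 0 < 2 * soundSpeed T - ε := by linarith
  have e1 : (-m * soundSpeed T / slope T ε - -m / amp T ε) / ε =
      m * (soundSpeed T / (2 * soundSpeed T - ε)) := by
    rw [slope, amp, ← soundSpeed_sq hT]
    field_simp
    rw [show shockSpeed T ε = soundSpeed T - ε from rfl]; ring
  rw [e1, abs_mul]
  refine mul_le_of_le_one_right (abs_nonneg _) ?_
  rw [abs_of_pos (by positivity), div_le_one h2]
  linarith

end

end IonShock

namespace IonShock

/-! ### The families of profiles -/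

/-- Small values of `ε` and `δ`. -/
structure Params (ε₀ δ₀ : ℝ) where
  ε : ℝ
  δ : ℝ
  ε_pos : 0 < ε
  ε_le : ε ≤ ε₀
  δ_pos : 0 < δ
  δ_le : δ ≤ δ₀

/-- The normalised fronts of the shock profile, of the modified first-order profiles and of the
first-order profile, with bounds for their differences. -/
lemma exists_profile_families {T m α : ℝ} (hT : 0 ≤ T) (hm₁ : -(2 / soundSpeed T) < m) (hm₀ : m < 0)
    (hα₀ : 0 < α) (hα : α < 2) {η : ℝ} (hη : 0 < η) :
    ∃ a, α < a ∧ ∃ ε₀ > 0, ε₀ ≤ 1 / 8 ∧ ε₀ ≤ η ∧ ∃ δ₀ > 0, δ₀ ≤ 1 ∧ δ₀ ≤ η ∧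
    ∃ g x y gN xN yN gU xU yU gΦ xΦ yΦ g₁ x₁ y₁ : Params ε₀ δ₀ → ℝ → ℝ,
      FrontFamily a (fun t => slope T t.ε) (fun t => t.δ / shockSpeed T t.ε)
        (fun t => strength T t.ε) (fun t => t.ε * shockSpeed T t.ε) (fun t => -m / amp T t.ε) g x y ∧
      FrontFamily a (fun t => soundSpeed T * amp T t.ε) (fun t => t.δ / soundSpeed T) (fun _ => 0)
        (fun _ => 0) (fun t => -m / amp T t.ε) gN xN yN ∧
      FrontFamily a (fun t => slope T t.ε) (fun t => t.δ / soundSpeed T) (fun _ => 0)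
        (fun _ => 0) (fun t => -m * soundSpeed T / slope T t.ε) gU xU yU ∧
      FrontFamily a (fun t => soundSpeed T * potAmp T t.ε) (fun t => t.δ / soundSpeed T) (fun _ => 0)
        (fun _ => 0) (fun t => -m / potAmp T t.ε) gΦ xΦ yΦ ∧
      FrontFamily a (fun _ => 2) (fun t => t.δ / soundSpeed T) (fun _ => 0)
        (fun _ => 0) (fun _ => -m * soundSpeed T / 2) g₁ x₁ y₁ ∧
      (∀ n, Dec a n fun t z => (g t z - gN t z) / t.ε) ∧
      (∀ n, Dec a n fun t z => (gU t z - gN t z) / t.ε) ∧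
      (∀ n, Dec a n fun t z => (gΦ t z - gN t z) / t.ε) := by
  -- Two intermediate rates α < a < a₁ < 2 are used: the gap between α and a makes weighted
  -- functions square integrable, and the gap between a and a₁ is the room needed by the slow
  -- equation.
  set a := (α + 2) / 2 with ha
  set a₁ := (a + 2) / 2 with ha₁
  have haa : a < a₁ := by linarith
  have ha0 : 0 < a := by linarith
  have hc := one_le_soundSpeed hT
  have hc0 : 0 < soundSpeed T := by linarith
  have hθ : 0 < -m * soundSpeed T := mul_pos (by linarith) hc0
  have hθ1 : -m * soundSpeed T / 2 < 1 := by
    have : -m < 2 / soundSpeed T := by linarith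
    rw [lt_div_iff₀ hc0] at this
    linarith
  set μ₀ := min (-m * soundSpeed T / 4) ((1 - -m * soundSpeed T / 2) / 2) with hμ
  have hμ₀ : 0 < μ₀ := lt_min (by linarith) (by linarith)
  obtain ⟨M, hM, g, x, y, hf, hdiff⟩ := exists_frontFamily_diff ha0 haa hμ₀
  obtain ⟨ε', hε', hε'8, δ', hδ', hδ'1, H⟩ := front_params hT hm₁ hm₀ (a₁ := a₁) (by linarith) hM
  set ε₀ := min ε' η
  set δ₀ := min δ' η
  have hε₀8 : ε₀ ≤ 1 / 8 := (min_le_left _ _).trans hε'8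
  have hδ₀1 : δ₀ ≤ 1 := (min_le_left _ _).trans hδ'1
  refine ⟨a, by linarith, ε₀, by positivity, hε₀8, min_le_right _ _, δ₀, by positivity, hδ₀1,
    min_le_right _ _, ?_⟩
  have e8 : ∀ t : Params ε₀ δ₀, t.ε ≤ 1 / 8 := fun t => t.ε_le.trans hε₀8
  have e4 : ∀ t : Params ε₀ δ₀, t.ε ≤ 1 / 4 := fun t => by linarith [e8 t]
  have d1 : ∀ t : Params ε₀ δ₀, t.δ ≤ 1 := fun t => t.δ_le.trans hδ₀1
  have hs : ∀ t : Params ε₀ δ₀, 0 < shockSpeed T t.ε := fun t => (smallShock hT t.ε_pos (e4 t)).s_pos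
  have hsl := fun t : Params ε₀ δ₀ => slope_bounds hT t.ε_pos (e4 t)
  have hca := fun t : Params ε₀ δ₀ => soundSpeed_mul_amp_bounds hT t.ε_pos
  have ham := fun t : Params ε₀ δ₀ => amp_pos hT t.ε_pos (e4 t)
  have hpa := fun t : Params ε₀ δ₀ => potAmp_bounds hT t.ε_pos (e8 t)
  have hpp := fun t : Params ε₀ δ₀ => potAmp_pos hT t.ε_pos (e8 t)
  have hcp := fun t : Params ε₀ δ₀ => soundSpeed_mul_potAmp_le hT t.ε_pos (e8 t)
  have hN : ∀ t : Params ε₀ δ₀, -m * soundSpeed T / (soundSpeed T * amp T t.ε) = -m / amp T t.ε :=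
    fun t => by have := (ham t).ne'; field_simp
  have hΦ : ∀ t : Params ε₀ δ₀,
      -m * soundSpeed T / (soundSpeed T * potAmp T t.ε) = -m / potAmp T t.ε :=
    fun t => by have := (hpp t).ne'; field_simp
  have K := fun t : Params ε₀ δ₀ => H t.ε t.δ t.ε_pos
    (t.ε_le.trans (min_le_left _ _)) t.δ_pos (t.δ_le.trans (min_le_left _ _))
  have R := fun (t : Params ε₀ δ₀) (r : ℝ) (h : soundSpeed T * amp T t.ε ≤ r) (h3 : r ≤ 3) =>
    (K t).2.2.2.2.2 μ₀ hμ r (by rw [mul_comm]; exact h) h3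
  have hN3 : ∀ t : Params ε₀ δ₀, soundSpeed T * amp T t.ε ≤ 3 := fun t => by linarith [(hca t).2]
  -- The KdV-Burgers profiles share the dispersion δ / c and differ only in the slope k and in the
  -- initial value, which is -m c / k in every case.
  let kdv (k μ : Params ε₀ δ₀ → ℝ) (h1 : ∀ t, soundSpeed T * amp T t.ε ≤ k t) (h2 : ∀ t, k t ≤ 3)
      (h3 : ∀ t, -m * soundSpeed T / k t = μ t) (t : Params ε₀ δ₀) : FrontIdx a₁ μ₀ M :=
    { k := k t, e := t.δ / soundSpeed T, σ := 0, τ := 0, μ := μ t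
      le_k := (K t).2.2.2.2.1.trans (h1 t), k_le := h2 t, e_pos := div_pos t.δ_pos hc0
      e_le := (K t).2.1, σ_nonneg := le_rfl, σ_le := hM.le, τ_nonneg := le_rfl, τ_le := hM.le
      pos_or := Or.inr ⟨rfl, rfl⟩
      le_μ := by rw [← h3]; exact (R t _ (h1 t) (h2 t)).1
      μ_le := by rw [← h3]; exact (R t _ (h1 t) (h2 t)).2 }
  -- The initial value is that of the modified density front, which is what gives n_R(0) = 0.
  let iP (t : Params ε₀ δ₀) : FrontIdx a₁ μ₀ M :=
    { k := slope T t.ε, e := t.δ / shockSpeed T t.ε, σ := strength T t.ε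
      τ := t.ε * shockSpeed T t.ε, μ := -m / amp T t.ε
      le_k := by linarith [(hsl t).1], k_le := (hsl t).2, e_pos := div_pos t.δ_pos (hs t)
      e_le := (K t).1, σ_nonneg := (strength_pos hT t.ε_pos (e4 t)).le, σ_le := (K t).2.2.1
      τ_nonneg := (mul_pos t.ε_pos (hs t)).le, τ_le := (K t).2.2.2.1
      pos_or := Or.inl (mul_pos t.ε_pos (hs t))
      le_μ := by rw [← hN]; exact (R t _ le_rfl (hN3 t)).1
      μ_le := by rw [← hN]; exact (R t _ le_rfl (hN3 t)).2 }
  let iN := kdv (fun t => soundSpeed T * amp T t.ε) (fun t => -m / amp T t.ε) (fun t => le_rfl) hN3 hN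
  let iU := kdv (fun t => slope T t.ε) (fun t => -m * soundSpeed T / slope T t.ε)
    (fun t => (hca t).2.trans (hsl t).1) (fun t => (hsl t).2) (fun t => rfl)
  let iΦ := kdv (fun t => soundSpeed T * potAmp T t.ε) (fun t => -m / potAmp T t.ε)
    (fun t => mul_le_mul_of_nonneg_left (hpa t).1 hc0.le) hcp hΦ
  let i₁ := kdv (fun _ => 2) (fun _ => -m * soundSpeed T / 2) (fun t => (hca t).2)
    (fun _ => by norm_num) (fun _ => rfl)
  have z0 : Bd fun _ : Params ε₀ δ₀ => (0 : ℝ) := Bd.const 0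
  have zd : Bd fun t : Params ε₀ δ₀ => (0 : ℝ) / t.ε := by simpa using z0
  refine ⟨_, _, _, _, _, _, _, _, _, _, _, _, _, _, _, hf.reindex iP, hf.reindex iN, hf.reindex iU,
    hf.reindex iΦ, hf.reindex i₁, ?_, ?_, ?_⟩
  · refine hdiff iP iN (fun t => t.ε) (fun t => t.ε_pos) (fun t => ⟨rfl, rfl⟩)
      ⟨3, fun t => slope_sub_bound hT t.ε_pos (e4 t)⟩
      ⟨2, fun t => dispersion_sub_bound hT t.ε_pos (e4 t) t.δ_pos (d1 t)⟩ ⟨2, fun t => ?_⟩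
      ⟨soundSpeed T, fun t => ?_⟩ ⟨0, fun t => ?_⟩
    · have h1 := t.ε_pos.ne'
      simp only [iP]
      rw [strength, mul_div_cancel_left₀ _ h1, abs_of_pos (ham t)]
      exact amp_le_two hT t.ε_pos (e4 t)
    · have h1 := t.ε_pos.ne'
      simp only [iP]
      rw [mul_div_cancel_left₀ _ h1, abs_of_pos (hs t)]
      exact (smallShock hT t.ε_pos (e4 t)).s_lt.le
    · simp [iP, iN, kdv]
  · refine hdiff iU iN (fun t => t.ε) (fun t => t.ε_pos) (fun t => ⟨rfl, rfl⟩)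
      ⟨3, fun t => slope_sub_bound hT t.ε_pos (e4 t)⟩ ?_ zd zd
      ⟨_, fun t => velocity_init_sub_bound hT t.ε_pos (e4 t)⟩
    simpa [iU, iN, kdv] using z0
  · refine hdiff iΦ iN (fun t => t.ε) (fun t => t.ε_pos) (fun t => ⟨rfl, rfl⟩)
      ⟨soundSpeed T * 8, fun t => ?_⟩ ?_ zd zd
      ⟨_, fun t => potential_init_sub_bound hT t.ε_pos (e8 t)⟩
    · have := potAmp_sub_bound hT t.ε_pos (e8 t)
      simp only [iΦ, iN, kdv]
      rw [← mul_sub, mul_div_assoc, abs_mul, abs_of_pos hc0]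
      gcongr
    · simpa [iΦ, iN, kdv] using z0

end IonShock

/-! ### Profiles built from fronts, and uniqueness of the first-order profiles. -/

namespace IonShock

lemma tendsto_ew_atTop {a : ℝ} (ha : 0 < a) : Tendsto (ew a) atTop (𝓝 0) :=
  Real.tendsto_exp_neg_atTop_nhds_zero.comp (tendsto_abs_atTop_atTop.const_mul_atTop ha)

lemma tendsto_ew_atBot {a : ℝ} (ha : 0 < a) : Tendsto (ew a) atBot (𝓝 0) :=
  Real.tendsto_exp_neg_atTop_nhds_zero.comp (tendsto_abs_atBot_atTop.const_mul_atTop ha)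

section
variable {ι : Type*} {a : ℝ} {n : ℕ} {f : ι → ℝ → ℝ}

lemma Dec.tendsto_atTop (ha : 0 < a) (hf : Dec a n f) (i : ι) : Tendsto (f i) atTop (𝓝 0) := by
  obtain ⟨C, hC⟩ := hf.bound
  exact squeeze_zero_norm (hC i) (by simpa using (tendsto_ew_atTop ha).const_mul C)

lemma Dec.tendsto_atBot (ha : 0 < a) (hf : Dec a n f) (i : ι) : Tendsto (f i) atBot (𝓝 0) := by
  obtain ⟨C, hC⟩ := hf.bound
  exact squeeze_zero_norm (hC i) (by simpa using (tendsto_ew_atBot ha).const_mul C)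

lemma FrontFamily.tendsto {k e σ τ μ : ι → ℝ} {g x y : ι → ℝ → ℝ}
    (h : FrontFamily a k e σ τ μ g x y) (ha : 0 < a) (i : ι) :
    Tendsto (g i) atBot (𝓝 0) ∧ Tendsto (g i) atTop (𝓝 1) := by
  obtain ⟨B, hB, H⟩ := h.tails
  constructor
  · refine squeeze_zero_norm' (a := fun z => B * ew a z) ?_
      (by simpa using (tendsto_ew_atBot ha).const_mul B)
    filter_upwards [eventually_le_atBot 0] with z hz using (H i z).2 hz
  · have h1 : Tendsto (fun z => 1 - g i z) atTop (𝓝 0) := by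
      refine squeeze_zero_norm' (a := fun z => B * ew a z) ?_
        (by simpa using (tendsto_ew_atTop ha).const_mul B)
      filter_upwards [eventually_ge_atTop 0] with z hz using (H i z).1 hz
    simpa using h1.const_sub 1

end

lemma IsKdVBurgersFront.of_frontSys {c b d e r k e' : ℝ} {g x y : ℝ → ℝ} (hd : 0 < d)
    (he : 0 < e') (hb : 0 < b) (h : IsFrontSys k e' 0 0 g x y) (hl : Tendsto g atBot (𝓝 0))
    (hr : Tendsto g atTop (𝓝 1)) (hk : d * k = c) (he' : d * e' = e) (hr' : r = -(c / b)) :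
    IsKdVBurgersFront c b d e r (fun z => r * g z) := by
  subst hk he' hr'
  exact isKdVBurgersFront_of_frontSys hd he hb h hl hr

/-- The first-order profile attached to a normalised front. -/
noncomputable def firstTriple (T : ℝ) (g : ℝ → ℝ) : Triple where
  n := fun z => -(2 / soundSpeed T) * g z
  u := fun z => -2 * g z
  φ := fun z => -(2 / soundSpeed T) * g z

/-- The modified first-order profile attached to normalised fronts. -/
noncomputable def modifiedTriple (T ε : ℝ) (gN gU gΦ : ℝ → ℝ) : Triple where
  n := fun z => 1 / ε * (nPlus T ε - 1) * gN z
  u := fun z => 1 / ε * uPlus T ε * gU z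
  φ := fun z => 1 / ε * phiPlus T ε * gΦ z

/-- The remainder in the expansion of `p`. -/
noncomputable def remainder (ε : ℝ) (q p : Triple) : Triple where
  n := fun z => (p.n z - 1 - ε * q.n z) / ε ^ 2
  u := fun z => (p.u z - ε * q.u z) / ε ^ 2
  φ := fun z => (p.φ z - ε * q.φ z) / ε ^ 2

/-- The first-order profiles cancel against the second-order correction, so the expansion merely
defines the remainder. Its uniqueness therefore reduces to that of the shock profile. -/
lemma hasExpansion_iff {ε : ℝ} {p₁ q r p : Triple} (hε : ε ≠ 0) :
    HasExpansion ε p₁ (secondOrder ε p₁ q) r p ↔ r = remainder ε q p := by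
  constructor
  · intro h
    ext z
    · simp only [remainder, h.n_eq, secondOrder]; field_simp; ring
    · simp only [remainder, h.u_eq, secondOrder]; field_simp; ring
    · simp only [remainder, h.φ_eq, secondOrder]; field_simp; ring
  · rintro rfl
    refine ⟨fun z => ?_, fun z => ?_, fun z => ?_⟩ <;>
    · simp only [remainder, secondOrder]; field_simp; ring

section
variable {T ε δ m : ℝ}

lemma uPlus_div (hε : ε ≠ 0) (hT : 0 ≤ T) (hs : shockSpeed T ε ≠ 0) :
    1 / ε * uPlus T ε = -slope T ε := by
  have : T + 1 ≠ 0 := by linarith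
  rw [uPlus, nPlus, slope, ← soundSpeed_sq hT]
  rw [← soundSpeed_sq hT] at this
  field_simp
  rw [show shockSpeed T ε = soundSpeed T - ε from rfl]
  ring

lemma phiPlus_div : 1 / ε * phiPlus T ε = -potAmp T ε := by rw [potAmp, neg_neg]

/-- This is the purpose of a_ε: the linear coefficient becomes T + 1 times the amplitude of the
potential, so the prescribed far field is an equilibrium of the modified equation. -/
lemma potential_coeff (hT : 0 ≤ T) :
    soundSpeed T * (soundSpeed T * potAmp T ε) = 2 * soundSpeed T - aCoeff T ε * (T + 1) := by
  have hc := one_le_soundSpeed hT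
  have hc0 : soundSpeed T ≠ 0 := by linarith
  rw [potAmp, aCoeff, phiPlus, nPlus]
  generalize Real.log (shockSpeed T ε ^ 2 / (T + 1)) = L
  rw [← soundSpeed_sq hT]
  field_simp
  ring

lemma velocity_coeff (hs : shockSpeed T ε ≠ 0) : slope T ε = 2 + ε / (soundSpeed T - ε) := by
  rw [slope]
  have h : shockSpeed T ε = soundSpeed T - ε := rfl
  rw [← h]
  field_simp
  rw [h]; ring

lemma isFirstOrder_firstTriple (hT : 0 ≤ T) (hδ : 0 < δ) {g x y : ℝ → ℝ}
    (h : IsFrontSys 2 (δ / soundSpeed T) 0 0 g x y) (h0 : g 0 = -m * soundSpeed T / 2)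
    (hl : Tendsto g atBot (𝓝 0)) (hr : Tendsto g atTop (𝓝 1)) :
    IsFirstOrder T δ m (firstTriple T g) := by
  have hc := one_le_soundSpeed hT
  have hc0 : 0 < soundSpeed T := by linarith
  have hf : IsKdVBurgersFront (2 * soundSpeed T) (T + 1) (soundSpeed T) δ (-(2 / soundSpeed T))
      (fun z => -(2 / soundSpeed T) * g z) :=
    IsKdVBurgersFront.of_frontSys hc0 (div_pos hδ hc0) (by linarith) h hl hr (by ring)
      (by field_simp) (by rw [← soundSpeed_sq hT]; field_simp)
  refine ⟨hf, ?_, hf, fun z => ?_, fun z => rfl, ?_⟩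
  · exact IsKdVBurgersFront.of_frontSys one_pos (div_pos hδ hc0) one_pos h hl hr (by ring)
      (by ring) (by ring)
  · simp only [firstTriple]; field_simp
  · simp only [firstTriple, h0]; field_simp

lemma isModifiedFirstOrder_modifiedTriple (hT : 0 ≤ T) (hε : 0 < ε) (hε8 : ε ≤ 1 / 8) (hδ : 0 < δ)
    {g₁ gN xN yN gU xU yU gΦ xΦ yΦ : ℝ → ℝ} (h₁ : g₁ 0 = -m * soundSpeed T / 2)
    (hN : IsFrontSys (soundSpeed T * amp T ε) (δ / soundSpeed T) 0 0 gN xN yN)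
    (hU : IsFrontSys (slope T ε) (δ / soundSpeed T) 0 0 gU xU yU)
    (hΦ : IsFrontSys (soundSpeed T * potAmp T ε) (δ / soundSpeed T) 0 0 gΦ xΦ yΦ)
    (iN : gN 0 = -m / amp T ε) (iU : gU 0 = -m * soundSpeed T / slope T ε)
    (iΦ : gΦ 0 = -m / potAmp T ε)
    (lN : Tendsto gN atBot (𝓝 0) ∧ Tendsto gN atTop (𝓝 1))
    (lU : Tendsto gU atBot (𝓝 0) ∧ Tendsto gU atTop (𝓝 1))
    (lΦ : Tendsto gΦ atBot (𝓝 0) ∧ Tendsto gΦ atTop (𝓝 1)) :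
    IsModifiedFirstOrder T ε δ (firstTriple T g₁) (modifiedTriple T ε gN gU gΦ) := by
  have S := smallShock hT hε (by linarith)
  have hs := S.s_pos.ne'
  have hc := S.hc
  have hc0 : 0 < soundSpeed T := by linarith
  have ha := (amp_pos hT hε (by linarith)).ne'
  have hp := (potAmp_pos hT hε hε8).ne'
  have hk : slope T ε ≠ 0 := by linarith [(slope_bounds hT hε (by linarith)).1]
  have hT1 : 0 < T + 1 := by linarith
  have he := div_pos hδ hc0
  refine ⟨?_, ?_, ?_, ?_, ?_, ?_⟩
  · refine IsKdVBurgersFront.of_frontSys hc0 he hT1 hN lN.1 lN.2 ?_ (by field_simp)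
      (nPlus_sub_one hT hε.ne')
    rw [soundSpeed_mul_amp hT]; field_simp
  · refine IsKdVBurgersFront.of_frontSys one_pos he one_pos hU lU.1 lU.2 ?_ (by ring) ?_
    · rw [one_mul, velocity_coeff hs]
    · rw [uPlus_div hε.ne' hT hs, velocity_coeff hs, div_one]
  · refine IsKdVBurgersFront.of_frontSys hc0 he hT1 hΦ lΦ.1 lΦ.2 (potential_coeff hT) (by field_simp) ?_
    rw [phiPlus_div, ← potential_coeff hT, ← soundSpeed_sq hT]
    field_simp
  · simp only [modifiedTriple, firstTriple, iN, h₁, nPlus_sub_one hT hε.ne']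
    rw [← amp]; field_simp
  · simp only [modifiedTriple, firstTriple, iU, h₁, uPlus_div hε.ne' hT hs]
    field_simp
  · simp only [modifiedTriple, firstTriple, iΦ, h₁, phiPlus_div]
    field_simp

end

/-- Uniqueness of the first-order profiles and of the modified ones. -/
lemma first_order_unique : ∃ M > 0, ∀ T ε δ m : ℝ, 0 ≤ T → 0 < ε → ε ≤ 1 / 8 → 0 < δ → δ ≤ M →
    (∀ p p', IsFirstOrder T δ m p → IsFirstOrder T δ m p' → p' = p) ∧
    ∀ p₁ p p', IsModifiedFirstOrder T ε δ p₁ p → IsModifiedFirstOrder T ε δ p₁ p' → p' = p := by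
  obtain ⟨M, hM, H⟩ := kdv_front_unique
  refine ⟨M, hM, fun T ε δ m hT hε hε8 hδ hδM => ?_⟩
  have S := smallShock hT hε (by linarith)
  have hs := S.s_pos.ne'
  have hc := S.hc
  have hc0 : 0 < soundSpeed T := by linarith
  have hT1 : 0 < T + 1 := by linarith
  have heM : δ / soundSpeed T ≤ M := (div_le_self hδ.le hc).trans hδM
  constructor
  · intro p p' h h'
    have hn : p'.n = p.n := H _ _ _ _ _ _ _ (by linarith) hT1 hc0 hδ
      (by rw [← soundSpeed_sq hT]; field_simp) (by rw [mul_div_cancel_right₀ _ hc0.ne']; norm_num)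
      heM h'.front_n h.front_n (by rw [h.shift, h'.shift])
    ext z
    · rw [hn]
    · rw [h.u_eq, h'.u_eq, hn]
    · rw [h.φ_eq, h'.φ_eq, hn]
  · intro p₁ p p' h h'
    have hk := slope_bounds hT hε (by linarith)
    have hpp := potAmp_pos hT hε hε8
    have hn : p'.n = p.n := H _ _ _ _ _ _ _ (by linarith) hT1 hc0 hδ (nPlus_sub_one hT hε.ne')
      (by rw [div_le_iff₀ hc0]; linarith) heM h'.front_n h.front_n (by rw [h.shift_n, h'.shift_n])
    have hu : p'.u = p.u := H _ _ _ _ _ _ _ (by rw [← velocity_coeff hs]; linarith) one_pos one_pos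
      (div_pos hδ hc0) (by rw [uPlus_div hε.ne' hT hs, velocity_coeff hs, div_one])
      (by rw [← velocity_coeff hs, div_one]; exact hk.2) (by rw [div_one]; exact heM)
      h'.front_u h.front_u (by rw [h.shift_u, h'.shift_u])
    have hφ : p'.φ = p.φ := H _ _ _ _ _ _ _ (by rw [← potential_coeff hT]; positivity) hT1 hc0 hδ
      (by rw [phiPlus_div, ← potential_coeff hT, ← soundSpeed_sq hT]; field_simp)
      (by rw [← potential_coeff hT, mul_div_cancel_left₀ _ hc0.ne']
          exact soundSpeed_mul_potAmp_le hT hε hε8) heM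
      h'.front_φ h.front_φ (by rw [h.shift_φ, h'.shift_φ])
    ext z
    · rw [hn]
    · rw [hu]
    · rw [hφ]

end IonShock

namespace IonShock

/-! ### Decay of the remainder -/

lemma IsFrontSys.y_eq {k e σ τ : ℝ} {g x y : ℝ → ℝ} (h : IsFrontSys k e σ τ g x y)
    (hx : ContDiff ℝ ∞ x) (z : ℝ) :
    y z = deriv g z + τ * deriv x z + σ * ((g z + τ * x z) * y z) := by
  have h2 := ((contDiff_hasDerivAt hx z).const_mul τ).unique (h.hx z)
  have h3 := (h.hg z).deriv
  unfold fastPert at h2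
  rw [h3]
  linarith

section
variable {T a ε₀ δ₀ : ℝ} {g x y gN xN yN gU xU yU gΦ xΦ yΦ : Params ε₀ δ₀ → ℝ → ℝ}
  {μ : Params ε₀ δ₀ → ℝ}

lemma FrontFamily.density_lower (hT : 0 ≤ T) (hε₀ : ε₀ ≤ 1 / 8)
    (h : FrontFamily a (fun t : Params ε₀ δ₀ => slope T t.ε) (fun t => t.δ / shockSpeed T t.ε)
      (fun t => strength T t.ε) (fun t => t.ε * shockSpeed T t.ε) μ g x y) (t : Params ε₀ δ₀) (z : ℝ) :
    5 / 8 ≤ 1 - strength T t.ε * g t z := by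
  have e8 := t.ε_le.trans hε₀
  have h1 := strength_le_quarter hT t.ε_pos e8
  have h2 := strength_pos hT t.ε_pos (by linarith)
  have h3 := (abs_le.mp (h.le t z)).2
  have h4 : strength T t.ε * g t z ≤ strength T t.ε * (3 / 2) := by gcongr
  linarith

lemma FrontFamily.isShockProfile (hT : 0 ≤ T) (ha : 0 < a) (hε₀ : ε₀ ≤ 1 / 8)
    (h : FrontFamily a (fun t : Params ε₀ δ₀ => slope T t.ε) (fun t => t.δ / shockSpeed T t.ε)
      (fun t => strength T t.ε) (fun t => t.ε * shockSpeed T t.ε) μ g x y) (t : Params ε₀ δ₀) :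
    IsShockProfile T t.ε t.δ (shockTriple T t.ε (g t) (x t)) := by
  have e8 := t.ε_le.trans hε₀
  have hs := (smallShock hT t.ε_pos (by linarith : t.ε ≤ 1 / 4)).s_pos
  refine isShockProfile_of_frontSys hT t.ε_pos t.δ_pos hs (h.sys t)
    (fun z => by linarith [h.density_lower hT hε₀ t z])
    (fun z => by linarith [h.density_lower hT hε₀ t z, (abs_le.mp (h.small t z)).2])
    (h.tendsto ha t).1 (h.tendsto ha t).2 ((h.dec_x 0).tendsto_atBot ha t)
    ((h.dec_x 0).tendsto_atTop ha t)

lemma bd_amp (hT : 0 ≤ T) (hε₀ : ε₀ ≤ 1 / 8) : Bd fun t : Params ε₀ δ₀ => amp T t.ε :=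
  ⟨2, fun t => by
    have e8 := t.ε_le.trans hε₀
    rw [abs_of_pos (amp_pos hT t.ε_pos (by linarith))]
    exact amp_le_two hT t.ε_pos (by linarith)⟩

lemma bd_shockSpeed (hT : 0 ≤ T) (hε₀ : ε₀ ≤ 1 / 8) : Bd fun t : Params ε₀ δ₀ => shockSpeed T t.ε :=
  ⟨soundSpeed T, fun t => by
    have e8 := t.ε_le.trans hε₀
    have S := smallShock hT t.ε_pos (by linarith : t.ε ≤ 1 / 4)
    rw [abs_of_pos S.s_pos]
    exact S.s_lt.le⟩

lemma bd_strength (hT : 0 ≤ T) (hε₀ : ε₀ ≤ 1 / 8) : Bd fun t : Params ε₀ δ₀ => strength T t.ε :=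
  ⟨1 / 4, fun t => by
    have e8 := t.ε_le.trans hε₀
    rw [abs_of_pos (strength_pos hT t.ε_pos (by linarith))]
    exact strength_le_quarter hT t.ε_pos e8⟩

lemma bd_eps (hε₀ : ε₀ ≤ 1 / 8) : Bd fun t : Params ε₀ δ₀ => t.ε :=
  ⟨1 / 8, fun t => by rw [abs_of_pos t.ε_pos]; exact t.ε_le.trans hε₀⟩

/-- Both densities have the same amplitude, so n_R is minus the amplitude times the difference
quotient (g - g_N) / ε. -/
lemma remainder_density_dec (hT : 0 ≤ T) (hε₀ : ε₀ ≤ 1 / 8) {n : ℕ}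
    (h : Dec a n fun t z => (g t z - gN t z) / t.ε) :
    Dec a n fun t => (remainder t.ε (modifiedTriple T t.ε (gN t) (gU t) (gΦ t))
      (shockTriple T t.ε (g t) (x t))).n :=
  (Dec.smul (bd_amp hT hε₀).neg h).congr fun t z => by
    have := t.ε_pos.ne'
    simp only [remainder, modifiedTriple, shockTriple, nPlus_sub_one hT this, strength]
    rw [show (2 * soundSpeed T - t.ε) / (T + 1) = amp T t.ε from rfl]
    field_simp
    ring

/-- Since s (1 - 1 / n) = -k ε (1 - σ) g / n, one finds u_R = (k / n) ((g_U - g) / ε + amp · g (1 -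
g_U)). The last product decays because it differs from g (1 - g) by g times a decaying difference.
-/
lemma remainder_velocity_dec (hT : 0 ≤ T) (hε₀ : ε₀ ≤ 1 / 8) {n : ℕ} {k' e' σ' τ' μ'}
    (h : FrontFamily a (fun t : Params ε₀ δ₀ => slope T t.ε) (fun t => t.δ / shockSpeed T t.ε)
      (fun t => strength T t.ε) (fun t => t.ε * shockSpeed T t.ε) μ g x y)
    (hU : FrontFamily a k' e' σ' τ' μ' gU xU yU)
    (hd : Dec a n fun t z => (gU t z - g t z) / t.ε) :
    Dec a n fun t => (remainder t.ε (modifiedTriple T t.ε (gN t) (gU t) (gΦ t))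
      (shockTriple T t.ε (g t) (x t))).u := by
  have e8 : ∀ t : Params ε₀ δ₀, t.ε ≤ 1 / 8 := fun t => t.ε_le.trans hε₀
  have hk : Bd fun t : Params ε₀ δ₀ => slope T t.ε := ⟨3, fun t => by
    have := slope_bounds hT t.ε_pos (by linarith [e8 t])
    rw [abs_of_nonneg (by linarith)]; exact this.2⟩
  have hk' : Bd fun t : Params ε₀ δ₀ => 1 / slope T t.ε := ⟨1, fun t => by
    have := slope_bounds hT t.ε_pos (by linarith [e8 t])
    rw [abs_of_nonneg (by apply one_div_nonneg.mpr; linarith), div_le_one (by linarith)]; linarith⟩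
  have hinv : Dec 0 n fun t z => (1 - strength T t.ε * g t z)⁻¹ :=
    (Dec.const_sub (Bd.const 1) (Dec.smul (bd_strength hT hε₀) (h.dec_g n))).inv
      (by norm_num : (0 : ℝ) < 5 / 8) fun t z => h.density_lower hT hε₀ t z
  have hq : Dec a n fun t z => g t z * (1 - gU t z) :=
    ((Dec.smul hk' (h.dec_prod n)).sub ((h.dec_g n).bdd_mul (hU.sub_dec h n))).congr fun t z => by
      have : slope T t.ε ≠ 0 := by linarith [(slope_bounds hT t.ε_pos (by linarith [e8 t])).1]
      field_simp
      ring
  refine (Dec.smul hk (hinv.bdd_mul (hd.add (Dec.smul (bd_amp hT hε₀) hq)))).congr fun t z => ?_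
  have hε := t.ε_pos.ne'
  have S := smallShock hT t.ε_pos (by linarith [e8 t] : t.ε ≤ 1 / 4)
  have hs := S.s_pos.ne'
  have hc : soundSpeed T ≠ 0 := by linarith [S.hc]
  have h0 : 1 - strength T t.ε * g t z ≠ 0 := by linarith [h.density_lower hT hε₀ t z]
  simp only [remainder, modifiedTriple, shockTriple, uPlus_div hε hT hs]
  have e1 : shockSpeed T t.ε * (1 - 1 / (1 - strength T t.ε * g t z)) =
      -(slope T t.ε * (t.ε * ((1 - strength T t.ε) * g t z * (1 - strength T t.ε * g t z)⁻¹))) := by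
    have e2 : slope T t.ε * (t.ε * (1 - strength T t.ε)) = shockSpeed T t.ε * strength T t.ε := by
      rw [one_sub_strength hT, nPlus, slope, strength, amp]
      have : T + 1 ≠ 0 := by linarith
      field_simp
    have e3 : slope T t.ε * (t.ε * ((1 - strength T t.ε) * g t z * (1 - strength T t.ε * g t z)⁻¹)) =
      slope T t.ε * (t.ε * (1 - strength T t.ε)) * (g t z * (1 - strength T t.ε * g t z)⁻¹) := by ring
    rw [e3, e2]
    field_simp
    ring
  rw [e1]
  have e4 : strength T t.ε = t.ε * amp T t.ε := rfl
  rw [e4] at h0 ⊢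
  field_simp
  ring

/-- Working with φ' = -σ y avoids expanding the logarithm: φ_R' combines the quotient of the
potential fronts, the O(ε) discrepancy of amplitudes, and y - g', which the fast equation shows to
be O(ε). As both potentials have the same limits, φ_R vanishes at ± ∞ and inherits the decay of its
derivative. -/
lemma remainder_potential_dec (hT : 0 ≤ T) (ha : 0 < a) (hε₀ : ε₀ ≤ 1 / 8)
    {k' e' σ' τ' μ'}
    (h : FrontFamily a (fun t : Params ε₀ δ₀ => slope T t.ε) (fun t => t.δ / shockSpeed T t.ε)
      (fun t => strength T t.ε) (fun t => t.ε * shockSpeed T t.ε) μ g x y)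
    (hΦ : FrontFamily a k' e' σ' τ' μ' gΦ xΦ yΦ)
    (hd : ∀ n, Dec a n fun t z => (gΦ t z - g t z) / t.ε) (n : ℕ) :
    Dec a n fun t => (remainder t.ε (modifiedTriple T t.ε (gN t) (gU t) (gΦ t))
      (shockTriple T t.ε (g t) (x t))).φ := by
  have e8 : ∀ t : Params ε₀ δ₀, t.ε ≤ 1 / 8 := fun t => t.ε_le.trans hε₀
  have hP := h.isShockProfile hT ha hε₀
  have sP : ∀ t, ContDiff ℝ ∞ (shockTriple T t.ε (g t) (x t)).φ := fun t => (hP t).smooth_φ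
  have sΦ : ∀ t, ContDiff ℝ ∞ (gΦ t) := fun t => (hΦ.dec_g 0).smooth t
  have sg : ∀ t, ContDiff ℝ ∞ (g t) := fun t => (h.dec_g 0).smooth t
  have sx : ∀ t, ContDiff ℝ ∞ (x t) := fun t => (h.dec_x 0).smooth t
  have hτ : Bd fun t : Params ε₀ δ₀ => t.ε * shockSpeed T t.ε :=
    (bd_eps hε₀).mul (bd_shockSpeed hT hε₀)
  have hpa : Bd fun t : Params ε₀ δ₀ => (potAmp T t.ε - amp T t.ε) / t.ε :=
    ⟨8, fun t => potAmp_sub_bound hT t.ε_pos (e8 t)⟩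
  -- the derivative of the potential of the shock profile
  have dP : ∀ t z, deriv (shockTriple T t.ε (g t) (x t)).φ z = -(strength T t.ε * y t z) := fun t z =>
    (hasDerivAt_shock_potential (h.sys t) (fun z => by
      linarith [h.density_lower hT hε₀ t z, (abs_le.mp (h.small t z)).2]) z).deriv
  have dR : ∀ t z, deriv (remainder t.ε (modifiedTriple T t.ε (gN t) (gU t) (gΦ t))
      (shockTriple T t.ε (g t) (x t))).φ z =
      (-(strength T t.ε * y t z) - t.ε * (1 / t.ε * phiPlus T t.ε * deriv (gΦ t) z)) / t.ε ^ 2 := by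
    intro t z
    rw [← dP]
    exact (((contDiff_hasDerivAt (sP t) z).fun_sub
      (((contDiff_hasDerivAt (sΦ t) z).const_mul _).const_mul t.ε)).div_const _).deriv
  have dD : ∀ t z, deriv (fun z => (gΦ t z - g t z) / t.ε) z =
      (deriv (gΦ t) z - deriv (g t) z) / t.ε := fun t z =>
    (((contDiff_hasDerivAt (sΦ t) z).fun_sub (contDiff_hasDerivAt (sg t) z)).div_const _).deriv
  have key : Dec a n fun t => deriv (remainder t.ε (modifiedTriple T t.ε (gN t) (gU t) (gΦ t))
      (shockTriple T t.ε (g t) (x t))).φ := by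
    refine (((Dec.smul hpa (hΦ.dec_deriv n)).add (Dec.smul (bd_amp hT hε₀) (hd (n + 1)).deriv)).sub
      (Dec.smul (bd_amp hT hε₀) ((Dec.smul (bd_shockSpeed hT hε₀) (h.dec_x (n + 1)).deriv).add
        (Dec.smul (bd_amp hT hε₀) (((h.dec_g n).add ((Dec.smul hτ (h.dec_x n)).mono ha.le)).bdd_mul
          (h.dec_y n)))))).congr fun t z => ?_
    have hε := t.ε_pos.ne'
    have hy := (h.sys t).y_eq (sx t) z
    rw [dR, dD, phiPlus_div]
    set Y := (g t z + t.ε * shockSpeed T t.ε * x t z) * y t z with hY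
    have e1 : deriv (g t) z = y t z - t.ε * shockSpeed T t.ε * deriv (x t) z - strength T t.ε * Y := by
      linarith
    rw [e1]
    have e4 : strength T t.ε = t.ε * amp T t.ε := rfl
    rw [e4]
    field_simp
    ring
  refine (dec_of_deriv ha (fun t => ?_) key (fun t => ?_) fun t => ?_).pred
  · exact ((sP t).sub (contDiff_const.mul (contDiff_const.mul (sΦ t)))).div_const _
  · have h1 := (((hP t).left_φ).sub ((((hΦ.tendsto ha t).1).const_mul
      (1 / t.ε * phiPlus T t.ε)).const_mul t.ε)).div_const (t.ε ^ 2)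
    have e1 : (0 - t.ε * (1 / t.ε * phiPlus T t.ε * 0)) / t.ε ^ 2 = 0 := by simp
    rw [e1] at h1
    exact h1
  · have h1 := (((hP t).right_φ).sub ((((hΦ.tendsto ha t).2).const_mul
      (1 / t.ε * phiPlus T t.ε)).const_mul t.ε)).div_const (t.ε ^ 2)
    have hε := t.ε_pos.ne'
    have e1 : (phiPlus T t.ε - t.ε * (1 / t.ε * phiPlus T t.ε * 1)) / t.ε ^ 2 = 0 := by
      field_simp; ring
    rw [e1] at h1
    exact h1

end

end IonShock

/-! ### The main theorem. -/

theorem theorem1p2 (T α m : ℝ) (hT : 0 ≤ T) (hα₀ : 0 < α) (hα₂ : α < 2)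
    (hm₁ : -(2 / Real.sqrt (T + 1)) < m) (hm₀ : m < 0) :
    ∃ ε₀ > (0 : ℝ), ∃ δ₀ > (0 : ℝ), ∃ c₁ > (0 : ℝ), ∃ c₂ > (0 : ℝ), ∃ C : ℕ → ℝ, (∀ k, 0 < C k) ∧
      ∀ ε μbar lbar δ : ℝ, 0 < ε → ε ≤ ε₀ → 0 < μbar → 0 < lbar →
        δ = lbar ^ 2 / μbar ^ 2 → δ ≤ δ₀ →
        -- the shock strength is of order `ε`
        (c₁ * ε ≤ 1 - IonShock.nPlus T ε ∧ 1 - IonShock.nPlus T ε ≤ c₂ * ε) ∧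
        -- the first-order KdV-Burgers profiles
        ∃ p₁ : IonShock.Triple, IonShock.IsFirstOrder T δ m p₁ ∧
          (∀ p₁' : IonShock.Triple, IonShock.IsFirstOrder T δ m p₁' → p₁' = p₁) ∧
        -- their modified version
        ∃ pε : IonShock.Triple, IonShock.IsModifiedFirstOrder T ε δ p₁ pε ∧
          (∀ pε' : IonShock.Triple, IonShock.IsModifiedFirstOrder T ε δ p₁ pε' → pε' = pε) ∧
        -- the shock profile `p` and the remainder `pR`
        ∃ p pR : IonShock.Triple,
          (IonShock.IsShockProfile T ε δ p ∧
            IonShock.HasExpansion ε p₁ (IonShock.secondOrder ε p₁ pε) pR p ∧ pR.n 0 = 0) ∧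
          (∀ p' pR' : IonShock.Triple, IonShock.IsShockProfile T ε δ p' →
            IonShock.HasExpansion ε p₁ (IonShock.secondOrder ε p₁ pε) pR' p' → pR'.n 0 = 0 →
            p' = p ∧ pR' = pR) ∧
          IonShock.SolvesRemainderSystem T ε δ p₁ pε pR ∧
          ∀ k : ℕ, 2 ≤ k →
            IonShock.normX ε δ α k pR.n pR.φ ≤ ENNReal.ofReal (C k) ∧
            IonShock.normH α k pR.u ≤ ENNReal.ofReal (C k) := by
  open IonShock in
  obtain ⟨ε₂, hε₂, δ₂, hδ₂, huniq⟩ := shock_unique hT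
  obtain ⟨M, hM, hfirst⟩ := first_order_unique
  -- The thresholds are taken below those of both uniqueness results, so existence, estimates and
  -- uniqueness hold in the same parameter range.
  obtain ⟨a, haα, ε₀, hε₀, hε₀8, hε₀η, δ₀, hδ₀, hδ₀1, hδ₀η, g, x, y, gN, xN, yN, gU, xU, yU, gΦ, xΦ,
    yΦ, g₁, x₁, y₁, F, FN, FU, FΦ, F₁, DN, DU, DΦ⟩ := exists_profile_families hT hm₁ hm₀ hα₀ hα₂
      (η := min ε₂ (min δ₂ M)) (by positivity)
  have ha : 0 < a := hα₀.trans haα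
  have hc := one_le_soundSpeed hT
  have hR : ∀ n, Dec a n fun t => (remainder t.ε (modifiedTriple T t.ε (gN t) (gU t) (gΦ t))
      (shockTriple T t.ε (g t) (x t))).n := fun n => remainder_density_dec hT hε₀8 (DN n)
  have hU : ∀ n, Dec a n fun t => (remainder t.ε (modifiedTriple T t.ε (gN t) (gU t) (gΦ t))
      (shockTriple T t.ε (g t) (x t))).u := fun n => remainder_velocity_dec hT hε₀8 F FU
    (((DU n).sub (DN n)).congr fun t z => by ring)
  have hΦ : ∀ n, Dec a n fun t => (remainder t.ε (modifiedTriple T t.ε (gN t) (gU t) (gΦ t))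
      (shockTriple T t.ε (g t) (x t))).φ := remainder_potential_dec hT ha hε₀8 F FΦ
    fun n => ((DΦ n).sub (DN n)).congr fun t z => by ring
  choose K₁ hK₁ B₁ using dec_normX_le hα₀.le haα hR hΦ (ε := Params.ε) (δ := Params.δ) fun t => by
    have h1 := t.ε_le.trans hε₀8
    have h2 := t.δ_le.trans hδ₀1
    have h3 := t.δ_pos
    have h4 := t.ε_pos
    nlinarith
  choose K₂ hK₂ B₂ using dec_normH_le hα₀.le haα hU
  refine ⟨ε₀, hε₀, δ₀, hδ₀, 1 / soundSpeed T, by positivity, 2 / soundSpeed T, by positivity,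
    fun k => K₁ k + K₂ k + 1, fun k => by have := hK₁ k; have := hK₂ k; positivity, ?_⟩
  intro ε μbar lbar δ hε hεm hμ hl hδe hδm
  have hδ : 0 < δ := by rw [hδe]; positivity
  have hε8 : ε ≤ 1 / 8 := hεm.trans hε₀8
  have hε4 : ε ≤ 1 / 4 := by linarith
  obtain ⟨u₁, uε⟩ := hfirst T ε δ m hT hε hε8 hδ
    ((hδm.trans hδ₀η).trans ((min_le_right _ _).trans (min_le_right _ _)))
  have uP := huniq ε δ
  set t : Params ε₀ δ₀ := ⟨ε, δ, hε, hεm, hδ, hδm⟩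
  have I₁ : IsFirstOrder T δ m (firstTriple T (g₁ t)) := isFirstOrder_firstTriple hT hδ (F₁.sys t)
    (F₁.init t) (F₁.tendsto ha t).1 (F₁.tendsto ha t).2
  have Iε : IsModifiedFirstOrder T ε δ (firstTriple T (g₁ t))
      (modifiedTriple T ε (gN t) (gU t) (gΦ t)) :=
    isModifiedFirstOrder_modifiedTriple hT hε hε8 hδ (F₁.init t) (FN.sys t) (FU.sys t) (FΦ.sys t)
      (FN.init t) (FU.init t) (FΦ.init t) (FN.tendsto ha t) (FU.tendsto ha t) (FΦ.tendsto ha t)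
  have IP : IsShockProfile T ε δ (shockTriple T ε (g t) (x t)) := F.isShockProfile hT ha hε₀8 t
  have h0 : (remainder ε (modifiedTriple T ε (gN t) (gU t) (gΦ t))
      (shockTriple T ε (g t) (x t))).n 0 = 0 := by
    have h1 := F.init t
    have h2 := FN.init t
    simp only [remainder, modifiedTriple, shockTriple, nPlus_sub_one hT hε.ne', h1, h2]
    rw [show (2 * soundSpeed T - ε) / (T + 1) = amp T ε from rfl,
      show strength T ε = ε * amp T ε from rfl, show t.ε = ε from rfl]
    ring
  have hexp : HasExpansion ε (firstTriple T (g₁ t)) (secondOrder ε (firstTriple T (g₁ t))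
      (modifiedTriple T ε (gN t) (gU t) (gΦ t))) (remainder ε
      (modifiedTriple T ε (gN t) (gU t) (gΦ t)) (shockTriple T ε (g t) (x t)))
      (shockTriple T ε (g t) (x t)) := (hasExpansion_iff hε.ne').2 rfl
  refine ⟨?_, _, I₁, fun p' h' => u₁ _ _ I₁ h', _, Iε, fun p' h' => uε _ _ _ Iε h', _, _,
    ⟨IP, hexp, h0⟩, ?_, solvesRemainderSystem hT hε hε4 hδ IP Iε hexp, fun k _ => ⟨?_, ?_⟩⟩
  · rw [← one_sub_strength hT, sub_sub_cancel, strength, mul_comm ε]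
    have := amp_bounds hT hε hε4
    exact ⟨by gcongr; exact this.1, by gcongr; exact this.2⟩
  · intro p' pR' hp' hexp' h0'
    -- The condition n_R(0) = 0 fixes the density at the origin, which is all that `shock_unique`
    -- asks for; no decay of the competing remainder is assumed.
    have e0 : p'.n 0 = (shockTriple T ε (g t) (x t)).n 0 := by
      rw [hexp'.n_eq, hexp.n_eq, h0, h0']
    have ep : p' = shockTriple T ε (g t) (x t) := uP _ _ hε
      ((hεm.trans hε₀η).trans (min_le_left _ _)) hδ
      ((hδm.trans hδ₀η).trans ((min_le_right _ _).trans (min_le_left _ _))) hp' IP e0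
    refine ⟨ep, ?_⟩
    rw [(hasExpansion_iff hε.ne').1 hexp', ep]
  · refine (B₁ k t).trans (ENNReal.ofReal_le_ofReal ?_)
    linarith [hK₂ k]
  · refine (B₂ k t).trans (ENNReal.ofReal_le_ofReal ?_)
    linarith [hK₁ k]
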